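/- Let $\Pi^2=(\mathbb R/\mathbb Z)^2$ be the periodic unit square, let $c\in\mathbb R$, $\mu\ge 0$, and let $p\in C^\infty((0,\infty))$ satisfy $p'(\rho)>0$ for all $\rho>0$. For a function $\varphi$ write $\Omega=(\cos\varphi,\sin\varphi)$ (so $|\Omega|=1$) and $P_{\Omega^\perp}=\mathrm{Id}-\Omega\otimes\Omega$. Consider on $\Pi^2$ the system $$\partial_t\rho+\nabla_x\cdot(\rho\,\Omega)=0,\qquad \rho\,(\partial_t\Omega+c\,\Omega\cdot\nabla_x\Omega)+P_{\Omega^\perp}\nabla_x\big(p(\rho)\big)=\mu\,P_{\Omega^\perp}\Delta(\rho\,\Omega).$$ Let $m>2$ be a real number and let the initial data $\rho_0,\varphi_0\in H^m(\Pi^2)$ be real-valued (and identified with their continuous representatives), with $\rho_0>0$ everywhere on $\Pi^2$. Then there exists a time $T>0$ such that the system has a unique solution $(\rho,\varphi)$ with $\rho|_{t=0}=\rho_0$, $\varphi|_{t=0}=\varphi_0$, $$\rho,\ \varphi\in L^\infty(0,T;H^m(\Pi^2))\cap H^1(0,T;H^{m-1}(\Pi^2)),$$ and $\rho>0$ on $[0,T]\times\Pi^2$.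 Here derivatives are weak derivatives, the equations hold almost everywhere, and initial values are taken in the representative that is continuous on $[0,T]\times\Pi^2$. If, in addition, $\mu>0$, then $\varphi\in L^2(0,T;H^{m+1}(\Pi^2))$. -/

import Mathlib

open MeasureTheory Set
open scoped ContDiff ENNReal

noncomputable section

namespace SelfPropelled

/-- The periodic unit square `Π² = (ℝ/ℤ)²`. -/
abbrev Torus : Type := UnitAddTorus (Fin 2)

/-- Lebesgue measure on `Π²`, of total mass one (the measure that `mFourierCoeff` uses). -/
def torusMeasure : Measure Torus := Measure.pi fun _ => AddCircle.haarAddCircle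

theorem torusMeasure_eq_volume : torusMeasure = volume := by
  have h : (AddCircle.haarAddCircle : Measure UnitAddCircle) = volume := by
    rw [AddCircle.volume_eq_smul_haarAddCircle]; simp
  rw [torusMeasure, h]; rfl

/-- The Hilbert space `ℓ²(ℤ²; ℂ)`. -/
abbrev EllTwo : Type := lp (fun _ : Fin 2 → ℤ => ℂ) 2

/-- The Fourier coefficients `∫ f(x) exp(-2πi k·x) dx` of a real function on the torus. -/
def fourierCoeff (f : Torus → ℝ) (k : Fin 2 → ℤ) : ℂ :=
  UnitAddTorus.mFourierCoeff (fun x => (f x : ℂ)) k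

/-- `4π²|k|²`, the symbol of `-Δ`. -/
def laplaceSymbol (k : Fin 2 → ℤ) : ℝ := 4 * Real.pi ^ 2 * ∑ i, (k i : ℝ) ^ 2

/-- `f` belongs to `H^s(Π²)`, `s ≥ 0`, and `a ∈ ℓ²` is its image under the isometry
`f ↦ ((1 + 4π²|k|²)^{s/2} f̂(k))_k` from `H^s(Π²)` into `ℓ²(ℤ²; ℂ)`. -/
def IsSobolevSeq (s : ℝ) (f : Torus → ℝ) (a : EllTwo) : Prop :=
  MemLp f 2 torusMeasure ∧
    ∀ k, a k = (((1 + laplaceSymbol k) ^ (s / 2) : ℝ) : ℂ) * fourierCoeff f k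

/-- `f ∈ H^s(Π²)`. -/
def MemSobolev (s : ℝ) (f : Torus → ℝ) : Prop := ∃ a : EllTwo, IsSobolevSeq s f a

/-- `u ∈ L^q(0,T; H^s(Π²))`, as a Bochner space (`H^s` being identified with weighted `ℓ²`). -/
def MemBochner (q : ℝ≥0∞) (s T : ℝ) (u : ℝ → Torus → ℝ) : Prop :=
  ∃ U : ℝ → EllTwo, MemLp U q (volume.restrict (Ioo 0 T)) ∧
    ∀ᵐ t ∂(volume.restrict (Ioo 0 T)), IsSobolevSeq s (u t) (U t)

/-- `V` is the weak derivative of `U` on the interval `(0,T)`. -/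
def HasWeakDerivOn (T : ℝ) (U V : ℝ → EllTwo) : Prop :=
  ∀ η : ℝ → ℝ, ContDiff ℝ ∞ η → HasCompactSupport η → tsupport η ⊆ Ioo 0 T →
    ∫ t in Ioo 0 T, deriv η t • U t = -∫ t in Ioo 0 T, η t • V t

/-- `u ∈ H¹(0,T; H^s(Π²))` and its weak time derivative is `∂ₜu = v`. -/
def HasTimeDeriv (s T : ℝ) (u v : ℝ → Torus → ℝ) : Prop :=
  ∃ U V : ℝ → EllTwo,
    MemLp U 2 (volume.restrict (Ioo 0 T)) ∧ MemLp V 2 (volume.restrict (Ioo 0 T)) ∧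
    (∀ᵐ t ∂(volume.restrict (Ioo 0 T)), IsSobolevSeq s (u t) (U t) ∧ IsSobolevSeq s (v t) (V t)) ∧
    HasWeakDerivOn T U V

/-- `u ∈ H¹(0,T; H^s(Π²))`. -/
def MemH1Sobolev (s T : ℝ) (u : ℝ → Torus → ℝ) : Prop :=
  ∃ v : ℝ → Torus → ℝ, HasTimeDeriv s T u v

/-- `g` is the distributional partial derivative `∂f/∂xᵢ` on the torus: since trigonometric
polynomials are dense in `C^∞(Π²)`, it suffices to test against the characters. -/
def HasWeakPartial (i : Fin 2) (f g : Torus → ℝ) : Prop :=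
  Integrable f torusMeasure ∧ Integrable g torusMeasure ∧
    ∀ k, fourierCoeff g k = 2 * Real.pi * Complex.I * (k i : ℂ) * fourierCoeff f k

/-- `g` is the distributional Laplacian `Δf` on the torus. -/
def HasWeakLaplacian (f g : Torus → ℝ) : Prop :=
  Integrable f torusMeasure ∧ Integrable g torusMeasure ∧
    ∀ k, fourierCoeff g k = -(laplaceSymbol k : ℂ) * fourierCoeff f k

/-- The unit vector `Ω = (cos θ, sin θ)`. -/
def direction (θ : ℝ) : Fin 2 → ℝ := ![Real.cos θ, Real.sin θ]

/-- `P_{Ω^⊥} v = v - (Ω · v) Ω`, the orthogonal projection onto the line normal to the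
unit vector `Ω`. -/
def perpProj (Ω v : Fin 2 → ℝ) : Fin 2 → ℝ := v - (Ω ⬝ᵥ v) • Ω

/-- The mass equation `∂ₜρ + ∇·(ρΩ) = 0` almost everywhere on the torus, at a fixed time;
`ρt` stands for `∂ₜρ`. -/
def MassEquation (ρ φ ρt : Torus → ℝ) : Prop :=
  ∃ D : Fin 2 → Torus → ℝ,
    (∀ i, HasWeakPartial i (fun x => ρ x * direction (φ x) i) (D i)) ∧
    ∀ᵐ x ∂torusMeasure, ρt x + ∑ i, D i x = 0

/-- The momentum equation `ρ(∂ₜΩ + cΩ·∇Ω) + P_{Ω^⊥}∇(p(ρ)) = μ P_{Ω^⊥}Δ(ρΩ)` almost everywhere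
on the torus, at a fixed time; `Ωt` stands for `∂ₜΩ`, `DΩ i j` for `∂ᵢΩⱼ`, `Dp i` for `∂ᵢ(p(ρ))`
and `L j` for `Δ(ρΩⱼ)`. -/
def MomentumEquation (c μ : ℝ) (p : ℝ → ℝ) (ρ φ : Torus → ℝ) (Ωt : Fin 2 → Torus → ℝ) : Prop :=
  ∃ (DΩ : Fin 2 → Fin 2 → Torus → ℝ) (Dp L : Fin 2 → Torus → ℝ),
    (∀ i j, HasWeakPartial i (fun x => direction (φ x) j) (DΩ i j)) ∧
    (∀ i, HasWeakPartial i (fun x => p (ρ x)) (Dp i)) ∧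
    (∀ j, HasWeakLaplacian (fun x => ρ x * direction (φ x) j) (L j)) ∧
    ∀ᵐ x ∂torusMeasure,
      ρ x • ((fun j => Ωt j x) + c • fun j => ∑ i, direction (φ x) i * DΩ i j x)
          + perpProj (direction (φ x)) (fun i => Dp i x)
        = μ • perpProj (direction (φ x)) (fun j => L j x)

/-- `(ρ, φ)`, with `ρ > 0` and `Ω = (cos φ, sin φ)`, solves the system on `[0,T]` with initial data
`(ρ₀, φ₀)`. The initial values are those of the representative of `(ρ, φ)` that is continuous
on `[0,T] × Π²`; it exists and is unique for every pair in the regularity class below. -/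
structure IsSolution (c μ : ℝ) (p : ℝ → ℝ) (ρ₀ φ₀ : C(Torus, ℝ)) (T : ℝ)
    (ρ φ : ℝ → C(Torus, ℝ)) : Prop where
  continuousOn_density : ContinuousOn ρ (Icc 0 T)
  continuousOn_angle : ContinuousOn φ (Icc 0 T)
  initial_density : ρ 0 = ρ₀
  initial_angle : φ 0 = φ₀
  density_pos : ∀ t ∈ Icc 0 T, ∀ x, 0 < ρ t x
  equations : ∃ (ρt : ℝ → Torus → ℝ) (Ωt : Fin 2 → ℝ → Torus → ℝ),
    HasTimeDeriv 0 T (fun t x => ρ t x) ρt ∧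
    (∀ j, HasTimeDeriv 0 T (fun t x => direction (φ t x) j) (Ωt j)) ∧
    ∀ᵐ t ∂(volume.restrict (Ioo 0 T)),
      MassEquation (ρ t) (φ t) (ρt t) ∧
      MomentumEquation c μ p (ρ t) (φ t) (fun j => Ωt j t)

/-- `u ∈ L^∞(0,T; H^m(Π²)) ∩ H¹(0,T; H^{m-1}(Π²))`. -/
def InClass (m T : ℝ) (u : ℝ → C(Torus, ℝ)) : Prop :=
  MemBochner ∞ m T (fun t x => u t x) ∧ MemH1Sobolev (m - 1) T (fun t x => u t x)

end SelfPropelled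

end

noncomputable section
namespace SelfPropelled
open Filter Topology

/-! ### Weights -/

/-! Put `Ω^⊥ = (-sin φ, cos φ)`. Since `∂Ω = ∂φ Ω^⊥`, every term of the momentum equation is a
multiple of `Ω^⊥`, and the equation is equivalent to the scalar one `ρ(∂ₜφ + cΩ·∇φ) + p'(ρ) Ω^⊥·∇ρ =
μ(ρΔφ + 2∇ρ·∇φ)` (`momentumEquation_iff_scalar`). A new unknown `r` with `dr/dρ = √p'(ρ)/ρ`
symmetrizes the first-order part. With `a = √p'(ρ)` and `b = 1/a` the system becomes `∂ₜr + Ω·∇r +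
aΩ^⊥·∇φ = 0`, `∂ₜφ + cΩ·∇φ + aΩ^⊥·∇r = μΔφ + 2μb∇r·∇φ`, the same coefficient `a` coupling both
equations (`exists_symVars`, `SymVars.massEquation_iff`, `SymVars.momentumEquation_iff`).

Existence is a Galerkin argument in Fourier space. By symmetry the top-order terms of the `H^m`
energy balance occur in pairs in which one derivative cancels (`abs_pairing_add_pairing_le`). The
term `2μb∇r·∇φ` is controlled only in `H^{m-1}` and is absorbed by the viscous dissipation
(`two_mul_pairing_le`). The resulting bound (`exists_energy_bound`) is independent of the
truncation, so all truncated solutions live on a common interval (`exists_truncated_solution`).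
Arzelà–Ascoli applied to each Fourier coefficient gives a limit; as `m > 2`, boundedness in `H^m`
upgrades coefficientwise convergence to convergence in `C¹` (`tendsto_of_coeff`), which suffices for
the nonlinear terms (`exists_coefficient_solution`). The dissipation integral survives in the limit
and gives `φ ∈ L²(0,T;H^{m+1})` when `μ > 0`.

For uniqueness, any solution in the class is carried to the symmetrized system: weak time
derivatives in `H^{m-1}`, `m - 1 > 1`, are true primitives of continuous-function-valued paths
(`HasTimeDeriv.exists_intDeriv`), so the chain rule in time is available
(`IsSolution.exists_reducedSolution`). Two solutions are compared in `L²`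
(`exists_difference_estimate`). Integration by parts there produces `μΔφ₂`, whose sup norm is merely
integrable in time, which is enough for Gronwall's inequality (`ReducedSolution.eq`). -/

/-- The frequency lattice `ℤ²`. -/
abbrev Freq : Type := Fin 2 → ℤ

/-- The weight `(1 + 4π²|k|²)^{s/2}`. -/
def wt (s : ℝ) (k : Freq) : ℝ := (1 + laplaceSymbol k) ^ (s / 2)

theorem laplaceSymbol_nonneg (k : Freq) : 0 ≤ laplaceSymbol k := by
  unfold laplaceSymbol; positivity

theorem laplaceSymbol_neg (k : Freq) : laplaceSymbol (-k) = laplaceSymbol k := by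
  simp [laplaceSymbol]

theorem wt_pos (s : ℝ) (k : Freq) : 0 < wt s k :=
  Real.rpow_pos_of_pos (by linarith [laplaceSymbol_nonneg k]) _

theorem wt_zero (k : Freq) : wt 0 k = 1 := by simp [wt]

theorem wt_neg_index (s : ℝ) (k : Freq) : wt s (-k) = wt s k := by
  simp [wt, laplaceSymbol_neg]

theorem wt_add (s t : ℝ) (k : Freq) : wt (s + t) k = wt s k * wt t k := by
  rw [wt, add_div, Real.rpow_add (by linarith [laplaceSymbol_nonneg k])]; rfl

theorem wt_mono {s t : ℝ} (h : s ≤ t) (k : Freq) : wt s k ≤ wt t k :=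
  Real.rpow_le_rpow_of_exponent_le (by linarith [laplaceSymbol_nonneg k]) (by linarith)

theorem one_le_wt {s : ℝ} (h : 0 ≤ s) (k : Freq) : 1 ≤ wt s k := by
  rw [← wt_zero k]; exact wt_mono h k

theorem wt_sq (s : ℝ) (k : Freq) : wt s k ^ 2 = wt (2 * s) k := by
  rw [sq, ← wt_add]; ring_nf

theorem wt_two (k : Freq) : wt 2 k = 1 + laplaceSymbol k := by simp [wt]

theorem wt_one_sq (k : Freq) : wt 1 k ^ 2 = 1 + laplaceSymbol k := by
  rw [wt_sq, mul_one, wt_two]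

theorem wt_eq_rpow (s : ℝ) (k : Freq) : wt s k = wt 1 k ^ s := by
  rw [wt, wt, ← Real.rpow_mul (by linarith [laplaceSymbol_nonneg k])]; ring_nf

/-- `wt 1 k` is the Euclidean length of `(1, 2πk)`, so this is a triangle inequality: after
squaring, the cross term is handled by Cauchy–Schwarz. -/
theorem wt_one_add_le (k l : Freq) : wt 1 (k + l) ≤ wt 1 k + wt 1 l := by
  have hx := wt_pos 1 k
  have hy := wt_pos 1 l
  refine le_of_sq_le_sq ?_ (by positivity)
  have h1 := wt_one_sq k
  have h2 := wt_one_sq l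
  rw [wt_one_sq, add_sq, h1, h2]
  have key : 4 * Real.pi ^ 2 * ((k 0 : ℝ) * l 0 + k 1 * l 1) ≤ wt 1 k * wt 1 l := by
    refine le_of_sq_le_sq ?_ (by positivity)
    rw [mul_pow, mul_pow (wt 1 k), h1, h2]
    simp only [laplaceSymbol, Fin.sum_univ_two]
    -- Lagrange's identity: the squared determinant is the defect in the Cauchy–Schwarz inequality
    -- for `k` and `l`.
    have : 0 ≤ (4 * Real.pi ^ 2) ^ 2 * ((k 0 : ℝ) * l 1 - k 1 * l 0) ^ 2 := by positivity
    have : 0 ≤ 4 * Real.pi ^ 2 * ((k 0 : ℝ) ^ 2 + (k 1 : ℝ) ^ 2) := by positivity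
    have : 0 ≤ 4 * Real.pi ^ 2 * ((l 0 : ℝ) ^ 2 + (l 1 : ℝ) ^ 2) := by positivity
    nlinarith
  simp only [laplaceSymbol, Fin.sum_univ_two, Pi.add_apply, Int.cast_add] at key ⊢
  nlinarith
where
  le_of_sq_le_sq {a b : ℝ} (h : a ^ 2 ≤ b ^ 2) (hb : 0 ≤ b) : a ≤ b :=
    le_of_abs_le ((sq_le_sq₀ (abs_nonneg a) hb).1 (by rwa [sq_abs]))

/-- A sum is at most twice the larger term, and raising this to the power `s` costs only `2 ^ s`.
This distributes derivatives over a product. -/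
theorem wt_add_index_le {s : ℝ} (hs : 0 ≤ s) (k l : Freq) :
    wt s (k + l) ≤ 2 ^ s * (wt s k + wt s l) := by
  rw [wt_eq_rpow, wt_eq_rpow s k, wt_eq_rpow s l]
  have hx := wt_pos 1 k
  have hy := wt_pos 1 l
  have h1 : wt 1 (k + l) ≤ 2 * max (wt 1 k) (wt 1 l) := by
    have := wt_one_add_le k l
    have := le_max_left (wt 1 k) (wt 1 l)
    have := le_max_right (wt 1 k) (wt 1 l)
    linarith
  refine (Real.rpow_le_rpow (wt_pos _ _).le h1 hs).trans ?_
  rw [Real.mul_rpow (by norm_num) (by positivity)]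
  gcongr
  rcases max_choice (wt 1 k) (wt 1 l) with h | h <;> rw [h]
  · linarith [Real.rpow_nonneg hy.le s]
  · linarith [Real.rpow_nonneg hx.le s]

theorem abs_two_pi_mul_le (k : Freq) (j : Fin 2) : |2 * Real.pi * (k j : ℝ)| ≤ wt 1 k := by
  rw [← Real.sqrt_sq (wt_pos 1 k).le, wt_one_sq]
  refine Real.abs_le_sqrt ?_
  have : (k j : ℝ) ^ 2 ≤ ∑ i, (k i : ℝ) ^ 2 :=
    Finset.single_le_sum (f := fun i => (k i : ℝ) ^ 2) (fun i _ => sq_nonneg _) (Finset.mem_univ j)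
  unfold laplaceSymbol
  have hp : 0 ≤ 4 * Real.pi ^ 2 := by positivity
  nlinarith

/-- Bernoulli's inequality applied to the ratio of the smaller number to the larger takes the place
of the mean value theorem. -/
theorem abs_rpow_sub_rpow_le {p x y : ℝ} (hp : 1 ≤ p) (hx : 0 < x) (hy : 0 < y) :
    |x ^ p - y ^ p| ≤ p * max x y ^ (p - 1) * |x - y| := by
  have key : ∀ x y : ℝ, 0 < x → 0 < y → y ≤ x → x ^ p - y ^ p ≤ p * x ^ (p - 1) * (x - y) := by
    intro x y hx hy hxy
    have h := one_add_mul_self_le_rpow_one_add (s := y / x - 1) (by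
      have : 0 < y / x := by positivity
      linarith) hp
    have e : (1 + (y / x - 1)) = y / x := by ring
    rw [e, Real.div_rpow hy.le hx.le, le_div_iff₀ (by positivity)] at h
    have e2 : x ^ p = x ^ (p - 1) * x := by
      rw [← Real.rpow_add_one hx.ne']; ring_nf
    have e3 : (1 + p * (y / x - 1)) * x ^ p = x ^ p + p * x ^ (p - 1) * (y - x) := by
      rw [e2]; field_simp
    rw [e3] at h
    linarith
  have mono : ∀ x y : ℝ, 0 < x → 0 < y → y ≤ x → y ^ p ≤ x ^ p := fun x y hx hy h =>
    Real.rpow_le_rpow hy.le h (by linarith)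
  rcases le_total y x with h | h
  · rw [max_eq_left h, abs_of_nonneg (by linarith [mono x y hx hy h]), abs_of_nonneg (by linarith)]
    exact key x y hx hy h
  · rw [max_eq_right h, abs_sub_comm, abs_sub_comm x,
      abs_of_nonneg (by linarith [mono y x hy hx h]), abs_of_nonneg (by linarith)]
    exact key y x hy hx h

/-- Here `x`, `y`, `z` play the weights of `k`, `l`, `k - l`, and `p`, `q` the derivative symbols.
If `z` dominates, the coefficient carries the high frequency and absorbs `m` derivatives. Otherwise
`x` and `y` are comparable and the difference gains a factor `z`. In every term on the right no
factor bears more than `m` derivatives. -/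
theorem abs_symbol_sub_le {m x y z p q : ℝ} (hm : 1 ≤ m) (hx : 0 < x) (hy : 0 < y) (hz : 0 < z)
    (hp : |p| ≤ x) (hq : |q| ≤ y) (hpq : |p - q| ≤ z) (hxyz : |x - y| ≤ z) :
    |x ^ (2 * m) * q - y ^ (2 * m) * p| ≤
      2 ^ m * (2 * m + 1) * (z * (x ^ m * y ^ m) + x ^ m * y * z ^ m + y ^ m * x * z ^ m) := by
  have xm : 0 < x ^ m := by positivity
  have ym : 0 < y ^ m := by positivity
  have zm : 0 < z ^ m := by positivity
  have tm : 0 < (2 : ℝ) ^ m := by positivity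
  have sqx : x ^ (2 * m) = x ^ m * x ^ m := by rw [two_mul, Real.rpow_add hx]
  have sqy : y ^ (2 * m) = y ^ m * y ^ m := by rw [two_mul, Real.rpow_add hy]
  have t1 : 0 ≤ z * (x ^ m * y ^ m) := by positivity
  have t2 : 0 ≤ x ^ m * y * z ^ m := by positivity
  have t3 : 0 ≤ y ^ m * x * z ^ m := by positivity
  by_cases hA : x ≤ 2 * z ∧ y ≤ 2 * z
  · have h1 : x ^ m ≤ 2 ^ m * z ^ m := by
      rw [← Real.mul_rpow (by norm_num) hz.le]; exact Real.rpow_le_rpow hx.le hA.1 (by linarith)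
    have h2 : y ^ m ≤ 2 ^ m * z ^ m := by
      rw [← Real.mul_rpow (by norm_num) hz.le]; exact Real.rpow_le_rpow hy.le hA.2 (by linarith)
    calc |x ^ (2 * m) * q - y ^ (2 * m) * p|
        ≤ |x ^ (2 * m) * q| + |y ^ (2 * m) * p| := abs_sub _ _
      _ = x ^ m * x ^ m * |q| + y ^ m * y ^ m * |p| := by
          rw [abs_mul, abs_mul, sqx, sqy, abs_of_pos (mul_pos xm xm), abs_of_pos (mul_pos ym ym)]
      _ ≤ x ^ m * (2 ^ m * z ^ m) * y + y ^ m * (2 ^ m * z ^ m) * x := by gcongr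
      _ = 2 ^ m * 1 * (x ^ m * y * z ^ m + y ^ m * x * z ^ m) := by ring
      _ ≤ 2 ^ m * (2 * m + 1) * (z * (x ^ m * y ^ m) + x ^ m * y * z ^ m + y ^ m * x * z ^ m) := by
          gcongr
          · linarith
          · linarith
  · have hxyz' := abs_le.1 hxyz
    -- One of `x`, `y` exceeds `2 z`, and `z` bounds their distance, so they differ at most by a
    -- factor of two.
    have hcmp : x ≤ 2 * y ∧ y ≤ 2 * x := by
      rw [not_and_or, not_le, not_le] at hA
      rcases hA with h | h <;> constructor <;> linarith [hxyz'.1, hxyz'.2]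
    have hM : 0 < max x y := lt_max_of_lt_left hx
    have hMm : max x y ^ (2 * m) ≤ 2 ^ m * (x ^ m * y ^ m) := by
      rcases max_choice x y with h | h <;> rw [h]
      · rw [sqx]
        have : x ^ m ≤ 2 ^ m * y ^ m := by
          rw [← Real.mul_rpow (by norm_num) hy.le]
          exact Real.rpow_le_rpow hx.le hcmp.1 (by linarith)
        nlinarith
      · rw [sqy]
        have : y ^ m ≤ 2 ^ m * x ^ m := by
          rw [← Real.mul_rpow (by norm_num) hx.le]
          exact Real.rpow_le_rpow hy.le hcmp.2 (by linarith)
        nlinarith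
    have hy2 : y ^ (2 * m) ≤ 2 ^ m * (x ^ m * y ^ m) :=
      (Real.rpow_le_rpow hy.le (le_max_right x y) (by linarith)).trans hMm
    have hd := abs_rpow_sub_rpow_le (p := 2 * m) (by linarith) hx hy
    have hMM : max x y ^ (2 * m - 1) * y ≤ max x y ^ (2 * m) := by
      calc max x y ^ (2 * m - 1) * y ≤ max x y ^ (2 * m - 1) * max x y := by
            gcongr; exact le_max_right _ _
        _ = max x y ^ (2 * m) := by rw [← Real.rpow_add_one hM.ne']; ring_nf
    calc |x ^ (2 * m) * q - y ^ (2 * m) * p|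
        = |(x ^ (2 * m) - y ^ (2 * m)) * q + y ^ (2 * m) * (q - p)| := by ring_nf
      _ ≤ |(x ^ (2 * m) - y ^ (2 * m))| * |q| + y ^ (2 * m) * |q - p| := by
          refine (abs_add_le _ _).trans ?_
          rw [abs_mul, abs_mul, abs_of_pos (a := y ^ (2 * m)) (by positivity)]
      _ ≤ (2 * m * max x y ^ (2 * m - 1) * z) * y + 2 ^ m * (x ^ m * y ^ m) * z := by
          rw [abs_sub_comm q]
          gcongr
          exact hd.trans (by gcongr)
      _ = 2 * m * (max x y ^ (2 * m - 1) * y) * z + 2 ^ m * (x ^ m * y ^ m) * z := by ring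
      _ ≤ 2 * m * (2 ^ m * (x ^ m * y ^ m)) * z + 2 ^ m * (x ^ m * y ^ m) * z := by
          gcongr ?_ + _
          exact mul_le_mul_of_nonneg_right
            (mul_le_mul_of_nonneg_left (hMM.trans hMm) (by linarith)) hz.le
      _ = 2 ^ m * (2 * m + 1) * (z * (x ^ m * y ^ m)) := by ring
      _ ≤ _ := by gcongr; linarith

theorem abs_wt_one_sub_le (k l : Freq) : |wt 1 k - wt 1 l| ≤ wt 1 (k - l) := by
  have h1 := wt_one_add_le (k - l) l
  have h2 := wt_one_add_le (l - k) k
  rw [sub_add_cancel] at h1 h2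
  rw [← neg_sub k l, wt_neg_index] at h2
  exact abs_le.2 ⟨by linarith, by linarith⟩

/-- This difference is the symbol left over when the `H^m` pairings of `f ∂ⱼv` with `u` and of `f
∂ⱼu` with `v` are added. -/
theorem abs_wt_symbol_sub_le {m : ℝ} (hm : 1 ≤ m) (k l : Freq) (j : Fin 2) :
    |wt m k ^ 2 * (2 * Real.pi * l j) - wt m l ^ 2 * (2 * Real.pi * k j)| ≤
      2 ^ m * (2 * m + 1) * (wt 1 (k - l) * (wt m k * wt m l) + wt m k * wt 1 l * wt m (k - l)
        + wt m l * wt 1 k * wt m (k - l)) := by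
  have := abs_symbol_sub_le hm (wt_pos 1 k) (wt_pos 1 l) (wt_pos 1 (k - l))
    (abs_two_pi_mul_le k j) (abs_two_pi_mul_le l j) (by
      have := abs_two_pi_mul_le (k - l) j
      rw [Pi.sub_apply, Int.cast_sub, mul_sub] at this
      exact this) (abs_wt_one_sub_le k l)
  simpa only [← wt_eq_rpow, wt_sq] using this

/-- The dimension enters here: `‖k‖ ^ (-s)` is summable over `ℤ²` exactly beyond exponent two. The
origin is discarded because the comparison fails there. -/
theorem summable_wt_neg {s : ℝ} (hs : 2 < s) : Summable fun k : Freq => wt (-s) k := by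
  refine Summable.of_norm_bounded_eventually (EisensteinSeries.summable_one_div_norm_rpow hs) ?_
  filter_upwards [(Set.finite_singleton (0 : Freq)).compl_mem_cofinite] with k hk
  have hk0 : k ≠ 0 := hk
  have hpos : 0 < ‖k‖ := norm_pos_iff.2 hk0
  rw [Real.norm_of_nonneg (wt_pos _ _).le, wt_eq_rpow]
  refine Real.rpow_le_rpow_of_nonpos hpos ?_ (by linarith)
  refine (pi_norm_le_iff_of_nonneg (wt_pos 1 k).le).2 fun i => ?_
  refine le_trans ?_ (abs_two_pi_mul_le k i)
  rw [abs_mul, abs_of_pos (by positivity), Int.norm_eq_abs]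
  nlinarith [Real.two_le_pi, abs_nonneg (k i : ℝ)]

end SelfPropelled
end

noncomputable section
namespace SelfPropelled
open Filter Topology

/-! ### Fourier coefficients -/

open UnitAddTorus (mFourier mFourierCoeff)
open scoped ComplexConjugate

instance : IsProbabilityMeasure torusMeasure :=
  inferInstanceAs (IsProbabilityMeasure (Measure.pi fun _ => AddCircle.haarAddCircle))

instance : Measure.IsOpenPosMeasure torusMeasure :=
  inferInstanceAs (Measure.IsOpenPosMeasure (Measure.pi fun _ => AddCircle.haarAddCircle))

theorem memLp_continuousMap {F : Type*} [NormedAddCommGroup F] (f : C(Torus, F)) (p : ℝ≥0∞) :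
    MemLp f p torusMeasure :=
  MemLp.of_bound f.continuous.aestronglyMeasurable ‖f‖ (Eventually.of_forall f.norm_coe_le_norm)

theorem integrable_continuousMap {F : Type*} [NormedAddCommGroup F] (f : C(Torus, F)) :
    Integrable f torusMeasure := memLp_one_iff_integrable.1 (memLp_continuousMap f 1)

theorem norm_mFourier_apply (k : Freq) (x : Torus) : ‖mFourier k x‖ = 1 := by
  simp only [mFourier, fourier_apply, ContinuousMap.coe_mk, norm_prod,
    Circle.norm_coe, Finset.prod_const_one]

theorem integrable_ofReal {f : Torus → ℝ} (hf : Integrable f torusMeasure) :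
    Integrable (fun x => (f x : ℂ)) torusMeasure := hf.ofReal

theorem memLp_ofReal {f : Torus → ℝ} {p : ℝ≥0∞} (hf : MemLp f p torusMeasure) :
    MemLp (fun x => (f x : ℂ)) p torusMeasure := hf.ofReal

theorem integrable_mFourier_mul {f : Torus → ℂ} (hf : Integrable f torusMeasure) (k : Freq) :
    Integrable (fun x => mFourier k x * f x) torusMeasure :=
  hf.bdd_mul (c := 1) (mFourier k).continuous.aestronglyMeasurable
    (Eventually.of_forall fun x => (norm_mFourier_apply k x).le)

theorem fourierCoeff_def (f : Torus → ℝ) (k : Freq) :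
    fourierCoeff f k = ∫ x, mFourier (-k) x * (f x : ℂ) ∂torusMeasure := rfl

theorem fourierCoeff_congr_ae {f g : Torus → ℝ} (h : f =ᵐ[torusMeasure] g) (k : Freq) :
    fourierCoeff f k = fourierCoeff g k := by
  rw [fourierCoeff_def, fourierCoeff_def]
  refine integral_congr_ae ?_
  filter_upwards [h] with x hx
  rw [hx]

theorem fourierCoeff_add {f g : Torus → ℝ} (hf : Integrable f torusMeasure)
    (hg : Integrable g torusMeasure) (k : Freq) :
    fourierCoeff (fun x => f x + g x) k = fourierCoeff f k + fourierCoeff g k := by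
  simp only [fourierCoeff_def]
  rw [← integral_add (integrable_mFourier_mul (integrable_ofReal hf) _)
    (integrable_mFourier_mul (integrable_ofReal hg) _)]
  refine integral_congr_ae (Eventually.of_forall fun x => ?_)
  simp only; push_cast; ring

theorem fourierCoeff_const_mul (c : ℝ) (f : Torus → ℝ) (k : Freq) :
    fourierCoeff (fun x => c * f x) k = c * fourierCoeff f k := by
  simp only [fourierCoeff_def]
  rw [← integral_const_mul]
  refine integral_congr_ae (Eventually.of_forall fun x => ?_)
  simp only; push_cast; ring

theorem fourierCoeff_neg {f : Torus → ℝ} (k : Freq) :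
    fourierCoeff (fun x => -f x) k = -fourierCoeff f k := by
  simpa using fourierCoeff_const_mul (-1) f k

theorem fourierCoeff_sub {f g : Torus → ℝ} (hf : Integrable f torusMeasure)
    (hg : Integrable g torusMeasure) (k : Freq) :
    fourierCoeff (fun x => f x - g x) k = fourierCoeff f k - fourierCoeff g k := by
  have := fourierCoeff_add hf hg.neg k
  simp only [Pi.neg_apply] at this
  simp only [sub_eq_add_neg]
  rw [this]
  exact congrArg _ (fourierCoeff_neg k)

theorem fourierCoeff_sum {ι : Type*} (s : Finset ι) {f : ι → Torus → ℝ}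
    (hf : ∀ i ∈ s, Integrable (f i) torusMeasure) (k : Freq) :
    fourierCoeff (fun x => ∑ i ∈ s, f i x) k = ∑ i ∈ s, fourierCoeff (f i) k := by
  classical
  induction s using Finset.induction_on with
  | empty => simp [fourierCoeff_def]
  | insert i s hi ih =>
    simp only [Finset.sum_insert hi]
    rw [fourierCoeff_add (hf i (by simp)) (integrable_finsetSum _ fun j hj => hf j (by simp [hj])),
      ih fun j hj => hf j (by simp [hj])]

theorem fourierCoeff_neg_index (f : Torus → ℝ) (k : Freq) :
    fourierCoeff f (-k) = conj (fourierCoeff f k) := by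
  simp only [fourierCoeff_def]
  rw [← integral_conj]
  refine integral_congr_ae (Eventually.of_forall fun x => ?_)
  simp [UnitAddTorus.mFourier_neg]

theorem fourierCoeff_zero_eq (f : Torus → ℝ) :
    fourierCoeff f 0 = ((∫ x, f x ∂torusMeasure : ℝ) : ℂ) := by
  rw [fourierCoeff_def, ← integral_complex_ofReal]
  simp [UnitAddTorus.mFourier_zero]

theorem norm_fourierCoeff_le (f : Torus → ℝ) (k : Freq) :
    ‖fourierCoeff f k‖ ≤ ∫ x, |f x| ∂torusMeasure := by
  rw [fourierCoeff_def]
  refine (norm_integral_le_integral_norm _).trans (le_of_eq ?_)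
  refine integral_congr_ae (Eventually.of_forall fun x => ?_)
  simp [norm_mFourier_apply]

theorem norm_fourierCoeff_le_norm (f : C(Torus, ℝ)) (k : Freq) : ‖fourierCoeff f k‖ ≤ ‖f‖ := by
  refine (norm_fourierCoeff_le f k).trans ?_
  calc ∫ x, |f x| ∂torusMeasure ≤ ∫ _x, ‖f‖ ∂torusMeasure :=
        integral_mono (integrable_continuousMap f).abs (integrable_const _) f.norm_coe_le_norm
    _ = ‖f‖ := by simp

/-- The `k`-th Fourier coefficient as a bounded linear functional on continuous functions. -/
def coeffCLM (k : Freq) : C(Torus, ℝ) →L[ℝ] ℂ :=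
  LinearMap.mkContinuous
    { toFun := fun f => fourierCoeff f k
      map_add' := fun f g =>
        fourierCoeff_add (integrable_continuousMap f) (integrable_continuousMap g) k
      map_smul' := fun c f => fourierCoeff_const_mul c f k } 1
    (fun f => by simpa using norm_fourierCoeff_le_norm f k)

@[simp] theorem coeffCLM_apply (k : Freq) (f : C(Torus, ℝ)) : coeffCLM k f = fourierCoeff f k := rfl

/-- Pairing with `h` is a bounded functional on continuous functions that vanishes on the
characters, whose span is dense. -/
theorem integral_continuousMap_mul_eq_zero {h : Torus → ℝ} (hh : Integrable h torusMeasure)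
    (h0 : ∀ k, fourierCoeff h k = 0) (P : C(Torus, ℂ)) : ∫ x, P x * (h x : ℂ) ∂torusMeasure = 0 := by
  let Φ : C(Torus, ℂ) →L[ℂ] ℂ := LinearMap.mkContinuous
    { toFun := fun P => ∫ x, P x * (h x : ℂ) ∂torusMeasure
      map_add' := fun P Q => by
        rw [← integral_add]
        · simp [add_mul]
        · exact hh.ofReal.bdd_mul P.continuous.aestronglyMeasurable
            (Eventually.of_forall P.norm_coe_le_norm)
        · exact hh.ofReal.bdd_mul Q.continuous.aestronglyMeasurable
            (Eventually.of_forall Q.norm_coe_le_norm)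
      map_smul' := fun c P => by
        simp only [ContinuousMap.smul_apply, smul_eq_mul, mul_assoc, integral_const_mul]
        rfl } (∫ x, |h x| ∂torusMeasure) (fun P => by
      change ‖∫ x, P x * (h x : ℂ) ∂torusMeasure‖ ≤ _
      rw [← integral_mul_const]
      refine norm_integral_le_of_norm_le (hh.abs.mul_const _) (Eventually.of_forall fun x => ?_)
      rw [norm_mul, Complex.norm_real, mul_comm, Real.norm_eq_abs]
      gcongr
      exact P.norm_coe_le_norm x)
  have hker : (Submodule.span ℂ (range <| mFourier (d := Fin 2))).topologicalClosure ≤ Φ.ker := by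
    refine Submodule.topologicalClosure_minimal _ ?_ Φ.isClosed_ker
    rw [Submodule.span_le]
    rintro _ ⟨k, rfl⟩
    have := h0 (-k)
    rw [fourierCoeff_def, neg_neg] at this
    exact this
  rw [UnitAddTorus.span_mFourier_closure_eq_top] at hker
  exact hker (Submodule.mem_top (x := P))

/-- Uniqueness for integrable functions, where the Hilbert basis of `L²` does not apply. Thickened
indicators are continuous and converge to the indicator of a closed set, so dominated convergence
gives zero integral over every closed set. -/
theorem ae_eq_zero_of_fourierCoeff_eq_zero {h : Torus → ℝ} (hh : Integrable h torusMeasure)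
    (h0 : ∀ k, fourierCoeff h k = 0) : h =ᵐ[torusMeasure] 0 := by
  refine ae_eq_zero_of_forall_setIntegral_isClosed_eq_zero hh fun s hs => ?_
  have hδ : ∀ n : ℕ, (0 : ℝ) < 1 / ((n : ℝ) + 1) := fun n => Nat.one_div_pos_of_nat
  have key : ∀ n : ℕ, ∫ x, (thickenedIndicator (hδ n) s x : ℝ) * h x ∂torusMeasure = 0 := by
    intro n
    have := integral_continuousMap_mul_eq_zero hh h0
      ⟨fun x => ((thickenedIndicator (hδ n) s x : ℝ) : ℂ), by
        exact Complex.continuous_ofReal.comp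
          (NNReal.continuous_coe.comp (thickenedIndicator (hδ n) s).continuous)⟩
    simp only [ContinuousMap.coe_mk] at this
    rw [← Complex.ofReal_inj, ← integral_complex_ofReal]
    simpa using this
  have lim : Tendsto (fun n : ℕ => ∫ x, (thickenedIndicator (hδ n) s x : ℝ) * h x ∂torusMeasure)
      atTop (𝓝 (∫ x, s.indicator h x ∂torusMeasure)) := by
    refine tendsto_integral_of_dominated_convergence (fun x => |h x|) ?_ hh.abs ?_ ?_
    · intro n
      exact (NNReal.continuous_coe.comp
        (thickenedIndicator (hδ n) s).continuous).aestronglyMeasurable.mul hh.1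
    · intro n
      refine Eventually.of_forall fun x => ?_
      have h1 := thickenedIndicator_le_one (hδ n) s x
      have h1' : (thickenedIndicator (hδ n) s x : ℝ) ≤ 1 := by exact_mod_cast h1
      rw [norm_mul, Real.norm_of_nonneg NNReal.zero_le_coe, Real.norm_eq_abs]
      exact mul_le_of_le_one_left (abs_nonneg _) h1'
    · refine Eventually.of_forall fun x => ?_
      have := tendsto_pi_nhds.1 (thickenedIndicator_tendsto_indicator_closure hδ
        tendsto_one_div_add_atTop_nhds_zero_nat s) x
      rw [hs.closure_eq] at this
      have h2 := ((NNReal.continuous_coe.tendsto _).comp this).mul_const (h x)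
      convert! h2 using 1
      by_cases hx : x ∈ s <;> simp [hx]
  rw [integral_indicator hs.measurableSet] at lim
  simp only [key] at lim
  exact tendsto_nhds_unique lim tendsto_const_nhds

theorem ae_eq_of_fourierCoeff_eq {f g : Torus → ℝ} (hf : Integrable f torusMeasure)
    (hg : Integrable g torusMeasure) (h : ∀ k, fourierCoeff f k = fourierCoeff g k) :
    f =ᵐ[torusMeasure] g := by
  have := ae_eq_zero_of_fourierCoeff_eq_zero (hf.sub hg) fun k => by
    have := fourierCoeff_sub hf hg k
    rw [h k, sub_self] at this
    exact this
  filter_upwards [this] with x hx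
  simpa [sub_eq_zero] using hx

theorem eq_of_fourierCoeff_eq {f g : C(Torus, ℝ)}
    (h : ∀ k, fourierCoeff f k = fourierCoeff g k) : f = g :=
  ContinuousMap.ext fun x => congrFun (Continuous.ae_eq_iff_eq torusMeasure f.continuous
    g.continuous |>.1 (ae_eq_of_fourierCoeff_eq (integrable_continuousMap f)
      (integrable_continuousMap g) h)) x

/-! ### Square integrable functions -/

theorem mFourierCoeff_toLp_ofReal {f : Torus → ℝ} (hf : MemLp f 2 torusMeasure) (k : Freq) :
    mFourierCoeff ((memLp_ofReal hf).toLp _) k = fourierCoeff f k := by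
  change ∫ x, mFourier (-k) x • ((memLp_ofReal hf).toLp _ : Torus → ℂ) x ∂torusMeasure = _
  rw [fourierCoeff_def]
  refine integral_congr_ae ?_
  filter_upwards [(memLp_ofReal hf).coeFn_toLp] with x hx
  rw [hx]; rfl

theorem hasSum_sq_fourierCoeff {f : Torus → ℝ} (hf : MemLp f 2 torusMeasure) :
    HasSum (fun k => ‖fourierCoeff f k‖ ^ 2) (∫ x, f x ^ 2 ∂torusMeasure) := by
  have h := UnitAddTorus.hasSum_sq_mFourierCoeff ((memLp_ofReal hf).toLp _)
  convert! h using 1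
  · funext k
    rw [← mFourierCoeff_toLp_ofReal hf]; rfl
  refine integral_congr_ae ?_
  filter_upwards [(memLp_ofReal hf).coeFn_toLp] with x hx
  have : f x ^ 2 = ‖((memLp_ofReal hf).toLp _ : Torus → ℂ) x‖ ^ 2 := by rw [hx]; simp
  exact this

/-- The convolution theorem is Parseval's identity for `mFourier k * f` and `g`; since `f` is real,
the conjugated coefficient is the one of index `k - l`. -/
theorem hasSum_fourierCoeff_mul {f g : Torus → ℝ} (hf : MemLp f 2 torusMeasure)
    (hg : MemLp g 2 torusMeasure) (k : Freq) :
    HasSum (fun l => fourierCoeff f (k - l) * fourierCoeff g l)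
      (fourierCoeff (fun x => f x * g x) k) := by
  have hF : MemLp (fun x => mFourier k x * (f x : ℂ)) 2 torusMeasure :=
    MemLp.of_le (g := f) hf ((mFourier k).continuous.aestronglyMeasurable.mul
      (memLp_ofReal hf).1) (Eventually.of_forall fun x => by
        simp [norm_mFourier_apply])
  have h := UnitAddTorus.hasSum_prod_mFourierCoeff (hF.toLp _) ((memLp_ofReal hg).toLp _)
  convert! h using 1
  · funext l
    refine congrArg₂ _ ?_ (mFourierCoeff_toLp_ofReal hg l).symm
    have : mFourierCoeff (hF.toLp _) l = fourierCoeff f (l - k) := by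
      change ∫ x, mFourier (-l) x • (hF.toLp _ : Torus → ℂ) x ∂torusMeasure = _
      rw [fourierCoeff_def]
      refine integral_congr_ae ?_
      filter_upwards [hF.coeFn_toLp] with x hx
      rw [hx, smul_eq_mul, ← mul_assoc, ← UnitAddTorus.mFourier_add]
      rw [show -(l - k) = -l + k by abel]
    have h' : fourierCoeff f (k - l) = conj (mFourierCoeff (hF.toLp _) l) := by
      rw [this, ← fourierCoeff_neg_index, neg_sub]
    exact h'
  · change _ = ∫ x, conj ((hF.toLp _ : Torus → ℂ) x) * ((memLp_ofReal hg).toLp _ : Torus → ℂ) x ∂torusMeasure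
    rw [fourierCoeff_def]
    refine integral_congr_ae ?_
    filter_upwards [hF.coeFn_toLp, (memLp_ofReal hg).coeFn_toLp] with x hx hx'
    rw [hx, hx', UnitAddTorus.mFourier_neg]
    simp [mul_assoc]

/-- Riesz–Fischer gives a complex function. Hermitian symmetry says that its conjugate has the same
coefficients, hence so does its real part. -/
theorem exists_memLp_of_coeff {a : Freq → ℂ} (ha : Summable fun k => ‖a k‖ ^ 2)
    (hs : ∀ k, a (-k) = conj (a k)) :
    ∃ f : Torus → ℝ, MemLp f 2 torusMeasure ∧ ∀ k, fourierCoeff f k = a k := by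
  have hmem : Memℓp a 2 := memℓp_gen (by simpa using ha)
  let F := (UnitAddTorus.mFourierBasis (d := Fin 2)).repr.symm ⟨a, hmem⟩
  have hF : ∀ k, mFourierCoeff F k = a k := fun k => by
    rw [← UnitAddTorus.mFourierBasis_repr]; simp [F]
  have hFm : MemLp F 2 torusMeasure := Lp.memLp F
  refine ⟨fun x => (F x).re, hFm.re, fun k => ?_⟩
  have hint : Integrable F torusMeasure := hFm.integrable (by norm_num)
  have h1 := hF k
  have h2 := hF (-k)
  change ∫ x, mFourier (-k) x • F x ∂torusMeasure = _ at h1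
  change ∫ x, mFourier (- -k) x • F x ∂torusMeasure = _ at h2
  have h3 : ∫ x, mFourier (-k) x * conj (F x) ∂torusMeasure = a k := by
    rw [hs] at h2
    have := congrArg conj h2
    rw [← integral_conj, Complex.conj_conj] at this
    rw [← this]
    refine integral_congr_ae (Eventually.of_forall fun x => ?_)
    simp [UnitAddTorus.mFourier_neg]
  have hconj : Integrable (fun x => conj (F x)) torusMeasure :=
    (Complex.conjCLE.toContinuousLinearMap.integrable_comp hint : _)
  rw [fourierCoeff_def]
  calc ∫ x, mFourier (-k) x * (((F x).re : ℝ) : ℂ) ∂torusMeasure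
      = ∫ x, (1 / 2 : ℂ) * (mFourier (-k) x * F x + mFourier (-k) x * conj (F x))
          ∂torusMeasure := by
        refine integral_congr_ae (Eventually.of_forall fun x => ?_)
        simp only
        rw [← mul_add, Complex.add_conj]; push_cast; ring
    _ = a k := by
        rw [integral_const_mul, integral_add (integrable_mFourier_mul hint _)
          (integrable_mFourier_mul hconj _), h3]
        simp only [smul_eq_mul] at h1
        rw [h1]; ring

/-! ### Synthesis of continuous functions -/

theorem mFourierCoeff_mFourier (k l : Freq) :
    ∫ x, mFourier (-k) x * mFourier l x ∂torusMeasure = if k = l then 1 else 0 := by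
  have h := UnitAddTorus.mFourierCoeff_toLp (mFourier l) k
  rw [← UnitAddTorus.mFourierBasis_repr] at h
  have h2 : (UnitAddTorus.mFourierBasis (d := Fin 2)).repr
      (UnitAddTorus.mFourierLp 2 l) = lp.single 2 l (1 : ℂ) := by
    rw [← UnitAddTorus.coe_mFourierBasis]; exact HilbertBasis.repr_self _ _
  have h3 := congrArg (fun a : EllTwo => a k) h2
  simp only [lp.coeFn_single] at h3
  refine (h.symm.trans h3).trans ?_
  rw [Pi.single_apply]

/-- The complex function with prescribed (absolutely summable) Fourier coefficients. -/
def synthC (a : Freq → ℂ) : C(Torus, ℂ) := ∑' k, a k • mFourier k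

/-- The real function with prescribed (Hermitian, absolutely summable) Fourier coefficients. -/
def synth (a : Freq → ℂ) : C(Torus, ℝ) :=
  ⟨fun x => (synthC a x).re, Complex.continuous_re.comp (synthC a).continuous⟩

theorem hasSum_synthC {a : Freq → ℂ} (ha : Summable fun k => ‖a k‖) :
    HasSum (fun k => a k • mFourier k) (synthC a) :=
  (Summable.of_norm (by simpa [norm_smul, UnitAddTorus.mFourier_norm] using ha)).hasSum

theorem ofReal_synth_apply {a : Freq → ℂ} (ha : Summable fun k => ‖a k‖)
    (hs : ∀ k, a (-k) = conj (a k)) (x : Torus) : ((synth a x : ℝ) : ℂ) = synthC a x := by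
  have h := (ContinuousMap.evalCLM ℂ x).hasSum (hasSum_synthC ha)
  have h1 : HasSum (fun k => a k * mFourier k x) (synthC a x) := by simpa using h
  have h2 := (Complex.conjCLE.toContinuousLinearMap.hasSum h1)
  rw [← (Equiv.neg Freq).hasSum_iff] at h2
  have h3 : HasSum (fun k => a k * mFourier k x) (conj (synthC a x)) := by
    convert! h2 using 1
    funext k
    simp [hs, UnitAddTorus.mFourier_neg]
  exact Complex.conj_eq_iff_re.1 (h3.unique h1)

theorem fourierCoeff_synth {a : Freq → ℂ} (ha : Summable fun k => ‖a k‖)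
    (hs : ∀ k, a (-k) = conj (a k)) (k : Freq) : fourierCoeff (synth a) k = a k := by
  rw [fourierCoeff_def]
  simp only [ofReal_synth_apply ha hs]
  have h : HasSum (fun l => ∫ x, mFourier (-k) x * (a l • mFourier l x) ∂torusMeasure)
      (∫ x, ∑' l, mFourier (-k) x * (a l • mFourier l x) ∂torusMeasure) := by
    refine hasSum_integral_of_summable_integral_norm
      (fun l => integrable_mFourier_mul (integrable_continuousMap (a l • mFourier l)) _) ?_
    refine ha.congr fun l => ?_
    simp [norm_mFourier_apply]
  have h1 : ∀ l, ∫ x, mFourier (-k) x * (a l • mFourier l x) ∂torusMeasure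
      = if k = l then a l else 0 := by
    intro l
    have := mFourierCoeff_mFourier k l
    calc _ = a l * ∫ x, mFourier (-k) x * mFourier l x ∂torusMeasure := by
          rw [← integral_const_mul]
          refine integral_congr_ae (Eventually.of_forall fun x => ?_)
          simp only [smul_eq_mul]; ring
      _ = _ := by rw [this]; split_ifs <;> simp
  simp only [h1] at h
  have h2 : HasSum (fun l => if k = l then a l else 0) (a k) := by
    convert! hasSum_ite_eq k (a k) using 2 with l
    by_cases hkl : k = l
    · simp [hkl]
    · simp [hkl, Ne.symm hkl]
  rw [← h.unique h2]
  refine integral_congr_ae (Eventually.of_forall fun x => ?_)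
  have := ((ContinuousMap.evalCLM ℂ x).hasSum (hasSum_synthC ha)).mul_left (mFourier (-k) x)
  exact this.tsum_eq.symm

theorem norm_synth_le {a : Freq → ℂ} (ha : Summable fun k => ‖a k‖) : ‖synth a‖ ≤ ∑' k, ‖a k‖ := by
  refine (ContinuousMap.norm_le _ (tsum_nonneg fun _ => norm_nonneg _)).2 fun x => ?_
  refine (Complex.abs_re_le_norm _).trans (((synthC a).norm_coe_le_norm x).trans ?_)
  refine (norm_tsum_le_tsum_norm (by simpa [norm_smul, UnitAddTorus.mFourier_norm] using ha)).trans
    (le_of_eq ?_)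
  simp [norm_smul, UnitAddTorus.mFourier_norm]

theorem synth_fourierCoeff {f : C(Torus, ℝ)} (h : Summable fun k => ‖fourierCoeff f k‖) :
    synth (fourierCoeff f) = f :=
  eq_of_fourierCoeff_eq fun k => fourierCoeff_synth h (fun k => fourierCoeff_neg_index f k) k

theorem norm_le_tsum_norm_fourierCoeff {f : C(Torus, ℝ)}
    (h : Summable fun k => ‖fourierCoeff f k‖) : ‖f‖ ≤ ∑' k, ‖fourierCoeff f k‖ := by
  conv_lhs => rw [← synth_fourierCoeff h]
  exact norm_synth_le h

end SelfPropelled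
end

noncomputable section
namespace SelfPropelled
open Filter Topology

/-! ### Sobolev norms -/

open scoped ComplexConjugate

/-- The weight as an extended nonnegative real. -/
def ew (s : ℝ) (k : Freq) : ℝ≥0∞ := ENNReal.ofReal (wt s k)

/-- The squared `H^s` norm. -/
def sobE (s : ℝ) (f : Torus → ℝ) : ℝ≥0∞ := ∑' k, (ew s k * ‖fourierCoeff f k‖ₑ) ^ 2

/-- The weighted Wiener norm `∑ₖ (1 + 4π²|k|²)^{s/2} |f̂(k)|`. -/
def wsum (s : ℝ) (f : Torus → ℝ) : ℝ≥0∞ := ∑' k, ew s k * ‖fourierCoeff f k‖ₑ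

theorem ew_zero (k : Freq) : ew 0 k = 1 := by simp [ew, wt_zero]

theorem ew_add (s t : ℝ) (k : Freq) : ew (s + t) k = ew s k * ew t k := by
  rw [ew, wt_add, ENNReal.ofReal_mul (wt_pos s k).le]; rfl

theorem ew_mono {s t : ℝ} (h : s ≤ t) (k : Freq) : ew s k ≤ ew t k :=
  ENNReal.ofReal_le_ofReal (wt_mono h k)

theorem ew_ne_top (s : ℝ) (k : Freq) : ew s k ≠ ⊤ := ENNReal.ofReal_ne_top

theorem ew_add_index_le {s : ℝ} (hs : 0 ≤ s) (k l : Freq) :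
    ew s (k + l) ≤ ENNReal.ofReal (2 ^ s) * (ew s k + ew s l) := by
  rw [ew, ew, ew, ← ENNReal.ofReal_add (wt_pos _ _).le (wt_pos _ _).le,
    ← ENNReal.ofReal_mul (by positivity)]
  exact ENNReal.ofReal_le_ofReal (wt_add_index_le hs k l)

theorem tsum_ew_neg_lt_top {s : ℝ} (hs : 2 < s) : ∑' k : Freq, ew (-s) k < ⊤ := by
  simp only [ew]
  rw [← ENNReal.ofReal_tsum_of_nonneg (fun k => (wt_pos _ k).le) (summable_wt_neg hs)]
  exact ENNReal.ofReal_lt_top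

theorem ENNReal_add_sq_le (a b : ℝ≥0∞) : (a + b) ^ 2 ≤ 2 * a ^ 2 + 2 * b ^ 2 := by
  rcases eq_or_ne a ⊤ with rfl | ha
  · simp
  rcases eq_or_ne b ⊤ with rfl | hb
  · simp
  lift a to NNReal using ha
  lift b to NNReal using hb
  rw [← mul_add]
  have := add_sq_le (a := a) (b := b)
  exact_mod_cast this

/-- A weighted Cauchy–Schwarz inequality for series. -/
theorem ENNReal_tsum_mul_sq_le {ι : Type*} (b c : ι → ℝ≥0∞) :
    (∑' i, b i * c i) ^ 2 ≤ (∑' i, b i ^ 2 * c i) * ∑' i, c i := by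
  let _ : MeasurableSpace ι := ⊤
  have h := ENNReal.lintegral_mul_le_Lp_mul_Lq (μ := Measure.count)
    (p := 2) (q := 2) (by constructor <;> norm_num)
    (f := fun i => b i * c i ^ (1 / 2 : ℝ)) (g := fun i => c i ^ (1 / 2 : ℝ))
    (Measurable.aemeasurable fun _ _ => trivial) (Measurable.aemeasurable fun _ _ => trivial)
  simp only [lintegral_count, Pi.mul_apply] at h
  have e1 : ∀ i, b i * c i ^ (1 / 2 : ℝ) * c i ^ (1 / 2 : ℝ) = b i * c i := fun i => by
    rw [mul_assoc, ← ENNReal.rpow_add_of_nonneg _ _ (by norm_num) (by norm_num)]; norm_num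
  have e2 : ∀ i, (b i * c i ^ (1 / 2 : ℝ)) ^ (2 : ℝ) = b i ^ 2 * c i := fun i => by
    rw [ENNReal.mul_rpow_of_nonneg _ _ (by norm_num), ← ENNReal.rpow_mul]; norm_num
  have e3 : ∀ i, (c i ^ (1 / 2 : ℝ)) ^ (2 : ℝ) = c i := fun i => by
    rw [← ENNReal.rpow_mul]; norm_num
  simp only [e1, e2, e3] at h
  calc (∑' i, b i * c i) ^ 2
      ≤ ((∑' i, b i ^ 2 * c i) ^ (1 / 2 : ℝ) * (∑' i, c i) ^ (1 / 2 : ℝ)) ^ 2 := by gcongr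
    _ = _ := by
        rw [mul_pow, ← ENNReal.rpow_natCast, ← ENNReal.rpow_natCast, ← ENNReal.rpow_mul,
          ← ENNReal.rpow_mul]
        norm_num

/-- Young's inequality `ℓ² * ℓ¹ ⊆ ℓ²`: Cauchy–Schwarz with weight `c`, followed by an exchange of
the two sums. -/
theorem tsum_conv_sq_le (b c : Freq → ℝ≥0∞) :
    ∑' k, (∑' l, b (k - l) * c l) ^ 2 ≤ (∑' k, b k ^ 2) * (∑' k, c k) ^ 2 := by
  calc ∑' k, (∑' l, b (k - l) * c l) ^ 2
      ≤ ∑' k, (∑' l, b (k - l) ^ 2 * c l) * ∑' l, c l :=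
        ENNReal.tsum_le_tsum fun k => ENNReal_tsum_mul_sq_le (fun l => b (k - l)) c
    _ = (∑' k, ∑' l, b (k - l) ^ 2 * c l) * ∑' l, c l := ENNReal.tsum_mul_right
    _ = (∑' l, ∑' k, b (k - l) ^ 2 * c l) * ∑' l, c l := by rw [ENNReal.tsum_comm]
    _ = (∑' l, (∑' k, b k ^ 2) * c l) * ∑' l, c l := by
        congr 2; funext l
        rw [ENNReal.tsum_mul_right]
        congr 1
        exact (Equiv.subRight l).tsum_eq (fun k => b k ^ 2)
    _ = _ := by rw [ENNReal.tsum_mul_left]; ring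

theorem sobE_congr {f g : Torus → ℝ} (s : ℝ) (h : ∀ k, fourierCoeff f k = fourierCoeff g k) :
    sobE s f = sobE s g := by simp only [sobE, h]

theorem sobE_mono {s t : ℝ} (h : s ≤ t) (f : Torus → ℝ) : sobE s f ≤ sobE t f :=
  ENNReal.tsum_le_tsum fun k => by gcongr; exact ew_mono h k

theorem sobE_add_le (s : ℝ) {f g : Torus → ℝ} (hf : Integrable f torusMeasure)
    (hg : Integrable g torusMeasure) :
    sobE s (fun x => f x + g x) ≤ 2 * sobE s f + 2 * sobE s g := by
  simp only [sobE]
  rw [← ENNReal.tsum_mul_left, ← ENNReal.tsum_mul_left, ← ENNReal.tsum_add]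
  refine ENNReal.tsum_le_tsum fun k => ?_
  rw [fourierCoeff_add hf hg]
  refine le_trans ?_ (ENNReal_add_sq_le _ _)
  rw [← mul_add]
  gcongr
  exact enorm_add_le _ _

theorem sobE_const_mul (s c : ℝ) (f : Torus → ℝ) :
    sobE s (fun x => c * f x) = ‖c‖ₑ ^ 2 * sobE s f := by
  simp only [sobE]
  rw [← ENNReal.tsum_mul_left]
  congr 1; funext k
  rw [fourierCoeff_const_mul, enorm_mul]
  have : ‖(c : ℂ)‖ₑ = ‖c‖ₑ := by
    rw [← ofReal_norm, ← ofReal_norm, Complex.norm_real]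
  rw [this]; ring

theorem sobE_neg (s : ℝ) (f : Torus → ℝ) : sobE s (fun x => -f x) = sobE s f := by
  simpa using sobE_const_mul s (-1) f

theorem sobE_zero_eq {f : Torus → ℝ} (hf : MemLp f 2 torusMeasure) :
    sobE 0 f = ENNReal.ofReal (∫ x, f x ^ 2 ∂torusMeasure) := by
  have h := hasSum_sq_fourierCoeff hf
  rw [← h.tsum_eq, ENNReal.ofReal_tsum_of_nonneg (fun k => by positivity) h.summable]
  simp only [sobE, ew_zero, one_mul]
  congr 1; funext k
  rw [← ofReal_norm, ENNReal.ofReal_pow (norm_nonneg _)]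

theorem sobE_zero_le_of_bound {f : Torus → ℝ} (hf : AEStronglyMeasurable f torusMeasure) {M : ℝ}
    (hM : ∀ᵐ x ∂torusMeasure, |f x| ≤ M) : sobE 0 f ≤ ENNReal.ofReal (M ^ 2) := by
  have hm : MemLp f 2 torusMeasure := MemLp.of_bound hf M hM
  rw [sobE_zero_eq hm]
  refine ENNReal.ofReal_le_ofReal ?_
  calc ∫ x, f x ^ 2 ∂torusMeasure ≤ ∫ _x, M ^ 2 ∂torusMeasure := by
        refine integral_mono_ae hm.integrable_sq (integrable_const _) ?_
        filter_upwards [hM] with x hx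
        rw [← sq_abs]
        gcongr
    _ = M ^ 2 := by simp

theorem wsum_mono {s t : ℝ} (h : s ≤ t) (f : Torus → ℝ) : wsum s f ≤ wsum t f :=
  ENNReal.tsum_le_tsum fun k => by gcongr; exact ew_mono h k

/-- Cauchy–Schwarz after moving the surplus weight to a constant series, which converges once `t > s
+ 1`. This is the Sobolev embedding into the Wiener algebra, from which all sup-norm bounds follow.
-/
theorem wsum_sq_le (s t : ℝ) (f : Torus → ℝ) :
    wsum s f ^ 2 ≤ (∑' k, ew (-(2 * (t - s))) k) * sobE t f := by
  have h := ENNReal_tsum_mul_sq_le (fun k => ew (2 * t - s) k * ‖fourierCoeff f k‖ₑ)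
    (fun k => ew (-(2 * (t - s))) k)
  have e1 : ∀ k, ew (2 * t - s) k * ‖fourierCoeff f k‖ₑ * ew (-(2 * (t - s))) k =
      ew s k * ‖fourierCoeff f k‖ₑ := fun k => by
    rw [mul_right_comm, ← ew_add]; ring_nf
  have e2 : ∀ k, (ew (2 * t - s) k * ‖fourierCoeff f k‖ₑ) ^ 2 * ew (-(2 * (t - s))) k =
      (ew t k * ‖fourierCoeff f k‖ₑ) ^ 2 := fun k => by
    rw [mul_pow, mul_pow, mul_right_comm, sq, sq (ew t k), ← ew_add, ← ew_add, ← ew_add]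
    ring_nf
  simp only [e1, e2] at h
  rw [mul_comm]
  exact h

theorem exists_wsum_sq_le {s t : ℝ} (h : s + 1 < t) :
    ∃ C : ℝ≥0∞, C ≠ ⊤ ∧ ∀ f, wsum s f ^ 2 ≤ C * sobE t f :=
  ⟨_, (tsum_ew_neg_lt_top (by linarith)).ne, fun f => wsum_sq_le s t f⟩

theorem wsum_ne_top {s t : ℝ} (h : s + 1 < t) {f : Torus → ℝ} (hf : sobE t f ≠ ⊤) :
    wsum s f ≠ ⊤ := by
  obtain ⟨C, hC, hle⟩ := exists_wsum_sq_le h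
  intro htop
  have := hle f
  rw [htop] at this
  have h2 := ENNReal.mul_ne_top hC hf
  simp only [ENNReal.top_pow (two_ne_zero), top_le_iff] at this
  exact h2 this

theorem enorm_fourierCoeff_mul_le {f g : Torus → ℝ} (hf : MemLp f 2 torusMeasure)
    (hg : MemLp g 2 torusMeasure) (k : Freq) :
    ‖fourierCoeff (fun x => f x * g x) k‖ₑ ≤
      ∑' l, ‖fourierCoeff f (k - l)‖ₑ * ‖fourierCoeff g l‖ₑ := by
  rw [← (hasSum_fourierCoeff_mul hf hg k).tsum_eq]
  refine (enorm_tsum_le_tsum_enorm).trans (le_of_eq ?_)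
  simp only [enorm_mul]

/-- The weight of `k` is distributed over `k - l` and `l`; in each half Young's inequality leaves
one factor in `H^s` and the other in the Wiener algebra. -/
theorem sobE_mul_le {s : ℝ} (hs : 0 ≤ s) {f g : Torus → ℝ} (hf : MemLp f 2 torusMeasure)
    (hg : MemLp g 2 torusMeasure) :
    sobE s (fun x => f x * g x) ≤ ENNReal.ofReal (2 ^ s) ^ 2 *
      (2 * (sobE s f * wsum 0 g ^ 2) + 2 * (sobE s g * wsum 0 f ^ 2)) := by
  have key : ∀ k, ew s k * ‖fourierCoeff (fun x => f x * g x) k‖ₑ ≤ ENNReal.ofReal (2 ^ s) *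
      ((∑' l, (ew s (k - l) * ‖fourierCoeff f (k - l)‖ₑ) * ‖fourierCoeff g l‖ₑ) +
        ∑' l, (ew s (k - l) * ‖fourierCoeff g (k - l)‖ₑ) * ‖fourierCoeff f l‖ₑ) := by
    intro k
    have swap : ∑' l, (ew s (k - l) * ‖fourierCoeff g (k - l)‖ₑ) * ‖fourierCoeff f l‖ₑ =
        ∑' l, (ew s l * ‖fourierCoeff g l‖ₑ) * ‖fourierCoeff f (k - l)‖ₑ := by
      rw [← (Equiv.subLeft k).tsum_eq]
      simp
    rw [swap, ← ENNReal.tsum_add, ← ENNReal.tsum_mul_left]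
    calc ew s k * ‖fourierCoeff (fun x => f x * g x) k‖ₑ
        ≤ ew s k * ∑' l, ‖fourierCoeff f (k - l)‖ₑ * ‖fourierCoeff g l‖ₑ := by
          gcongr; exact enorm_fourierCoeff_mul_le hf hg k
      _ = ∑' l, ew s k * (‖fourierCoeff f (k - l)‖ₑ * ‖fourierCoeff g l‖ₑ) :=
          ENNReal.tsum_mul_left.symm
      _ ≤ _ := by
          refine ENNReal.tsum_le_tsum fun l => ?_
          have := ew_add_index_le hs (k - l) l
          rw [sub_add_cancel] at this
          calc _ ≤ ENNReal.ofReal (2 ^ s) * (ew s (k - l) + ew s l) *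
                (‖fourierCoeff f (k - l)‖ₑ * ‖fourierCoeff g l‖ₑ) := by gcongr
            _ = _ := by ring
  calc sobE s (fun x => f x * g x)
      ≤ ∑' k, (ENNReal.ofReal (2 ^ s) *
      ((∑' l, (ew s (k - l) * ‖fourierCoeff f (k - l)‖ₑ) * ‖fourierCoeff g l‖ₑ) +
        ∑' l, (ew s (k - l) * ‖fourierCoeff g (k - l)‖ₑ) * ‖fourierCoeff f l‖ₑ)) ^ 2 :=
        ENNReal.tsum_le_tsum fun k => pow_le_pow_left' (key k) 2
    _ ≤ ∑' k, ENNReal.ofReal (2 ^ s) ^ 2 *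
      (2 * (∑' l, (ew s (k - l) * ‖fourierCoeff f (k - l)‖ₑ) * ‖fourierCoeff g l‖ₑ) ^ 2 +
        2 * (∑' l, (ew s (k - l) * ‖fourierCoeff g (k - l)‖ₑ) * ‖fourierCoeff f l‖ₑ) ^ 2) :=
        ENNReal.tsum_le_tsum fun k => by rw [mul_pow]; gcongr; exact ENNReal_add_sq_le _ _
    _ ≤ _ := by
        rw [ENNReal.tsum_mul_left, ENNReal.tsum_add, ENNReal.tsum_mul_left, ENNReal.tsum_mul_left]
        have h1 := tsum_conv_sq_le (fun k => ew s k * ‖fourierCoeff f k‖ₑ)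
          (fun k => ‖fourierCoeff g k‖ₑ)
        have h2 := tsum_conv_sq_le (fun k => ew s k * ‖fourierCoeff g k‖ₑ)
          (fun k => ‖fourierCoeff f k‖ₑ)
        simp only [wsum, ew_zero, one_mul]
        gcongr
        · exact h1
        · exact h2

/-- `H^s` is an algebra for `s > 1`. -/
theorem exists_sobE_mul_le {s : ℝ} (hs : 1 < s) :
    ∃ C : ℝ≥0∞, C ≠ ⊤ ∧ ∀ f g : Torus → ℝ, MemLp f 2 torusMeasure → MemLp g 2 torusMeasure →
      sobE s (fun x => f x * g x) ≤ C * (sobE s f * sobE s g) := by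
  obtain ⟨C, hC, hle⟩ := exists_wsum_sq_le (s := 0) (t := s) (by linarith)
  refine ⟨ENNReal.ofReal (2 ^ s) ^ 2 * (2 * C + 2 * C), ?_, fun f g hf hg => ?_⟩
  · finiteness
  · refine (sobE_mul_le (by linarith) hf hg).trans ?_
    calc _ ≤ ENNReal.ofReal (2 ^ s) ^ 2 *
        (2 * (sobE s f * (C * sobE s g)) + 2 * (sobE s g * (C * sobE s f))) := by
          gcongr
          · exact hle g
          · exact hle f
      _ = _ := by ring

/-! ### Weak partial derivatives -/

theorem HasWeakPartial.ae_eq {i : Fin 2} {f g g' : Torus → ℝ} (h : HasWeakPartial i f g)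
    (h' : HasWeakPartial i f g') : g =ᵐ[torusMeasure] g' :=
  ae_eq_of_fourierCoeff_eq h.2.1 h'.2.1 fun k => by rw [h.2.2, h'.2.2]

theorem HasWeakPartial.congr {i : Fin 2} {f f' g g' : Torus → ℝ} (h : HasWeakPartial i f g)
    (hf : f =ᵐ[torusMeasure] f') (hg : g =ᵐ[torusMeasure] g') : HasWeakPartial i f' g' :=
  ⟨h.1.congr hf, h.2.1.congr hg, fun k => by
    rw [← fourierCoeff_congr_ae hf, ← fourierCoeff_congr_ae hg, h.2.2]⟩

theorem HasWeakPartial.add {i : Fin 2} {f g f' g' : Torus → ℝ} (h : HasWeakPartial i f g)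
    (h' : HasWeakPartial i f' g') :
    HasWeakPartial i (fun x => f x + f' x) (fun x => g x + g' x) :=
  ⟨h.1.add h'.1, h.2.1.add h'.2.1, fun k => by
    rw [fourierCoeff_add h.1 h'.1, fourierCoeff_add h.2.1 h'.2.1, h.2.2, h'.2.2]; ring⟩

theorem HasWeakPartial.const_mul {i : Fin 2} {f g : Torus → ℝ} (h : HasWeakPartial i f g) (c : ℝ) :
    HasWeakPartial i (fun x => c * f x) (fun x => c * g x) :=
  ⟨h.1.const_mul c, h.2.1.const_mul c, fun k => by
    rw [fourierCoeff_const_mul, fourierCoeff_const_mul, h.2.2]; ring⟩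

theorem HasWeakPartial.sub {i : Fin 2} {f g f' g' : Torus → ℝ} (h : HasWeakPartial i f g)
    (h' : HasWeakPartial i f' g') :
    HasWeakPartial i (fun x => f x - f' x) (fun x => g x - g' x) :=
  ⟨h.1.sub h'.1, h.2.1.sub h'.2.1, fun k => by
    rw [fourierCoeff_sub h.1 h'.1, fourierCoeff_sub h.2.1 h'.2.1, h.2.2, h'.2.2]; ring⟩

/-- The Leibniz rule, in `L²`. -/
theorem HasWeakPartial.mul {i : Fin 2} {f g f' g' : Torus → ℝ} (h : HasWeakPartial i f g)
    (h' : HasWeakPartial i f' g') (hf : MemLp f 2 torusMeasure) (hg : MemLp g 2 torusMeasure)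
    (hf' : MemLp f' 2 torusMeasure) (hg' : MemLp g' 2 torusMeasure) :
    HasWeakPartial i (fun x => f x * f' x) (fun x => g x * f' x + f x * g' x) := by
  have i1 : Integrable (fun x => g x * f' x) torusMeasure := hg.integrable_mul hf'
  have i2 : Integrable (fun x => f x * g' x) torusMeasure := hf.integrable_mul hg'
  refine ⟨hf.integrable_mul hf', i1.add i2, fun k => ?_⟩
  rw [fourierCoeff_add i1 i2]
  refine (((hasSum_fourierCoeff_mul hg hf' k).add (hasSum_fourierCoeff_mul hf hg' k))).unique ?_
  convert! (hasSum_fourierCoeff_mul hf hf' k).mul_left (2 * Real.pi * Complex.I * (k i : ℂ)) using 1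
  funext l
  rw [h.2.2, h'.2.2, Pi.sub_apply, Int.cast_sub]
  ring

/-- The derivative symbol vanishes at frequency zero. Combined with the Leibniz rule, this is
integration by parts on the torus. -/
theorem HasWeakPartial.integral_eq_zero {i : Fin 2} {f g : Torus → ℝ} (h : HasWeakPartial i f g) :
    ∫ x, g x ∂torusMeasure = 0 := by
  have := h.2.2 0
  rw [fourierCoeff_zero_eq] at this
  simpa using this

theorem norm_derivSymbol_le (i : Fin 2) (k : Freq) (z : ℂ) :
    ‖2 * Real.pi * Complex.I * (k i : ℂ) * z‖ ≤ wt 1 k * ‖z‖ := by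
  rw [norm_mul]
  gcongr
  refine le_trans (le_of_eq ?_) (abs_two_pi_mul_le k i)
  simp [abs_mul]

theorem enorm_derivSymbol_le (i : Fin 2) (k : Freq) (z : ℂ) :
    ‖2 * Real.pi * Complex.I * (k i : ℂ) * z‖ₑ ≤ ew 1 k * ‖z‖ₑ := by
  rw [← ofReal_norm, ← ofReal_norm, ew, ← ENNReal.ofReal_mul (wt_pos _ _).le]
  exact ENNReal.ofReal_le_ofReal (norm_derivSymbol_le i k z)

theorem HasWeakPartial.sobE_le {i : Fin 2} {f g : Torus → ℝ} (h : HasWeakPartial i f g) {s t : ℝ}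
    (hst : s + 1 = t) : sobE s g ≤ sobE t f := by
  refine ENNReal.tsum_le_tsum fun k => ?_
  rw [h.2.2, ← hst, ew_add, mul_assoc (ew s k)]
  exact pow_le_pow_left' (mul_le_mul_right (enorm_derivSymbol_le i k _) _) 2

/-- An exact identity, since `wt 1 k ^ 2` is one plus the squared moduli of the derivative symbols.
It reduces bounds in `H^{s+1}` to bounds on the gradient in `H^s`. -/
theorem sobE_add_one_eq {f : Torus → ℝ} {g : Fin 2 → Torus → ℝ} (h : ∀ i, HasWeakPartial i f (g i))
    (s : ℝ) : sobE (s + 1) f = sobE s f + ∑ i, sobE s (g i) := by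
  simp only [sobE, Fin.sum_univ_two]
  rw [← ENNReal.tsum_add, ← ENNReal.tsum_add]
  congr 1; funext k
  rw [(h 0).2.2, (h 1).2.2, ew_add]
  simp only [mul_pow, enorm_mul]
  have e1 : ∀ i, ‖(k i : ℂ)‖ₑ ^ 2 = ENNReal.ofReal ((k i : ℝ) ^ 2) := fun i => by
    rw [← ofReal_norm, ← ENNReal.ofReal_pow (norm_nonneg _)]
    congr 1
    rw [Complex.norm_intCast, sq_abs]
  have e2 : ‖(2 : ℂ)‖ₑ ^ 2 * ‖(Real.pi : ℂ)‖ₑ ^ 2 * ‖Complex.I‖ₑ ^ 2 =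
      ENNReal.ofReal (4 * Real.pi ^ 2) := by
    simp only [← ofReal_norm]
    rw [← ENNReal.ofReal_pow (norm_nonneg _), ← ENNReal.ofReal_pow (norm_nonneg _),
      ← ENNReal.ofReal_pow (norm_nonneg _), ← ENNReal.ofReal_mul (by positivity),
      ← ENNReal.ofReal_mul (by positivity)]
    congr 1
    simp [sq_abs]; ring
  have e3 : ew 1 k ^ 2 = 1 + ENNReal.ofReal (4 * Real.pi ^ 2) * (ENNReal.ofReal ((k 0 : ℝ) ^ 2) +
      ENNReal.ofReal ((k 1 : ℝ) ^ 2)) := by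
    rw [ew, ← ENNReal.ofReal_pow (wt_pos _ _).le, wt_one_sq, ENNReal.ofReal_add zero_le_one
      (laplaceSymbol_nonneg k), ENNReal.ofReal_one, laplaceSymbol, Fin.sum_univ_two,
      ENNReal.ofReal_mul (by positivity), ENNReal.ofReal_add (by positivity) (by positivity)]
  rw [e3, e1, e1, e2]
  ring

/-! ### Classical partial derivatives -/

theorem summable_norm_of_wsum {s : ℝ} {f : Torus → ℝ} (h : wsum s f ≠ ⊤) :
    Summable fun k => wt s k * ‖fourierCoeff f k‖ := by
  refine (ENNReal.summable_toReal h).congr fun k => ?_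
  rw [ENNReal.toReal_mul, ew, ENNReal.toReal_ofReal (wt_pos _ _).le, toReal_enorm]

theorem toReal_wsum {s : ℝ} (f : Torus → ℝ) :
    (wsum s f).toReal = ∑' k, wt s k * ‖fourierCoeff f k‖ := by
  rw [wsum, ENNReal.tsum_toReal_eq (fun k => by finiteness [ew_ne_top s k])]
  congr 1; funext k
  rw [ENNReal.toReal_mul, ew, ENNReal.toReal_ofReal (wt_pos _ _).le, toReal_enorm]

/-- The partial derivative `∂ⱼf` of a function with `wsum 1 f < ∞`. -/
def pd (j : Fin 2) (f : Torus → ℝ) : C(Torus, ℝ) :=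
  synth fun k => 2 * Real.pi * Complex.I * (k j : ℂ) * fourierCoeff f k

theorem derivSymbol_symm (j : Fin 2) (f : Torus → ℝ) (k : Freq) :
    2 * Real.pi * Complex.I * ((-k) j : ℂ) * fourierCoeff f (-k) =
      conj (2 * Real.pi * Complex.I * (k j : ℂ) * fourierCoeff f k) := by
  rw [fourierCoeff_neg_index]; simp [Complex.conj_ofNat]

theorem summable_derivSymbol {f : Torus → ℝ} (h : wsum 1 f ≠ ⊤) (j : Fin 2) :
    Summable fun k : Freq => ‖2 * Real.pi * Complex.I * (k j : ℂ) * fourierCoeff f k‖ :=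
  (summable_norm_of_wsum h).of_nonneg_of_le (fun _ => norm_nonneg _)
    fun k => norm_derivSymbol_le j k _

theorem fourierCoeff_pd {f : Torus → ℝ} (h : wsum 1 f ≠ ⊤) (j : Fin 2) (k : Freq) :
    fourierCoeff (pd j f) k = 2 * Real.pi * Complex.I * (k j : ℂ) * fourierCoeff f k :=
  fourierCoeff_synth (summable_derivSymbol h j) (derivSymbol_symm j f) k

theorem hasWeakPartial_pd {f : Torus → ℝ} (hf : Integrable f torusMeasure) (h : wsum 1 f ≠ ⊤)
    (j : Fin 2) : HasWeakPartial j f (pd j f) :=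
  ⟨hf, integrable_continuousMap _, fourierCoeff_pd h j⟩

theorem norm_pd_le {f : Torus → ℝ} (h : wsum 1 f ≠ ⊤) (j : Fin 2) :
    ‖pd j f‖ ≤ (wsum 1 f).toReal := by
  rw [toReal_wsum]
  exact (norm_synth_le (summable_derivSymbol h j)).trans
    ((summable_derivSymbol h j).tsum_le_tsum (fun k => norm_derivSymbol_le j k _)
      (summable_norm_of_wsum h))

theorem norm_le_wsum {f : C(Torus, ℝ)} (h : wsum 0 f ≠ ⊤) : ‖f‖ ≤ (wsum 0 f).toReal := by
  rw [toReal_wsum]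
  have hs := summable_norm_of_wsum h
  simp only [wt_zero, one_mul] at hs ⊢
  exact norm_le_tsum_norm_fourierCoeff hs

theorem pd_sub {f g : Torus → ℝ} (hf : Integrable f torusMeasure) (hg : Integrable g torusMeasure)
    (h : wsum 1 f ≠ ⊤) (h' : wsum 1 g ≠ ⊤) (h'' : wsum 1 (fun x => f x - g x) ≠ ⊤) (j : Fin 2) :
    pd j (fun x => f x - g x) = pd j f - pd j g :=
  eq_of_fourierCoeff_eq fun k => by
    have e := fourierCoeff_sub (integrable_continuousMap (pd j f))
      (integrable_continuousMap (pd j g)) k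
    have e' : fourierCoeff (pd j f - pd j g : C(Torus, ℝ)) k =
      fourierCoeff (pd j f) k - fourierCoeff (pd j g) k := e
    rw [e', fourierCoeff_pd h'', fourierCoeff_pd h, fourierCoeff_pd h', fourierCoeff_sub hf hg]
    ring

/-! ### Relation with the sequence spaces -/

theorem IsSobolevSeq.sobE_eq {s : ℝ} {f : Torus → ℝ} {a : EllTwo} (h : IsSobolevSeq s f a) :
    sobE s f = ‖a‖ₑ ^ 2 := by
  have h1 : ‖a‖ ^ 2 = ∑' k, ‖a k‖ ^ 2 := by
    have := lp.norm_rpow_eq_tsum (p := 2) (by norm_num) a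
    simpa using this
  have h2 : Summable fun k => ‖a k‖ ^ 2 := by
    simpa using (lp.memℓp a).summable (by norm_num)
  rw [← ofReal_norm, ← ENNReal.ofReal_pow (norm_nonneg _), h1,
    ENNReal.ofReal_tsum_of_nonneg (fun k => by positivity) h2, sobE]
  congr 1; funext k
  rw [h.2 k, norm_mul, mul_pow, mul_pow, Complex.norm_real, ENNReal.ofReal_mul (by positivity),
    ENNReal.ofReal_pow (norm_nonneg _), ENNReal.ofReal_pow (norm_nonneg _),
    ofReal_norm (fourierCoeff f k)]
  rw [show (1 + laplaceSymbol k) ^ (s / 2) = wt s k from rfl,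
    Real.norm_of_nonneg (wt_pos s k).le]
  rfl

theorem exists_isSobolevSeq {s : ℝ} {f : Torus → ℝ} (hf : MemLp f 2 torusMeasure)
    (h : sobE s f ≠ ⊤) : ∃ a : EllTwo, IsSobolevSeq s f a := by
  refine ⟨⟨fun k => ((wt s k : ℝ) : ℂ) * fourierCoeff f k, memℓp_gen ?_⟩, hf, fun k => rfl⟩
  have := ENNReal.summable_toReal h
  refine this.congr fun k => ?_
  rw [ENNReal.toReal_pow, ENNReal.toReal_mul, ew, ENNReal.toReal_ofReal (wt_pos _ _).le,
    toReal_enorm, norm_mul, Complex.norm_real, Real.norm_of_nonneg (wt_pos s k).le]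
  norm_num

theorem memSobolev_iff {s : ℝ} {f : Torus → ℝ} :
    MemSobolev s f ↔ MemLp f 2 torusMeasure ∧ sobE s f ≠ ⊤ :=
  ⟨fun ⟨a, ha⟩ => ⟨ha.1, by rw [ha.sobE_eq]; finiteness⟩,
    fun ⟨h1, h2⟩ => exists_isSobolevSeq h1 h2⟩

end SelfPropelled
end

noncomputable section
namespace SelfPropelled
open Filter Topology

/-! ### The chain rule -/

open scoped ComplexConjugate

theorem hasWeakPartial_const (i : Fin 2) (c : ℝ) :
    HasWeakPartial i (fun _ => c) (fun _ => 0) := by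
  refine ⟨integrable_const _, integrable_const _, fun k => ?_⟩
  have h0 : fourierCoeff (fun _ : Torus => (0 : ℝ)) k = 0 := by simp [fourierCoeff_def]
  rw [h0]
  by_cases hk : k = 0
  · simp [hk]
  · have h1 := mFourierCoeff_mFourier k 0
    rw [if_neg hk] at h1
    have h2 : fourierCoeff (fun _ : Torus => c) k = 0 := by
      rw [fourierCoeff_def, integral_mul_const]
      simp only [UnitAddTorus.mFourier_zero, ContinuousMap.one_apply, mul_one] at h1
      rw [h1, zero_mul]
    rw [h2, mul_zero]

theorem memLp_comp {F : ℝ → ℝ} (hF : Continuous F) (f : C(Torus, ℝ)) (p : ℝ≥0∞) :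
    MemLp (fun x => F (f x)) p torusMeasure :=
  memLp_continuousMap (⟨fun x => F (f x), hF.comp f.continuous⟩ : C(Torus, ℝ)) p

theorem memLp_bdd_mul {u : Torus → ℝ} (f : C(Torus, ℝ)) (hu : MemLp u 2 torusMeasure) :
    MemLp (fun x => f x * u x) 2 torusMeasure :=
  MemLp.mul (r := 2) (p := ⊤) (q := 2) hu (memLp_continuousMap f ⊤)

theorem HasWeakPartial.pow {i : Fin 2} {f : C(Torus, ℝ)} {g : Torus → ℝ}
    (h : HasWeakPartial i f g) (hg : MemLp g 2 torusMeasure) (n : ℕ) :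
    HasWeakPartial i (fun x => f x ^ n) (fun x => n * f x ^ (n - 1) * g x) := by
  induction n with
  | zero => simpa using hasWeakPartial_const i 1
  | succ n ih =>
    have h1 : MemLp (fun x => (n : ℝ) * f x ^ (n - 1) * g x) 2 torusMeasure :=
      memLp_bdd_mul ((n : ℝ) • f ^ (n - 1)) hg
    have := ih.mul h (memLp_continuousMap (f ^ n) 2) h1 (memLp_continuousMap f 2) hg
    refine this.congr (Eventually.of_forall fun x => (pow_succ _ _).symm)
      (Eventually.of_forall fun x => ?_)
    simp only
    rcases n with _ | n
    · simp
    · simp only [Nat.add_sub_cancel]; push_cast; ring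

theorem HasWeakPartial.polynomial {i : Fin 2} {f : C(Torus, ℝ)} {g : Torus → ℝ}
    (h : HasWeakPartial i f g) (hg : MemLp g 2 torusMeasure) (P : Polynomial ℝ) :
    HasWeakPartial i (fun x => P.eval (f x)) (fun x => P.derivative.eval (f x) * g x) := by
  induction P using Polynomial.induction_on' with
  | add P Q hP hQ =>
    refine (hP.add hQ).congr (Eventually.of_forall fun x => ?_) (Eventually.of_forall fun x => ?_)
    · simp
    · simp [add_mul]
  | monomial n a =>
    refine ((h.pow hg n).const_mul a).congr (Eventually.of_forall fun x => ?_)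
      (Eventually.of_forall fun x => ?_)
    · simp
    · simp only [Polynomial.derivative_monomial, Polynomial.eval_monomial]; ring

theorem exists_polynomial_derivative_eq (P : Polynomial ℝ) :
    ∃ Q : Polynomial ℝ, Q.derivative = P := by
  induction P using Polynomial.induction_on' with
  | add P Q hP hQ =>
    obtain ⟨A, rfl⟩ := hP
    obtain ⟨B, rfl⟩ := hQ
    exact ⟨A + B, by simp⟩
  | monomial n a =>
    refine ⟨Polynomial.monomial (n + 1) (a / (n + 1)), ?_⟩
    rw [Polynomial.derivative_monomial]
    simp only [Nat.add_sub_cancel]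
    congr 1
    push_cast
    field_simp

/-- Weierstrass approximation is applied to the derivative and then integrated, so that both `F` and
its derivative are approximated. -/
theorem exists_polynomial_near_with_deriv {F : ℝ → ℝ} (hF : ContDiff ℝ 1 F) {M ε : ℝ} (hM : 0 ≤ M)
    (hε : 0 < ε) : ∃ Q : Polynomial ℝ, ∀ x ∈ Icc (-M) M,
      |Q.derivative.eval x - deriv F x| ≤ ε ∧ |Q.eval x - F x| ≤ ε * M := by
  obtain ⟨P, hP⟩ := exists_polynomial_near_of_continuousOn (-M) M (deriv F)
    (hF.continuous_deriv le_rfl).continuousOn ε hε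
  obtain ⟨Q, hQ⟩ := exists_polynomial_derivative_eq P
  -- The constant makes the polynomial agree with `F` at `0`; the mean value inequality then bounds
  -- the error by `ε * M`.
  refine ⟨Q + Polynomial.C (F 0 - Q.eval 0), fun x hx => ⟨?_, ?_⟩⟩
  · simpa [hQ] using (hP x hx).le
  · have hd : ∀ y ∈ Icc (-M) M, HasDerivWithinAt
        (fun y => (Q + Polynomial.C (F 0 - Q.eval 0)).eval y - F y)
        (P.eval y - deriv F y) (Icc (-M) M) y := fun y _ => by
      have h1 := (Q + Polynomial.C (F 0 - Q.eval 0)).hasDerivAt y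
      simp only [Polynomial.derivative_add, Polynomial.derivative_C, add_zero, hQ] at h1
      exact (h1.sub (hF.differentiable one_ne_zero y).hasDerivAt).hasDerivWithinAt
    have h0 : (0 : ℝ) ∈ Icc (-M) M := ⟨by linarith, hM⟩
    have := (convex_Icc (-M) M).norm_image_sub_le_of_norm_hasDerivWithin_le hd
      (fun y hy => (hP y hy).le) h0 hx
    simp only [Polynomial.eval_add, Polynomial.eval_C, sub_zero, Real.norm_eq_abs] at this ⊢
    refine le_trans (by simpa using this) ?_
    gcongr
    exact abs_le.2 hx

/-- The chain rule for weak partial derivatives. -/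
theorem HasWeakPartial.comp {i : Fin 2} {f : C(Torus, ℝ)} {g : Torus → ℝ}
    (h : HasWeakPartial i f g) (hg : MemLp g 2 torusMeasure) {F : ℝ → ℝ} (hF : ContDiff ℝ 1 F) :
    HasWeakPartial i (fun x => F (f x)) (fun x => deriv F (f x) * g x) := by
  have hgi : Integrable g torusMeasure := hg.integrable (by norm_num)
  have hint : ∀ {G : ℝ → ℝ}, Continuous G → Integrable (fun x => G (f x)) torusMeasure :=
    fun hG => memLp_one_iff_integrable.1 (memLp_comp hG f 1)
  have hint' : ∀ {G : ℝ → ℝ}, Continuous G → Integrable (fun x => G (f x) * g x) torusMeasure :=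
    fun hG => (memLp_comp hG f 2).integrable_mul hg
  have hd := hF.continuous_deriv le_rfl
  refine ⟨hint hF.continuous, hint' hd, fun k => ?_⟩
  set z : ℂ := 2 * Real.pi * Complex.I * (k i : ℂ)
  refine eq_of_forall_dist_le fun ε hε => ?_
  set B := ∫ x, |g x| ∂torusMeasure
  have hB : 0 ≤ B := integral_nonneg fun x => abs_nonneg _
  -- The identity is exact for polynomials. With accuracy `ε / D` the two approximation errors add
  -- up to at most `ε`; the `1` keeps `D` positive.
  set D := B + ‖z‖ * ‖f‖ + 1
  have hD : 0 < D := by positivity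
  obtain ⟨Q, hQ⟩ := exists_polynomial_near_with_deriv hF (norm_nonneg f) (div_pos hε hD)
  have hmem : ∀ x, f x ∈ Icc (-‖f‖) ‖f‖ := fun x => abs_le.1 (f.norm_coe_le_norm x)
  have hQw := (h.polynomial hg Q).2.2 k
  have h1 : ‖fourierCoeff (fun x => Q.derivative.eval (f x) * g x) k -
      fourierCoeff (fun x => deriv F (f x) * g x) k‖ ≤ ε / D * B := by
    rw [← fourierCoeff_sub (hint' Q.derivative.continuous) (hint' hd)]
    refine (norm_fourierCoeff_le _ k).trans ?_
    rw [← integral_const_mul]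
    refine integral_mono (((hint' Q.derivative.continuous).sub (hint' hd)).abs)
      (hgi.abs.const_mul _) fun x => ?_
    simp only
    rw [← sub_mul, abs_mul]
    gcongr
    exact (hQ _ (hmem x)).1
  have h2 : ‖fourierCoeff (fun x => Q.eval (f x)) k - fourierCoeff (fun x => F (f x)) k‖ ≤
      ε / D * ‖f‖ := by
    rw [← fourierCoeff_sub (hint Q.continuous) (hint hF.continuous)]
    refine (norm_fourierCoeff_le _ k).trans ?_
    calc _ ≤ ∫ _x, ε / D * ‖f‖ ∂torusMeasure :=
          integral_mono ((hint Q.continuous).sub (hint hF.continuous)).abs (integrable_const _)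
            fun x => (hQ _ (hmem x)).2
      _ = _ := by simp
  rw [dist_eq_norm]
  calc _ = ‖z * (fourierCoeff (fun x => Q.eval (f x)) k - fourierCoeff (fun x => F (f x)) k) -
        (fourierCoeff (fun x => Q.derivative.eval (f x) * g x) k -
          fourierCoeff (fun x => deriv F (f x) * g x) k)‖ := by rw [hQw]; congr 1; ring
    _ ≤ ‖z‖ * (ε / D * ‖f‖) + ε / D * B := by
        refine (norm_sub_le _ _).trans ?_
        rw [norm_mul]
        gcongr
    _ = ε * ((B + ‖z‖ * ‖f‖) / D) := by ring
    _ ≤ ε * 1 := by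
        gcongr
        rw [div_le_one hD]
        simp only [D]; linarith
    _ = ε := mul_one ε

theorem exists_hasWeakPartial {f : Torus → ℝ} (hf : Integrable f torusMeasure)
    (h : sobE 1 f ≠ ⊤) (i : Fin 2) :
    ∃ g : Torus → ℝ, MemLp g 2 torusMeasure ∧ HasWeakPartial i f g := by
  obtain ⟨g, hg, hc⟩ := exists_memLp_of_coeff
    (a := fun k => 2 * Real.pi * Complex.I * (k i : ℂ) * fourierCoeff f k) (by
      have := ENNReal.summable_toReal h
      refine this.of_nonneg_of_le (fun _ => by positivity) fun k => ?_
      rw [ENNReal.toReal_pow, ENNReal.toReal_mul, ew, ENNReal.toReal_ofReal (wt_pos _ _).le,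
        toReal_enorm]
      gcongr
      exact norm_derivSymbol_le i k _) (derivSymbol_symm i f)
  exact ⟨g, hg, hf, hg.integrable (by norm_num), hc⟩

theorem sobE_zero_bdd_mul_le {u v : Torus → ℝ} (hu : AEStronglyMeasurable u torusMeasure)
    (hv : MemLp v 2 torusMeasure) {B : ℝ} (hB : ∀ x, |u x| ≤ B) :
    sobE 0 (fun x => u x * v x) ≤ ENNReal.ofReal (B ^ 2) * sobE 0 v := by
  have hm : MemLp (fun x => u x * v x) 2 torusMeasure :=
    MemLp.mul (r := 2) (p := ⊤) (q := 2) hv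
      (memLp_top_of_bound hu B (Eventually.of_forall hB))
  rw [sobE_zero_eq hm, sobE_zero_eq hv, ← ENNReal.ofReal_mul (sq_nonneg B)]
  refine ENNReal.ofReal_le_ofReal ?_
  rw [← integral_const_mul]
  refine integral_mono hm.integrable_sq (hv.integrable_sq.const_mul _) fun x => ?_
  simp only
  rw [mul_pow, ← sq_abs (u x)]
  have := hB x
  gcongr

/-! ### Composition with smooth functions -/

theorem exists_bound_of_sobE_le {m : ℝ} (hm : 2 < m) {R : ℝ≥0∞} (hR : R ≠ ⊤) :
    ∃ M : ℝ, 0 ≤ M ∧ ∀ f : Torus → ℝ, sobE m f ≤ R → wsum 1 f ≤ ENNReal.ofReal M := by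
  obtain ⟨C, hC, hle⟩ := exists_wsum_sq_le (s := 1) (t := m) (by linarith)
  refine ⟨((C * R) ^ (1 / 2 : ℝ)).toReal, ENNReal.toReal_nonneg, fun f hf => ?_⟩
  rw [ENNReal.ofReal_toReal (by finiteness)]
  have h1 : wsum 1 f ^ 2 ≤ C * R := (hle f).trans (by gcongr)
  calc wsum 1 f = (wsum 1 f ^ 2) ^ (1 / 2 : ℝ) := by
        rw [← ENNReal.rpow_natCast, ← ENNReal.rpow_mul]; norm_num
    _ ≤ _ := by gcongr

theorem exists_norm_pd_le {m : ℝ} (hm : 2 < m) {R : ℝ≥0∞} (hR : R ≠ ⊤) :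
    ∃ M : ℝ, 0 ≤ M ∧ ∀ f : C(Torus, ℝ), sobE m f ≤ R → ‖f‖ ≤ M ∧ ∀ j, ‖pd j f‖ ≤ M := by
  obtain ⟨M, hM, h⟩ := exists_bound_of_sobE_le hm hR
  refine ⟨M, hM, fun f hf => ?_⟩
  have h1 := h f hf
  have h0 : wsum 0 f ≤ ENNReal.ofReal M := (wsum_mono zero_le_one f).trans h1
  have t1 := ne_top_of_le_ne_top ENNReal.ofReal_ne_top h1
  have t0 := ne_top_of_le_ne_top ENNReal.ofReal_ne_top h0
  exact ⟨(norm_le_wsum t0).trans (ENNReal.toReal_le_of_le_ofReal hM h0),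
    fun j => (norm_pd_le t1 j).trans (ENNReal.toReal_le_of_le_ofReal hM h1)⟩

theorem exists_abs_comp_le {F : ℝ → ℝ} (hF : Continuous F) (M : ℝ) :
    ∃ B : ℝ, 0 ≤ B ∧ ∀ f : C(Torus, ℝ), ‖f‖ ≤ M → ∀ x, |F (f x)| ≤ B := by
  obtain ⟨B, hB⟩ := (isCompact_Icc (a := -M) (b := M)).exists_bound_of_continuousOn hF.continuousOn
  refine ⟨max B 0, le_max_right _ _, fun f hf x => (hB _ ?_).trans (le_max_left _ _)⟩
  exact abs_le.1 ((f.norm_coe_le_norm x).trans hf)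

theorem wsum_one_ne_top {m : ℝ} (hm : 2 < m) {f : Torus → ℝ} (hf : sobE m f ≠ ⊤) :
    wsum 1 f ≠ ⊤ := wsum_ne_top (by linarith) hf

theorem hasWeakPartial_comp_pd {m : ℝ} (hm : 2 < m) {f : C(Torus, ℝ)} (hf : sobE m f ≠ ⊤)
    {F : ℝ → ℝ} (hF : ContDiff ℝ 1 F) (j : Fin 2) :
    HasWeakPartial j (fun x => F (f x)) (fun x => deriv F (f x) * pd j f x) :=
  (hasWeakPartial_pd (integrable_continuousMap f) (wsum_one_ne_top hm hf) j).comp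
    (memLp_continuousMap _ 2) hF

theorem exists_sobE_comp_le_zero {F : ℝ → ℝ} (hF : Continuous F) {m : ℝ} (hm : 2 < m) {R : ℝ≥0∞}
    (hR : R ≠ ⊤) : ∃ C : ℝ≥0∞, C ≠ ⊤ ∧ ∀ f : C(Torus, ℝ), sobE m f ≤ R →
      sobE 0 (fun x => F (f x)) ≤ C := by
  obtain ⟨M, -, hM⟩ := exists_norm_pd_le hm hR
  obtain ⟨B, -, hB⟩ := exists_abs_comp_le hF M
  exact ⟨_, ENNReal.ofReal_ne_top, fun f hf => sobE_zero_le_of_bound (memLp_comp hF f 2).1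
    (Eventually.of_forall (hB f (hM f hf).1))⟩

theorem exists_sobE_comp_le_one {F : ℝ → ℝ} (hF : ContDiff ℝ 1 F) {m : ℝ} (hm : 2 < m) {R : ℝ≥0∞}
    (hR : R ≠ ⊤) : ∃ C : ℝ≥0∞, C ≠ ⊤ ∧ ∀ f : C(Torus, ℝ), sobE m f ≤ R →
      sobE 1 (fun x => F (f x)) ≤ C := by
  obtain ⟨M, hM0, hM⟩ := exists_norm_pd_le hm hR
  obtain ⟨B, hB0, hB⟩ := exists_abs_comp_le (hF.continuous_deriv le_rfl) M
  obtain ⟨C, hC, hle⟩ := exists_sobE_comp_le_zero hF.continuous hm hR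
  refine ⟨C + ∑ _i : Fin 2, ENNReal.ofReal ((B * M) ^ 2), by
    simp only [Fin.sum_univ_two]; finiteness, fun f hf => ?_⟩
  have := sobE_add_one_eq (hasWeakPartial_comp_pd hm (ne_top_of_le_ne_top hR hf) hF) 0
  rw [zero_add] at this
  rw [this]
  gcongr with i
  · exact hle f hf
  · refine sobE_zero_le_of_bound
      ((memLp_comp (hF.continuous_deriv le_rfl) f 2).1.mul (pd i f).continuous.aestronglyMeasurable)
      (Eventually.of_forall fun x => ?_)
    simp only [Pi.mul_apply]
    rw [abs_mul]
    gcongr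
    · exact hB f (hM f hf).1 x
    · exact ((pd i f).norm_coe_le_norm x).trans ((hM f hf).2 i)

/-- The base of the bootstrap is done by hand, because `H^1` lies below the algebra range. In
`F''(f) ∂f ∂f + F'(f) ∂²f` everything is bounded except `∂²f`, which enters linearly and is square
integrable. -/
theorem exists_sobE_comp_le_two {F : ℝ → ℝ} (hF : ContDiff ℝ 2 F) {m : ℝ} (hm : 2 < m) {R : ℝ≥0∞}
    (hR : R ≠ ⊤) : ∃ C : ℝ≥0∞, C ≠ ⊤ ∧ ∀ f : C(Torus, ℝ), sobE m f ≤ R →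
      sobE 2 (fun x => F (f x)) ≤ C := by
  have hF1 : ContDiff ℝ 1 F := hF.of_le (by norm_num)
  have hF' : ContDiff ℝ 1 (deriv F) := ((contDiff_succ_iff_deriv (n := 1)).1 hF).2.2
  have c1 := hF'.continuous
  have c2 := hF'.continuous_deriv le_rfl
  obtain ⟨M, hM0, hM⟩ := exists_norm_pd_le hm hR
  obtain ⟨B, hB0, hB⟩ := exists_abs_comp_le c1 M
  obtain ⟨B', hB0', hB'⟩ := exists_abs_comp_le c2 M
  obtain ⟨C, hC, hle⟩ := exists_sobE_comp_le_one hF1 hm hR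
  refine ⟨C + ∑ _i : Fin 2, (ENNReal.ofReal ((B * M) ^ 2) + ∑ _j : Fin 2,
    (2 * ENNReal.ofReal ((B' * M * M) ^ 2) + 2 * (ENNReal.ofReal (B ^ 2) * R))), by
    simp only [Fin.sum_univ_two]; finiteness,
    fun f hf => ?_⟩
  have hft := ne_top_of_le_ne_top hR hf
  have hfM := hM f hf
  have hpd : ∀ i x, |pd i f x| ≤ M := fun i x => ((pd i f).norm_coe_le_norm x).trans (hfM.2 i)
  have hw := hasWeakPartial_pd (integrable_continuousMap f) (wsum_one_ne_top hm hft)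
  have e1 := sobE_add_one_eq (hasWeakPartial_comp_pd hm hft hF1) 1
  rw [one_add_one_eq_two] at e1
  rw [e1]
  gcongr with i
  · exact hle f hf
  have h2f : ∀ i, sobE 1 (pd i f) ≤ R := fun i =>
    ((hw i).sobE_le (by norm_num)).trans ((sobE_mono hm.le f).trans hf)
  choose D hD hDw using fun j => exists_hasWeakPartial (integrable_continuousMap (pd i f))
    (ne_top_of_le_ne_top hR (h2f i)) j
  have m1 : ∀ j, MemLp (fun x => deriv (deriv F) (f x) * pd j f x) 2 torusMeasure := fun j =>
    memLp_bdd_mul ⟨fun x => deriv (deriv F) (f x), c2.comp f.continuous⟩ (memLp_continuousMap _ 2)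
  have hprod := fun j => (hasWeakPartial_comp_pd hm hft hF' j).mul (hDw j)
    (memLp_comp c1 f 2) (m1 j) (memLp_continuousMap _ 2) (hD j)
  have e2 := sobE_add_one_eq hprod 0
  rw [zero_add] at e2
  rw [e2]
  gcongr with j
  · refine sobE_zero_le_of_bound
      ((memLp_comp c1 f 2).1.mul (pd i f).continuous.aestronglyMeasurable)
      (Eventually.of_forall fun x => ?_)
    simp only [Pi.mul_apply]
    rw [abs_mul]
    gcongr
    · exact hB f hfM.1 x
    · exact hpd i x
  · have hi1 : MemLp (fun x => deriv (deriv F) (f x) * pd j f x * pd i f x) 2 torusMeasure := by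
      refine (memLp_bdd_mul (pd i f) (m1 j)).congr_norm ?_ ?_
      · exact (m1 j).1.mul (pd i f).continuous.aestronglyMeasurable
      · exact Eventually.of_forall fun x => by rw [mul_comm]
    have hi2 : MemLp (fun x => deriv F (f x) * D j x) 2 torusMeasure :=
      memLp_bdd_mul ⟨fun x => deriv F (f x), c1.comp f.continuous⟩ (hD j)
    refine (sobE_add_le 0 (hi1.integrable (by norm_num)) (hi2.integrable (by norm_num))).trans ?_
    gcongr
    · refine sobE_zero_le_of_bound hi1.1 (Eventually.of_forall fun x => ?_)
      rw [abs_mul, abs_mul]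
      gcongr
      · exact hB' f hfM.1 x
      · exact hpd j x
      · exact hpd i x
    · refine (sobE_zero_bdd_mul_le (memLp_comp c1 f 2).1 (hD j) (hB f hfM.1)).trans ?_
      gcongr
      exact ((hDw j).sobE_le (by norm_num)).trans (h2f i)

/-- Composition with a smooth function is bounded on bounded subsets of `H^m`, `m > 2`. -/
theorem exists_sobE_comp_le {F : ℝ → ℝ} (hF : ContDiff ℝ ∞ F) {m : ℝ} (hm : 2 < m) {R : ℝ≥0∞}
    (hR : R ≠ ⊤) : ∃ C : ℝ≥0∞, C ≠ ⊤ ∧ ∀ f : C(Torus, ℝ), sobE m f ≤ R →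
      sobE m (fun x => F (f x)) ≤ C := by
  -- Bootstrap on `∂(F(f)) = F'(f) ∂f`: the induction hypothesis for the derivative of `F` gains one
  -- order at each step, until the cap `m` set by `f` is reached.
  have key : ∀ n : ℕ, ∀ F : ℝ → ℝ, ContDiff ℝ ∞ F → ∃ C : ℝ≥0∞, C ≠ ⊤ ∧ ∀ f : C(Torus, ℝ),
      sobE m f ≤ R → sobE (min (2 + n) m) (fun x => F (f x)) ≤ C := by
    intro n
    induction n with
    | zero =>
      intro F hF
      rw [Nat.cast_zero, add_zero, min_eq_left hm.le]
      exact exists_sobE_comp_le_two (contDiff_infty.1 hF 2) hm hR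
    | succ n ih =>
      intro F hF
      have hF1 : ContDiff ℝ 1 F := contDiff_infty.1 hF 1
      have hF' : ContDiff ℝ ∞ (deriv F) := (contDiff_infty_iff_deriv.1 hF).2
      obtain ⟨C1, hC1, h1⟩ := ih F hF
      obtain ⟨C2, hC2, h2⟩ := ih (deriv F) hF'
      -- The target order less one: it exceeds `1`, so `H^τ` is an algebra, and it does not exceed
      -- the order already reached.
      set τ := min (2 + (n + 1 : ℕ) : ℝ) m - 1 with hτ
      have hn : (0 : ℝ) ≤ n := Nat.cast_nonneg n
      have hτ1 : 1 < τ := by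
        rw [hτ, lt_sub_iff_add_lt, lt_min_iff]; push_cast; constructor <;> linarith
      have hτ2 : τ ≤ min (2 + (n : ℝ)) m := by
        rw [hτ, le_min_iff]
        constructor
        · have := min_le_left (2 + (n + 1 : ℕ) : ℝ) m
          push_cast at this ⊢; linarith
        · have := min_le_right (2 + (n + 1 : ℕ) : ℝ) m
          linarith
      have hτ3 : τ + 1 ≤ m := by rw [hτ, sub_add_cancel]; exact min_le_right _ _
      obtain ⟨A, hA, hmul⟩ := exists_sobE_mul_le hτ1
      refine ⟨C1 + ∑ _i : Fin 2, A * (C2 * R), by simp only [Fin.sum_univ_two]; finiteness,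
        fun f hf => ?_⟩
      have hft := ne_top_of_le_ne_top hR hf
      have hw := hasWeakPartial_pd (integrable_continuousMap f) (wsum_one_ne_top hm hft)
      have e := sobE_add_one_eq (hasWeakPartial_comp_pd hm hft hF1) τ
      rw [hτ, sub_add_cancel, ← hτ] at e
      rw [e]
      gcongr with i
      · exact (sobE_mono hτ2 _).trans (h1 f hf)
      · refine (hmul _ _ (memLp_comp hF'.continuous f 2) (memLp_continuousMap _ 2)).trans ?_
        gcongr
        · exact (sobE_mono hτ2 _).trans (h2 f hf)
        · exact ((hw i).sobE_le rfl).trans ((sobE_mono hτ3 f).trans hf)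
  obtain ⟨n, hn⟩ := exists_nat_ge m
  have := key n F hF
  rwa [min_eq_right (by linarith)] at this

/-- A smooth function on `(0, ∞)` agrees on `(δ, ∞)` with a smooth function on `ℝ`. -/
theorem exists_contDiff_eqOn {F : ℝ → ℝ} (hF : ContDiffOn ℝ ∞ F (Ioi 0)) {δ : ℝ} (hδ : 0 < δ) :
    ∃ G : ℝ → ℝ, ContDiff ℝ ∞ G ∧ ∀ x, δ < x → G x = F x := by
  -- The factor vanishes for `x ≤ δ / 2` and equals `1` for `x ≥ δ`, so the values of `F` at
  -- nonpositive points do not matter.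
  refine ⟨fun x => Real.smoothTransition ((x - δ / 2) / (δ / 2)) * F x, ?_, fun x hx => ?_⟩
  · rw [contDiff_iff_contDiffAt]
    intro x
    rcases lt_or_ge 0 x with h | h
    · refine ContDiffAt.mul ?_ (hF.contDiffAt (Ioi_mem_nhds h))
      exact Real.smoothTransition.contDiff.contDiffAt.comp x
        ((contDiffAt_id.sub contDiffAt_const).div_const _)
    · refine (contDiffAt_const (c := (0 : ℝ))).congr_of_eventuallyEq ?_
      filter_upwards [Iio_mem_nhds (show x < δ / 2 by linarith)] with y hy
      rw [Real.smoothTransition.zero_of_nonpos, zero_mul]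
      exact div_nonpos_of_nonpos_of_nonneg (by linarith [mem_Iio.1 hy]) (by linarith)
  · simp only
    rw [Real.smoothTransition.one_of_one_le, one_mul]
    rw [le_div_iff₀ (by linarith)]; linarith

end SelfPropelled
end

noncomputable section
namespace SelfPropelled
open Filter Topology

/-! ### The symmetrised system -/

open scoped ComplexConjugate

/-- The cosine as a bundled continuous map. -/
def cosMap : C(ℝ, ℝ) := ⟨Real.cos, Real.continuous_cos⟩

/-- The sine as a bundled continuous map. -/
def sinMap : C(ℝ, ℝ) := ⟨Real.sin, Real.continuous_sin⟩

theorem contDiff_cosMap : ContDiff ℝ ∞ cosMap := Real.contDiff_cos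
theorem contDiff_sinMap : ContDiff ℝ ∞ sinMap := Real.contDiff_sin

/-- `-(Ω·∇r + a(r) Ω^⊥·∇φ)`, the gradients being given as separate arguments. -/
def rhsDensity (a : C(ℝ, ℝ)) (r φ : C(Torus, ℝ)) (dr dφ : Fin 2 → C(Torus, ℝ)) : C(Torus, ℝ) :=
  -(cosMap.comp φ * dr 0 + sinMap.comp φ * dr 1 + (a.comp r * cosMap.comp φ) * dφ 1
    - (a.comp r * sinMap.comp φ) * dφ 0)

/-- `-(c Ω·∇φ + a(r) Ω^⊥·∇r) + 2μ b(r) ∇r·∇φ`, the gradients being given as separate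
arguments. -/
def rhsAngle (c μ : ℝ) (a b : C(ℝ, ℝ)) (r φ : C(Torus, ℝ)) (dr dφ : Fin 2 → C(Torus, ℝ)) :
    C(Torus, ℝ) :=
  -(c • (cosMap.comp φ * dφ 0 + sinMap.comp φ * dφ 1) + (a.comp r * cosMap.comp φ) * dr 1
    - (a.comp r * sinMap.comp φ) * dr 0) + (2 * μ) • (b.comp r * (dr 0 * dφ 0 + dr 1 * dφ 1))

/-- The right-hand side of the equation for `r`. -/
def fluxDensity (a : C(ℝ, ℝ)) (r φ : C(Torus, ℝ)) : C(Torus, ℝ) :=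
  rhsDensity a r φ (fun j => pd j r) (fun j => pd j φ)

/-- The right-hand side of the equation for `φ`, without the Laplacian. -/
def fluxAngle (c μ : ℝ) (a b : C(ℝ, ℝ)) (r φ : C(Torus, ℝ)) : C(Torus, ℝ) :=
  rhsAngle c μ a b r φ (fun j => pd j r) (fun j => pd j φ)

/-- `Φ(r, φ)` is bounded in `H^s` for `(r, φ)` bounded in `H^m`. -/
def SobBounded (m s : ℝ) (Φ : C(Torus, ℝ) → C(Torus, ℝ) → C(Torus, ℝ)) : Prop :=
  ∀ R : ℝ≥0∞, R ≠ ⊤ → ∃ C : ℝ≥0∞, C ≠ ⊤ ∧ ∀ r φ : C(Torus, ℝ), sobE m r ≤ R → sobE m φ ≤ R →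
    sobE s (Φ r φ) ≤ C

namespace SobBounded

variable {m s : ℝ} {Φ Ψ : C(Torus, ℝ) → C(Torus, ℝ) → C(Torus, ℝ)}

theorem mono {t : ℝ} (h : SobBounded m s Φ) (hst : t ≤ s) : SobBounded m t Φ := fun R hR => by
  obtain ⟨C, hC, hle⟩ := h R hR
  exact ⟨C, hC, fun r φ hr hφ => (sobE_mono hst _).trans (hle r φ hr hφ)⟩

theorem add (h : SobBounded m s Φ) (h' : SobBounded m s Ψ) :
    SobBounded m s fun r φ => Φ r φ + Ψ r φ := fun R hR => by
  obtain ⟨C, hC, hle⟩ := h R hR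
  obtain ⟨C', hC', hle'⟩ := h' R hR
  refine ⟨2 * C + 2 * C', by finiteness, fun r φ hr hφ => ?_⟩
  refine (sobE_add_le s (integrable_continuousMap (Φ r φ))
    (integrable_continuousMap (Ψ r φ))).trans ?_
  gcongr
  · exact hle r φ hr hφ
  · exact hle' r φ hr hφ

theorem smul (h : SobBounded m s Φ) (c : ℝ) : SobBounded m s fun r φ => c • Φ r φ := fun R hR => by
  obtain ⟨C, hC, hle⟩ := h R hR
  refine ⟨‖c‖ₑ ^ 2 * C, by finiteness, fun r φ hr hφ => ?_⟩
  refine (sobE_const_mul s c (Φ r φ)).le.trans ?_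
  gcongr
  exact hle r φ hr hφ

theorem neg (h : SobBounded m s Φ) : SobBounded m s fun r φ => -Φ r φ := by
  simpa using h.smul (-1)

theorem sub (h : SobBounded m s Φ) (h' : SobBounded m s Ψ) :
    SobBounded m s fun r φ => Φ r φ - Ψ r φ := by
  simpa [sub_eq_add_neg] using h.add h'.neg

theorem mul (hs : 1 < s) (h : SobBounded m s Φ) (h' : SobBounded m s Ψ) :
    SobBounded m s fun r φ => Φ r φ * Ψ r φ := fun R hR => by
  obtain ⟨C, hC, hle⟩ := h R hR
  obtain ⟨C', hC', hle'⟩ := h' R hR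
  obtain ⟨A, hA, hmul⟩ := exists_sobE_mul_le hs
  refine ⟨A * (C * C'), by finiteness, fun r φ hr hφ => ?_⟩
  refine (hmul _ _ (memLp_continuousMap (Φ r φ) 2) (memLp_continuousMap (Ψ r φ) 2)).trans ?_
  gcongr
  · exact hle r φ hr hφ
  · exact hle' r φ hr hφ

theorem comp_left (hm : 2 < m) {F : C(ℝ, ℝ)} (hF : ContDiff ℝ ∞ F) :
    SobBounded m m fun r _ => F.comp r := fun R hR => by
  obtain ⟨C, hC, hle⟩ := exists_sobE_comp_le hF hm hR
  exact ⟨C, hC, fun r _ hr _ => hle r hr⟩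

theorem comp_right (hm : 2 < m) {F : C(ℝ, ℝ)} (hF : ContDiff ℝ ∞ F) :
    SobBounded m m fun _ φ => F.comp φ := fun R hR => by
  obtain ⟨C, hC, hle⟩ := exists_sobE_comp_le hF hm hR
  exact ⟨C, hC, fun _ φ _ hφ => hle φ hφ⟩

theorem pd_left (hm : 2 < m) (j : Fin 2) : SobBounded m (m - 1) fun r _ => pd j r := fun R hR =>
  ⟨R, hR, fun r _ hr _ => ((hasWeakPartial_pd (integrable_continuousMap r)
    (wsum_one_ne_top hm (ne_top_of_le_ne_top hR hr)) j).sobE_le (by ring)).trans hr⟩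

theorem pd_right (hm : 2 < m) (j : Fin 2) : SobBounded m (m - 1) fun _ φ => pd j φ := fun R hR =>
  ⟨R, hR, fun _ φ _ hφ => ((hasWeakPartial_pd (integrable_continuousMap φ)
    (wsum_one_ne_top hm (ne_top_of_le_ne_top hR hφ)) j).sobE_le (by ring)).trans hφ⟩

end SobBounded

theorem sobBounded_gradProd {m : ℝ} (hm : 2 < m) {b : C(ℝ, ℝ)} (hb : ContDiff ℝ ∞ b) :
    SobBounded m (m - 1) fun r φ => b.comp r * (pd 0 r * pd 0 φ + pd 1 r * pd 1 φ) := by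
  have h1 : 1 < m - 1 := by linarith
  exact ((SobBounded.comp_left hm hb).mono (by linarith)).mul h1
    (((SobBounded.pd_left hm 0).mul h1 (SobBounded.pd_right hm 0)).add
      ((SobBounded.pd_left hm 1).mul h1 (SobBounded.pd_right hm 1)))

theorem sobBounded_fluxDensity {m : ℝ} (hm : 2 < m) {a : C(ℝ, ℝ)} (ha : ContDiff ℝ ∞ a) :
    SobBounded m (m - 1) (fluxDensity a) := by
  have h1 : 1 < m - 1 := by linarith
  have hc := (SobBounded.comp_right hm contDiff_cosMap).mono (show m - 1 ≤ m by linarith)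
  have hs := (SobBounded.comp_right hm contDiff_sinMap).mono (show m - 1 ≤ m by linarith)
  have ha' := (SobBounded.comp_left hm ha).mono (show m - 1 ≤ m by linarith)
  exact ((((hc.mul h1 (SobBounded.pd_left hm 0)).add (hs.mul h1 (SobBounded.pd_left hm 1))).add
    ((ha'.mul h1 hc).mul h1 (SobBounded.pd_right hm 1))).sub
    ((ha'.mul h1 hs).mul h1 (SobBounded.pd_right hm 0))).neg

theorem sobBounded_fluxAngle (c μ : ℝ) {m : ℝ} (hm : 2 < m) {a b : C(ℝ, ℝ)} (ha : ContDiff ℝ ∞ a)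
    (hb : ContDiff ℝ ∞ b) : SobBounded m (m - 1) (fluxAngle c μ a b) := by
  have h1 : 1 < m - 1 := by linarith
  have hc := (SobBounded.comp_right hm contDiff_cosMap).mono (show m - 1 ≤ m by linarith)
  have hs := (SobBounded.comp_right hm contDiff_sinMap).mono (show m - 1 ≤ m by linarith)
  have ha' := (SobBounded.comp_left hm ha).mono (show m - 1 ≤ m by linarith)
  exact (((((hc.mul h1 (SobBounded.pd_right hm 0)).add
    (hs.mul h1 (SobBounded.pd_right hm 1))).smul c).add
    ((ha'.mul h1 hc).mul h1 (SobBounded.pd_left hm 1))).sub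
    ((ha'.mul h1 hs).mul h1 (SobBounded.pd_left hm 0))).neg.add
      ((sobBounded_gradProd hm hb).smul (2 * μ))

/-! ### Convergence of gradients -/

/-- Finitely many modes tend to zero by hypothesis. The remaining ones are uniformly small, by
Cauchy–Schwarz, the `H^m` bound, and the summability of `ew (-(2 * (m - 1)))`, which needs `m > 2`.
-/
theorem tendsto_wsum_of_coeff {ι : Type*} {l : Filter ι} {m : ℝ} (hm : 2 < m) {f : ι → Torus → ℝ}
    {R : ℝ≥0∞} (hR : R ≠ ⊤) (hf : ∀ᶠ i in l, sobE m (f i) ≤ R)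
    (hc : ∀ k, Tendsto (fun i => fourierCoeff (f i) k) l (𝓝 0)) :
    Tendsto (fun i => wsum 1 (f i)) l (𝓝 0) := by
  have hsum : ∑' k : Freq, ew (-(2 * (m - 1))) k ≠ ⊤ := (tsum_ew_neg_lt_top (by linarith)).ne
  have hsq : Tendsto (fun i => wsum 1 (f i) ^ 2) l (𝓝 0) := by
    rw [ENNReal.tendsto_nhds_zero]
    intro ε hε
    have htail := ENNReal.tendsto_tsum_compl_atTop_zero hsum
    have htail' : Tendsto (fun s : Finset Freq =>
        2 * ((∑' k : { x // x ∉ s }, ew (-(2 * (m - 1))) k) * R)) atTop (𝓝 0) := by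
      have := ENNReal.Tendsto.const_mul (a := 2)
        (ENNReal.Tendsto.mul_const htail (Or.inr hR)) (Or.inr (by norm_num))
      simpa using this
    obtain ⟨S, hS⟩ := ((ENNReal.tendsto_nhds_zero.1 htail') (ε / 2)
      (ENNReal.half_pos hε.ne')).exists
    have hfin : Tendsto (fun i => 2 * (∑ k ∈ S, ew 1 k * ‖fourierCoeff (f i) k‖ₑ) ^ 2) l (𝓝 0) := by
      have h1 : Tendsto (fun i => ∑ k ∈ S, ew 1 k * ‖fourierCoeff (f i) k‖ₑ) l
          (𝓝 (∑ k ∈ S, ew 1 k * 0)) := by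
        refine tendsto_finsetSum _ fun k _ => ENNReal.Tendsto.const_mul ?_ (Or.inr (ew_ne_top 1 k))
        simpa using (hc k).enorm
      simp only [mul_zero, Finset.sum_const_zero] at h1
      have h2 := ENNReal.Tendsto.const_mul (a := 2)
        (ENNReal.Tendsto.pow (n := 2) h1) (Or.inr (by norm_num))
      simpa using h2
    filter_upwards [hf, (ENNReal.tendsto_nhds_zero.1 hfin) (ε / 2) (ENNReal.half_pos hε.ne')]
      with i hi hi'
    have hsplit : wsum 1 (f i) = (∑ k ∈ S, ew 1 k * ‖fourierCoeff (f i) k‖ₑ) +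
        ∑' k : { x // x ∉ S }, ew 1 k * ‖fourierCoeff (f i) k‖ₑ := by
      have h := (ENNReal.summable (f := fun k : (S : Set Freq) =>
        ew 1 k * ‖fourierCoeff (f i) k‖ₑ)).tsum_add_tsum_compl
        (f := fun k : Freq => ew 1 k * ‖fourierCoeff (f i) k‖ₑ) ENNReal.summable
      rw [Finset.tsum_subtype' S fun k : Freq => ew 1 k * ‖fourierCoeff (f i) k‖ₑ] at h
      exact h.symm
    rw [hsplit]
    refine (ENNReal_add_sq_le _ _).trans ?_
    rw [← ENNReal.add_halves ε]
    refine add_le_add hi' (le_trans ?_ hS)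
    gcongr
    have h := ENNReal_tsum_mul_sq_le
      (fun k : { x // x ∉ S } => ew (2 * m - 1) k * ‖fourierCoeff (f i) k‖ₑ)
      (fun k => ew (-(2 * (m - 1))) k)
    have e1 : ∀ k : Freq, ew (2 * m - 1) k * ‖fourierCoeff (f i) k‖ₑ * ew (-(2 * (m - 1))) k =
        ew 1 k * ‖fourierCoeff (f i) k‖ₑ := fun k => by
      rw [mul_right_comm, ← ew_add]; ring_nf
    have e2 : ∀ k : Freq, (ew (2 * m - 1) k * ‖fourierCoeff (f i) k‖ₑ) ^ 2 *
        ew (-(2 * (m - 1))) k = (ew m k * ‖fourierCoeff (f i) k‖ₑ) ^ 2 := fun k => by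
      rw [mul_pow, mul_pow, mul_right_comm, sq, sq (ew m k), ← ew_add, ← ew_add, ← ew_add]
      ring_nf
    simp only [e1, e2] at h
    rw [mul_comm] at h
    refine h.trans ?_
    gcongr
    refine le_trans ?_ hi
    exact ENNReal.tsum_comp_le_tsum_of_injective Subtype.val_injective
      (fun k => (ew m k * ‖fourierCoeff (f i) k‖ₑ) ^ 2)
  have := ((ENNReal.continuous_rpow_const (y := 1 / 2)).tendsto 0).comp hsq
  rw [ENNReal.zero_rpow_of_pos (by norm_num)] at this
  refine this.congr fun i => ?_
  simp only [Function.comp_apply]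
  rw [← ENNReal.rpow_natCast, ← ENNReal.rpow_mul]; norm_num

/-- Coefficientwise convergence together with boundedness in `H^m`, `m > 2`, implies convergence
in `C¹`. -/
theorem tendsto_of_coeff {ι : Type*} {l : Filter ι} {m : ℝ} (hm : 2 < m) {f : ι → C(Torus, ℝ)}
    {g : C(Torus, ℝ)} {R : ℝ≥0∞} (hR : R ≠ ⊤) (hf : ∀ᶠ i in l, sobE m (f i) ≤ R)
    (hg : sobE m g ≤ R) (hc : ∀ k, Tendsto (fun i => fourierCoeff (f i) k) l
      (𝓝 (fourierCoeff g k))) :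
    Tendsto f l (𝓝 g) ∧ ∀ j, Tendsto (fun i => pd j (f i)) l (𝓝 (pd j g)) := by
  have hd : ∀ i, sobE m (f i) ≤ R → sobE m (fun x => f i x - g x) ≤ 2 * R + 2 * R := by
    intro i hi
    have := sobE_add_le m (integrable_continuousMap (f i)) (integrable_continuousMap g).neg
    simp only [Pi.neg_apply, ← sub_eq_add_neg] at this
    refine this.trans ?_
    gcongr
    exact (sobE_neg m g).le.trans hg
  have h0 : Tendsto (fun i => wsum 1 (fun x => f i x - g x)) l (𝓝 0) := by
    refine tendsto_wsum_of_coeff hm (R := 2 * R + 2 * R) (by finiteness) ?_ fun k => ?_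
    · filter_upwards [hf] with i hi using hd i hi
    · simp only [fourierCoeff_sub (integrable_continuousMap _) (integrable_continuousMap g)]
      simpa using (hc k).sub_const (fourierCoeff g k)
  have h1 : Tendsto (fun i => (wsum 1 (fun x => f i x - g x)).toReal) l (𝓝 0) := by
    have := (ENNReal.tendsto_toReal ENNReal.zero_ne_top).comp h0
    rw [ENNReal.toReal_zero] at this
    exact this
  have hfin : ∀ i, sobE m (f i) ≤ R → wsum 1 (fun x => f i x - g x) ≠ ⊤ := fun i hi =>
    wsum_one_ne_top hm (ne_top_of_le_ne_top (by finiteness) (hd i hi))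
  constructor
  · rw [tendsto_iff_norm_sub_tendsto_zero]
    refine squeeze_zero' (Eventually.of_forall fun _ => norm_nonneg _) ?_ h1
    filter_upwards [hf] with i hi
    have e : wsum 0 (f i - g : C(Torus, ℝ)) ≤ wsum 1 (fun x => f i x - g x) :=
      wsum_mono zero_le_one _
    exact (norm_le_wsum (ne_top_of_le_ne_top (hfin i hi) e)).trans
      (ENNReal.toReal_mono (hfin i hi) e)
  · intro j
    rw [tendsto_iff_norm_sub_tendsto_zero]
    refine squeeze_zero' (Eventually.of_forall fun _ => norm_nonneg _) ?_ h1
    filter_upwards [hf] with i hi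
    rw [← pd_sub (integrable_continuousMap _) (integrable_continuousMap g)
      (wsum_one_ne_top hm (ne_top_of_le_ne_top hR hi))
      (wsum_one_ne_top hm (ne_top_of_le_ne_top hR hg)) (hfin i hi)]
    exact norm_pd_le (hfin i hi) j

theorem tendsto_rhsDensity {ι : Type*} {l : Filter ι} (a : C(ℝ, ℝ)) {r φ : ι → C(Torus, ℝ)}
    {dr dφ : ι → Fin 2 → C(Torus, ℝ)} {r₀ φ₀ : C(Torus, ℝ)} {dr₀ dφ₀ : Fin 2 → C(Torus, ℝ)}
    (hr : Tendsto r l (𝓝 r₀)) (hφ : Tendsto φ l (𝓝 φ₀))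
    (hdr : ∀ j, Tendsto (fun i => dr i j) l (𝓝 (dr₀ j)))
    (hdφ : ∀ j, Tendsto (fun i => dφ i j) l (𝓝 (dφ₀ j))) :
    Tendsto (fun i => rhsDensity a (r i) (φ i) (dr i) (dφ i)) l
      (𝓝 (rhsDensity a r₀ φ₀ dr₀ dφ₀)) := by
  have hcomp : ∀ (F : C(ℝ, ℝ)) {u : ι → C(Torus, ℝ)} {u₀ : C(Torus, ℝ)}, Tendsto u l (𝓝 u₀) →
      Tendsto (fun i => F.comp (u i)) l (𝓝 (F.comp u₀)) := fun F u u₀ h =>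
    ((ContinuousMap.continuous_postcomp F).tendsto u₀).comp h
  exact (((((hcomp cosMap hφ).mul (hdr 0)).add ((hcomp sinMap hφ).mul (hdr 1))).add
    (((hcomp a hr).mul (hcomp cosMap hφ)).mul (hdφ 1))).sub
    (((hcomp a hr).mul (hcomp sinMap hφ)).mul (hdφ 0))).neg

theorem tendsto_rhsAngle {ι : Type*} {l : Filter ι} (c μ : ℝ) (a b : C(ℝ, ℝ))
    {r φ : ι → C(Torus, ℝ)}
    {dr dφ : ι → Fin 2 → C(Torus, ℝ)} {r₀ φ₀ : C(Torus, ℝ)} {dr₀ dφ₀ : Fin 2 → C(Torus, ℝ)}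
    (hr : Tendsto r l (𝓝 r₀)) (hφ : Tendsto φ l (𝓝 φ₀))
    (hdr : ∀ j, Tendsto (fun i => dr i j) l (𝓝 (dr₀ j)))
    (hdφ : ∀ j, Tendsto (fun i => dφ i j) l (𝓝 (dφ₀ j))) :
    Tendsto (fun i => rhsAngle c μ a b (r i) (φ i) (dr i) (dφ i)) l
      (𝓝 (rhsAngle c μ a b r₀ φ₀ dr₀ dφ₀)) := by
  have hcomp : ∀ (F : C(ℝ, ℝ)) {u : ι → C(Torus, ℝ)} {u₀ : C(Torus, ℝ)}, Tendsto u l (𝓝 u₀) →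
      Tendsto (fun i => F.comp (u i)) l (𝓝 (F.comp u₀)) := fun F u u₀ h =>
    ((ContinuousMap.continuous_postcomp F).tendsto u₀).comp h
  exact ((((((hcomp cosMap hφ).mul (hdφ 0)).add ((hcomp sinMap hφ).mul (hdφ 1))).const_smul c).add
    (((hcomp a hr).mul (hcomp cosMap hφ)).mul (hdr 1))).sub
    (((hcomp a hr).mul (hcomp sinMap hφ)).mul (hdr 0))).neg.add
    (((hcomp b hr).mul (((hdr 0).mul (hdφ 0)).add ((hdr 1).mul (hdφ 1)))).const_smul (2 * μ))

theorem tendsto_flux {ι : Type*} {l : Filter ι} {m : ℝ} (hm : 2 < m) (c μ : ℝ) (a b : C(ℝ, ℝ))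
    {r φ : ι → C(Torus, ℝ)} {r₀ φ₀ : C(Torus, ℝ)} {R : ℝ≥0∞} (hR : R ≠ ⊤)
    (hr : ∀ᶠ i in l, sobE m (r i) ≤ R) (hφ : ∀ᶠ i in l, sobE m (φ i) ≤ R)
    (hr₀ : sobE m r₀ ≤ R) (hφ₀ : sobE m φ₀ ≤ R)
    (hcr : ∀ k, Tendsto (fun i => fourierCoeff (r i) k) l (𝓝 (fourierCoeff r₀ k)))
    (hcφ : ∀ k, Tendsto (fun i => fourierCoeff (φ i) k) l (𝓝 (fourierCoeff φ₀ k))) :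
    Tendsto (fun i => fluxDensity a (r i) (φ i)) l (𝓝 (fluxDensity a r₀ φ₀)) ∧
    Tendsto (fun i => fluxAngle c μ a b (r i) (φ i)) l (𝓝 (fluxAngle c μ a b r₀ φ₀)) := by
  have h1 := tendsto_of_coeff hm hR hr hr₀ hcr
  have h2 := tendsto_of_coeff hm hR hφ hφ₀ hcφ
  exact ⟨tendsto_rhsDensity a h1.1 h2.1 h1.2 h2.2, tendsto_rhsAngle c μ a b h1.1 h2.1 h1.2 h2.2⟩

/-! ### Fourier truncation -/

/-- The frequencies with `|kᵢ| ≤ N`. -/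
def box (N : ℕ) : Finset Freq := Fintype.piFinset fun _ => Finset.Icc (-(N : ℤ)) N

theorem mem_box {N : ℕ} {k : Freq} : k ∈ box N ↔ ∀ i, |k i| ≤ N := by
  simp [box, Fintype.mem_piFinset, abs_le]

theorem neg_mem_box {N : ℕ} {k : Freq} : -k ∈ box N ↔ k ∈ box N := by
  simp [mem_box]

theorem eventually_mem_box (k : Freq) : ∀ᶠ N : ℕ in atTop, k ∈ box N := by
  filter_upwards [eventually_ge_atTop (∑ i, (k i).natAbs)] with N hN
  rw [mem_box]
  intro i
  have : (k i).natAbs ≤ ∑ i, (k i).natAbs :=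
    Finset.single_le_sum (f := fun i => (k i).natAbs) (fun _ _ => Nat.zero_le _) (Finset.mem_univ i)
  rw [Int.abs_eq_natAbs]
  exact_mod_cast this.trans hN

/-- The truncated Fourier multiplier with symbol `σ`. -/
def mult (N : ℕ) (σ : Freq → ℂ) : C(Torus, ℝ) →L[ℝ] C(Torus, ℝ) :=
  (Complex.reCLM.compLeftContinuous ℝ Torus).comp
    (∑ k ∈ box N, ((ContinuousLinearMap.toSpanSingleton ℂ
      (σ k • (UnitAddTorus.mFourier k : C(Torus, ℂ)))).restrictScalars ℝ).comp (coeffCLM k))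

theorem mult_eq_synth (N : ℕ) (σ : Freq → ℂ) (f : C(Torus, ℝ)) :
    mult N σ f = synth fun k => if k ∈ box N then σ k * fourierCoeff f k else 0 := by
  ext x
  have h : (synthC fun k => if k ∈ box N then σ k * fourierCoeff f k else 0) =
      ∑ k ∈ box N, (σ k * fourierCoeff f k) • (UnitAddTorus.mFourier k : C(Torus, ℂ)) := by
    rw [synthC, tsum_eq_sum (s := box N) fun k hk => by
      rw [if_neg hk]; exact zero_smul ℂ (UnitAddTorus.mFourier k : C(Torus, ℂ))]
    exact Finset.sum_congr rfl fun k hk => by simp [hk]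
  change Complex.re ((∑ k ∈ box N, ((ContinuousLinearMap.toSpanSingleton ℂ
      (σ k • (UnitAddTorus.mFourier k : C(Torus, ℂ)))).restrictScalars ℝ).comp (coeffCLM k)) f x) =
    Complex.re (synthC (fun k => if k ∈ box N then σ k * fourierCoeff f k else 0) x)
  rw [h, sum_apply]
  congr 2
  refine Finset.sum_congr rfl fun k _ => ?_
  simp [ContinuousLinearMap.toSpanSingleton_apply, smul_smul, mul_comm]

theorem fourierCoeff_mult {N : ℕ} {σ : Freq → ℂ} (hσ : ∀ k, σ (-k) = conj (σ k)) (f : C(Torus, ℝ))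
    (k : Freq) : fourierCoeff (mult N σ f) k = if k ∈ box N then σ k * fourierCoeff f k else 0 := by
  rw [mult_eq_synth, fourierCoeff_synth]
  · exact summable_of_ne_finset_zero (s := box N) fun k hk => by simp [hk]
  · intro k
    simp only [neg_mem_box]
    split_ifs
    · rw [hσ, fourierCoeff_neg_index, map_mul]
    · simp

/-- The Fourier truncation. -/
def proj (N : ℕ) : C(Torus, ℝ) →L[ℝ] C(Torus, ℝ) := mult N fun _ => 1

/-- The truncated partial derivative. -/
def pdTrunc (N : ℕ) (j : Fin 2) : C(Torus, ℝ) →L[ℝ] C(Torus, ℝ) :=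
  mult N fun k => 2 * Real.pi * Complex.I * (k j : ℂ)

/-- The truncated Laplacian. -/
def lapTrunc (N : ℕ) : C(Torus, ℝ) →L[ℝ] C(Torus, ℝ) := mult N fun k => -(laplaceSymbol k : ℂ)

theorem fourierCoeff_proj (N : ℕ) (f : C(Torus, ℝ)) (k : Freq) :
    fourierCoeff (proj N f) k = if k ∈ box N then fourierCoeff f k else 0 := by
  rw [proj, fourierCoeff_mult (by simp)]; simp

theorem fourierCoeff_pdTrunc (N : ℕ) (j : Fin 2) (f : C(Torus, ℝ)) (k : Freq) :
    fourierCoeff (pdTrunc N j f) k =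
      if k ∈ box N then 2 * Real.pi * Complex.I * (k j : ℂ) * fourierCoeff f k else 0 := by
  rw [pdTrunc, fourierCoeff_mult (by simp [Complex.conj_ofNat])]

theorem fourierCoeff_lapTrunc (N : ℕ) (f : C(Torus, ℝ)) (k : Freq) :
    fourierCoeff (lapTrunc N f) k =
      if k ∈ box N then -(laplaceSymbol k : ℂ) * fourierCoeff f k else 0 := by
  rw [lapTrunc, fourierCoeff_mult (by simp [laplaceSymbol_neg])]

theorem proj_proj (N : ℕ) (f : C(Torus, ℝ)) : proj N (proj N f) = proj N f :=
  eq_of_fourierCoeff_eq fun k => by simp only [fourierCoeff_proj]; split_ifs <;> rfl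

theorem pdTrunc_proj (N : ℕ) (j : Fin 2) (f : C(Torus, ℝ)) :
    pdTrunc N j (proj N f) = pdTrunc N j f :=
  eq_of_fourierCoeff_eq fun k => by
    simp only [fourierCoeff_pdTrunc, fourierCoeff_proj]; split_ifs <;> rfl

theorem lapTrunc_proj (N : ℕ) (f : C(Torus, ℝ)) : lapTrunc N (proj N f) = lapTrunc N f :=
  eq_of_fourierCoeff_eq fun k => by
    simp only [fourierCoeff_lapTrunc, fourierCoeff_proj]; split_ifs <;> rfl

theorem proj_lapTrunc (N : ℕ) (f : C(Torus, ℝ)) : proj N (lapTrunc N f) = lapTrunc N f :=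
  eq_of_fourierCoeff_eq fun k => by
    simp only [fourierCoeff_lapTrunc, fourierCoeff_proj]; split_ifs <;> rfl

theorem fourierCoeff_eq_zero_of_proj {N : ℕ} {f : C(Torus, ℝ)} (h : proj N f = f) {k : Freq}
    (hk : k ∉ box N) : fourierCoeff f k = 0 := by
  rw [← h, fourierCoeff_proj, if_neg hk]

theorem sobE_of_proj {N : ℕ} {f : C(Torus, ℝ)} (h : proj N f = f) (s : ℝ) :
    sobE s f = ENNReal.ofReal (∑ k ∈ box N, (wt s k * ‖fourierCoeff f k‖) ^ 2) := by
  rw [sobE, tsum_eq_sum (s := box N) fun k hk => by simp [fourierCoeff_eq_zero_of_proj h hk],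
    ENNReal.ofReal_sum_of_nonneg fun k _ => by positivity]
  refine Finset.sum_congr rfl fun k _ => ?_
  rw [ENNReal.ofReal_pow (mul_nonneg (wt_pos s k).le (norm_nonneg _)),
    ENNReal.ofReal_mul (wt_pos s k).le, ofReal_norm]; rfl

theorem wsum_ne_top_of_proj {N : ℕ} {f : C(Torus, ℝ)} (h : proj N f = f) (s : ℝ) :
    wsum s f ≠ ⊤ := by
  refine wsum_ne_top (t := s + 2) (by linarith) ?_
  rw [sobE_of_proj h]; exact ENNReal.ofReal_ne_top

theorem pdTrunc_eq_pd {N : ℕ} {f : C(Torus, ℝ)} (h : proj N f = f) (j : Fin 2) :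
    pdTrunc N j f = pd j f :=
  eq_of_fourierCoeff_eq fun k => by
    rw [fourierCoeff_pdTrunc, fourierCoeff_pd (wsum_ne_top_of_proj h 1)]
    split_ifs with hk
    · rfl
    · simp [fourierCoeff_eq_zero_of_proj h hk]

theorem sobE_proj_le (N : ℕ) (s : ℝ) (f : C(Torus, ℝ)) : sobE s (proj N f) ≤ sobE s f := by
  refine ENNReal.tsum_le_tsum fun k => ?_
  rw [fourierCoeff_proj]
  split_ifs <;> simp

end SelfPropelled
end

noncomputable section
namespace SelfPropelled
open Filter Topology

/-! ### The energy estimate -/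

open scoped ComplexConjugate

/-- The truncated `H^m` inner product. -/
def pairing (m : ℝ) (N : ℕ) (u w : C(Torus, ℝ)) : ℝ :=
  ∑ k ∈ box N, wt m k ^ 2 * (conj (fourierCoeff u k) * fourierCoeff w k).re

section Pairing

variable (m : ℝ) (N : ℕ) (u w w' : C(Torus, ℝ))

theorem pairing_add : pairing m N u (w + w') = pairing m N u w + pairing m N u w' := by
  simp only [pairing, ← Finset.sum_add_distrib]
  refine Finset.sum_congr rfl fun k _ => ?_
  have : fourierCoeff (w + w' : C(Torus, ℝ)) k = fourierCoeff w k + fourierCoeff w' k :=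
    (coeffCLM k).map_add w w'
  rw [this, mul_add, Complex.add_re, mul_add]

theorem pairing_smul (c : ℝ) : pairing m N u (c • w) = c * pairing m N u w := by
  simp only [pairing, Finset.mul_sum]
  refine Finset.sum_congr rfl fun k _ => ?_
  have : fourierCoeff (c • w : C(Torus, ℝ)) k = c * fourierCoeff w k :=
    ((coeffCLM k).map_smul c w).trans (by simp)
  rw [this, mul_left_comm, Complex.re_ofReal_mul]; ring

theorem pairing_neg : pairing m N u (-w) = -pairing m N u w := by
  simpa using pairing_smul m N u w (-1)

theorem pairing_sub : pairing m N u (w - w') = pairing m N u w - pairing m N u w' := by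
  rw [sub_eq_add_neg, pairing_add, pairing_neg, sub_eq_add_neg]

end Pairing

theorem sum_le_of_wsum_le {s M : ℝ} (hM : 0 ≤ M) {f : Torus → ℝ} (h : wsum s f ≤ ENNReal.ofReal M)
    (S : Finset Freq) : ∑ k ∈ S, wt s k * ‖fourierCoeff f k‖ ≤ M := by
  have h0 : ∀ k ∈ S, 0 ≤ wt s k * ‖fourierCoeff f k‖ := fun k _ =>
    mul_nonneg (wt_pos s k).le (norm_nonneg _)
  rw [← ENNReal.ofReal_le_ofReal_iff hM, ENNReal.ofReal_sum_of_nonneg h0]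
  refine le_trans (le_of_eq ?_) ((ENNReal.sum_le_tsum S).trans h)
  refine Finset.sum_congr rfl fun k _ => ?_
  rw [ENNReal.ofReal_mul (wt_pos s k).le, ofReal_norm]; rfl

theorem sum_le_of_sobE_le {s R : ℝ} (hR : 0 ≤ R) {f : Torus → ℝ} (h : sobE s f ≤ ENNReal.ofReal R)
    (S : Finset Freq) : ∑ k ∈ S, (wt s k * ‖fourierCoeff f k‖) ^ 2 ≤ R := by
  rw [← ENNReal.ofReal_le_ofReal_iff hR, ENNReal.ofReal_sum_of_nonneg fun k _ => by positivity]
  refine le_trans (le_of_eq ?_) ((ENNReal.sum_le_tsum S).trans h)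
  refine Finset.sum_congr rfl fun k _ => ?_
  rw [ENNReal.ofReal_pow (mul_nonneg (wt_pos s k).le (norm_nonneg _)),
    ENNReal.ofReal_mul (wt_pos s k).le, ofReal_norm]; rfl

theorem sobE_le_of_sum_le {s : ℝ} {f : Torus → ℝ} {R : ℝ}
    (h : ∀ S : Finset Freq, ∑ k ∈ S, (wt s k * ‖fourierCoeff f k‖) ^ 2 ≤ R) :
    sobE s f ≤ ENNReal.ofReal R := by
  rw [sobE, ENNReal.tsum_eq_iSup_sum]
  refine iSup_le fun S => ?_
  refine le_trans (le_of_eq ?_) (ENNReal.ofReal_le_ofReal (h S))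
  rw [ENNReal.ofReal_sum_of_nonneg fun k _ => by positivity]
  refine Finset.sum_congr rfl fun k _ => ?_
  rw [ENNReal.ofReal_pow (mul_nonneg (wt_pos s k).le (norm_nonneg _)),
    ENNReal.ofReal_mul (wt_pos s k).le, ofReal_norm]; rfl

/-- A Schur test: `2AB ≤ A² + B²`, after which each translate of `F` sums to at most `M`. -/
theorem sum_sum_sub_le {F A B : Freq → ℝ} (hF : ∀ k, 0 ≤ F k) {M R : ℝ} {S : Finset Freq}
    (hFM : ∀ S : Finset Freq, ∑ k ∈ S, F k ≤ M) (hA : ∑ k ∈ S, A k ^ 2 ≤ R)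
    (hB : ∑ k ∈ S, B k ^ 2 ≤ R) :
    ∑ k ∈ S, ∑ l ∈ S, F (k - l) * (A k * B l) ≤ M * R := by
  have hM : 0 ≤ M := by simpa using hFM ∅
  have inj1 : ∀ k : Freq, ∑ l ∈ S, F (k - l) ≤ M := fun k => by
    rw [← Finset.sum_image (f := F) (s := S) (g := fun l => k - l) fun x _ y _ h => by simpa using h]
    exact hFM _
  have inj2 : ∀ l : Freq, ∑ k ∈ S, F (k - l) ≤ M := fun l => by
    rw [← Finset.sum_image (f := F) (s := S) (g := fun k => k - l) fun x _ y _ h => by simpa using h]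
    exact hFM _
  calc ∑ k ∈ S, ∑ l ∈ S, F (k - l) * (A k * B l)
      ≤ ∑ k ∈ S, ∑ l ∈ S, (F (k - l) * (A k ^ 2 / 2) + F (k - l) * (B l ^ 2 / 2)) := by
        refine Finset.sum_le_sum fun k _ => Finset.sum_le_sum fun l _ => ?_
        rw [← mul_add]
        refine mul_le_mul_of_nonneg_left ?_ (hF _)
        nlinarith [sq_nonneg (A k - B l)]
    _ = ∑ k ∈ S, (∑ l ∈ S, F (k - l)) * (A k ^ 2 / 2) +
        ∑ l ∈ S, (∑ k ∈ S, F (k - l)) * (B l ^ 2 / 2) := by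
        simp only [Finset.sum_add_distrib, Finset.sum_mul]
        congr 1
        exact Finset.sum_comm
    _ ≤ ∑ k ∈ S, M * (A k ^ 2 / 2) + ∑ l ∈ S, M * (B l ^ 2 / 2) := by
        gcongr with k _ l _
        · exact inj1 k
        · exact inj2 l
    _ = M * ((∑ k ∈ S, A k ^ 2) / 2 + (∑ k ∈ S, B k ^ 2) / 2) := by
        rw [← Finset.mul_sum, ← Finset.mul_sum, ← Finset.sum_div, ← Finset.sum_div]; ring
    _ ≤ M * R := by gcongr; linarith

/-- The companion bound in which the kernel is only square summable, and the summable factor is `B`.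
-/
theorem sum_sum_sub_le' {F A B : Freq → ℝ} (hB0 : ∀ k, 0 ≤ B k) {M R : ℝ} {S : Finset Freq}
    (hFR : ∀ S : Finset Freq, ∑ k ∈ S, F k ^ 2 ≤ R) (hA : ∑ k ∈ S, A k ^ 2 ≤ R)
    (hB : ∑ k ∈ S, B k ≤ M) :
    ∑ k ∈ S, ∑ l ∈ S, F (k - l) * (A k * B l) ≤ M * R := by
  have hR : 0 ≤ R := by simpa using hFR ∅
  have inj : ∀ l : Freq, ∑ k ∈ S, F (k - l) ^ 2 ≤ R := fun l => by
    rw [← Finset.sum_image (f := fun k => F k ^ 2) (s := S) (g := fun k => k - l)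
      fun x _ y _ h => by simpa using h]
    exact hFR _
  calc ∑ k ∈ S, ∑ l ∈ S, F (k - l) * (A k * B l)
      ≤ ∑ k ∈ S, ∑ l ∈ S, B l * ((F (k - l) ^ 2 + A k ^ 2) / 2) := by
        refine Finset.sum_le_sum fun k _ => Finset.sum_le_sum fun l _ => ?_
        rw [← mul_assoc, mul_comm _ (B l)]
        refine mul_le_mul_of_nonneg_left ?_ (hB0 _)
        nlinarith [sq_nonneg (F (k - l) - A k)]
    _ = ∑ l ∈ S, B l * ((∑ k ∈ S, F (k - l) ^ 2 + ∑ k ∈ S, A k ^ 2) / 2) := by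
        rw [Finset.sum_comm]
        refine Finset.sum_congr rfl fun l _ => ?_
        rw [← Finset.mul_sum, ← Finset.sum_div, Finset.sum_add_distrib]
    _ ≤ ∑ l ∈ S, B l * R := by
        refine Finset.sum_le_sum fun l _ => mul_le_mul_of_nonneg_left ?_ (hB0 l)
        linarith [inj l]
    _ = (∑ l ∈ S, B l) * R := (Finset.sum_mul _ _ _).symm
    _ ≤ M * R := by gcongr

theorem fourierCoeff_mul_pd {N : ℕ} (f : C(Torus, ℝ)) {v : C(Torus, ℝ)} (hv : proj N v = v)
    (j : Fin 2) (k : Freq) : fourierCoeff (f * pd j v : C(Torus, ℝ)) k =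
      ∑ l ∈ box N, fourierCoeff f (k - l) *
        (2 * Real.pi * Complex.I * (l j : ℂ) * fourierCoeff v l) := by
  have h := hasSum_fourierCoeff_mul (memLp_continuousMap f 2) (memLp_continuousMap (pd j v) 2) k
  simp only [fourierCoeff_pd (wsum_ne_top_of_proj hv 1)] at h
  refine h.unique (hasSum_sum_of_ne_finset_zero fun l hl => ?_)
  rw [fourierCoeff_eq_zero_of_proj hv hl]; ring

theorem pairing_mul_pd {m : ℝ} {N : ℕ} (f u : C(Torus, ℝ)) {v : C(Torus, ℝ)} (hv : proj N v = v)
    (j : Fin 2) : pairing m N u (f * pd j v) =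
      ∑ k ∈ box N, ∑ l ∈ box N, wt m k ^ 2 * (2 * Real.pi * l j) *
        (Complex.I * (conj (fourierCoeff u k) * fourierCoeff f (k - l) * fourierCoeff v l)).re := by
  refine Finset.sum_congr rfl fun k _ => ?_
  rw [fourierCoeff_mul_pd f hv, Finset.mul_sum, Complex.re_sum, Finset.mul_sum]
  refine Finset.sum_congr rfl fun l _ => ?_
  rw [mul_assoc (wt m k ^ 2), ← Complex.re_ofReal_mul (2 * Real.pi * l j)]
  congr 2
  push_cast
  ring

/-- The commutator estimate behind the energy method. Each pairing alone would cost `m + 1`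
derivatives of `u` or `v`. In the sum only the symbol difference of `abs_wt_symbol_sub_le` remains,
and its three terms are each bounded by `M * R`. -/
theorem abs_pairing_add_pairing_le {m M R : ℝ} (hm : 1 ≤ m) (hM : 0 ≤ M) (hR : 0 ≤ R) {N : ℕ}
    {f u v : C(Torus, ℝ)} (hu : proj N u = u) (hv : proj N v = v) (j : Fin 2)
    (hf1 : wsum 1 f ≤ ENNReal.ofReal M) (hu1 : wsum 1 u ≤ ENNReal.ofReal M)
    (hv1 : wsum 1 v ≤ ENNReal.ofReal M) (hf2 : sobE m f ≤ ENNReal.ofReal R)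
    (hu2 : sobE m u ≤ ENNReal.ofReal R) (hv2 : sobE m v ≤ ENNReal.ofReal R) :
    |pairing m N u (f * pd j v) + pairing m N v (f * pd j u)| ≤
      2 ^ m * (2 * m + 1) * (3 * (M * R)) := by
  set X : Freq → Freq → ℝ := fun k l =>
    (Complex.I * (conj (fourierCoeff u k) * fourierCoeff f (k - l) * fourierCoeff v l)).re with hX
  have e1 := pairing_mul_pd (m := m) f u hv j
  have e2 : pairing m N v (f * pd j u) = ∑ k ∈ box N, ∑ l ∈ box N,
      -(wt m l ^ 2 * (2 * Real.pi * k j) * X k l) := by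
    -- Exchanging `k` and `l` conjugates the product, because `f` is real, and `conj I = -I`
    -- supplies the sign. Both pairings are thus written with the same `X k l`.
    rw [pairing_mul_pd f v hu j, Finset.sum_comm]
    refine Finset.sum_congr rfl fun k _ => Finset.sum_congr rfl fun l _ => ?_
    rw [← mul_neg]
    congr 1
    rw [hX]
    simp only
    rw [← Complex.conj_re, ← Complex.neg_re]
    congr 1
    simp only [map_mul, Complex.conj_conj, Complex.conj_I]
    rw [← fourierCoeff_neg_index, neg_sub]
    ring
  have e3 : pairing m N u (f * pd j v) + pairing m N v (f * pd j u) =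
      ∑ k ∈ box N, ∑ l ∈ box N,
        (wt m k ^ 2 * (2 * Real.pi * l j) - wt m l ^ 2 * (2 * Real.pi * k j)) * X k l := by
    rw [e1, e2, ← Finset.sum_add_distrib]
    refine Finset.sum_congr rfl fun k _ => ?_
    rw [← Finset.sum_add_distrib]
    refine Finset.sum_congr rfl fun l _ => ?_
    ring
  have hXle : ∀ k l, |X k l| ≤ ‖fourierCoeff u k‖ * ‖fourierCoeff f (k - l)‖ * ‖fourierCoeff v l‖ :=
    fun k l => (Complex.abs_re_le_norm _).trans (by simp)
  rw [e3]
  calc _ ≤ ∑ k ∈ box N, ∑ l ∈ box N, 2 ^ m * (2 * m + 1) *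
        ((wt 1 (k - l) * ‖fourierCoeff f (k - l)‖) *
          ((wt m k * ‖fourierCoeff u k‖) * (wt m l * ‖fourierCoeff v l‖)) +
        (wt m (k - l) * ‖fourierCoeff f (k - l)‖) *
          ((wt m k * ‖fourierCoeff u k‖) * (wt 1 l * ‖fourierCoeff v l‖)) +
        (wt m (k - l) * ‖fourierCoeff f (k - l)‖) *
          ((wt 1 k * ‖fourierCoeff u k‖) * (wt m l * ‖fourierCoeff v l‖))) := by
        refine (Finset.abs_sum_le_sum_abs _ _).trans (Finset.sum_le_sum fun k _ => ?_)
        refine (Finset.abs_sum_le_sum_abs _ _).trans (Finset.sum_le_sum fun l _ => ?_)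
        rw [abs_mul]
        refine (mul_le_mul (abs_wt_symbol_sub_le hm k l j) (hXle k l) (abs_nonneg _) ?_).trans
          (le_of_eq ?_)
        · have := wt_pos 1 k
          have := wt_pos 1 l
          have := wt_pos m k
          have := wt_pos m l
          have := wt_pos 1 (k - l)
          have := wt_pos m (k - l)
          positivity
        · ring
    _ = 2 ^ m * (2 * m + 1) *
        (∑ k ∈ box N, ∑ l ∈ box N, (wt 1 (k - l) * ‖fourierCoeff f (k - l)‖) *
          ((wt m k * ‖fourierCoeff u k‖) * (wt m l * ‖fourierCoeff v l‖)) +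
        ∑ k ∈ box N, ∑ l ∈ box N, (wt m (k - l) * ‖fourierCoeff f (k - l)‖) *
          ((wt m k * ‖fourierCoeff u k‖) * (wt 1 l * ‖fourierCoeff v l‖)) +
        ∑ k ∈ box N, ∑ l ∈ box N, (wt m (k - l) * ‖fourierCoeff f (k - l)‖) *
          ((wt 1 k * ‖fourierCoeff u k‖) * (wt m l * ‖fourierCoeff v l‖))) := by
        simp only [← Finset.mul_sum, Finset.sum_add_distrib]
    _ ≤ 2 ^ m * (2 * m + 1) * (M * R + M * R + M * R) := by
        have h1 := sum_sum_sub_le (F := fun k => wt 1 k * ‖fourierCoeff f k‖)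
          (A := fun k => wt m k * ‖fourierCoeff u k‖) (B := fun k => wt m k * ‖fourierCoeff v k‖)
          (fun k => mul_nonneg (wt_pos 1 k).le (norm_nonneg _)) (sum_le_of_wsum_le hM hf1)
          (sum_le_of_sobE_le hR hu2 (box N)) (sum_le_of_sobE_le hR hv2 (box N))
        have h2 := sum_sum_sub_le' (F := fun k => wt m k * ‖fourierCoeff f k‖)
          (A := fun k => wt m k * ‖fourierCoeff u k‖) (B := fun k => wt 1 k * ‖fourierCoeff v k‖)
          (fun k => mul_nonneg (wt_pos 1 k).le (norm_nonneg _)) (sum_le_of_sobE_le hR hf2)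
          (sum_le_of_sobE_le hR hu2 (box N)) (sum_le_of_wsum_le hM hv1 (box N))
        have h3 := sum_sum_sub_le' (F := fun k => wt m k * ‖fourierCoeff f k‖)
          (A := fun k => wt m k * ‖fourierCoeff v k‖) (B := fun k => wt 1 k * ‖fourierCoeff u k‖)
          (fun k => mul_nonneg (wt_pos 1 k).le (norm_nonneg _)) (sum_le_of_sobE_le hR hf2)
          (sum_le_of_sobE_le hR hv2 (box N)) (sum_le_of_wsum_le hM hu1 (box N))
        rw [Finset.sum_comm] at h3
        have h3' : ∑ k ∈ box N, ∑ l ∈ box N, (wt m (k - l) * ‖fourierCoeff f (k - l)‖) *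
          ((wt 1 k * ‖fourierCoeff u k‖) * (wt m l * ‖fourierCoeff v l‖)) ≤ M * R := by
          refine le_trans (le_of_eq ?_) h3
          refine Finset.sum_congr rfl fun k _ => Finset.sum_congr rfl fun l _ => ?_
          have : ‖fourierCoeff f (l - k)‖ = ‖fourierCoeff f (k - l)‖ := by
            rw [← neg_sub, fourierCoeff_neg_index, RCLike.norm_conj]
          rw [this, ← neg_sub k l, wt_neg_index]; ring
        gcongr
    _ = _ := by ring

/-- `-laplaceSymbol k = 1 - wt 1 k ^ 2`: the dissipation controls the `H^{m+1}` norm up to an `H^m`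
term. -/
theorem pairing_lapTrunc (m : ℝ) (N : ℕ) (φ : C(Torus, ℝ)) :
    pairing m N φ (lapTrunc N φ) = ∑ k ∈ box N, (wt m k * ‖fourierCoeff φ k‖) ^ 2 -
      ∑ k ∈ box N, (wt (m + 1) k * ‖fourierCoeff φ k‖) ^ 2 := by
  rw [pairing, ← Finset.sum_sub_distrib]
  refine Finset.sum_congr rfl fun k hk => ?_
  rw [fourierCoeff_lapTrunc, if_pos hk]
  have : conj (fourierCoeff φ k) * (-(laplaceSymbol k : ℂ) * fourierCoeff φ k) =
      ((-laplaceSymbol k * ‖fourierCoeff φ k‖ ^ 2 : ℝ) : ℂ) := by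
    rw [mul_left_comm, mul_comm (conj _), Complex.mul_conj, Complex.normSq_eq_norm_sq]
    push_cast; ring
  rw [this, Complex.ofReal_re, wt_add, mul_pow, mul_pow, mul_pow, wt_one_sq]
  ring

/-- Splits `wt m k ^ 2` as `wt (m + 1) k * wt (m - 1) k` and applies Young's inequality. It is meant
for `∇r·∇φ`, which is bounded only in `H^{m-1}`; the half of the `H^{m+1}` norm is absorbed by the
Laplacian. -/
theorem two_mul_pairing_le {m Q : ℝ} (hQ : 0 ≤ Q) {N : ℕ} (φ : C(Torus, ℝ)) {q : C(Torus, ℝ)}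
    (hq : sobE (m - 1) q ≤ ENNReal.ofReal Q) :
    2 * pairing m N φ q ≤ (∑ k ∈ box N, (wt (m + 1) k * ‖fourierCoeff φ k‖) ^ 2) / 2 + 2 * Q := by
  have h := sum_le_of_sobE_le hQ hq (box N)
  calc 2 * pairing m N φ q ≤ ∑ k ∈ box N, ((wt (m + 1) k * ‖fourierCoeff φ k‖) ^ 2 / 2 +
        2 * (wt (m - 1) k * ‖fourierCoeff q k‖) ^ 2) := by
        rw [pairing, Finset.mul_sum]
        refine Finset.sum_le_sum fun k _ => ?_
        have h1 : (conj (fourierCoeff φ k) * fourierCoeff q k).re ≤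
            ‖fourierCoeff φ k‖ * ‖fourierCoeff q k‖ :=
          (Complex.re_le_norm _).trans (by simp)
        have h2 : wt m k ^ 2 = wt (m + 1) k * wt (m - 1) k := by
          rw [wt_sq, ← wt_add]; ring_nf
        have h3 : wt m k ^ 2 * (conj (fourierCoeff φ k) * fourierCoeff q k).re ≤
            (wt (m + 1) k * ‖fourierCoeff φ k‖) * (wt (m - 1) k * ‖fourierCoeff q k‖) := by
          refine (mul_le_mul_of_nonneg_left h1 (sq_nonneg _)).trans (le_of_eq ?_)
          rw [h2]; ring
        nlinarith [sq_nonneg ((wt (m + 1) k * ‖fourierCoeff φ k‖) -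
          2 * (wt (m - 1) k * ‖fourierCoeff q k‖))]
    _ = (∑ k ∈ box N, (wt (m + 1) k * ‖fourierCoeff φ k‖) ^ 2) / 2 +
        2 * ∑ k ∈ box N, (wt (m - 1) k * ‖fourierCoeff q k‖) ^ 2 := by
        rw [Finset.sum_add_distrib, Finset.sum_div, Finset.mul_sum]
    _ ≤ _ := by gcongr

/-- The energy estimate for Fourier-truncated data. -/
theorem exists_energy_bound (c : ℝ) {μ m : ℝ} (hμ : 0 ≤ μ) (hm : 2 < m) {a b : C(ℝ, ℝ)}
    (ha : ContDiff ℝ ∞ a) (hb : ContDiff ℝ ∞ b) {R : ℝ} (hR : 0 ≤ R) :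
    ∃ G : ℝ, 0 ≤ G ∧ ∀ (N : ℕ) (r φ : C(Torus, ℝ)), proj N r = r → proj N φ = φ →
      sobE m r ≤ ENNReal.ofReal R → sobE m φ ≤ ENNReal.ofReal R →
      2 * (pairing m N r (fluxDensity a r φ) +
        pairing m N φ (fluxAngle c μ a b r φ + μ • lapTrunc N φ)) ≤
        G - μ * ∑ k ∈ box N, (wt (m + 1) k * ‖fourierCoeff φ k‖) ^ 2 := by
  have hm1 : 1 < m := by linarith
  obtain ⟨C1, hC1, h1⟩ := SobBounded.comp_right hm contDiff_cosMap _
    (ENNReal.ofReal_ne_top (r := R))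
  obtain ⟨C2, hC2, h2⟩ := SobBounded.comp_right hm contDiff_sinMap _
    (ENNReal.ofReal_ne_top (r := R))
  obtain ⟨C3, hC3, h3⟩ := ((SobBounded.comp_left hm ha).mul hm1
    (SobBounded.comp_right hm contDiff_cosMap)) _ (ENNReal.ofReal_ne_top (r := R))
  obtain ⟨C4, hC4, h4⟩ := ((SobBounded.comp_left hm ha).mul hm1
    (SobBounded.comp_right hm contDiff_sinMap)) _ (ENNReal.ofReal_ne_top (r := R))
  obtain ⟨Q, hQ, hq⟩ := sobBounded_gradProd hm hb _ (ENNReal.ofReal_ne_top (r := R))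
  set R' := (ENNReal.ofReal R + C1 + C2 + C3 + C4).toReal with hR'
  have hofR : ENNReal.ofReal R' = ENNReal.ofReal R + C1 + C2 + C3 + C4 :=
    ENNReal.ofReal_toReal (by finiteness)
  have hR0 : 0 ≤ R' := ENNReal.toReal_nonneg
  have l0 : ENNReal.ofReal R ≤ ENNReal.ofReal R' := by
    rw [hofR]; simp only [add_assoc]; exact le_self_add
  have l1 : C1 ≤ ENNReal.ofReal R' := by
    rw [hofR, show ENNReal.ofReal R + C1 + C2 + C3 + C4 = C1 + (ENNReal.ofReal R + C2 + C3 + C4) by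
      ring]; exact le_self_add
  have l2 : C2 ≤ ENNReal.ofReal R' := by
    rw [hofR, show ENNReal.ofReal R + C1 + C2 + C3 + C4 = C2 + (ENNReal.ofReal R + C1 + C3 + C4) by
      ring]; exact le_self_add
  have l3 : C3 ≤ ENNReal.ofReal R' := by
    rw [hofR, show ENNReal.ofReal R + C1 + C2 + C3 + C4 = C3 + (ENNReal.ofReal R + C1 + C2 + C4) by
      ring]; exact le_self_add
  have l4 : C4 ≤ ENNReal.ofReal R' := by
    rw [hofR]; exact le_add_self
  obtain ⟨M, hM0, hM⟩ := exists_bound_of_sobE_le hm (ENNReal.ofReal_ne_top (r := R'))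
  set K := 2 ^ m * (2 * m + 1) * (3 * (M * R')) with hK
  have hK0 : 0 ≤ K := by positivity
  -- `6K` comes from the two transport terms for `r` and the two coupling pairs, `2|c|K` from
  -- transport of `φ`, `2μR` from the `H^m` part of the Laplacian, and `4μQ` from the quadratic
  -- gradient term. Of the dissipation `2μ`, one `μ` is spent on absorption and one is left.
  refine ⟨(6 + 2 * |c|) * K + 2 * μ * R + 4 * μ * Q.toReal, by positivity,
    fun N r φ hr hφ hrR hφR => ?_⟩
  have comm : ∀ {f u v : C(Torus, ℝ)} (j : Fin 2), proj N u = u → proj N v = v →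
      sobE m f ≤ ENNReal.ofReal R' → sobE m u ≤ ENNReal.ofReal R' →
      sobE m v ≤ ENNReal.ofReal R' →
      |pairing m N u (f * pd j v) + pairing m N v (f * pd j u)| ≤ K :=
    fun j hu hv bf bu bv => abs_pairing_add_pairing_le hm1.le hM0 hR0 hu hv j (hM _ bf) (hM _ bu)
      (hM _ bv) bf bu bv
  have br := hrR.trans l0
  have bφ := hφR.trans l0
  have bc := (h1 r φ hrR hφR).trans l1
  have bs := (h2 r φ hrR hφR).trans l2
  have bac := (h3 r φ hrR hφR).trans l3
  have bas := (h4 r φ hrR hφR).trans l4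
  have t1 := abs_le.1 (comm 0 hr hr bc br br)
  have t2 := abs_le.1 (comm 1 hr hr bs br br)
  -- Symmetry of the system is used here: the two coupling terms carry the same coefficient, so they
  -- form one commutator pair.
  have t3 := abs_le.1 (comm 1 hr hφ bac br bφ)
  have t4 := abs_le.1 (comm 0 hr hφ bas br bφ)
  have t5 := comm 0 hφ hφ bc bφ bφ
  have t6 := comm 1 hφ hφ bs bφ bφ
  have t7 : -c * (2 * (pairing m N φ (cosMap.comp φ * pd 0 φ) +
      pairing m N φ (sinMap.comp φ * pd 1 φ))) ≤ |c| * (2 * K) := by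
    refine (le_abs_self _).trans ?_
    rw [abs_mul, abs_neg]
    gcongr
    refine le_trans (le_of_eq ?_) ((abs_add_le _ _).trans ((add_le_add t5 t6).trans
      (two_mul K).symm.le))
    congr 1; ring
  have tq := two_mul_pairing_le (m := m) (N := N) ENNReal.toReal_nonneg φ
    ((hq r φ hrR hφR).trans (ENNReal.ofReal_toReal hQ).ge)
  have tl := pairing_lapTrunc m N φ
  have tR := sum_le_of_sobE_le hR hφR (box N)
  simp only [fluxDensity, rhsDensity, fluxAngle, rhsAngle, pairing_add, pairing_sub, pairing_neg,
    pairing_smul]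
  rw [tl]
  set D := ∑ k ∈ box N, (wt (m + 1) k * ‖fourierCoeff φ k‖) ^ 2
  have tq' := mul_le_mul_of_nonneg_left tq hμ
  have tR' := mul_le_mul_of_nonneg_left tR hμ
  simp only [pairing_add, mul_add] at tq' t7 ⊢
  nlinarith [t1.1, t1.2, t2.1, t2.2, t3.1, t3.2, t4.1, t4.2]

end SelfPropelled
end

noncomputable section
namespace SelfPropelled
open Filter Topology

/-! ### The truncated system -/

open scoped ComplexConjugate

set_option linter.unusedSectionVars false
-- Calculus and ODEs for maps that are Lipschitz on balls
section LipOnBalls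

variable {E X Y Z : Type*} [NormedAddCommGroup E] [NormedSpace ℝ E] [NormedAddCommGroup X]
  [NormedSpace ℝ X] [NormedAddCommGroup Y] [NormedSpace ℝ Y] [NormedAddCommGroup Z]
  [NormedSpace ℝ Z]

/-- `f` is Lipschitz on every ball. -/
def LipOnBalls (f : E → X) : Prop :=
  ∀ ρ : ℝ, ∃ K : ℝ, 0 ≤ K ∧ ∀ u v, ‖u‖ ≤ ρ → ‖v‖ ≤ ρ → ‖f u - f v‖ ≤ K * ‖u - v‖

namespace LipOnBalls

theorem clm (L : E →L[ℝ] X) : LipOnBalls fun u => L u := fun _ =>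
  ⟨‖L‖, norm_nonneg _, fun u v _ _ => by rw [← map_sub]; exact L.le_opNorm _⟩

theorem const (x : X) : LipOnBalls fun _ : E => x := fun _ => ⟨0, le_rfl, by simp⟩

theorem exists_bound {f : E → X} (hf : LipOnBalls f) (ρ : ℝ) :
    ∃ B : ℝ, 0 ≤ B ∧ ∀ u, ‖u‖ ≤ ρ → ‖f u‖ ≤ B := by
  obtain ⟨K, hK, h⟩ := hf ρ
  refine ⟨K * |ρ| + ‖f 0‖, by positivity, fun u hu => ?_⟩
  have h0 : ‖(0 : E)‖ ≤ ρ := by rw [norm_zero]; exact (norm_nonneg u).trans hu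
  have h1 := h u 0 hu h0
  rw [sub_zero] at h1
  calc ‖f u‖ = ‖(f u - f 0) + f 0‖ := by rw [sub_add_cancel]
    _ ≤ ‖f u - f 0‖ + ‖f 0‖ := norm_add_le _ _
    _ ≤ K * |ρ| + ‖f 0‖ := by
        gcongr
        refine h1.trans ?_
        gcongr
        exact hu.trans (le_abs_self ρ)

theorem add {f g : E → X} (hf : LipOnBalls f) (hg : LipOnBalls g) :
    LipOnBalls fun u => f u + g u := fun ρ => by
  obtain ⟨K, hK, h⟩ := hf ρ
  obtain ⟨K', hK', h'⟩ := hg ρ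
  refine ⟨K + K', by positivity, fun u v hu hv => ?_⟩
  rw [add_sub_add_comm, add_mul]
  exact (norm_add_le _ _).trans (add_le_add (h u v hu hv) (h' u v hu hv))

theorem bilin (B : X →L[ℝ] Y →L[ℝ] Z) {f : E → X} {g : E → Y} (hf : LipOnBalls f)
    (hg : LipOnBalls g) : LipOnBalls fun u => B (f u) (g u) := fun ρ => by
  obtain ⟨K, hK, h⟩ := hf ρ
  obtain ⟨K', hK', h'⟩ := hg ρ
  obtain ⟨M, hM, hfM⟩ := hf.exists_bound ρ
  obtain ⟨M', hM', hgM⟩ := hg.exists_bound ρ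
  refine ⟨‖B‖ * (K * M' + M * K'), by positivity, fun u v hu hv => ?_⟩
  have e : B (f u) (g u) - B (f v) (g v) = B (f u - f v) (g u) + B (f v) (g u - g v) := by
    simp
  rw [e]
  calc _ ≤ ‖B‖ * ‖f u - f v‖ * ‖g u‖ + ‖B‖ * ‖f v‖ * ‖g u - g v‖ :=
        (norm_add_le _ _).trans (add_le_add (B.le_opNorm₂ _ _) (B.le_opNorm₂ _ _))
    _ ≤ ‖B‖ * (K * ‖u - v‖) * M' + ‖B‖ * M * (K' * ‖u - v‖) := by
        gcongr
        · exact h u v hu hv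
        · exact hgM u hu
        · exact hfM v hv
        · exact h' u v hu hv
    _ = _ := by ring

theorem const_smul {f : E → X} (hf : LipOnBalls f) (c : ℝ) : LipOnBalls fun u => c • f u :=
  bilin (ContinuousLinearMap.lsmul ℝ ℝ) (const c) hf

theorem smul {c : E → ℝ} {f : E → X} (hc : LipOnBalls c) (hf : LipOnBalls f) :
    LipOnBalls fun u => c u • f u := bilin (ContinuousLinearMap.lsmul ℝ ℝ) hc hf

theorem neg {f : E → X} (hf : LipOnBalls f) : LipOnBalls fun u => -f u := by
  simpa using hf.const_smul (-1)

theorem sub {f g : E → X} (hf : LipOnBalls f) (hg : LipOnBalls g) :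
    LipOnBalls fun u => f u - g u := by
  simpa [sub_eq_add_neg] using hf.add hg.neg

theorem clm_comp {f : E → X} (hf : LipOnBalls f) (L : X →L[ℝ] Y) : LipOnBalls fun u => L (f u) :=
  bilin (ContinuousLinearMap.id ℝ (X →L[ℝ] Y)) (const L) hf

theorem mul {A : Type*} [NormedRing A] [NormedAlgebra ℝ A] {f g : E → A} (hf : LipOnBalls f)
    (hg : LipOnBalls g) : LipOnBalls fun u => f u * g u :=
  bilin (ContinuousLinearMap.mul ℝ A) hf hg

theorem sum {ι : Type*} (s : Finset ι) {f : ι → E → X} (hf : ∀ i ∈ s, LipOnBalls (f i)) :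
    LipOnBalls fun u => ∑ i ∈ s, f i u := by
  classical
  induction s using Finset.induction_on with
  | empty => simpa using const (0 : X)
  | insert i s hi ih =>
    simp only [Finset.sum_insert hi]
    exact (hf i (by simp)).add (ih fun j hj => hf j (by simp [hj]))

theorem prodMk {f : E → X} {g : E → Y} (hf : LipOnBalls f) (hg : LipOnBalls g) :
    LipOnBalls fun u => (f u, g u) := by
  have := (hf.clm_comp (ContinuousLinearMap.inl ℝ X Y)).add
    (hg.clm_comp (ContinuousLinearMap.inr ℝ X Y))
  simpa using this

theorem lipschitz_comp {f : E → ℝ} (hf : LipOnBalls f) {F : ℝ → ℝ}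
    (hF : ∀ x y, |F x - F y| ≤ |x - y|) : LipOnBalls fun u => F (f u) := fun ρ => by
  obtain ⟨K, hK, h⟩ := hf ρ
  exact ⟨K, hK, fun u v hu hv => (hF _ _).trans (h u v hu hv)⟩

theorem comp {f : E → C(Torus, ℝ)} (hf : LipOnBalls f) {F : C(ℝ, ℝ)} (hF : ContDiff ℝ ∞ F) :
    LipOnBalls fun u => F.comp (f u) := fun ρ => by
  obtain ⟨K, hK, h⟩ := hf ρ
  obtain ⟨M, hM, hfM⟩ := hf.exists_bound ρ
  have hF1 : ContDiff ℝ 1 F := contDiff_infty.1 hF 1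
  obtain ⟨B, hB⟩ := (isCompact_Icc (a := -M) (b := M)).exists_bound_of_continuousOn
    (hF1.continuous_deriv le_rfl).continuousOn
  have hB0 : 0 ≤ B := (norm_nonneg _).trans (hB 0 ⟨by linarith, hM⟩)
  refine ⟨B * K, by positivity, fun u v hu hv => ?_⟩
  refine (ContinuousMap.norm_le _ (by positivity)).2 fun x => ?_
  have hmem : ∀ u, ‖u‖ ≤ ρ → f u x ∈ Icc (-M) M := fun u hu =>
    abs_le.1 (((f u).norm_coe_le_norm x).trans (hfM u hu))
  have := (convex_Icc (-M) M).norm_image_sub_le_of_norm_deriv_le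
    (fun y _ => hF1.differentiable one_ne_zero y) hB (hmem v hv) (hmem u hu)
  simp only [ContinuousMap.sub_apply, ContinuousMap.comp_apply]
  refine this.trans ?_
  rw [mul_assoc]
  gcongr
  exact ((f u - f v).norm_coe_le_norm x).trans (h u v hu hv)

theorem continuous {f : E → X} (hf : LipOnBalls f) : Continuous f := by
  rw [continuous_iff_continuousAt]
  intro u
  obtain ⟨K, hK, h⟩ := hf (‖u‖ + 1)
  rw [ContinuousAt, tendsto_iff_norm_sub_tendsto_zero]
  have h1 : Tendsto (fun v => K * ‖v - u‖) (𝓝 u) (𝓝 0) := by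
    have : Continuous fun v => K * ‖v - u‖ := by fun_prop
    simpa using this.tendsto u
  refine squeeze_zero' (Eventually.of_forall fun _ => norm_nonneg _) ?_ h1
  filter_upwards [Metric.ball_mem_nhds u one_pos] with v hv
  rw [mem_ball_iff_norm] at hv
  refine h v u ?_ (by linarith)
  have := norm_le_norm_add_norm_sub' v u
  linarith

/-- Global existence for bounded vector fields that are Lipschitz on balls. -/
theorem exists_solution [CompleteSpace E] {f : E → E} (hf : LipOnBalls f) {L : ℝ}
    (hL : ∀ u, ‖f u‖ ≤ L) (x₀ : E) {T : ℝ} (hT : 0 ≤ T) :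
    ∃ α : ℝ → E, α 0 = x₀ ∧ ∀ t ∈ Icc 0 T, HasDerivWithinAt α (f (α t)) (Icc 0 T) t := by
  have hL0 : 0 ≤ L := (norm_nonneg _).trans (hL 0)
  -- The speed is at most `L`, so no solution leaves the ball of radius `L * T` about `x₀` before
  -- time `T`, and one application of Picard–Lindelöf covers the whole interval.
  obtain ⟨K, hK, h⟩ := hf (‖x₀‖ + L * T)
  have hP : IsPicardLindelof (fun _ => f) (tmin := 0) (tmax := T) ⟨0, le_rfl, hT⟩ x₀
      ⟨L * T, by positivity⟩ 0 ⟨L, hL0⟩ ⟨K, hK⟩ := by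
    refine ⟨fun t _ => ?_, fun x _ => continuousOn_const, fun t _ x _ => hL x, ?_⟩
    · refine LipschitzOnWith.of_dist_le_mul fun u hu v hv => ?_
      have hb : ∀ u ∈ Metric.closedBall x₀ (L * T), ‖u‖ ≤ ‖x₀‖ + L * T := fun u hu => by
        rw [mem_closedBall_iff_norm] at hu
        have := norm_le_norm_add_norm_sub' u x₀
        linarith
      rw [dist_eq_norm, dist_eq_norm]
      exact h u v (hb u hu) (hb v hv)
    · simp only [sub_zero, sub_self, NNReal.coe_zero, max_eq_left hT]
      exact le_rfl
  exact hP.exists_eq_forall_mem_Icc_hasDerivWithinAt₀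

end LipOnBalls

end LipOnBalls

/-! ### Energy, cut-off and vector field of the truncated system -/

/-- The truncated energy. -/
def energy (m : ℝ) (N : ℕ) (u : C(Torus, ℝ) × C(Torus, ℝ)) : ℝ :=
  ∑ k ∈ box N, (wt m k * ‖fourierCoeff u.1 k‖) ^ 2 + ∑ k ∈ box N, (wt m k * ‖fourierCoeff u.2 k‖) ^ 2

/-- A Lipschitz cut-off, equal to `1` on `(-∞, R + 1]` and to `0` on `[R + 2, ∞)`. -/
def cutoff (R x : ℝ) : ℝ := max 0 (min 1 (R + 2 - x))

theorem cutoff_nonneg (R x : ℝ) : 0 ≤ cutoff R x := le_max_left _ _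

theorem cutoff_le_one (R x : ℝ) : cutoff R x ≤ 1 := max_le zero_le_one (min_le_left _ _)

theorem cutoff_eq_one {R x : ℝ} (h : x ≤ R + 1) : cutoff R x = 1 := by
  rw [cutoff, min_eq_left (by linarith), max_eq_right zero_le_one]

theorem cutoff_eq_zero {R x : ℝ} (h : R + 2 ≤ x) : cutoff R x = 0 := by
  rw [cutoff, min_eq_right (by linarith), max_eq_left (by linarith)]

theorem abs_cutoff_sub_le (R x y : ℝ) : |cutoff R x - cutoff R y| ≤ |x - y| := by
  rw [cutoff, cutoff]
  refine (abs_max_sub_max_le_max _ _ _ _).trans ?_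
  simp only [sub_self, abs_zero]
  refine max_le (abs_nonneg _) ((abs_min_sub_min_le_max _ _ _ _).trans ?_)
  simp only [sub_self, abs_zero]
  refine max_le (abs_nonneg _) (le_of_eq ?_)
  rw [abs_sub_comm]; congr 1; ring

/-- The vector field of the truncated system. -/
def field (c μ : ℝ) (a b : C(ℝ, ℝ)) (m R : ℝ) (N : ℕ) (u : C(Torus, ℝ) × C(Torus, ℝ)) :
    C(Torus, ℝ) × C(Torus, ℝ) :=
  cutoff R (energy m N u) •
    (proj N (rhsDensity a (proj N u.1) (proj N u.2) (fun j => pdTrunc N j u.1)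
        (fun j => pdTrunc N j u.2)),
      proj N (rhsAngle c μ a b (proj N u.1) (proj N u.2) (fun j => pdTrunc N j u.1)
        (fun j => pdTrunc N j u.2)) + μ • lapTrunc N u.2)

/-- The squared modulus is the sum of the squares of two real linear functionals, so the product
rule applies although the norm itself is not smooth. -/
theorem lipOnBalls_normSq {E : Type*} [NormedAddCommGroup E] [NormedSpace ℝ E] (L : E →L[ℝ] ℂ)
    (c : ℝ) : LipOnBalls fun u => (c * ‖L u‖) ^ 2 := by
  have h1 := LipOnBalls.clm (Complex.reCLM.comp L)
  have h2 := LipOnBalls.clm (Complex.imCLM.comp L)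
  have h := ((h1.mul h1).add (h2.mul h2)).const_smul (c ^ 2)
  have e : (fun u => (c * ‖L u‖) ^ 2) = fun u => c ^ 2 • ((Complex.reCLM.comp L) u *
      (Complex.reCLM.comp L) u + (Complex.imCLM.comp L) u * (Complex.imCLM.comp L) u) := by
    funext u
    rw [mul_pow, ← Complex.normSq_eq_norm_sq, Complex.normSq_apply]; rfl
  rw [e]; exact h

theorem lipOnBalls_energy (m : ℝ) (N : ℕ) : LipOnBalls (energy m N) := by
  have h1 := LipOnBalls.sum (box N) fun k _ => lipOnBalls_normSq
    ((coeffCLM k).comp (ContinuousLinearMap.fst ℝ C(Torus, ℝ) C(Torus, ℝ))) (wt m k)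
  have h2 := LipOnBalls.sum (box N) fun k _ => lipOnBalls_normSq
    ((coeffCLM k).comp (ContinuousLinearMap.snd ℝ C(Torus, ℝ) C(Torus, ℝ))) (wt m k)
  have h := h1.add h2
  simp only [ContinuousLinearMap.comp_apply, coeffCLM_apply, ContinuousLinearMap.coe_fst',
    ContinuousLinearMap.coe_snd'] at h
  exact h

theorem lipOnBalls_field (c μ : ℝ) {a b : C(ℝ, ℝ)} (ha : ContDiff ℝ ∞ a) (hb : ContDiff ℝ ∞ b)
    (m R : ℝ) (N : ℕ) : LipOnBalls (field c μ a b m R N) := by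
  have hfst : LipOnBalls fun u : C(Torus, ℝ) × C(Torus, ℝ) => u.1 :=
    LipOnBalls.clm (ContinuousLinearMap.fst ℝ C(Torus, ℝ) C(Torus, ℝ))
  have hsnd : LipOnBalls fun u : C(Torus, ℝ) × C(Torus, ℝ) => u.2 :=
    LipOnBalls.clm (ContinuousLinearMap.snd ℝ C(Torus, ℝ) C(Torus, ℝ))
  have hr := hfst.clm_comp (proj N)
  have hφ := hsnd.clm_comp (proj N)
  have hdr := fun j => hfst.clm_comp (pdTrunc N j)
  have hdφ := fun j => hsnd.clm_comp (pdTrunc N j)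
  have hc := hφ.comp contDiff_cosMap
  have hs := hφ.comp contDiff_sinMap
  have har := hr.comp ha
  have hbr := hr.comp hb
  refine ((lipOnBalls_energy m N).lipschitz_comp (abs_cutoff_sub_le R)).smul
    (LipOnBalls.prodMk (LipOnBalls.clm_comp ?_ (proj N))
      ((LipOnBalls.clm_comp ?_ (proj N)).add ((hsnd.clm_comp (lapTrunc N)).const_smul μ)))
  · exact ((((hc.mul (hdr 0)).add (hs.mul (hdr 1))).add ((har.mul hc).mul (hdφ 1))).sub
      ((har.mul hs).mul (hdφ 0))).neg
  · exact ((((((hc.mul (hdφ 0)).add (hs.mul (hdφ 1))).const_smul c).add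
      ((har.mul hc).mul (hdr 1))).sub ((har.mul hs).mul (hdr 0))).neg).add
      ((hbr.mul (((hdr 0).mul (hdφ 0)).add ((hdr 1).mul (hdφ 1)))).const_smul (2 * μ))

theorem energy_proj (m : ℝ) (N : ℕ) (u : C(Torus, ℝ) × C(Torus, ℝ)) :
    energy m N (proj N u.1, proj N u.2) = energy m N u := by
  simp only [energy]
  congr 1 <;> exact Finset.sum_congr rfl fun k hk => by rw [fourierCoeff_proj, if_pos hk]

theorem field_proj (c μ : ℝ) (a b : C(ℝ, ℝ)) (m R : ℝ) (N : ℕ) (u : C(Torus, ℝ) × C(Torus, ℝ)) :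
    field c μ a b m R N (proj N u.1, proj N u.2) = field c μ a b m R N u := by
  simp only [field, energy_proj, proj_proj, pdTrunc_proj, lapTrunc_proj]

theorem sobE_proj_fst_le (m : ℝ) (N : ℕ) (u : C(Torus, ℝ) × C(Torus, ℝ)) :
    sobE m (proj N u.1) ≤ ENNReal.ofReal (energy m N u) := by
  rw [sobE_of_proj (proj_proj N u.1), ← energy_proj]
  exact ENNReal.ofReal_le_ofReal (le_add_of_nonneg_right (Finset.sum_nonneg fun _ _ => sq_nonneg _))

theorem sobE_proj_snd_le (m : ℝ) (N : ℕ) (u : C(Torus, ℝ) × C(Torus, ℝ)) :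
    sobE m (proj N u.2) ≤ ENNReal.ofReal (energy m N u) := by
  rw [sobE_of_proj (proj_proj N u.2), ← energy_proj]
  exact ENNReal.ofReal_le_ofReal (le_add_of_nonneg_left (Finset.sum_nonneg fun _ _ => sq_nonneg _))

/-- The field vanishes where the energy is at least `R + 2`. Elsewhere the energy bounds the
projected state in sup norm, and the field depends on nothing else. -/
theorem exists_norm_field_le (c μ : ℝ) {a b : C(ℝ, ℝ)} (ha : ContDiff ℝ ∞ a) (hb : ContDiff ℝ ∞ b)
    {m : ℝ} (hm : 2 < m) (R : ℝ) (N : ℕ) : ∃ L : ℝ, ∀ u, ‖field c μ a b m R N u‖ ≤ L := by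
  obtain ⟨M, hM, h⟩ := exists_norm_pd_le hm (ENNReal.ofReal_ne_top (r := R + 2))
  obtain ⟨B, hB, hle⟩ := (lipOnBalls_field c μ ha hb m R N).exists_bound M
  refine ⟨B, fun u => ?_⟩
  rcases le_total (R + 2) (energy m N u) with hu | hu
  · rw [field, cutoff_eq_zero hu, zero_smul, norm_zero]; exact hB
  · rw [← field_proj]
    refine hle _ ?_
    have h1 := (h _ ((sobE_proj_fst_le m N u).trans (ENNReal.ofReal_le_ofReal hu))).1
    have h2 := (h _ ((sobE_proj_snd_le m N u).trans (ENNReal.ofReal_le_ofReal hu))).1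
    exact max_le h1 h2

end SelfPropelled
end

noncomputable section
namespace SelfPropelled
open Filter Topology

/-! ### Uniform bounds for the truncated solutions -/

open scoped ComplexConjugate

theorem pairing_proj (m : ℝ) (N : ℕ) (u w : C(Torus, ℝ)) :
    pairing m N u (proj N w) = pairing m N u w :=
  Finset.sum_congr rfl fun k hk => by rw [fourierCoeff_proj, if_pos hk]

theorem hasDerivAt_energy (m : ℝ) (N : ℕ) {r φ : ℝ → C(Torus, ℝ)} {r' φ' : C(Torus, ℝ)} {t : ℝ}
    (hr : HasDerivAt r r' t) (hφ : HasDerivAt φ φ' t) :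
    HasDerivAt (fun s => energy m N (r s, φ s))
      (2 * (pairing m N (r t) r' + pairing m N (φ t) φ')) t := by
  have key : ∀ {u : ℝ → C(Torus, ℝ)} {u' : C(Torus, ℝ)}, HasDerivAt u u' t →
      HasDerivAt (fun s => ∑ k ∈ box N, (wt m k * ‖fourierCoeff (u s) k‖) ^ 2)
        (2 * pairing m N (u t) u') t := by
    intro u u' hu
    have h1 : ∀ k ∈ box N, HasDerivAt (fun s => (wt m k * ‖fourierCoeff (u s) k‖) ^ 2)
        (wt m k ^ 2 * (2 * (conj (fourierCoeff (u t) k) * fourierCoeff u' k).re)) t := by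
      intro k _
      have h2 : HasDerivAt (fun s => coeffCLM k (u s)) (coeffCLM k u') t :=
        (coeffCLM k).hasFDerivAt.comp_hasDerivAt t hu
      have h3 := (h2.norm_sq).const_mul (wt m k ^ 2)
      simp only [coeffCLM_apply, Complex.inner] at h3
      refine (h3.congr_of_eventuallyEq (Eventually.of_forall fun s => ?_)).congr_deriv ?_
      · simp only [mul_pow]
      · rw [mul_comm (fourierCoeff u' k)]
    refine (HasDerivAt.fun_sum h1).congr_deriv ?_
    rw [pairing, Finset.mul_sum]
    exact Finset.sum_congr rfl fun k _ => by ring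
  refine ((key hr).add (key hφ)).congr_deriv (by ring)

theorem field_of_proj (c μ : ℝ) (a b : C(ℝ, ℝ)) {m R : ℝ} {N : ℕ} {r φ : C(Torus, ℝ)}
    (hr : proj N r = r) (hφ : proj N φ = φ) : field c μ a b m R N (r, φ) =
      cutoff R (energy m N (r, φ)) • (proj N (fluxDensity a r φ),
        proj N (fluxAngle c μ a b r φ) + μ • lapTrunc N φ) := by
  simp only [field, fluxDensity, fluxAngle, pdTrunc_eq_pd hr, pdTrunc_eq_pd hφ, hr, hφ]

/-- The energy grows at rate at most `G`, so during a time `1 / (G + 1)` it rises by at most one and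
never reaches the region where the cut-off acts. Hence the solution solves the system without
cut-off, and `T`, `R` do not depend on `N`. -/
theorem exists_truncated_solution (c : ℝ) {μ m : ℝ} (hμ : 0 ≤ μ) (hm : 2 < m) {a b : C(ℝ, ℝ)}
    (ha : ContDiff ℝ ∞ a) (hb : ContDiff ℝ ∞ b) {r₀ φ₀ : C(Torus, ℝ)} (hr₀ : sobE m r₀ ≠ ⊤)
    (hφ₀ : sobE m φ₀ ≠ ⊤) :
    ∃ T R : ℝ, 0 < T ∧ 0 ≤ R ∧ ∀ N, ∃ r φ : ℝ → C(Torus, ℝ),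
      r 0 = proj N r₀ ∧ φ 0 = proj N φ₀ ∧
      (∀ t ∈ Icc 0 T, proj N (φ t) = φ t ∧
        sobE m (r t) ≤ ENNReal.ofReal R ∧ sobE m (φ t) ≤ ENNReal.ofReal R ∧
        HasDerivWithinAt r (proj N (fluxDensity a (r t) (φ t))) (Icc 0 T) t ∧
        HasDerivWithinAt φ (proj N (fluxAngle c μ a b (r t) (φ t)) + μ • lapTrunc N (φ t))
          (Icc 0 T) t) ∧
      μ * ∫ t in 0..T, ∑ k ∈ box N, (wt (m + 1) k * ‖fourierCoeff (φ t) k‖) ^ 2 ≤ R := by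
  set R₀ := (sobE m r₀).toReal + (sobE m φ₀).toReal with hR₀
  have hR₀0 : 0 ≤ R₀ := by positivity
  -- `R₀ + 2` is the level beyond which the cut-off vanishes, so the estimate is available wherever
  -- the field is nonzero.
  obtain ⟨G, hG, hGle⟩ := exists_energy_bound c hμ hm ha hb (R := R₀ + 2) (by positivity)
  set T := 1 / (G + 1) with hT
  have hT0 : 0 < T := by positivity
  have hGT : G * T ≤ 1 := by
    rw [hT, mul_one_div]; exact (div_le_one (by positivity)).2 (by linarith)
  refine ⟨T, R₀ + 1, hT0, by positivity, fun N => ?_⟩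
  obtain ⟨L, hL⟩ := exists_norm_field_le c μ ha hb hm R₀ N
  obtain ⟨u, hu0, hu⟩ := (lipOnBalls_field c μ ha hb m R₀ N).exists_solution hL
    (proj N r₀, proj N φ₀) hT0.le
  have hucont : ContinuousOn u (Icc 0 T) := fun t ht => (hu t ht).continuousWithinAt
  -- the solution stays in the range of the projection
  have hproj : ∀ t ∈ Icc 0 T, proj N (u t).1 = (u t).1 ∧ proj N (u t).2 = (u t).2 := by
    set D : C(Torus, ℝ) × C(Torus, ℝ) →L[ℝ] C(Torus, ℝ) × C(Torus, ℝ) :=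
      ContinuousLinearMap.id ℝ _ - (proj N).prodMap (proj N) with hD
    have hDf : ∀ v, D (field c μ a b m R₀ N v) = 0 := by
      intro v
      simp [hD, field, proj_proj, proj_lapTrunc]
    have h0 := constant_of_has_deriv_right_zero (f := fun t => D (u t)) (a := 0) (b := T)
      (D.continuous.comp_continuousOn hucont) fun t ht => by
        have := D.hasFDerivAt.comp_hasDerivWithinAt t (hu t (Ico_subset_Icc_self ht))
        rw [hDf] at this
        exact this.mono_of_mem_nhdsWithin (Icc_mem_nhdsGE_of_mem ht)
    intro t ht
    have h1 := h0 t ht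
    have h2 : D (u 0) = 0 := by rw [hu0]; simp [hD, proj_proj]
    rw [h2, hD] at h1
    simp only [sub_apply, ContinuousLinearMap.id_apply, sub_eq_zero] at h1
    exact ⟨(congrArg Prod.fst h1).symm, (congrArg Prod.snd h1).symm⟩
  set S : ℝ → ℝ := fun t => ∑ k ∈ box N, (wt (m + 1) k * ‖fourierCoeff (u t).2 k‖) ^ 2 with hS
  have hS0 : ∀ t, 0 ≤ S t := fun t => Finset.sum_nonneg fun _ _ => sq_nonneg _
  have hScont : ContinuousOn S (Icc 0 T) := by
    refine continuousOn_finsetSum _ fun k _ => ?_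
    have : ContinuousOn (fun t => coeffCLM k (u t).2) (Icc 0 T) :=
      ((coeffCLM k).continuous.comp continuous_snd).comp_continuousOn hucont
    exact (this.norm.const_mul _).pow 2
  have hEcont : ContinuousOn (fun t => energy m N (u t)) (Icc 0 T) :=
    (lipOnBalls_energy m N).continuous.comp_continuousOn hucont
  have hderiv : ∀ t ∈ Ioo 0 T, ∃ e : ℝ, HasDerivAt (fun s => energy m N (u s)) e t ∧
      e ≤ cutoff R₀ (energy m N (u t)) * (G - μ * S t) := by
    intro t ht
    have htI := Ioo_subset_Icc_self ht
    obtain ⟨hp1, hp2⟩ := hproj t htI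
    have h1 := (hu t htI).hasDerivAt (Icc_mem_nhds ht.1 ht.2)
    have h2 := hasDerivAt_energy m N h1.fst h1.snd
    refine ⟨_, h2, ?_⟩
    have h3 : field c μ a b m R₀ N (u t) = _ := field_of_proj c μ a b hp1 hp2
    rw [h3]
    simp only [Prod.smul_fst, Prod.smul_snd, pairing_smul, pairing_add, pairing_proj]
    rcases le_total (R₀ + 2) (energy m N (u t)) with hle | hle
    · have : cutoff R₀ (energy m N ((u t).1, (u t).2)) = 0 := cutoff_eq_zero hle
      simp [this]
    · have h4 := sobE_proj_fst_le m N (u t)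
      have h5 := sobE_proj_snd_le m N (u t)
      rw [hp1] at h4
      rw [hp2] at h5
      have h6 := hGle N _ _ hp1 hp2 (h4.trans (ENNReal.ofReal_le_ofReal hle))
        (h5.trans (ENNReal.ofReal_le_ofReal hle))
      have h7 := mul_le_mul_of_nonneg_left h6 (cutoff_nonneg R₀ (energy m N (u t)))
      simp only [pairing_add, pairing_smul] at h7
      refine le_trans (le_of_eq ?_) h7
      simp only [Prod.mk.eta]
      ring
  choose! e he hele using hderiv
  have hE0 : energy m N (u 0) ≤ R₀ := by
    rw [hu0, energy]
    refine add_le_add ?_ ?_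
    · refine sum_le_of_sobE_le ENNReal.toReal_nonneg ?_ _
      rw [ENNReal.ofReal_toReal hr₀]; exact sobE_proj_le _ _ _
    · refine sum_le_of_sobE_le ENNReal.toReal_nonneg ?_ _
      rw [ENNReal.ofReal_toReal hφ₀]; exact sobE_proj_le _ _ _
  have hEle : ∀ t ∈ Icc 0 T, energy m N (u t) ≤ R₀ + 1 := by
    intro t ht
    have h1 := intervalIntegral.sub_le_integral_of_hasDeriv_right_of_le
      (g := fun s => energy m N (u s)) (g' := e) (φ := fun _ => G) ht.1
      (hEcont.mono (Icc_subset_Icc_right ht.2))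
      (fun s hs => (he s ⟨hs.1, hs.2.trans_le ht.2⟩).hasDerivWithinAt)
      (integrableOn_const (by simp)) (fun s hs => by
        refine (hele s ⟨hs.1, hs.2.trans_le ht.2⟩).trans ?_
        have h2 := cutoff_nonneg R₀ (energy m N (u s))
        have h3 := cutoff_le_one R₀ (energy m N (u s))
        have h4 := mul_nonneg h2 (mul_nonneg hμ (hS0 s))
        have h5 := mul_le_mul_of_nonneg_right h3 hG
        linarith)
    rw [intervalIntegral.integral_const, smul_eq_mul, sub_zero] at h1
    have : t * G ≤ G * T := by rw [mul_comm]; exact mul_le_mul_of_nonneg_left ht.2 hG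
    linarith
  have hcut : ∀ t ∈ Icc 0 T, cutoff R₀ (energy m N (u t)) = 1 := fun t ht =>
    cutoff_eq_one (hEle t ht)
  refine ⟨fun t => (u t).1, fun t => (u t).2, by simp only [hu0], by simp only [hu0],
    fun t ht => ?_, ?_⟩
  · obtain ⟨hp1, hp2⟩ := hproj t ht
    have h4 := sobE_proj_fst_le m N (u t)
    have h5 := sobE_proj_snd_le m N (u t)
    rw [hp1] at h4
    rw [hp2] at h5
    have h1 := hu t ht
    have h3 : field c μ a b m R₀ N (u t) = _ := field_of_proj c μ a b hp1 hp2
    have h6 : cutoff R₀ (energy m N ((u t).1, (u t).2)) = 1 := hcut t ht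
    rw [h3, h6, one_smul] at h1
    exact ⟨hp2, h4.trans (ENNReal.ofReal_le_ofReal (hEle t ht)),
      h5.trans (ENNReal.ofReal_le_ofReal (hEle t ht)), h1.fst, h1.snd⟩
  · have hSint : IntervalIntegrable S volume 0 T := by
      refine ContinuousOn.intervalIntegrable ?_
      rwa [uIcc_of_le hT0.le]
    -- The energy inequality is integrated again, now with the cut-off equal to `1` and the
    -- dissipation kept; nonnegativity of the final energy bounds the dissipation integral.
    have h1 := intervalIntegral.sub_le_integral_of_hasDeriv_right_of_le
      (g := fun s => energy m N (u s)) (g' := e) (φ := fun t => G - μ * S t) hT0.le hEcont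
      (fun s hs => (he s hs).hasDerivWithinAt)
      ((continuousOn_const.sub (hScont.const_mul μ)).integrableOn_Icc)
      (fun s hs => by
        have := hele s hs
        rwa [hcut s (Ioo_subset_Icc_self hs), one_mul] at this)
    rw [intervalIntegral.integral_sub (by simp) (hSint.const_mul μ),
      intervalIntegral.integral_const, intervalIntegral.integral_const_mul, smul_eq_mul,
      sub_zero] at h1
    have h2 : 0 ≤ energy m N (u T) := add_nonneg (Finset.sum_nonneg fun _ _ => sq_nonneg _)
      (Finset.sum_nonneg fun _ _ => sq_nonneg _)
    change μ * ∫ t in 0..T, S t ≤ _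
    linarith

end SelfPropelled
end

noncomputable section
namespace SelfPropelled
open Filter Topology

/-! ### Passage to the limit -/

open scoped ComplexConjugate

/-- Arzelà–Ascoli for each index and Tychonoff for the product. The product is metrizable because
the index set is countable, so compactness yields a single subsequence and no diagonal argument is
needed. -/
theorem exists_subseq_tendsto_of_lipschitz {ι : Type*} [Countable ι] {T : ℝ}
    {F : ℕ → ι → ℝ → ℂ} {M L : ι → ℝ} (hM : ∀ n i, ∀ t ∈ Icc 0 T, ‖F n i t‖ ≤ M i)
    (hL : ∀ n i, ∀ s ∈ Icc 0 T, ∀ t ∈ Icc 0 T, ‖F n i t - F n i s‖ ≤ L i * |t - s|) :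
    ∃ (σ : ℕ → ℕ) (G : ι → ℝ → ℂ), StrictMono σ ∧
      ∀ i, ∀ t ∈ Icc 0 T, Tendsto (fun n => F (σ n) i t) atTop (𝓝 (G i t)) := by
  classical
  let A : ι → Set (BoundedContinuousFunction (Icc (0 : ℝ) T) ℂ) := fun i =>
    {f | (∀ t, f t ∈ Metric.closedBall (0 : ℂ) (M i)) ∧ ∀ s t, dist (f s) (f t) ≤ L i * dist s t}
  have hA : ∀ i, IsCompact (closure (A i)) := fun i => by
    refine BoundedContinuousFunction.arzela_ascoli _ (isCompact_closedBall (0 : ℂ) (M i)) _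
      (fun f t hf => hf.1 t) ?_
    refine Metric.equicontinuous_of_continuity_modulus (fun x => L i * x) ?_ _
      fun s t f => f.2.2 s t
    have : Continuous fun x : ℝ => L i * x := by fun_prop
    simpa using this.tendsto 0
  have hFd : ∀ n i (s t : Icc (0 : ℝ) T), dist (F n i s) (F n i t) ≤ L i * dist s t := by
    intro n i s t
    have := hL n i t t.2 s s.2
    rwa [dist_eq_norm]
  have hcont : ∀ n i, Continuous fun t : Icc (0 : ℝ) T => F n i t := fun n i =>
    (LipschitzWith.of_dist_le_mul (K := (L i).toNNReal) fun s t => (hFd n i s t).trans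
      (mul_le_mul_of_nonneg_right (Real.le_coe_toNNReal _) dist_nonneg)).continuous
  let X : ℕ → ι → BoundedContinuousFunction (Icc (0 : ℝ) T) ℂ := fun n i =>
    BoundedContinuousFunction.mkOfCompact ⟨_, hcont n i⟩
  have hX : ∀ n, X n ∈ univ.pi fun i => closure (A i) := fun n i _ =>
    subset_closure ⟨fun t => by
      rw [mem_closedBall_zero_iff]; exact hM n i t t.2, hFd n i⟩
  obtain ⟨G, -, σ, hσ, hlim⟩ := (isCompact_univ_pi hA).tendsto_subseq hX
  refine ⟨σ, fun i t => if ht : t ∈ Icc 0 T then G i ⟨t, ht⟩ else 0, hσ, fun i t ht => ?_⟩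
  simp only [dif_pos ht]
  have h1 := (tendsto_pi_nhds.1 hlim) i
  exact ((BoundedContinuousFunction.evalCLM ℝ (⟨t, ht⟩ : Icc (0 : ℝ) T)).continuous.tendsto (G i)).comp h1

theorem norm_fourierCoeff_le_sqrt {s R : ℝ} (hs : 0 ≤ s) (hR : 0 ≤ R) {f : Torus → ℝ}
    (h : sobE s f ≤ ENNReal.ofReal R) (k : Freq) : ‖fourierCoeff f k‖ ≤ √R := by
  have h1 := sum_le_of_sobE_le hR h {k}
  rw [Finset.sum_singleton] at h1
  refine (le_mul_of_one_le_left (norm_nonneg _) (one_le_wt hs k)).trans ?_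
  exact Real.le_sqrt_of_sq_le h1

/-- Bounds on finite partial sums are what pointwise limits of coefficients preserve; since `m > 2`
they make the coefficients absolutely summable. -/
theorem exists_continuousMap_of_coeff {m R : ℝ} (hm : 2 < m) {a : Freq → ℂ}
    (hsym : ∀ k, a (-k) = conj (a k))
    (ha : ∀ S : Finset Freq, ∑ k ∈ S, (wt m k * ‖a k‖) ^ 2 ≤ R) :
    ∃ f : C(Torus, ℝ), (∀ k, fourierCoeff f k = a k) ∧ sobE m f ≤ ENNReal.ofReal R := by
  have h1 : Summable fun k => ‖a k‖ ^ 2 := by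
    refine summable_of_sum_le (c := R) (fun k => sq_nonneg _) fun S => ?_
    refine (Finset.sum_le_sum fun k _ => ?_).trans (ha S)
    exact pow_le_pow_left₀ (norm_nonneg _)
      (le_mul_of_one_le_left (norm_nonneg _) (one_le_wt (by linarith) k)) 2
  obtain ⟨f, -, hfa⟩ := exists_memLp_of_coeff h1 hsym
  have h2 : sobE m f ≤ ENNReal.ofReal R := sobE_le_of_sum_le fun S => by simpa [hfa] using ha S
  have h3 : Summable fun k => ‖a k‖ := by
    have := summable_norm_of_wsum (wsum_ne_top (s := 0) (by linarith)
      (h2.trans_lt ENNReal.ofReal_lt_top).ne)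
    simpa [hfa, wt_zero] using this
  have h4 : ∀ k, fourierCoeff (synth a) k = a k := fourierCoeff_synth h3 hsym
  refine ⟨synth a, h4, ?_⟩
  rwa [sobE_congr m fun k => (h4 k).trans (hfa k).symm]

theorem continuousOn_of_coeff {m R : ℝ} (hm : 2 < m) {u : ℝ → C(Torus, ℝ)} {I : Set ℝ}
    (hu : ∀ t ∈ I, sobE m (u t) ≤ ENNReal.ofReal R)
    (hc : ∀ k, ContinuousOn (fun t => fourierCoeff (u t) k) I) : ContinuousOn u I := fun t ht =>
  (tendsto_of_coeff hm ENNReal.ofReal_ne_top (eventually_mem_nhdsWithin.mono hu) (hu t ht)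
    fun k => hc k t ht).1

theorem continuousOn_fourierCoeff {u : ℝ → C(Torus, ℝ)} {I : Set ℝ} (hu : ContinuousOn u I)
    (k : Freq) : ContinuousOn (fun t => fourierCoeff (u t) k) I :=
  (coeffCLM k).continuous.comp_continuousOn hu

theorem continuousOn_flux {m R : ℝ} (hm : 2 < m) (c μ : ℝ) (a b : C(ℝ, ℝ))
    {r φ : ℝ → C(Torus, ℝ)} {I : Set ℝ} (hr : ContinuousOn r I) (hφ : ContinuousOn φ I)
    (hrR : ∀ t ∈ I, sobE m (r t) ≤ ENNReal.ofReal R)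
    (hφR : ∀ t ∈ I, sobE m (φ t) ≤ ENNReal.ofReal R) :
    ContinuousOn (fun t => fluxDensity a (r t) (φ t)) I ∧
    ContinuousOn (fun t => fluxAngle c μ a b (r t) (φ t)) I := by
  have key := fun t ht => tendsto_flux (l := 𝓝[I] t) hm c μ a b (ENNReal.ofReal_ne_top (r := R))
    (eventually_mem_nhdsWithin.mono hrR) (eventually_mem_nhdsWithin.mono hφR) (hrR t ht)
    (hφR t ht) (fun k => continuousOn_fourierCoeff hr k t ht)
    fun k => continuousOn_fourierCoeff hφ k t ht
  exact ⟨fun t ht => (key t ht).1, fun t ht => (key t ht).2⟩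

theorem exists_norm_coeff_flux_le (c μ : ℝ) {m : ℝ} (hm : 2 < m) {a b : C(ℝ, ℝ)}
    (ha : ContDiff ℝ ∞ a) (hb : ContDiff ℝ ∞ b) (R : ℝ) : ∃ A : ℝ, 0 ≤ A ∧
      ∀ r φ : C(Torus, ℝ), sobE m r ≤ ENNReal.ofReal R → sobE m φ ≤ ENNReal.ofReal R → ∀ k,
        ‖fourierCoeff (fluxDensity a r φ) k‖ ≤ A ∧ ‖fourierCoeff (fluxAngle c μ a b r φ) k‖ ≤ A := by
  obtain ⟨C₁, hC₁, h₁⟩ := sobBounded_fluxDensity hm ha _ (ENNReal.ofReal_ne_top (r := R))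
  obtain ⟨C₂, hC₂, h₂⟩ := sobBounded_fluxAngle c μ hm ha hb _ (ENNReal.ofReal_ne_top (r := R))
  refine ⟨max √C₁.toReal √C₂.toReal, by positivity, fun r φ hr hφ k => ⟨?_, ?_⟩⟩
  · refine (norm_fourierCoeff_le_sqrt (s := m - 1) (by linarith) ENNReal.toReal_nonneg ?_ k).trans
      (le_max_left _ _)
    rw [ENNReal.ofReal_toReal hC₁]; exact h₁ r φ hr hφ
  · refine (norm_fourierCoeff_le_sqrt (s := m - 1) (by linarith) ENNReal.toReal_nonneg ?_ k).trans
      (le_max_right _ _)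
    rw [ENNReal.ofReal_toReal hC₂]; exact h₂ r φ hr hφ

theorem fourierCoeff_add_smul (f g : C(Torus, ℝ)) (c : ℝ) (k : Freq) :
    fourierCoeff (f + c • g : C(Torus, ℝ)) k = fourierCoeff f k + c * fourierCoeff g k := by
  have := (coeffCLM k).map_add f (c • g)
  rw [(coeffCLM k).map_smul] at this
  simpa using this

theorem integral_coeff_of_hasDerivWithinAt {T : ℝ} {u u' : ℝ → C(Torus, ℝ)} {k : Freq}
    {q : ℝ → ℂ} (hu : ∀ t ∈ Icc 0 T, HasDerivWithinAt u (u' t) (Icc 0 T) t)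
    (hq : ∀ t ∈ Icc 0 T, fourierCoeff (u' t) k = q t) (hqc : ContinuousOn q (Icc 0 T)) {t : ℝ}
    (ht : t ∈ Icc 0 T) : fourierCoeff (u t) k = fourierCoeff (u 0) k + ∫ s in 0..t, q s := by
  have h1 : ∀ t ∈ Icc 0 T, HasDerivWithinAt (fun s => fourierCoeff (u s) k) (q t) (Icc 0 T) t :=
    fun t ht => by
      have := (coeffCLM k).hasFDerivAt.comp_hasDerivWithinAt t (hu t ht)
      rw [← hq t ht]; exact this
  have hsub : Icc 0 t ⊆ Icc 0 T := Icc_subset_Icc_right ht.2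
  rw [intervalIntegral.integral_eq_sub_of_hasDerivAt_of_le ht.1
    (fun s hs => (h1 s (hsub hs)).continuousWithinAt.mono hsub)
    (fun s hs => (h1 s ⟨hs.1.le, hs.2.le.trans ht.2⟩).hasDerivAt
      (Icc_mem_nhds hs.1 (hs.2.trans_le ht.2)))
    (ContinuousOn.intervalIntegrable (by rw [uIcc_of_le ht.1]; exact hqc.mono hsub))]
  ring

/-- The limit equation is written for Fourier coefficients in time-integrated form: the Laplacian is
then multiplication by a number and demands no regularity of `φ`, while the nonlinear terms converge
uniformly in space. Dominated convergence handles the time integral. -/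
theorem exists_coefficient_solution (c : ℝ) {μ m : ℝ} (hμ : 0 ≤ μ) (hm : 2 < m) {a b : C(ℝ, ℝ)}
    (ha : ContDiff ℝ ∞ a) (hb : ContDiff ℝ ∞ b) {r₀ φ₀ : C(Torus, ℝ)} (hr₀ : sobE m r₀ ≠ ⊤)
    (hφ₀ : sobE m φ₀ ≠ ⊤) :
    ∃ T R : ℝ, 0 < T ∧ ∃ r φ : ℝ → C(Torus, ℝ), ContinuousOn r (Icc 0 T) ∧
      ContinuousOn φ (Icc 0 T) ∧ r 0 = r₀ ∧ φ 0 = φ₀ ∧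
      (∀ t ∈ Icc 0 T, sobE m (r t) ≤ ENNReal.ofReal R ∧ sobE m (φ t) ≤ ENNReal.ofReal R ∧ ∀ k,
        fourierCoeff (r t) k = fourierCoeff r₀ k +
          ∫ s in 0..t, fourierCoeff (fluxDensity a (r s) (φ s)) k ∧
        fourierCoeff (φ t) k = fourierCoeff φ₀ k +
          ∫ s in 0..t, (fourierCoeff (fluxAngle c μ a b (r s) (φ s)) k
            + μ * (-(laplaceSymbol k : ℂ) * fourierCoeff (φ s) k))) ∧
      (0 < μ → ∫⁻ t in Ioo 0 T, sobE (m + 1) (φ t) < ⊤) := by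
  obtain ⟨T, R, hT, hR, H⟩ := exists_truncated_solution c hμ hm ha hb hr₀ hφ₀
  choose rN φN hr0 hφ0 hN hdiss using H
  have hproj := fun n t ht => (hN n t ht).1
  have hrR := fun n t ht => (hN n t ht).2.1
  have hφR := fun n t ht => (hN n t ht).2.2.1
  have hrD := fun n t ht => (hN n t ht).2.2.2.1
  have hφD := fun n t ht => (hN n t ht).2.2.2.2
  obtain ⟨A, hA, hAle⟩ := exists_norm_coeff_flux_le c μ hm ha hb R
  have hm0 : (0 : ℝ) ≤ m := by linarith
  have hrc : ∀ n, ContinuousOn (rN n) (Icc 0 T) := fun n t ht =>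
    (hrD n t ht).continuousWithinAt
  have hφc : ∀ n, ContinuousOn (φN n) (Icc 0 T) := fun n t ht =>
    (hφD n t ht).continuousWithinAt
  have hflux := fun n => continuousOn_flux hm c μ a b (hrc n) (hφc n) (hrR n) (hφR n)
  -- the derivatives of the coefficients
  let qr : ℕ → Freq → ℝ → ℂ := fun n k t =>
    if k ∈ box n then fourierCoeff (fluxDensity a (rN n t) (φN n t)) k else 0
  let qφ : ℕ → Freq → ℝ → ℂ := fun n k t =>
    if k ∈ box n then fourierCoeff (fluxAngle c μ a b (rN n t) (φN n t)) k
      + μ * (-(laplaceSymbol k : ℂ) * fourierCoeff (φN n t) k) else 0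
  have hqr : ∀ n k t, fourierCoeff (proj n (fluxDensity a (rN n t) (φN n t))) k = qr n k t :=
    fun n k t => fourierCoeff_proj _ _ _
  have hqφ : ∀ n k t, fourierCoeff (proj n (fluxAngle c μ a b (rN n t) (φN n t)) +
      μ • lapTrunc n (φN n t) : C(Torus, ℝ)) k = qφ n k t := fun n k t => by
    rw [fourierCoeff_add_smul, fourierCoeff_proj, fourierCoeff_lapTrunc]
    simp only [qφ]
    split_ifs <;> simp
  have hqrc : ∀ n k, ContinuousOn (qr n k) (Icc 0 T) := fun n k => by
    by_cases hk : k ∈ box n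
    · simp only [qr, if_pos hk]
      exact continuousOn_fourierCoeff (hflux n).1 k
    · simp only [qr, if_neg hk]; exact continuousOn_const
  have hqφc : ∀ n k, ContinuousOn (qφ n k) (Icc 0 T) := fun n k => by
    by_cases hk : k ∈ box n
    · simp only [qφ, if_pos hk]
      exact (continuousOn_fourierCoeff (hflux n).2 k).add
        (continuousOn_const.mul (continuousOn_const.mul (continuousOn_fourierCoeff (hφc n) k)))
    · simp only [qφ, if_neg hk]; exact continuousOn_const
  have hrint := fun n k t (ht : t ∈ Icc 0 T) => integral_coeff_of_hasDerivWithinAt (hrD n)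
    (fun t _ => hqr n k t) (hqrc n k) ht
  have hφint := fun n k t (ht : t ∈ Icc 0 T) => integral_coeff_of_hasDerivWithinAt (hφD n)
    (fun t _ => hqφ n k t) (hqφc n k) ht
  -- The Lipschitz constants grow with `k` because of the Laplacian, which is harmless: compactness
  -- is used one coefficient at a time.
  let L : Freq → ℝ := fun k => A + μ * (laplaceSymbol k * √R)
  have hL0 : ∀ k, 0 ≤ μ * (laplaceSymbol k * √R) := fun k =>
    mul_nonneg hμ (mul_nonneg (laplaceSymbol_nonneg k) (Real.sqrt_nonneg _))
  have hqrle : ∀ n k, ∀ t ∈ Icc 0 T, ‖qr n k t‖ ≤ L k := fun n k t ht => by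
    by_cases hk : k ∈ box n
    · simp only [qr, if_pos hk]
      exact ((hAle _ _ (hrR n t ht) (hφR n t ht) k).1).trans (le_add_of_nonneg_right (hL0 k))
    · simp only [qr, if_neg hk, norm_zero]; exact add_nonneg hA (hL0 k)
  have hqφle : ∀ n k, ∀ t ∈ Icc 0 T, ‖qφ n k t‖ ≤ L k := fun n k t ht => by
    by_cases hk : k ∈ box n
    · simp only [qφ, if_pos hk]
      refine (norm_add_le _ _).trans
        (add_le_add (hAle _ _ (hrR n t ht) (hφR n t ht) k).2 ?_)
      rw [norm_mul, norm_mul, norm_neg, Complex.norm_real, Complex.norm_real, Real.norm_eq_abs,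
        Real.norm_eq_abs, abs_of_nonneg hμ, abs_of_nonneg (laplaceSymbol_nonneg k)]
      exact mul_le_mul_of_nonneg_left (mul_le_mul_of_nonneg_left
        (norm_fourierCoeff_le_sqrt hm0 hR (hφR n t ht) k) (laplaceSymbol_nonneg k)) hμ
    · simp only [qφ, if_neg hk, norm_zero]; exact add_nonneg hA (hL0 k)
  -- compactness
  have hLip : ∀ {u u' : ℝ → C(Torus, ℝ)} {k : Freq} {q : ℝ → ℂ},
      (∀ t ∈ Icc 0 T, HasDerivWithinAt u (u' t) (Icc 0 T) t) →
      (∀ t, fourierCoeff (u' t) k = q t) → (∀ t ∈ Icc 0 T, ‖q t‖ ≤ L k) →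
      ∀ s ∈ Icc 0 T, ∀ t ∈ Icc 0 T,
        ‖fourierCoeff (u t) k - fourierCoeff (u s) k‖ ≤ L k * |t - s| := by
    intro u u' k q hu hq hqL s hs t ht
    refine Convex.norm_image_sub_le_of_norm_hasDerivWithin_le
      (f := fun t => fourierCoeff (u t) k) (f' := q) (fun t ht => ?_) hqL (convex_Icc 0 T) hs ht
    have := (coeffCLM k).hasFDerivAt.comp_hasDerivWithinAt t (hu t ht)
    rw [← hq t]; exact this
  obtain ⟨σ, G, hσ, hG⟩ := exists_subseq_tendsto_of_lipschitz (T := T) (ι := Freq ⊕ Freq)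
    (F := fun n => Sum.elim (fun k t => fourierCoeff (rN n t) k)
      fun k t => fourierCoeff (φN n t) k) (M := fun _ => √R) (L := Sum.elim L L)
    (by
      rintro n (k | k) t ht
      · exact norm_fourierCoeff_le_sqrt hm0 hR (hrR n t ht) k
      · exact norm_fourierCoeff_le_sqrt hm0 hR (hφR n t ht) k)
    (by
      rintro n (k | k)
      · exact hLip (hrD n) (hqr n k) (hqrle n k)
      · exact hLip (hφD n) (hqφ n k) (hqφle n k))
  have hGr := fun k => hG (Sum.inl k)
  have hGφ := fun k => hG (Sum.inr k)
  simp only [Sum.elim_inl, Sum.elim_inr] at hGr hGφ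
  have hlim : ∀ {u : ℕ → ℝ → C(Torus, ℝ)} {g : Freq → ℝ → ℂ},
      (∀ n, ∀ t ∈ Icc 0 T, sobE m (u n t) ≤ ENNReal.ofReal R) →
      (∀ k, ∀ t ∈ Icc 0 T, Tendsto (fun n => fourierCoeff (u (σ n) t) k) atTop (𝓝 (g k t))) →
      ∀ t, ∃ f : C(Torus, ℝ), t ∈ Icc 0 T → (∀ k, fourierCoeff f k = g k t) ∧
        sobE m f ≤ ENNReal.ofReal R := by
    intro u g hu hg t
    by_cases ht : t ∈ Icc 0 T
    · obtain ⟨f, hf⟩ := exists_continuousMap_of_coeff hm (a := fun k => g k t) (R := R)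
        (fun k => tendsto_nhds_unique (hg (-k) t ht) (by
          simp only [fourierCoeff_neg_index]
          exact (Complex.continuous_conj.tendsto _).comp (hg k t ht)))
        fun S => le_of_tendsto (tendsto_finsetSum _ fun k _ =>
          (((hg k t ht).norm.const_mul (wt m k)).pow 2)) (Eventually.of_forall fun n =>
            sum_le_of_sobE_le hR (hu (σ n) t ht) S)
      exact ⟨f, fun _ => hf⟩
    · exact ⟨0, fun h => absurd h ht⟩
  choose r hr using hlim hrR hGr
  choose φ hφ using hlim hφR hGφ
  have hrlim : ∀ k, ∀ t ∈ Icc 0 T,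
      Tendsto (fun n => fourierCoeff (rN (σ n) t) k) atTop (𝓝 (fourierCoeff (r t) k)) :=
    fun k t ht => by rw [(hr t ht).1 k]; exact hGr k t ht
  have hφlim : ∀ k, ∀ t ∈ Icc 0 T,
      Tendsto (fun n => fourierCoeff (φN (σ n) t) k) atTop (𝓝 (fourierCoeff (φ t) k)) :=
    fun k t ht => by rw [(hφ t ht).1 k]; exact hGφ k t ht
  have hcoefc : ∀ {u : ℕ → ℝ → C(Torus, ℝ)} {v : ℝ → C(Torus, ℝ)} {k : Freq} {q : ℕ → ℝ → ℂ},
      (∀ t ∈ Icc 0 T, Tendsto (fun n => fourierCoeff (u (σ n) t) k) atTop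
        (𝓝 (fourierCoeff (v t) k))) →
      (∀ n, ∀ s ∈ Icc 0 T, ∀ t ∈ Icc 0 T,
        ‖fourierCoeff (u n t) k - fourierCoeff (u n s) k‖ ≤ L k * |t - s|) →
      ContinuousOn (fun t => fourierCoeff (v t) k) (Icc 0 T) := by
    intro u v k q hv hle
    have : LipschitzOnWith (L k).toNNReal (fun t => fourierCoeff (v t) k) (Icc 0 T) := by
      refine LipschitzOnWith.of_dist_le_mul fun t ht s hs => ?_
      rw [Real.coe_toNNReal _ (add_nonneg hA (hL0 k)), dist_eq_norm, Real.dist_eq]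
      exact le_of_tendsto ((hv t ht).sub (hv s hs)).norm
        (Eventually.of_forall fun n => hle (σ n) s hs t ht)
    exact this.continuousOn
  have hrcont : ContinuousOn r (Icc 0 T) := continuousOn_of_coeff hm (fun t ht => (hr t ht).2)
    fun k => hcoefc (q := fun n => qr n k) (hrlim k) fun n => hLip (hrD n) (hqr n k) (hqrle n k)
  have hφcont : ContinuousOn φ (Icc 0 T) := continuousOn_of_coeff hm (fun t ht => (hφ t ht).2)
    fun k => hcoefc (q := fun n => qφ n k) (hφlim k) fun n => hLip (hφD n) (hqφ n k) (hqφle n k)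
  have hinit : ∀ {u : ℕ → ℝ → C(Torus, ℝ)} {v : ℝ → C(Torus, ℝ)} {v₀ : C(Torus, ℝ)},
      (∀ n, u n 0 = proj n v₀) → (∀ k, ∀ t ∈ Icc 0 T,
        Tendsto (fun n => fourierCoeff (u (σ n) t) k) atTop (𝓝 (fourierCoeff (v t) k))) →
      v 0 = v₀ := by
    intro u v v₀ hu hv
    refine eq_of_fourierCoeff_eq fun k => ?_
    refine tendsto_nhds_unique (hv k 0 ⟨le_rfl, hT.le⟩) (tendsto_const_nhds.congr' ?_)
    filter_upwards [hσ.tendsto_atTop.eventually (eventually_mem_box k)] with n hn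
    rw [hu, fourierCoeff_proj, if_pos hn]
  have hr00 : r 0 = r₀ := hinit hr0 hrlim
  have hφ00 : φ 0 = φ₀ := hinit hφ0 hφlim
  have hqlim : ∀ k, ∀ t ∈ Icc 0 T,
      Tendsto (fun n => qr (σ n) k t) atTop (𝓝 (fourierCoeff (fluxDensity a (r t) (φ t)) k)) ∧
      Tendsto (fun n => qφ (σ n) k t) atTop (𝓝 (fourierCoeff (fluxAngle c μ a b (r t) (φ t)) k
        + μ * (-(laplaceSymbol k : ℂ) * fourierCoeff (φ t) k))) := by
    intro k t ht
    have hbox := hσ.tendsto_atTop.eventually (eventually_mem_box k)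
    have h1 := tendsto_flux hm c μ a b (ENNReal.ofReal_ne_top (r := R))
      (Eventually.of_forall fun n => hrR (σ n) t ht) (Eventually.of_forall fun n => hφR (σ n) t ht)
      (hr t ht).2 (hφ t ht).2 (fun k => hrlim k t ht) fun k => hφlim k t ht
    have h2 := ((coeffCLM k).continuous.tendsto _).comp h1.1
    have h3 := ((coeffCLM k).continuous.tendsto _).comp h1.2
    refine ⟨h2.congr' ?_, (h3.add (((hφlim k t ht).const_mul _).const_mul _)).congr' ?_⟩
    · filter_upwards [hbox] with n hn
      simp only [qr, if_pos hn]; rfl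
    · filter_upwards [hbox] with n hn
      simp only [qφ, if_pos hn]; rfl
  have hpass : ∀ {u : ℕ → ℝ → C(Torus, ℝ)} {v : ℝ → C(Torus, ℝ)} {v₀ : C(Torus, ℝ)} {k : Freq}
      {q : ℕ → ℝ → ℂ} {q' : ℝ → ℂ}, v 0 = v₀ → (∀ t ∈ Icc 0 T,
        Tendsto (fun n => fourierCoeff (u (σ n) t) k) atTop (𝓝 (fourierCoeff (v t) k))) →
      (∀ n, ∀ t ∈ Icc 0 T, fourierCoeff (u n t) k = fourierCoeff (u n 0) k + ∫ s in 0..t, q n s) →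
      (∀ n, ContinuousOn (q n) (Icc 0 T)) → (∀ n, ∀ t ∈ Icc 0 T, ‖q n t‖ ≤ L k) →
      (∀ t ∈ Icc 0 T, Tendsto (fun n => q (σ n) t) atTop (𝓝 (q' t))) → ∀ t ∈ Icc 0 T,
      fourierCoeff (v t) k = fourierCoeff v₀ k + ∫ s in 0..t, q' s := by
    intro u v v₀ k q q' hv0 hv hint hqc hqL hq' t ht
    refine tendsto_nhds_unique (hv t ht) ?_
    simp only [fun n => hint (σ n) t ht]
    have hsub : uIoc 0 t ⊆ Icc 0 T := by
      rw [uIoc_of_le ht.1]; exact Ioc_subset_Icc_self.trans (Icc_subset_Icc_right ht.2)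
    rw [← hv0]
    refine (hv 0 ⟨le_rfl, hT.le⟩).add
      (intervalIntegral.tendsto_integral_filter_of_dominated_convergence (fun _ => L k)
        (Eventually.of_forall fun n => ((hqc (σ n)).mono hsub).aestronglyMeasurable
          measurableSet_uIoc)
        (Eventually.of_forall fun n => Eventually.of_forall fun s hs => hqL (σ n) s (hsub hs))
        (by simp) (Eventually.of_forall fun s hs => hq' s (hsub hs)))
  refine ⟨T, R, hT, r, φ, hrcont, hφcont, hr00, hφ00, fun t ht => ⟨(hr t ht).2, (hφ t ht).2,
    fun k => ⟨hpass hr00 (hrlim k) (fun n => hrint n k) (fun n => hqrc n k)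
      (fun n => hqrle n k) (fun t ht => (hqlim k t ht).1) t ht,
      hpass hφ00 (hφlim k) (fun n => hφint n k) (fun n => hqφc n k)
      (fun n => hqφle n k) (fun t ht => (hqlim k t ht).2) t ht⟩⟩, fun hμ0 => ?_⟩
  -- the additional regularity
  have hcφ : ∀ k, ContinuousOn (fun t => (wt (m + 1) k * ‖fourierCoeff (φ t) k‖) ^ 2) (Icc 0 T) :=
    fun k => ((continuousOn_fourierCoeff hφcont k).norm.const_mul _).pow 2
  have hsub : uIoc 0 T ⊆ Icc 0 T := by
    rw [uIoc_of_le hT.le]; exact Ioc_subset_Icc_self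
  -- Lower semicontinuity of the dissipation: a fixed finite set of modes is eventually contained in
  -- `box (σ n)`, the bound passes to the limit for that set, and then the supremum over such sets
  -- is taken.
  have hfin : ∀ S : Finset Freq,
      ∫ t in 0..T, ∑ k ∈ S, (wt (m + 1) k * ‖fourierCoeff (φ t) k‖) ^ 2 ≤ R / μ := by
    intro S
    refine le_of_tendsto (intervalIntegral.tendsto_integral_filter_of_dominated_convergence
      (F := fun n t => ∑ k ∈ S, (wt (m + 1) k * ‖fourierCoeff (φN (σ n) t) k‖) ^ 2)
      (l := atTop) (fun _ => ∑ k ∈ S, (wt (m + 1) k * √R) ^ 2)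
      (Eventually.of_forall fun n => ContinuousOn.aestronglyMeasurable
        (continuousOn_finsetSum _ fun k _ =>
          ((((continuousOn_fourierCoeff (hφc (σ n)) k).mono hsub).norm.const_mul _).pow 2))
          measurableSet_uIoc)
      (Eventually.of_forall fun n => Eventually.of_forall fun t ht => ?_) (by simp)
      (Eventually.of_forall fun t ht => tendsto_finsetSum _ fun k _ =>
        ((hφlim k t (hsub ht)).norm.const_mul _).pow 2)) ?_
    · rw [Real.norm_of_nonneg (Finset.sum_nonneg fun _ _ => sq_nonneg _)]
      refine Finset.sum_le_sum fun k _ => pow_le_pow_left₀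
        (mul_nonneg (wt_pos _ _).le (norm_nonneg _)) ?_ 2
      exact mul_le_mul_of_nonneg_left
        (norm_fourierCoeff_le_sqrt hm0 hR (hφR (σ n) t (hsub ht)) k) (wt_pos _ _).le
    · have hbox : ∀ᶠ n in atTop, ∀ k ∈ S, k ∈ box (σ n) :=
        (Finset.eventually_all S).2 fun k _ => hσ.tendsto_atTop.eventually (eventually_mem_box k)
      filter_upwards [hbox] with n hn
      rw [le_div_iff₀ hμ0, mul_comm]
      refine le_trans (mul_le_mul_of_nonneg_left ?_ hμ) (hdiss (σ n))
      have hci : ∀ S' : Finset Freq, IntervalIntegrable (fun t => ∑ k ∈ S',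
          (wt (m + 1) k * ‖fourierCoeff (φN (σ n) t) k‖) ^ 2) volume 0 T := fun S' =>
        ContinuousOn.intervalIntegrable (by
          rw [uIcc_of_le hT.le]
          exact continuousOn_finsetSum _ fun k _ =>
            (((continuousOn_fourierCoeff (hφc (σ n)) k).norm.const_mul _).pow 2))
      exact intervalIntegral.integral_mono_on hT.le (hci S) (hci _) fun t _ =>
        Finset.sum_le_sum_of_subset_of_nonneg hn fun _ _ _ => sq_nonneg _
  have hmeas : ∀ k, AEMeasurable (fun t => (ew (m + 1) k * ‖fourierCoeff (φ t) k‖ₑ) ^ 2)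
      (volume.restrict (Ioo 0 T)) := fun k =>
    (((((continuousOn_fourierCoeff hφcont k).mono Ioo_subset_Icc_self).aestronglyMeasurable
      measurableSet_Ioo).enorm).const_mul _).pow_const 2
  have hle : ∫⁻ t in Ioo 0 T, sobE (m + 1) (φ t) ≤ ENNReal.ofReal (R / μ) := by
    simp only [sobE]
    rw [lintegral_tsum hmeas, ENNReal.tsum_eq_iSup_sum]
    refine iSup_le fun S => ?_
    rw [← lintegral_finsetSum' _ fun k _ => hmeas k]
    refine le_trans (le_of_eq ?_) (ENNReal.ofReal_le_ofReal (hfin S))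
    rw [intervalIntegral.integral_of_le hT.le, integral_Ioc_eq_integral_Ioo,
      ofReal_integral_eq_lintegral_ofReal]
    · refine lintegral_congr fun t => ?_
      rw [ENNReal.ofReal_sum_of_nonneg fun _ _ => sq_nonneg _]
      refine Finset.sum_congr rfl fun k _ => ?_
      rw [ENNReal.ofReal_pow (mul_nonneg (wt_pos _ _).le (norm_nonneg _)),
        ENNReal.ofReal_mul (wt_pos _ _).le, ofReal_norm]; rfl
    · exact ((continuousOn_finsetSum _ fun k _ => hcφ k).integrableOn_Icc).mono_set
        Ioo_subset_Icc_self
    · exact Eventually.of_forall fun t => Finset.sum_nonneg fun _ _ => sq_nonneg _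
  exact hle.trans_lt ENNReal.ofReal_lt_top

end SelfPropelled
end

noncomputable section
namespace SelfPropelled
open Filter Topology

/-! ### Calculus in time -/

open scoped ComplexConjugate

section IntDeriv

variable {E F : Type*} [NormedAddCommGroup E] [NormedSpace ℝ E] [NormedAddCommGroup F]
  [NormedSpace ℝ F]

/-- `u` is a primitive of the integrable function `v` on `[0,T]`. -/
def IntDeriv (T : ℝ) (u v : ℝ → E) : Prop :=
  IntervalIntegrable v volume 0 T ∧ ∀ t ∈ Icc 0 T, u t = u 0 + ∫ s in 0..t, v s

theorem absolutelyContinuousOnInterval_comp {F f : ℝ → ℝ} {a b : ℝ} {K : NNReal} {s : Set ℝ}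
    (hf : AbsolutelyContinuousOnInterval f a b) (hF : LipschitzOnWith K F s)
    (hs : ∀ t ∈ uIcc a b, f t ∈ s) : AbsolutelyContinuousOnInterval (fun t => F (f t)) a b := by
  rw [absolutelyContinuousOnInterval_iff] at hf ⊢
  intro ε hε
  obtain ⟨δ, hδ, h⟩ := hf (ε / (K + 1)) (by positivity)
  refine ⟨δ, hδ, fun E hE hlt => ?_⟩
  have h1 := h E hE hlt
  rw [lt_div_iff₀ (by positivity), mul_comm] at h1
  refine lt_of_le_of_lt ?_ h1
  rw [Finset.mul_sum]
  refine Finset.sum_le_sum fun i hi => ?_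
  have h2 := hE.1 i hi
  refine (hF.dist_le_mul _ (hs _ h2.1) _ (hs _ h2.2)).trans ?_
  exact mul_le_mul_of_nonneg_right (by simp) dist_nonneg

namespace IntDeriv

variable {T : ℝ}

theorem intervalIntegrable {u v : ℝ → E} (h : IntDeriv T u v) {t : ℝ} (ht : t ∈ Icc 0 T) :
    IntervalIntegrable v volume 0 t :=
  h.1.mono_set (uIcc_subset_uIcc_left (by rw [uIcc_of_le (ht.1.trans ht.2)]; exact ht))

theorem clm [CompleteSpace E] [CompleteSpace F] {u v : ℝ → E} (h : IntDeriv T u v) (L : E →L[ℝ] F) :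
    IntDeriv T (fun t => L (u t)) (fun t => L (v t)) := by
  refine ⟨⟨L.integrable_comp h.1.1, L.integrable_comp h.1.2⟩, fun t ht => ?_⟩
  rw [L.intervalIntegral_comp_comm (h.intervalIntegrable ht), ← map_add, ← h.2 t ht]

theorem sub {u v u' v' : ℝ → E} (h : IntDeriv T u v) (h' : IntDeriv T u' v') :
    IntDeriv T (fun t => u t - u' t) (fun t => v t - v' t) := by
  refine ⟨h.1.sub h'.1, fun t ht => ?_⟩
  beta_reduce
  rw [intervalIntegral.integral_sub (h.intervalIntegrable ht) (h'.intervalIntegrable ht), h.2 t ht,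
    h'.2 t ht]
  abel

theorem add {u v u' v' : ℝ → E} (h : IntDeriv T u v) (h' : IntDeriv T u' v') :
    IntDeriv T (fun t => u t + u' t) (fun t => v t + v' t) := by
  refine ⟨h.1.add h'.1, fun t ht => ?_⟩
  beta_reduce
  rw [intervalIntegral.integral_add (h.intervalIntegrable ht) (h'.intervalIntegrable ht), h.2 t ht,
    h'.2 t ht]
  abel

theorem mono {u v : ℝ → E} (h : IntDeriv T u v) {T' : ℝ} (h0 : 0 ≤ T') (hT : T' ≤ T) :
    IntDeriv T' u v :=
  ⟨h.intervalIntegrable ⟨h0, hT⟩, fun t ht => h.2 t ⟨ht.1, ht.2.trans hT⟩⟩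

theorem continuousOn (hT : 0 ≤ T) {u v : ℝ → E} (h : IntDeriv T u v) : ContinuousOn u (Icc 0 T) := by
  have h1 : ContinuousOn (fun t => u 0 + ∫ s in 0..t, v s) (Icc 0 T) := by
    have := intervalIntegral.continuousOn_primitive_interval' h.1 left_mem_uIcc
    rw [uIcc_of_le hT] at this
    exact continuousOn_const.add this
  exact h1.congr h.2

theorem absolutelyContinuous {f g : ℝ → ℝ} (h : IntDeriv T f g) :
    AbsolutelyContinuousOnInterval (fun t => f 0 + ∫ s in 0..t, g s) 0 T := by
  have h1 := h.1.absolutelyContinuousOnInterval_intervalIntegral (c := 0) left_mem_uIcc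
  have h2 : AbsolutelyContinuousOnInterval (fun _ : ℝ => f 0) 0 T :=
    (LipschitzWith.const (f 0)).lipschitzOnWith.absolutelyContinuousOnInterval
  exact h2.fun_add h1

/-- The explicit primitive stands in for `f`, which it equals on `[0,T]`; nothing is known about `f`
outside. -/
theorem ae_hasDerivAt {f g : ℝ → ℝ} (h : IntDeriv T f g) : ∀ᵐ t, t ∈ uIcc 0 T →
    HasDerivAt (fun t => f 0 + ∫ s in 0..t, g s) (g t) t := by
  filter_upwards [h.1.ae_hasDerivAt_integral] with t ht ht'
  exact (ht ht' 0 left_mem_uIcc).const_add _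

/-- Integration by parts for absolutely continuous functions, whose derivatives are identified
almost everywhere with the given integrands. -/
theorem mul {f g f' g' : ℝ → ℝ} (hT : 0 ≤ T) (h : IntDeriv T f g) (h' : IntDeriv T f' g') :
    IntDeriv T (fun t => f t * f' t) (fun t => g t * f' t + f t * g' t) := by
  have hc := h.continuousOn hT
  have hc' := h'.continuousOn hT
  rw [← uIcc_of_le hT] at hc hc'
  refine ⟨(h.1.mul_continuousOn hc').add (h'.1.continuousOn_mul hc), fun t ht => ?_⟩
  have ht0 : 0 ≤ t := ht.1
  have h1 := h.mono ht.1 ht.2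
  have h1' := h'.mono ht.1 ht.2
  have h2 := h1.absolutelyContinuous.integral_deriv_mul_eq_sub h1'.absolutelyContinuous
  simp only [intervalIntegral.integral_same, add_zero] at h2
  rw [← h.2 t ht, ← h'.2 t ht, eq_sub_iff_add_eq'] at h2
  beta_reduce
  rw [← h2]
  congr 1
  refine intervalIntegral.integral_congr_ae ?_
  filter_upwards [h1.ae_hasDerivAt, h1'.ae_hasDerivAt] with s hs hs' hst
  have hs1 := uIoc_subset_uIcc hst
  have hs2 : s ∈ Icc 0 T := by
    rw [uIcc_of_le ht.1] at hs1; exact ⟨hs1.1, hs1.2.trans ht.2⟩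
  rw [(hs hs1).deriv, (hs' hs1).deriv, ← h.2 s hs2, ← h'.2 s hs2]

/-- `f` stays in a compact interval, on which `F` is Lipschitz. The composition is therefore
absolutely continuous and is the integral of its almost everywhere derivative. -/
theorem comp {f g : ℝ → ℝ} (hT : 0 ≤ T) (h : IntDeriv T f g) {F F' : ℝ → ℝ}
    (hF : ∀ x, HasDerivAt F (F' x) x) (hF' : Continuous F') :
    IntDeriv T (fun t => F (f t)) (fun t => F' (f t) * g t) := by
  have hc := h.continuousOn hT
  have hc' := hc
  rw [← uIcc_of_le hT] at hc'
  refine ⟨h.1.continuousOn_mul (hF'.comp_continuousOn hc'), fun t ht => ?_⟩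
  have h1 := h.mono ht.1 ht.2
  obtain ⟨M, hM⟩ := isCompact_Icc.exists_bound_of_continuousOn hc
  obtain ⟨K, hK⟩ := (isCompact_Icc (a := -M) (b := M)).exists_bound_of_continuousOn
    hF'.continuousOn
  have hlip : LipschitzOnWith K.toNNReal F (Icc (-M) M) :=
    (convex_Icc (-M) M).lipschitzOnWith_of_nnnorm_hasDerivWithin_le
      (fun x _ => (hF x).hasDerivWithinAt) fun x hx => by
        rw [← NNReal.coe_le_coe, coe_nnnorm]
        exact (hK x hx).trans (Real.le_coe_toNNReal K)
  have h2 := (absolutelyContinuousOnInterval_comp h1.absolutelyContinuous hlip fun s hs => by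
    rw [uIcc_of_le ht.1] at hs
    have hs2 : s ∈ Icc 0 T := ⟨hs.1, hs.2.trans ht.2⟩
    rw [← h.2 s hs2]
    exact abs_le.1 (hM s hs2)).integral_deriv_eq_sub
  simp only [intervalIntegral.integral_same, add_zero] at h2
  rw [← h.2 t ht, eq_sub_iff_add_eq'] at h2
  beta_reduce
  rw [← h2]
  congr 1
  refine intervalIntegral.integral_congr_ae ?_
  filter_upwards [h1.ae_hasDerivAt] with s hs hst
  have hs1 := uIoc_subset_uIcc hst
  have hs2 : s ∈ Icc 0 T := by
    rw [uIcc_of_le ht.1] at hs1; exact ⟨hs1.1, hs1.2.trans ht.2⟩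
  have := (hF _).comp s (hs hs1)
  rw [← h.2 s hs2] at this
  exact this.deriv

/-- Evaluation at a point commutes with the integral, and evaluations separate functions. Calculus
for function-valued paths thus reduces to the scalar case, once the candidate derivative is known to
be integrable. -/
theorem of_eval {u v : ℝ → C(Torus, ℝ)} (hv : IntervalIntegrable v volume 0 T)
    (h : ∀ x, IntDeriv T (fun t => u t x) fun t => v t x) : IntDeriv T u v := by
  refine ⟨hv, fun t ht => ?_⟩
  have hv' := hv.mono_set (uIcc_subset_uIcc_left
    (by rw [uIcc_of_le (ht.1.trans ht.2)]; exact ht))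
  ext x
  have := (ContinuousMap.evalCLM ℝ x).intervalIntegral_comp_comm hv'
  simp only [ContinuousMap.evalCLM_apply] at this
  have h3 := (h x).2 t ht
  beta_reduce at h3
  rw [h3, ContinuousMap.add_apply, this]

theorem eval {u v : ℝ → C(Torus, ℝ)} (h : IntDeriv T u v) (x : Torus) :
    IntDeriv T (fun t => u t x) fun t => v t x := h.clm (ContinuousMap.evalCLM ℝ x)

theorem mul_map {u v u' v' : ℝ → C(Torus, ℝ)} (hT : 0 ≤ T) (h : IntDeriv T u v)
    (h' : IntDeriv T u' v') : IntDeriv T (fun t => u t * u' t) (fun t => v t * u' t + u t * v' t) := by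
  have hc := h.continuousOn hT
  have hc' := h'.continuousOn hT
  rw [← uIcc_of_le hT] at hc hc'
  exact of_eval ((h.1.mul_continuousOn hc').add (h'.1.continuousOn_mul hc)) fun x =>
    (h.eval x).mul hT (h'.eval x)

theorem comp_map {u v : ℝ → C(Torus, ℝ)} (hT : 0 ≤ T) (h : IntDeriv T u v) {F F' : C(ℝ, ℝ)}
    (hF : ∀ x, HasDerivAt F (F' x) x) :
    IntDeriv T (fun t => F.comp (u t)) (fun t => F'.comp (u t) * v t) := by
  have hc := h.continuousOn hT
  rw [← uIcc_of_le hT] at hc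
  exact of_eval (h.1.continuousOn_mul
    ((ContinuousMap.continuous_postcomp F').comp_continuousOn hc)) fun x =>
      (h.eval x).comp hT hF F'.continuous

/-- Integration by parts against a test function. -/
theorem integral_deriv_smul {u v : ℝ → C(Torus, ℝ)} (hT : 0 ≤ T) (h : IntDeriv T u v) {η : ℝ → ℝ}
    (hη : ContDiff ℝ 1 η) (h0 : η 0 = 0) (h1 : η T = 0) :
    ∫ t in 0..T, deriv η t • u t = -∫ t in 0..T, η t • v t := by
  have hη' := hη.continuous_deriv le_rfl
  have hc := h.continuousOn hT
  rw [← uIcc_of_le hT] at hc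
  have hi1 : IntervalIntegrable (fun t => deriv η t • u t) volume 0 T :=
    (hη'.continuousOn.smul hc).intervalIntegrable
  have hi2 : IntervalIntegrable (fun t => η t • v t) volume 0 T :=
    h.1.continuousOn_smul hη.continuous.continuousOn
  ext x
  have e1 := (ContinuousMap.evalCLM ℝ x).intervalIntegral_comp_comm hi1
  have e2 := (ContinuousMap.evalCLM ℝ x).intervalIntegral_comp_comm hi2
  simp only [ContinuousMap.evalCLM_apply, ContinuousMap.smul_apply, smul_eq_mul] at e1 e2
  rw [ContinuousMap.neg_apply, ← e1, ← e2]
  have hηd : IntDeriv T η (deriv η) := ⟨hη'.intervalIntegrable _ _, fun t ht => by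
    rw [intervalIntegral.integral_eq_sub_of_hasDerivAt
      (fun s _ => (hη.differentiable one_ne_zero s).hasDerivAt) (hη'.intervalIntegrable _ _)]
    ring⟩
  have h2 := ((hηd.mul hT (h.eval x)).2 T ⟨hT, le_rfl⟩)
  beta_reduce at h2
  rw [h0, h1, zero_mul, zero_mul, zero_add, intervalIntegral.integral_add] at h2
  · linarith
  · have l := (ContinuousMap.evalCLM ℝ x : C(Torus, ℝ) →L[ℝ] ℝ).integrable_comp hi1.1
    have l' := (ContinuousMap.evalCLM ℝ x : C(Torus, ℝ) →L[ℝ] ℝ).integrable_comp hi1.2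
    exact ⟨l, l'⟩
  · have l := (ContinuousMap.evalCLM ℝ x : C(Torus, ℝ) →L[ℝ] ℝ).integrable_comp hi2.1
    have l' := (ContinuousMap.evalCLM ℝ x : C(Torus, ℝ) →L[ℝ] ℝ).integrable_comp hi2.2
    exact ⟨l, l'⟩

end IntDeriv

end IntDeriv

end SelfPropelled
end

noncomputable section
namespace SelfPropelled
open Filter Topology

/-! ### Paths in Sobolev spaces and weak time derivatives -/

open scoped ComplexConjugate

theorem enorm_le_wsum (f : C(Torus, ℝ)) : ‖f‖ₑ ≤ wsum 0 f := by
  by_cases h : wsum 0 f = ⊤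
  · rw [h]; exact le_top
  · rw [← ENNReal.ofReal_toReal h, ← ofReal_norm]
    exact ENNReal.ofReal_le_ofReal (norm_le_wsum h)

theorem tendsto_proj {f : C(Torus, ℝ)} (h : wsum 0 f ≠ ⊤) :
    Tendsto (fun N => proj N f) atTop (𝓝 f) := by
  have hs : Summable fun k => ‖fourierCoeff f k‖ := by
    simpa [wt_zero] using summable_norm_of_wsum h
  have hc : ∀ N k, fourierCoeff (proj N f - f : C(Torus, ℝ)) k =
      if k ∈ box N then 0 else -fourierCoeff f k := fun N k => by
    have h1 := (coeffCLM k).map_sub (proj N f) f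
    simp only [coeffCLM_apply] at h1
    rw [h1, fourierCoeff_proj]
    split_ifs <;> simp
  have hle : ∀ N k, ‖fourierCoeff (proj N f - f : C(Torus, ℝ)) k‖ ≤ ‖fourierCoeff f k‖ :=
    fun N k => by rw [hc]; split_ifs <;> simp
  rw [tendsto_iff_norm_sub_tendsto_zero]
  refine squeeze_zero (fun _ => norm_nonneg _) (fun N => norm_le_tsum_norm_fourierCoeff
    (hs.of_nonneg_of_le (fun _ => norm_nonneg _) (hle N))) ?_
  have := tendsto_tsum_of_dominated_convergence (𝓕 := atTop) (g := fun _ : Freq => (0 : ℝ)) hs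
    (f := fun N k => ‖fourierCoeff (proj N f - f : C(Torus, ℝ)) k‖) (fun k => by
      refine tendsto_const_nhds.congr' ?_
      filter_upwards [eventually_mem_box k] with N hN
      rw [hc, if_pos hN, norm_zero]) (Eventually.of_forall fun N k => by
        rw [norm_norm]; exact hle N k)
  simpa using this

/-- Almost every value is the limit of its Fourier truncations, which are finite combinations of
measurable scalar functions. -/
theorem aestronglyMeasurable_of_coeff {ν : Measure ℝ} {u : ℝ → C(Torus, ℝ)}
    (hc : ∀ k, AEStronglyMeasurable (fun t => fourierCoeff (u t) k) ν)
    (h : ∀ᵐ t ∂ν, wsum 0 (u t) ≠ ⊤) : AEStronglyMeasurable u ν := by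
  refine aestronglyMeasurable_of_tendsto_ae atTop (f := fun N t => proj N (u t)) (fun N => ?_)
    (h.mono fun t ht => tendsto_proj ht)
  have e : (fun t => proj N (u t)) = fun t => (Complex.reCLM.compLeftContinuous ℝ Torus)
      (∑ k ∈ box N, fourierCoeff (u t) k • ((1 : ℂ) • (UnitAddTorus.mFourier k : C(Torus, ℂ)))) := by
    funext t
    simp only [proj, mult, ContinuousLinearMap.comp_apply, sum_apply]
    rfl
  rw [e]
  refine (ContinuousLinearMap.continuous _).comp_aestronglyMeasurable ?_
  exact Finset.aestronglyMeasurable_fun_sum _ fun k _ => (hc k).smul_const _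

/-- The sequence is chosen separately for each `t`; measurability is recovered because it is the
limit of its restrictions to boxes, which depend on finitely many coefficients. -/
theorem exists_sobolevPath {s : ℝ} {ν : Measure ℝ} {u : ℝ → Torus → ℝ}
    (hc : ∀ k, AEStronglyMeasurable (fun t => fourierCoeff (u t) k) ν)
    (h : ∀ᵐ t ∂ν, MemSobolev s (u t)) :
    ∃ U : ℝ → EllTwo, AEStronglyMeasurable U ν ∧ ∀ᵐ t ∂ν, IsSobolevSeq s (u t) (U t) := by
  classical
  let U : ℝ → EllTwo := fun t => if ht : MemSobolev s (u t) then ht.choose else 0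
  have hU : ∀ᵐ t ∂ν, IsSobolevSeq s (u t) (U t) := h.mono fun t ht => by
    simp only [U, dif_pos ht]; exact ht.choose_spec
  refine ⟨U, ?_, hU⟩
  have hbox : Tendsto box atTop atTop := tendsto_atTop_finset_of_monotone
    (fun M N hMN k hk => mem_box.2 fun i => (mem_box.1 hk i).trans (by exact_mod_cast hMN))
    fun k => (eventually_mem_box k).exists
  refine aestronglyMeasurable_of_tendsto_ae atTop (f := fun N t => ∑ k ∈ box N,
    lp.singleContinuousLinearMap ℂ (fun _ : Freq => ℂ) 2 k ((wt s k : ℂ) * fourierCoeff (u t) k))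
    (fun N => Finset.aestronglyMeasurable_fun_sum _ fun k _ =>
      (ContinuousLinearMap.continuous _).comp_aestronglyMeasurable ((hc k).const_mul _)) ?_
  filter_upwards [hU] with t ht
  have h1 := (lp.hasSum_single (p := 2) (by simp) (U t)).comp hbox
  refine h1.congr fun N => Finset.sum_congr rfl fun k _ => ?_
  rw [lp.singleContinuousLinearMap_apply]
  have e : U t k = (wt s k : ℂ) * fourierCoeff (u t) k := ht.2 k
  simp only [e]

theorem memLp_two_of_lintegral {E : Type*} [NormedAddCommGroup E] {ν : Measure ℝ} {U : ℝ → E}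
    (hU : AEStronglyMeasurable U ν) (h : ∫⁻ t, ‖U t‖ₑ ^ 2 ∂ν < ⊤) : MemLp U 2 ν := by
  refine ⟨hU, (eLpNorm_lt_top_iff_lintegral_rpow_enorm_lt_top (by simp) (by simp)).2 ?_⟩
  simpa using h

theorem lintegral_of_memLp_two {E : Type*} [NormedAddCommGroup E] {ν : Measure ℝ} {U : ℝ → E}
    (h : MemLp U 2 ν) : ∫⁻ t, ‖U t‖ₑ ^ 2 ∂ν < ⊤ := by
  have := (eLpNorm_lt_top_iff_lintegral_rpow_enorm_lt_top (by simp) (by simp)).1 h.2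
  simpa using this

theorem exists_memLp_sobolevPath {s : ℝ} {ν : Measure ℝ} {u : ℝ → Torus → ℝ}
    (hc : ∀ k, AEStronglyMeasurable (fun t => fourierCoeff (u t) k) ν)
    (hu : ∀ᵐ t ∂ν, MemLp (u t) 2 torusMeasure) (hm : ∀ᵐ t ∂ν, sobE s (u t) ≠ ⊤)
    (h : ∫⁻ t, sobE s (u t) ∂ν < ⊤) :
    ∃ U : ℝ → EllTwo, MemLp U 2 ν ∧ ∀ᵐ t ∂ν, IsSobolevSeq s (u t) (U t) := by
  obtain ⟨U, hU, hU'⟩ := exists_sobolevPath (s := s) hc (by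
    filter_upwards [hu, hm] with t h1 h2 using memSobolev_iff.2 ⟨h1, h2⟩)
  refine ⟨U, memLp_two_of_lintegral hU ?_, hU'⟩
  rwa [← lintegral_congr_ae (hU'.mono fun t ht => ht.sobE_eq)]

theorem memBochner_top {s T : ℝ} {u : ℝ → C(Torus, ℝ)} (hu : ContinuousOn u (Icc 0 T)) {R : ℝ}
    (hR : ∀ t ∈ Icc 0 T, sobE s (u t) ≤ ENNReal.ofReal R) :
    MemBochner ⊤ s T fun t x => u t x := by
  have hc : ∀ k, AEStronglyMeasurable (fun t => fourierCoeff (u t) k)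
      (volume.restrict (Ioo 0 T)) := fun k =>
    ((continuousOn_fourierCoeff hu k).mono Ioo_subset_Icc_self).aestronglyMeasurable
      measurableSet_Ioo
  have hm : ∀ᵐ t ∂(volume.restrict (Ioo 0 T)), sobE s (u t) ≤ ENNReal.ofReal R :=
    (ae_restrict_mem measurableSet_Ioo).mono fun t ht => hR t (Ioo_subset_Icc_self ht)
  obtain ⟨U, hU, hU'⟩ := exists_sobolevPath (s := s) hc (hm.mono fun t ht =>
    memSobolev_iff.2 ⟨memLp_continuousMap (u t) 2, (ht.trans_lt ENNReal.ofReal_lt_top).ne⟩)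
  refine ⟨U, memLp_top_of_bound hU √R ?_, hU'⟩
  filter_upwards [hU', hm] with t h1 h2
  rw [h1.sobE_eq] at h2
  -- `R` may be negative; then `ENNReal.ofReal R = 0` forces the value to vanish.
  rcases le_total R 0 with hR0 | hR0
  · rw [ENNReal.ofReal_of_nonpos hR0, nonpos_iff_eq_zero, pow_eq_zero_iff two_ne_zero,
      enorm_eq_zero] at h2
    rw [h2, norm_zero]; positivity
  · refine Real.le_sqrt_of_sq_le ?_
    rw [← ofReal_norm, ← ENNReal.ofReal_pow (norm_nonneg _)] at h2
    exact (ENNReal.ofReal_le_ofReal_iff hR0).1 h2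

theorem integrable_smul_of_test {E : Type*} [NormedAddCommGroup E] [NormedSpace ℝ E] {T : ℝ}
    {η : ℝ → ℝ} (hη : Continuous η) {U : ℝ → E} (hU : Integrable U (volume.restrict (Ioo 0 T))) :
    Integrable (fun t => η t • U t) (volume.restrict (Ioo 0 T)) := by
  rw [restrict_Ioo_eq_restrict_Ioc] at hU ⊢
  rw [← IntegrableOn, ← integrableOn_Icc_iff_integrableOn_Ioc] at hU ⊢
  exact hU.continuousOn_smul hη.continuousOn isCompact_Icc

theorem test_eq_zero {T : ℝ} {η : ℝ → ℝ} (hη : tsupport η ⊆ Ioo 0 T) {t : ℝ} (ht : t ∉ Ioo 0 T) :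
    η t = 0 := image_eq_zero_of_notMem_tsupport fun h => ht (hη h)

/-- A function of the coefficient `k` of a Sobolev path, integrated against a test function. -/
theorem coeff_integral_smul {s T : ℝ} {u : ℝ → Torus → ℝ} {U : ℝ → EllTwo}
    (hU : MemLp U 2 (volume.restrict (Ioo 0 T)))
    (h : ∀ᵐ t ∂(volume.restrict (Ioo 0 T)), IsSobolevSeq s (u t) (U t)) {η : ℝ → ℝ}
    (hη : Continuous η) (k : Freq) :
    (∫ t in Ioo 0 T, η t • U t) k =
      (wt s k : ℂ) * ∫ t in Ioo 0 T, η t • fourierCoeff (u t) k := by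
  have h1 := (lp.evalCLM ℝ (fun _ : Freq => ℂ) 2 k).integral_comp_comm
    (integrable_smul_of_test hη (hU.integrable one_le_two))
  refine h1.symm.trans ?_
  rw [← integral_const_mul]
  refine integral_congr_ae (h.mono fun t ht => ?_)
  change η t • (U t k) = _
  rw [ht.2 k, ← mul_smul_comm]; rfl

theorem coeffCLM_integral {T : ℝ} {u : ℝ → C(Torus, ℝ)} (hu : IntervalIntegrable u volume 0 T)
    (k : Freq) : fourierCoeff (∫ t in 0..T, u t : C(Torus, ℝ)) k =
      ∫ t in 0..T, fourierCoeff (u t) k := ((coeffCLM k).intervalIntegral_comp_comm hu).symm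

theorem IntDeriv.integral_test_coeff {T : ℝ} {u v : ℝ → C(Torus, ℝ)} (hT : 0 ≤ T)
    (h : IntDeriv T u v) {η : ℝ → ℝ} (hη : ContDiff ℝ ∞ η) (hs : tsupport η ⊆ Ioo 0 T) (k : Freq) :
    ∫ t in Ioo 0 T, deriv η t • fourierCoeff (u t) k =
      -∫ t in Ioo 0 T, η t • fourierCoeff (v t) k := by
  have hη1 : ContDiff ℝ 1 η := contDiff_infty.1 hη 1
  have h1 := h.integral_deriv_smul hT hη1 (test_eq_zero hs (by simp)) (test_eq_zero hs (by simp))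
  have hc := h.continuousOn hT
  rw [← uIcc_of_le hT] at hc
  have hi1 : IntervalIntegrable (fun t => deriv η t • u t) volume 0 T :=
    ((hη1.continuous_deriv le_rfl).continuousOn.smul hc).intervalIntegrable
  have hi2 : IntervalIntegrable (fun t => η t • v t) volume 0 T :=
    h.1.continuousOn_smul hη.continuous.continuousOn
  have h2 := congrArg (coeffCLM k) h1
  rw [map_neg, coeffCLM_apply, coeffCLM_apply, coeffCLM_integral hi1, coeffCLM_integral hi2] at h2
  have e : ∀ (c : ℝ) (f : C(Torus, ℝ)), fourierCoeff (c • f : C(Torus, ℝ)) k =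
      c • fourierCoeff f k := fun c f => (coeffCLM k).map_smul c f
  simpa only [e, intervalIntegral.integral_of_le hT, integral_Ioc_eq_integral_Ioo] using h2

theorem IntDeriv.aestronglyMeasurable {E : Type*} [NormedAddCommGroup E] [NormedSpace ℝ E] {T : ℝ}
    {u v : ℝ → E} (h : IntDeriv T u v) : AEStronglyMeasurable v (volume.restrict (Ioo 0 T)) := by
  rw [restrict_Ioo_eq_restrict_Ioc]; exact h.1.1.aestronglyMeasurable

theorem IntDeriv.hasTimeDeriv {s T : ℝ} {u v : ℝ → C(Torus, ℝ)} (hT : 0 ≤ T) (h : IntDeriv T u v)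
    (hum : ∀ᵐ t ∂(volume.restrict (Ioo 0 T)), sobE s (u t) ≠ ⊤)
    (hvm : ∀ᵐ t ∂(volume.restrict (Ioo 0 T)), sobE s (v t) ≠ ⊤)
    (hu : ∫⁻ t in Ioo 0 T, sobE s (u t) < ⊤) (hv : ∫⁻ t in Ioo 0 T, sobE s (v t) < ⊤) :
    HasTimeDeriv s T (fun t x => u t x) fun t x => v t x := by
  obtain ⟨U, hU, hU'⟩ := exists_memLp_sobolevPath (ν := volume.restrict (Ioo 0 T)) (s := s)
    (u := fun t x => u t x) (fun k => ((continuousOn_fourierCoeff (h.continuousOn hT) k).mono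
      Ioo_subset_Icc_self).aestronglyMeasurable measurableSet_Ioo)
    (Eventually.of_forall fun t => memLp_continuousMap (u t) 2) hum hu
  obtain ⟨V, hV, hV'⟩ := exists_memLp_sobolevPath (ν := volume.restrict (Ioo 0 T)) (s := s)
    (u := fun t x => v t x) (fun k => (coeffCLM k).continuous.comp_aestronglyMeasurable
      h.aestronglyMeasurable)
    (Eventually.of_forall fun t => memLp_continuousMap (v t) 2) hvm hv
  refine ⟨U, V, hU, hV, hU'.and hV', fun η hη _ hs => ?_⟩
  refine lp.ext (funext fun k => ?_)
  have h1 : ContDiff ℝ 1 η := contDiff_infty.1 hη 1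
  rw [coeff_integral_smul hU hU' (h1.continuous_deriv le_rfl) k, lp.coeFn_neg, Pi.neg_apply,
    coeff_integral_smul hV hV' hη.continuous k, h.integral_test_coeff hT hη hs k, mul_neg]

theorem exists_bump (T : ℝ) (hT : 0 < T) : ∃ ψ : ℝ → ℝ, ContDiff ℝ ∞ ψ ∧ HasCompactSupport ψ ∧
    tsupport ψ ⊆ Ioo 0 T ∧ ∫ t, ψ t = 1 := by
  let f : ContDiffBump (T / 2) := ⟨T / 8, T / 4, by positivity, by linarith⟩
  refine ⟨f.normed volume, f.contDiff_normed, f.hasCompactSupport_normed, ?_, f.integral_normed⟩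
  rw [f.tsupport_normed_eq]
  intro t ht
  rw [Metric.mem_closedBall, Real.dist_eq, abs_le] at ht
  have : f.rOut = T / 4 := rfl
  rw [this] at ht
  constructor <;> linarith [ht.1, ht.2]

/-- A continuous function with vanishing weak derivative is constant. -/
theorem eq_of_weakDeriv_eq_zero {F : Type*} [NormedAddCommGroup F] [NormedSpace ℝ F]
    [CompleteSpace F] {T : ℝ} (hT : 0 < T) {f : ℝ → F} (hf : ContinuousOn f (Icc 0 T))
    (h : ∀ η : ℝ → ℝ, ContDiff ℝ ∞ η → HasCompactSupport η → tsupport η ⊆ Ioo 0 T →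
      ∫ t in Ioo 0 T, deriv η t • f t = 0) : ∀ t ∈ Icc 0 T, f t = f 0 := by
  obtain ⟨ψ₀, hψ₀, hψ₀c, hψ₀s, hψ₀i⟩ := exists_bump T hT
  have hfi : Integrable f (volume.restrict (Ioo 0 T)) :=
    hf.integrableOn_Icc.mono_set Ioo_subset_Icc_self
  set C := ∫ t in Ioo 0 T, ψ₀ t • f t with hC
  have hfull : ∀ ψ : ℝ → ℝ, tsupport ψ ⊆ Ioo 0 T → ∀ g : ℝ → F,
      ∫ t in Ioo 0 T, ψ t • g t = ∫ t, ψ t • g t := fun ψ hψ g =>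
    setIntegral_eq_integral_of_forall_compl_eq_zero fun t ht => by
      rw [test_eq_zero hψ ht, zero_smul]
  have hfull' : ∀ ψ : ℝ → ℝ, tsupport ψ ⊆ Ioo 0 T →
      ∫ t in Ioo 0 T, ψ t = ∫ t, ψ t := fun ψ hψ =>
    setIntegral_eq_integral_of_forall_compl_eq_zero fun t ht => test_eq_zero hψ ht
  have key : ∀ ψ : ℝ → ℝ, ContDiff ℝ ∞ ψ → HasCompactSupport ψ → tsupport ψ ⊆ Ioo 0 T →
      ∫ t, ψ t • (f t - C) = 0 := by
    intro ψ hψ hψc hψs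
    set I := ∫ t, ψ t with hI
    -- The argument of du Bois-Reymond: subtracting a multiple of the fixed bump gives zero mean, so
    -- the primitive of `θ` is again a test function.
    let θ : ℝ → ℝ := fun t => ψ t - I * ψ₀ t
    have hθ : ContDiff ℝ ∞ θ := hψ.sub (contDiff_const.mul hψ₀)
    have hint : ∀ {ψ : ℝ → ℝ}, ContDiff ℝ ∞ ψ → HasCompactSupport ψ → Integrable ψ :=
      fun h h' => h.continuous.integrable_of_hasCompactSupport h'
    -- the support of `θ`
    obtain ⟨α, β, hα, hβ, hsupp⟩ : ∃ α β : ℝ, 0 < α ∧ β < T ∧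
        ∀ t, t ∉ Icc α β → θ t = 0 := by
      -- The point `T / 2` only makes the compact set nonempty, so that its extreme points exist.
      have hK : IsCompact (tsupport ψ ∪ tsupport ψ₀ ∪ {T / 2}) :=
        (hψc.isCompact.union hψ₀c.isCompact).union isCompact_singleton
      have hKs : tsupport ψ ∪ tsupport ψ₀ ∪ {T / 2} ⊆ Ioo 0 T :=
        union_subset (union_subset hψs hψ₀s) (by
          rw [singleton_subset_iff]; constructor <;> linarith)
      obtain ⟨α, hα, hα'⟩ := hK.exists_isLeast ⟨T / 2, by simp⟩
      obtain ⟨β, hβ, hβ'⟩ := hK.exists_isGreatest ⟨T / 2, by simp⟩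
      refine ⟨α, β, (hKs hα).1, (hKs hβ).2, fun t ht => ?_⟩
      have ht' : t ∉ tsupport ψ ∪ tsupport ψ₀ := fun h' =>
        ht ⟨hα' (Or.inl h'), hβ' (Or.inl h')⟩
      rw [mem_union, not_or] at ht'
      simp only [θ, image_eq_zero_of_notMem_tsupport ht'.1,
        image_eq_zero_of_notMem_tsupport ht'.2, mul_zero, sub_zero]
    let η : ℝ → ℝ := fun t => ∫ s in 0..t, θ s
    have hηd : ∀ t, HasDerivAt η (θ t) t := fun t =>
      (hθ.continuous.integral_hasStrictDerivAt 0 t).hasDerivAt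
    have hηd' : deriv η = θ := funext fun t => (hηd t).deriv
    have hη : ContDiff ℝ ∞ η := contDiff_infty_iff_deriv.2
      ⟨fun t => (hηd t).differentiableAt, by rw [hηd']; exact hθ⟩
    have hθint : ∫ t, θ t = 0 := by
      simp only [θ]
      rw [integral_sub (hint hψ hψc) ((hint hψ₀ hψ₀c).const_mul I), integral_const_mul, hψ₀i,
        mul_one, sub_self]
    have hη0 : ∀ t, t ∉ Icc α β → η t = 0 := by
      intro t ht
      rw [mem_Icc, not_and_or, not_le, not_le] at ht
      rcases ht with ht | ht
      · refine intervalIntegral.integral_zero_ae (Eventually.of_forall fun s hs => hsupp s ?_)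
        intro hs'
        rcases mem_uIoc.1 hs with h1 | h1 <;> linarith [hs'.1, h1.2]
      · by_cases hαt : t < α
        · refine intervalIntegral.integral_zero_ae (Eventually.of_forall fun s hs => hsupp s ?_)
          intro hs'
          rcases mem_uIoc.1 hs with h1 | h1 <;> linarith [hs'.1, h1.2]
        · have ht0 : 0 ≤ t := by linarith
          change ∫ s in 0..t, θ s = 0
          rw [intervalIntegral.integral_of_le ht0, ← hθint]
          refine setIntegral_eq_integral_of_forall_compl_eq_zero fun s hs => hsupp s fun hs' => ?_
          exact hs ⟨by linarith [hs'.1], by linarith [hs'.2]⟩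
    have hηs : tsupport η ⊆ Icc α β :=
      closure_minimal (fun t ht => by_contra fun h' => ht (hη0 t h')) isClosed_Icc
    have h1 := h η hη (HasCompactSupport.of_support_subset_isCompact isCompact_Icc
      (subset_closure.trans hηs)) (hηs.trans fun t ht => ⟨hα.trans_le ht.1, ht.2.trans_lt hβ⟩)
    rw [hηd'] at h1
    simp only [θ, sub_smul, mul_smul] at h1
    rw [integral_sub (integrable_smul_of_test hψ.continuous hfi)
      ((integrable_smul_of_test hψ₀.continuous hfi).fun_smul I), integral_smul, ← hC, sub_eq_zero] at h1
    rw [← hfull ψ hψs]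
    simp only [smul_sub]
    rw [integral_sub (integrable_smul_of_test hψ.continuous hfi)
      (integrable_smul_of_test hψ.continuous (integrable_const C)), h1, integral_smul_const,
      hfull' ψ hψs, sub_self]
  have hloc : LocallyIntegrableOn (fun t => f t - C) (Ioo 0 T) volume :=
    ((hf.mono Ioo_subset_Icc_self).sub continuousOn_const).locallyIntegrableOn measurableSet_Ioo
  have hae := isOpen_Ioo.ae_eq_zero_of_integral_contDiff_smul_eq_zero hloc key
  have hae' : f =ᵐ[volume.restrict (Icc 0 T)] fun _ => C := by
    rw [← restrict_Ioo_eq_restrict_Icc]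
    filter_upwards [ae_restrict_of_ae hae, ae_restrict_mem measurableSet_Ioo] with t h1 h2
    exact sub_eq_zero.1 (h1 h2)
  have heq := Measure.eqOn_Icc_of_ae_eq volume hT.ne hae' hf continuousOn_const
  intro t ht
  rw [heq ht, heq ⟨le_rfl, hT.le⟩]

end SelfPropelled
end

noncomputable section
namespace SelfPropelled
open Filter Topology

/-! ### Primitives from weak time derivatives -/

open scoped ComplexConjugate

theorem aestronglyMeasurable_coeff {s : ℝ} {ν : Measure ℝ} {u : ℝ → Torus → ℝ} {U : ℝ → EllTwo}
    (hU : AEStronglyMeasurable U ν) (h : ∀ᵐ t ∂ν, IsSobolevSeq s (u t) (U t)) (k : Freq) :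
    AEStronglyMeasurable (fun t => fourierCoeff (u t) k) ν := by
  have h1 := ((lp.evalCLM ℂ (fun _ : Freq => ℂ) 2 k).continuous.comp_aestronglyMeasurable
    hU).const_mul ((wt s k : ℂ)⁻¹)
  refine h1.congr (h.mono fun t ht => ?_)
  have h2 : (wt s k : ℂ) ≠ 0 := by exact_mod_cast (wt_pos s k).ne'
  change (wt s k : ℂ)⁻¹ * (U t k) = _
  rw [ht.2 k]
  exact inv_mul_cancel_left₀ h2 _

theorem HasTimeDeriv.integral_test_coeff {s T : ℝ} {u v : ℝ → Torus → ℝ}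
    (h : HasTimeDeriv s T u v) {η : ℝ → ℝ} (hη : ContDiff ℝ ∞ η) (hc : HasCompactSupport η)
    (hs : tsupport η ⊆ Ioo 0 T) (k : Freq) :
    ∫ t in Ioo 0 T, deriv η t • fourierCoeff (u t) k =
      -∫ t in Ioo 0 T, η t • fourierCoeff (v t) k := by
  obtain ⟨U, V, hU, hV, hUV, hw⟩ := h
  have h1 : ContDiff ℝ 1 η := contDiff_infty.1 hη 1
  have h2 := congrArg (fun a : EllTwo => a k) (hw η hη hc hs)
  simp only [lp.coeFn_neg, Pi.neg_apply] at h2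
  rw [coeff_integral_smul hU (hUV.mono fun t ht => ht.1) (h1.continuous_deriv le_rfl) k,
    coeff_integral_smul hV (hUV.mono fun t ht => ht.2) hη.continuous k, ← mul_neg] at h2
  exact mul_left_cancel₀ (by exact_mod_cast (wt_pos s k).ne') h2

theorem HasTimeDeriv.integrable_coeff {s T : ℝ} (hs : 0 ≤ s) {u v : ℝ → Torus → ℝ}
    (h : HasTimeDeriv s T u v) (k : Freq) :
    Integrable (fun t => fourierCoeff (v t) k) (volume.restrict (Ioo 0 T)) := by
  obtain ⟨U, V, hU, hV, hUV, -⟩ := h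
  refine (hV.integrable one_le_two).mono (aestronglyMeasurable_coeff hV.1
    (hUV.mono fun t ht => ht.2) k) (hUV.mono fun t ht => ?_)
  refine le_trans ?_ (lp.norm_apply_le_norm (by simp) (V t) k)
  rw [ht.2.2 k, norm_mul]
  refine le_mul_of_one_le_left (norm_nonneg _) ?_
  rw [Complex.norm_real]
  exact (one_le_wt hs k).trans (le_abs_self _)

/-- A continuous path with a weak time derivative in `H^s`, `s > 1`, is a primitive. -/
theorem HasTimeDeriv.exists_intDeriv {s T : ℝ} (hT : 0 < T) (hs : 1 < s) {u : ℝ → C(Torus, ℝ)}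
    (hu : ContinuousOn u (Icc 0 T)) {v : ℝ → Torus → ℝ}
    (h : HasTimeDeriv s T (fun t x => u t x) v) : ∃ w : ℝ → C(Torus, ℝ), IntDeriv T u w := by
  have htest := fun η h1 h2 h3 k => h.integral_test_coeff (η := η) h1 h2 h3 k
  obtain ⟨U, V, hU, hV, hUV, -⟩ := h
  have hVs := hUV.mono fun t ht => ht.2
  obtain ⟨C, hC, hle⟩ := exists_wsum_sq_le (s := 0) (t := s) (by linarith)
  -- Since `s > 1`, almost every value of the derivative has absolutely summable coefficients, hence
  -- a continuous representative. The sup norm of the latter is controlled by the `H^s` norm, so `w`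
  -- is square integrable in time.
  let w : ℝ → C(Torus, ℝ) := fun t => synth (fourierCoeff (v t))
  have hfin : ∀ᵐ t ∂(volume.restrict (Ioo 0 T)), wsum 0 (v t) ≠ ⊤ := hVs.mono fun t ht =>
    wsum_ne_top (t := s) (by linarith) (by rw [ht.sobE_eq]; finiteness)
  have hwc : ∀ᵐ t ∂(volume.restrict (Ioo 0 T)), ∀ k, fourierCoeff (w t) k = fourierCoeff (v t) k :=
    hfin.mono fun t ht k => fourierCoeff_synth
      (by simpa [wt_zero] using summable_norm_of_wsum ht) (fourierCoeff_neg_index _) k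
  have hwsum : ∀ᵐ t ∂(volume.restrict (Ioo 0 T)), wsum 0 (w t) = wsum 0 (v t) :=
    hwc.mono fun t ht => by simp only [wsum, ht]
  have hwm : AEStronglyMeasurable w (volume.restrict (Ioo 0 T)) := by
    refine aestronglyMeasurable_of_coeff (fun k => (aestronglyMeasurable_coeff hV.1 hVs k).congr
      (hwc.mono fun t ht => (ht k).symm)) ?_
    filter_upwards [hfin, hwsum] with t h1 h2
    rwa [h2]
  have hw2 : MemLp w 2 (volume.restrict (Ioo 0 T)) := by
    refine memLp_two_of_lintegral hwm ?_
    have : ∫⁻ t in Ioo 0 T, ‖w t‖ₑ ^ 2 ≤ ∫⁻ t in Ioo 0 T, C * ‖V t‖ₑ ^ 2 := by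
      refine lintegral_mono_ae ?_
      filter_upwards [hVs, hwsum] with t h1 h2
      rw [← h1.sobE_eq]
      exact (pow_le_pow_left' ((enorm_le_wsum (w t)).trans_eq h2) 2).trans (hle _)
    refine this.trans_lt ?_
    rw [lintegral_const_mul' _ _ hC]
    exact ENNReal.mul_lt_top hC.lt_top (lintegral_of_memLp_two hV)
  have hwi : IntervalIntegrable w volume 0 T :=
    (intervalIntegrable_iff_integrableOn_Ioo_of_le hT.le).2 (hw2.integrable one_le_two)
  let g : ℝ → C(Torus, ℝ) := fun t => ∫ s in 0..t, w s
  have hg : IntDeriv T g w := ⟨hwi, fun t _ => by simp [g]⟩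
  have hgc := hg.continuousOn hT.le
  refine ⟨w, hwi, fun t ht => ?_⟩
  refine eq_of_fourierCoeff_eq fun k => ?_
  -- Each coefficient of `u` minus the primitive `g` has vanishing weak derivative and is therefore
  -- constant in time.
  have h1 := eq_of_weakDeriv_eq_zero hT (f := fun t => coeffCLM k (u t - g t))
    ((coeffCLM k).continuous.comp_continuousOn (hu.sub hgc)) (fun η hη hηc hηs => by
      have hη1 : ContDiff ℝ 1 η := contDiff_infty.1 hη 1
      have hi : ∀ {f : ℝ → C(Torus, ℝ)}, ContinuousOn f (Icc 0 T) → Integrable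
          (fun t => deriv η t • fourierCoeff (f t) k) (volume.restrict (Ioo 0 T)) := fun hf =>
        integrable_smul_of_test (hη1.continuous_deriv le_rfl)
          ((continuousOn_fourierCoeff hf k).integrableOn_Icc.mono_set Ioo_subset_Icc_self)
      simp only [map_sub, coeffCLM_apply, smul_sub]
      rw [integral_sub (hi hu) (hi hgc), htest η hη hηc hηs k,
        hg.integral_test_coeff hT.le hη hηs k, sub_eq_zero, neg_inj]
      exact integral_congr_ae (hwc.mono fun t ht => by simp only [ht k])) t ht
  simp only [map_sub, g, intervalIntegral.integral_same, sub_zero] at h1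
  have h2 := (coeffCLM k).map_add (u 0) (∫ s in 0..t, w s)
  simp only [coeffCLM_apply] at h1 h2
  rw [h2, ← h1]; ring

/-- The weak time derivative is unique. -/
theorem HasTimeDeriv.ae_eq {s T : ℝ} (hT : 0 < T) (hs : 0 ≤ s) {u w : ℝ → C(Torus, ℝ)}
    {v : ℝ → Torus → ℝ} (h : HasTimeDeriv s T (fun t x => u t x) v) (hw : IntDeriv T u w) :
    ∀ᵐ t ∂(volume.restrict (Ioo 0 T)), w t =ᵐ[torusMeasure] v t := by
  have hk : ∀ k, ∀ᵐ t ∂(volume.restrict (Ioo 0 T)),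
      fourierCoeff (w t) k = fourierCoeff (v t) k := by
    intro k
    have hvi := h.integrable_coeff hs k
    have hwi : Integrable (fun t => fourierCoeff (w t) k) (volume.restrict (Ioo 0 T)) :=
      (coeffCLM k).integrable_comp
        ((intervalIntegrable_iff_integrableOn_Ioo_of_le hT.le).1 hw.1)
    have hloc : LocallyIntegrableOn (fun t => fourierCoeff (w t) k - fourierCoeff (v t) k)
        (Ioo 0 T) volume := IntegrableOn.locallyIntegrableOn (hwi.sub hvi)
    have hae := isOpen_Ioo.ae_eq_zero_of_integral_contDiff_smul_eq_zero hloc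
      fun η hη hηc hηs => by
        rw [← setIntegral_eq_integral_of_forall_compl_eq_zero (s := Ioo 0 T) fun t ht => by
          rw [test_eq_zero hηs ht, zero_smul]]
        simp only [smul_sub]
        rw [integral_sub (integrable_smul_of_test hη.continuous hwi)
          (integrable_smul_of_test hη.continuous hvi), sub_eq_zero, ← neg_inj,
          ← h.integral_test_coeff hη hηc hηs k, ← hw.integral_test_coeff hT.le hη hηs k]
    filter_upwards [ae_restrict_of_ae hae, ae_restrict_mem measurableSet_Ioo] with t h1 h2
    exact sub_eq_zero.1 (h1 h2)
  obtain ⟨U, V, hU, hV, hUV, -⟩ := h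
  filter_upwards [ae_all_iff.2 hk, hUV] with t h1 h2
  exact ae_eq_of_fourierCoeff_eq (integrable_continuousMap _) (h2.2.1.integrable one_le_two) h1

end SelfPropelled
end

noncomputable section
namespace SelfPropelled
open Filter Topology

/-! ### The equations at a fixed time -/

open scoped ComplexConjugate

/-- `Ω^⊥ = (-sin θ, cos θ)`. -/
def normalDir (θ : ℝ) : Fin 2 → ℝ := ![-Real.sin θ, Real.cos θ]

theorem hasDerivAt_direction (j : Fin 2) (θ : ℝ) :
    HasDerivAt (fun θ => direction θ j) (normalDir θ j) θ := by
  fin_cases j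
  · exact Real.hasDerivAt_cos θ
  · exact Real.hasDerivAt_sin θ

theorem hasDerivAt_normalDir (j : Fin 2) (θ : ℝ) :
    HasDerivAt (fun θ => normalDir θ j) (-direction θ j) θ := by
  fin_cases j
  · exact (Real.hasDerivAt_sin θ).neg
  · exact Real.hasDerivAt_cos θ

theorem contDiff_direction (j : Fin 2) : ContDiff ℝ ∞ fun θ => direction θ j := by
  fin_cases j
  · exact Real.contDiff_cos
  · exact Real.contDiff_sin

theorem contDiff_normalDir (j : Fin 2) : ContDiff ℝ ∞ fun θ => normalDir θ j := by
  fin_cases j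
  · exact Real.contDiff_sin.neg
  · exact Real.contDiff_cos

theorem normalDir_ne_zero (θ : ℝ) : normalDir θ ≠ 0 := by
  intro h
  have h0 := congrFun h 0
  have h1 := congrFun h 1
  simp only [normalDir, Matrix.cons_val_zero, Matrix.cons_val_one, Pi.zero_apply,
    neg_eq_zero] at h0 h1
  have := Real.sin_sq_add_cos_sq θ
  rw [h0, h1] at this
  norm_num at this

/-- In the plane the orthogonal complement of `Ω` is the line spanned by `Ω^⊥`. This is what makes
the momentum equation scalar. -/
theorem perpProj_direction (θ : ℝ) (v : Fin 2 → ℝ) :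
    perpProj (direction θ) v = (normalDir θ ⬝ᵥ v) • normalDir θ := by
  have hcs := Real.sin_sq_add_cos_sq θ
  refine funext (Fin.forall_fin_two.2 ⟨?_, ?_⟩) <;>
  simp only [perpProj, direction, normalDir, dotProduct, Fin.sum_univ_two, Pi.smul_apply,
    Pi.sub_apply, smul_eq_mul, Matrix.cons_val_zero, Matrix.cons_val_one]
  · linear_combination (-v 0) * hcs
  · linear_combination (-v 1) * hcs

def directionMap (j : Fin 2) : C(ℝ, ℝ) := ⟨fun θ => direction θ j, (contDiff_direction j).continuous⟩

def normalMap (j : Fin 2) : C(ℝ, ℝ) := ⟨fun θ => normalDir θ j, (contDiff_normalDir j).continuous⟩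

theorem hasWeakLaplacian_of_partials {f : Torus → ℝ} {g h : Fin 2 → Torus → ℝ}
    (hg : ∀ i, HasWeakPartial i f (g i)) (hh : ∀ i, HasWeakPartial i (g i) (h i)) :
    HasWeakLaplacian f fun x => ∑ i, h i x := by
  refine ⟨(hg 0).1, integrable_finsetSum _ fun i _ => (hh i).2.1, fun k => ?_⟩
  rw [fourierCoeff_sum _ fun i _ => (hh i).2.1]
  simp only [(hh _).2.2, (hg _).2.2, laplaceSymbol, Fin.sum_univ_two]
  push_cast
  linear_combination (4 * (Real.pi : ℂ) ^ 2 * ((k 0 : ℂ) ^ 2 + (k 1 : ℂ) ^ 2) *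
    fourierCoeff f k) * Complex.I_sq

theorem HasWeakLaplacian.ae_eq {f g g' : Torus → ℝ} (h : HasWeakLaplacian f g)
    (h' : HasWeakLaplacian f g') : g =ᵐ[torusMeasure] g' :=
  ae_eq_of_fourierCoeff_eq h.2.1 h'.2.1 fun k => by rw [h.2.2, h'.2.2]

variable {m : ℝ}

theorem hasWeakPartial_pd_of_sobE (hm : 2 < m) {f : C(Torus, ℝ)} (hf : sobE m f ≠ ⊤) (i : Fin 2) :
    HasWeakPartial i f (pd i f) :=
  hasWeakPartial_pd (integrable_continuousMap f) (wsum_one_ne_top hm hf) i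

theorem exists_second_partial (hm : 2 < m) {f : C(Torus, ℝ)} (hf : sobE m f ≠ ⊤) (i : Fin 2) :
    ∃ h : Torus → ℝ, MemLp h 2 torusMeasure ∧ HasWeakPartial i (pd i f) h := by
  refine exists_hasWeakPartial (integrable_continuousMap _) ?_ i
  have h1 := (hasWeakPartial_pd_of_sobE hm hf i).sobE_le (s := 1) (t := 2) (by norm_num)
  exact ((h1.trans (sobE_mono hm.le f)).trans_lt hf.lt_top).ne

theorem exists_hasWeakLaplacian (hm : 2 < m) {f : C(Torus, ℝ)} (hf : sobE m f ≠ ⊤) :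
    ∃ q : Torus → ℝ, HasWeakLaplacian f q := by
  choose h _ hh using exists_second_partial hm hf
  exact ⟨_, hasWeakLaplacian_of_partials (hasWeakPartial_pd_of_sobE hm hf) hh⟩

theorem hasWeakPartial_comp_of_hasDerivAt (hm : 2 < m) {f : C(Torus, ℝ)} (hf : sobE m f ≠ ⊤)
    {F F' : ℝ → ℝ} (hF : ContDiff ℝ ∞ F) (hF' : ∀ x, HasDerivAt F (F' x) x) (i : Fin 2) :
    HasWeakPartial i (fun x => F (f x)) (fun x => F' (f x) * pd i f x) := by
  have := hasWeakPartial_comp_pd hm hf (contDiff_infty.1 hF 1) i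
  simpa only [(hF' _).deriv] using this

section Products

variable (hm : 2 < m) {ρ φ : C(Torus, ℝ)} (hρ : sobE m ρ ≠ ⊤) (hφ : sobE m φ ≠ ⊤)
include hm hρ hφ

theorem hasWeakPartial_mul_direction (i j : Fin 2) :
    HasWeakPartial i (fun x => ρ x * direction (φ x) j)
      (fun x => pd i ρ x * direction (φ x) j + ρ x * (normalDir (φ x) j * pd i φ x)) :=
  (hasWeakPartial_pd_of_sobE hm hρ i).mul
    (hasWeakPartial_comp_of_hasDerivAt hm hφ (contDiff_direction j) (hasDerivAt_direction j) i)
    (memLp_continuousMap ρ 2) (memLp_continuousMap (pd i ρ) 2)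
    (memLp_comp (contDiff_direction j).continuous φ 2)
    (memLp_continuousMap ((normalMap j).comp φ * pd i φ) 2)

theorem hasWeakPartial_second_mul_direction (i j : Fin 2) {ρ₂ φ₂ : Torus → ℝ}
    (hρ₂ : HasWeakPartial i (pd i ρ) ρ₂) (hρ₂L : MemLp ρ₂ 2 torusMeasure)
    (hφ₂ : HasWeakPartial i (pd i φ) φ₂) (hφ₂L : MemLp φ₂ 2 torusMeasure) :
    HasWeakPartial i
      (fun x => pd i ρ x * direction (φ x) j + ρ x * (normalDir (φ x) j * pd i φ x))
      (fun x => (ρ₂ x * direction (φ x) j + pd i ρ x * (normalDir (φ x) j * pd i φ x)) +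
        (pd i ρ x * (normalDir (φ x) j * pd i φ x) +
          ρ x * (-direction (φ x) j * pd i φ x * pd i φ x + normalDir (φ x) j * φ₂ x))) := by
  have h1 := hρ₂.mul
    (hasWeakPartial_comp_of_hasDerivAt hm hφ (contDiff_direction j) (hasDerivAt_direction j) i)
    (memLp_continuousMap _ 2) hρ₂L (memLp_comp (contDiff_direction j).continuous φ 2)
    (memLp_continuousMap ((normalMap j).comp φ * pd i φ) 2)
  have h2 := (hasWeakPartial_comp_of_hasDerivAt hm hφ (contDiff_normalDir j)
    (hasDerivAt_normalDir j) i).mul hφ₂ (memLp_comp (contDiff_normalDir j).continuous φ 2)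
    (memLp_continuousMap (-((directionMap j).comp φ) * pd i φ) 2) (memLp_continuousMap _ 2) hφ₂L
  have h3 := (hasWeakPartial_pd_of_sobE hm hρ i).mul h2 (memLp_continuousMap ρ 2)
    (memLp_continuousMap (pd i ρ) 2) (memLp_continuousMap ((normalMap j).comp φ * pd i φ) 2)
    ((memLp_continuousMap (-((directionMap j).comp φ) * pd i φ * pd i φ) 2).add
      (memLp_bdd_mul ((normalMap j).comp φ) hφ₂L))
  exact h1.add h3

/-- Weak partial derivatives are unique almost everywhere, so the unspecified ones can be replaced
by those computed from the product and chain rules. -/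
theorem massEquation_iff_scalar {ρt : Torus → ℝ} : MassEquation ρ φ ρt ↔ ∀ᵐ x ∂torusMeasure,
    ρt x + ∑ i, (pd i ρ x * direction (φ x) i + ρ x * (normalDir (φ x) i * pd i φ x)) = 0 := by
  have h := fun i => hasWeakPartial_mul_direction hm hρ hφ i i
  constructor
  · rintro ⟨D, hD, hx⟩
    filter_upwards [hx, ae_all_iff.2 fun i => (hD i).ae_eq (h i)] with x h1 h2
    simpa only [h2] using h1
  · exact fun hx => ⟨_, h, hx⟩

/-- Both sides are multiples of the nonzero vector `Ω^⊥`, so only the scalar factors are compared.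
In `Δ(ρΩ)` the parts with `Δρ` and `|∇φ|²` point along `Ω` and are removed by the projection. `P` is
a globally smooth function agreeing with `p` on the values of `ρ`, as the chain rule requires. -/
theorem momentumEquation_iff_scalar {c μ : ℝ} {p P : ℝ → ℝ} (hP : ContDiff ℝ ∞ P)
    (hpP : ∀ x, P (ρ x) = p (ρ x)) {q w : Torus → ℝ} (hq : HasWeakLaplacian φ q)
    {Ωt : Fin 2 → Torus → ℝ} (hΩ : ∀ j, Ωt j =ᵐ[torusMeasure] fun x => normalDir (φ x) j * w x) :
    MomentumEquation c μ p ρ φ Ωt ↔ ∀ᵐ x ∂torusMeasure,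
      ρ x * (w x + c * (direction (φ x) 0 * pd 0 φ x + direction (φ x) 1 * pd 1 φ x)) +
        deriv P (ρ x) * (normalDir (φ x) 0 * pd 0 ρ x + normalDir (φ x) 1 * pd 1 ρ x) =
      μ * (2 * (pd 0 ρ x * pd 0 φ x + pd 1 ρ x * pd 1 φ x) + ρ x * q x) := by
  have hDΩ : ∀ i j, HasWeakPartial i (fun x => direction (φ x) j)
      (fun x => normalDir (φ x) j * pd i φ x) := fun i j =>
    hasWeakPartial_comp_of_hasDerivAt hm hφ (contDiff_direction j) (hasDerivAt_direction j) i
  have hDp : ∀ i, HasWeakPartial i (fun x => p (ρ x)) (fun x => deriv P (ρ x) * pd i ρ x) :=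
    fun i => by simpa only [hpP] using hasWeakPartial_comp_pd hm hρ (contDiff_infty.1 hP 1) i
  choose ρ₂ hρ₂L hρ₂ using exists_second_partial hm hρ
  choose φ₂ hφ₂L hφ₂ using exists_second_partial hm hφ
  have hL := fun j => hasWeakLaplacian_of_partials
    (fun i => hasWeakPartial_mul_direction hm hρ hφ i j)
    (fun i => hasWeakPartial_second_mul_direction hm hρ hφ i j (hρ₂ i) (hρ₂L i) (hφ₂ i) (hφ₂L i))
  have hq2 := (hasWeakLaplacian_of_partials (hasWeakPartial_pd_of_sobE hm hφ) hφ₂).ae_eq hq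
  -- the pointwise identity
  have key : ∀ x, (∀ j, Ωt j x = normalDir (φ x) j * w x) → φ₂ 0 x + φ₂ 1 x = q x →
      (ρ x • ((fun j => Ωt j x) + c • fun j => ∑ i, direction (φ x) i *
          (normalDir (φ x) j * pd i φ x))
          + perpProj (direction (φ x)) (fun i => deriv P (ρ x) * pd i ρ x)
        = μ • perpProj (direction (φ x)) (fun j => ∑ i,
          ((ρ₂ i x * direction (φ x) j + pd i ρ x * (normalDir (φ x) j * pd i φ x)) +
        (pd i ρ x * (normalDir (φ x) j * pd i φ x) +
          ρ x * (-direction (φ x) j * pd i φ x * pd i φ x + normalDir (φ x) j * φ₂ i x)))) ↔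
      ρ x * (w x + c * (direction (φ x) 0 * pd 0 φ x + direction (φ x) 1 * pd 1 φ x)) +
        deriv P (ρ x) * (normalDir (φ x) 0 * pd 0 ρ x + normalDir (φ x) 1 * pd 1 ρ x) =
      μ * (2 * (pd 0 ρ x * pd 0 φ x + pd 1 ρ x * pd 1 φ x) + ρ x * q x)) := by
    intro x hx hqx
    have hcs := Real.sin_sq_add_cos_sq (φ x)
    rw [perpProj_direction, perpProj_direction, ← smul_assoc,
      show (fun j => Ωt j x) = w x • normalDir (φ x) from
        funext fun j => by rw [hx, Pi.smul_apply, smul_eq_mul, mul_comm],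
      show (fun j => ∑ i, direction (φ x) i * (normalDir (φ x) j * pd i φ x)) =
        (direction (φ x) 0 * pd 0 φ x + direction (φ x) 1 * pd 1 φ x) • normalDir (φ x) from
        funext fun j => by rw [Fin.sum_univ_two, Pi.smul_apply, smul_eq_mul]; ring,
      ← smul_assoc, ← add_smul, ← smul_assoc, ← add_smul,
      (smul_left_injective ℝ (normalDir_ne_zero (φ x))).eq_iff, ← hqx]
    simp only [direction, normalDir, dotProduct, Fin.sum_univ_two, smul_eq_mul,
      Matrix.cons_val_zero, Matrix.cons_val_one]
    generalize Real.cos (φ x) = C at *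
    generalize Real.sin (φ x) = S at *
    constructor <;> intro h
    · linear_combination h + μ * (2 * (pd 0 ρ x * pd 0 φ x + pd 1 ρ x * pd 1 φ x) +
        ρ x * (φ₂ 0 x + φ₂ 1 x)) * hcs
    · linear_combination h - μ * (2 * (pd 0 ρ x * pd 0 φ x + pd 1 ρ x * pd 1 φ x) +
        ρ x * (φ₂ 0 x + φ₂ 1 x)) * hcs
  have hΩ' := ae_all_iff.2 hΩ
  constructor
  · rintro ⟨DΩ, Dp, L, h1, h2, h3, h4⟩
    filter_upwards [h4, hΩ', hq2, ae_all_iff.2 fun i => ae_all_iff.2 fun j => (h1 i j).ae_eq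
      (hDΩ i j), ae_all_iff.2 fun i => (h2 i).ae_eq (hDp i),
      ae_all_iff.2 fun j => (h3 j).ae_eq (hL j)] with x e4 eΩ eq e1 e2 e3
    rw [Fin.sum_univ_two] at eq
    refine (key x eΩ eq).1 ?_
    simpa only [e1, e2, e3] using e4
  · intro h
    refine ⟨_, _, _, hDΩ, hDp, hL, ?_⟩
    filter_upwards [h, hΩ', hq2] with x e4 eΩ eq
    rw [Fin.sum_univ_two] at eq
    exact (key x eΩ eq).2 e4

end Products

end SelfPropelled
end

noncomputable section
namespace SelfPropelled
open Filter Topology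

/-! ### Symmetrizing variables -/

open scoped ComplexConjugate

/-- A change of variables `ρ = g(r)` that symmetrizes the system for `ρ ∈ [δ, M]`. -/
structure SymVars (p : ℝ → ℝ) (δ M : ℝ) (a b g G : C(ℝ, ℝ)) : Prop where
  smooth_a : ContDiff ℝ ∞ a
  smooth_b : ContDiff ℝ ∞ b
  smooth_g : ContDiff ℝ ∞ g
  smooth_G : ContDiff ℝ ∞ G
  g_pos : ∀ y, 0 < g y
  hasDerivAt_g : ∀ y, HasDerivAt g (b y * g y) y
  a_mul_b : ∀ y, a y * b y = 1
  g_G : ∀ ρ ∈ Icc δ M, g (G ρ) = ρ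
  deriv_p : ∀ y, g y ∈ Icc δ M → deriv p (g y) = a y ^ 2

theorem sobE_comp_ne_top {m : ℝ} (hm : 2 < m) {F : C(ℝ, ℝ)} (hF : ContDiff ℝ ∞ F) {f : C(Torus, ℝ)}
    (hf : sobE m f ≠ ⊤) : sobE m (F.comp f) ≠ ⊤ := by
  obtain ⟨C, hC, h⟩ := exists_sobE_comp_le hF hm hf
  exact ((h f le_rfl).trans_lt hC.lt_top).ne

theorem fluxDensity_apply (a : C(ℝ, ℝ)) (r φ : C(Torus, ℝ)) (x : Torus) :
    fluxDensity a r φ x = -(direction (φ x) 0 * pd 0 r x + direction (φ x) 1 * pd 1 r x +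
      a (r x) * (normalDir (φ x) 0 * pd 0 φ x + normalDir (φ x) 1 * pd 1 φ x)) := by
  change -(Real.cos (φ x) * pd 0 r x + Real.sin (φ x) * pd 1 r x +
    a (r x) * Real.cos (φ x) * pd 1 φ x - a (r x) * Real.sin (φ x) * pd 0 φ x) = _
  simp only [direction, normalDir, Matrix.cons_val_zero, Matrix.cons_val_one]
  ring

theorem fluxAngle_apply (c μ : ℝ) (a b : C(ℝ, ℝ)) (r φ : C(Torus, ℝ)) (x : Torus) :
    fluxAngle c μ a b r φ x =
      -(c * (direction (φ x) 0 * pd 0 φ x + direction (φ x) 1 * pd 1 φ x) +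
      a (r x) * (normalDir (φ x) 0 * pd 0 r x + normalDir (φ x) 1 * pd 1 r x)) +
      2 * μ * (b (r x) * (pd 0 r x * pd 0 φ x + pd 1 r x * pd 1 φ x)) := by
  change -(c * (Real.cos (φ x) * pd 0 φ x + Real.sin (φ x) * pd 1 φ x) +
    a (r x) * Real.cos (φ x) * pd 1 r x - a (r x) * Real.sin (φ x) * pd 0 r x) +
    2 * μ * (b (r x) * (pd 0 r x * pd 0 φ x + pd 1 r x * pd 1 φ x)) = _
  simp only [direction, normalDir, Matrix.cons_val_zero, Matrix.cons_val_one]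
  ring

theorem eq_of_ae_eq {f g : C(Torus, ℝ)} (h : ∀ᵐ x ∂torusMeasure, f x = g x) : f = g :=
  eq_of_fourierCoeff_eq fun k => fourierCoeff_congr_ae h k

namespace SymVars

variable {p : ℝ → ℝ} {δ M : ℝ} {a b g G : C(ℝ, ℝ)} (S : SymVars p δ M a b g G)
  {m : ℝ} (hm : 2 < m) {r φ : C(Torus, ℝ)} (hr : sobE m r ≠ ⊤) (hφ : sobE m φ ≠ ⊤)
include S

theorem b_ne_zero (y : ℝ) : b y ≠ 0 := fun h => by
  have := S.a_mul_b y
  rw [h, mul_zero] at this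
  exact zero_ne_one this

include hm hr

theorem ae_pd_comp : ∀ᵐ x ∂torusMeasure, ∀ i,
    pd i (g.comp r) x = b (r x) * g (r x) * pd i r x :=
  ae_all_iff.2 fun i => (hasWeakPartial_pd_of_sobE hm (sobE_comp_ne_top hm S.smooth_g hr) i).ae_eq
    (hasWeakPartial_comp_of_hasDerivAt hm hr S.smooth_g S.hasDerivAt_g i)

include hφ

/-- With `ρ = g(r)` and `g' = b g`, both `∂ₜρ` and `∇ρ` carry the factor `b g`. Dividing by it turns
the coefficient of `Ω^⊥·∇φ` into `1 / b = a`. -/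
theorem massEquation_iff {v : C(Torus, ℝ)} :
    MassEquation (g.comp r) φ (fun x => b (r x) * g (r x) * v x) ↔ v = fluxDensity a r φ := by
  rw [massEquation_iff_scalar hm (sobE_comp_ne_top hm S.smooth_g hr) hφ]
  have key : ∀ x, (∀ i, pd i (g.comp r) x = b (r x) * g (r x) * pd i r x) →
      (b (r x) * g (r x) * v x + ∑ i, (pd i (g.comp r) x * direction (φ x) i +
        (g.comp r) x * (normalDir (φ x) i * pd i φ x)) = 0 ↔ v x = fluxDensity a r φ x) := by
    intro x hx
    have h1 : b (r x) * g (r x) ≠ 0 := mul_ne_zero (S.b_ne_zero _) (S.g_pos _).ne'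
    have h2 := S.a_mul_b (r x)
    rw [← sub_eq_zero (a := v x), ← mul_right_inj' h1 (b := v x - _), mul_zero,
      fluxDensity_apply, Fin.sum_univ_two, hx, hx, ContinuousMap.comp_apply]
    constructor <;> intro h
    · linear_combination h + g (r x) * (normalDir (φ x) 0 * pd 0 φ x +
        normalDir (φ x) 1 * pd 1 φ x) * h2
    · linear_combination h - g (r x) * (normalDir (φ x) 0 * pd 0 φ x +
        normalDir (φ x) 1 * pd 1 φ x) * h2
  constructor
  · intro h
    refine eq_of_ae_eq ?_
    filter_upwards [h, S.ae_pd_comp hm hr] with x h1 h2 using (key x h2).1 h1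
  · rintro h
    filter_upwards [S.ae_pd_comp hm hr] with x h2 using (key x h2).2 (by rw [h])

/-- After division by `ρ`, the pressure term becomes `a² b Ω^⊥·∇r = a Ω^⊥·∇r`, with the coefficient
already present in the density equation, and `2∇ρ·∇φ / ρ` becomes `2b∇r·∇φ`. The range condition is
needed because `p' = a²` is available only for densities in `[δ, M]`. -/
theorem momentumEquation_iff {c μ : ℝ} (hp : ContDiffOn ℝ ∞ p (Ioi 0)) (hδ : 0 < δ)
    (hrange : ∀ x, g (r x) ∈ Icc δ M) {q w : Torus → ℝ} (hq : HasWeakLaplacian φ q)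
    {Ωt : Fin 2 → Torus → ℝ} (hΩ : ∀ j, Ωt j =ᵐ[torusMeasure] fun x => normalDir (φ x) j * w x) :
    MomentumEquation c μ p (g.comp r) φ Ωt ↔
      ∀ᵐ x ∂torusMeasure, w x = fluxAngle c μ a b r φ x + μ * q x := by
  -- Passing to `δ / 2` makes `P` agree with `p` on a neighbourhood of each density value, so that
  -- their derivatives agree too.
  obtain ⟨P, hP, hPp⟩ := exists_contDiff_eqOn hp (half_pos hδ)
  have hlt : ∀ x, δ / 2 < g (r x) := fun x => (half_lt_self hδ).trans_le (hrange x).1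
  rw [momentumEquation_iff_scalar hm (sobE_comp_ne_top hm S.smooth_g hr) hφ hP
    (fun x => hPp _ (hlt x)) hq hΩ]
  have key : ∀ x, (∀ i, pd i (g.comp r) x = b (r x) * g (r x) * pd i r x) →
      ((g.comp r) x * (w x + c * (direction (φ x) 0 * pd 0 φ x + direction (φ x) 1 * pd 1 φ x)) +
        deriv P ((g.comp r) x) * (normalDir (φ x) 0 * pd 0 (g.comp r) x +
          normalDir (φ x) 1 * pd 1 (g.comp r) x) =
      μ * (2 * (pd 0 (g.comp r) x * pd 0 φ x + pd 1 (g.comp r) x * pd 1 φ x) +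
        (g.comp r) x * q x) ↔ w x = fluxAngle c μ a b r φ x + μ * q x) := by
    intro x hx
    have h1 : g (r x) ≠ 0 := (S.g_pos _).ne'
    have h2 := S.a_mul_b (r x)
    have h3 : deriv P (g (r x)) = a (r x) ^ 2 := by
      rw [← S.deriv_p _ (hrange x)]
      refine Filter.EventuallyEq.deriv_eq ?_
      filter_upwards [lt_mem_nhds (hlt x)] with y hy using hPp y hy
    rw [← sub_eq_zero (a := w x), ← mul_right_inj' h1 (b := w x - _), mul_zero,
      fluxAngle_apply, hx, hx, ContinuousMap.comp_apply, h3]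
    constructor <;> intro h
    · linear_combination h - a (r x) * g (r x) * (normalDir (φ x) 0 * pd 0 r x +
        normalDir (φ x) 1 * pd 1 r x) * h2
    · linear_combination h + a (r x) * g (r x) * (normalDir (φ x) 0 * pd 0 r x +
        normalDir (φ x) 1 * pd 1 r x) * h2
  constructor <;> intro h <;>
    filter_upwards [h, S.ae_pd_comp hm hr] with x h1 h2
  · exact (key x h2).1 h1
  · exact (key x h2).2 h1

end SymVars

/-- A solution of the symmetrized system; `v` and `w` are the time derivatives. -/
structure ReducedSolution (c μ m T : ℝ) (a b : C(ℝ, ℝ)) (r φ v w : ℝ → C(Torus, ℝ)) : Prop where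
  density : IntDeriv T r v
  angle : IntDeriv T φ w
  bounded : ∃ R : ℝ, ∀ᵐ t ∂(volume.restrict (Ioo 0 T)),
    sobE m (r t) ≤ ENNReal.ofReal R ∧ sobE m (φ t) ≤ ENNReal.ofReal R
  eq_density : ∀ᵐ t ∂(volume.restrict (Ioo 0 T)), v t = fluxDensity a (r t) (φ t)
  eq_angle : ∀ᵐ t ∂(volume.restrict (Ioo 0 T)), ∀ q, HasWeakLaplacian (φ t) q →
    ∀ᵐ x ∂torusMeasure, w t x = fluxAngle c μ a b (r t) (φ t) x + μ * q x

theorem MemBochner.ae_sobE_le {s T : ℝ} {u : ℝ → Torus → ℝ} (h : MemBochner ⊤ s T u) :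
    ∃ R : ℝ, ∀ᵐ t ∂(volume.restrict (Ioo 0 T)), sobE s (u t) ≤ ENNReal.ofReal R := by
  obtain ⟨U, hU, hU'⟩ := h
  have hfin : eLpNorm U ⊤ (volume.restrict (Ioo 0 T)) ^ 2 ≠ ⊤ := ENNReal.pow_ne_top hU.2.ne
  refine ⟨(eLpNorm U ⊤ (volume.restrict (Ioo 0 T)) ^ 2).toReal, ?_⟩
  rw [ENNReal.ofReal_toReal hfin, eLpNorm_exponent_top]
  filter_upwards [hU', ae_le_eLpNormEssSup (f := U)] with t h1 h2
  rw [h1.sobE_eq]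
  exact pow_le_pow_left' h2 2

theorem IntDeriv.congr_left {E : Type*} [NormedAddCommGroup E] [NormedSpace ℝ E] {T : ℝ}
    (hT : 0 ≤ T) {u u' v : ℝ → E} (h : IntDeriv T u v) (hu : ∀ t ∈ Icc 0 T, u t = u' t) :
    IntDeriv T u' v :=
  ⟨h.1, fun t ht => by rw [← hu t ht, ← hu 0 ⟨le_rfl, hT⟩]; exact h.2 t ht⟩

/-- The weak time derivatives of `ρ` and `φ` lie in `H^{m-1}` and are genuine primitives, so the
chain rule in time applies to `G(ρ)` and to `Ω`. Uniqueness of weak derivatives then identifies the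
`∂ₜρ` and `∂ₜΩ` occurring in the equations. -/
theorem IsSolution.exists_reducedSolution {c μ m T : ℝ} (hT : 0 < T) (hm : 2 < m) {p : ℝ → ℝ}
    (hp : ContDiffOn ℝ ∞ p (Ioi 0)) {δ M : ℝ} (hδ : 0 < δ) {a b g G : C(ℝ, ℝ)}
    (S : SymVars p δ M a b g G) {ρ₀ φ₀ : C(Torus, ℝ)} {ρ φ : ℝ → C(Torus, ℝ)}
    (h : IsSolution c μ p ρ₀ φ₀ T ρ φ) (hρ : InClass m T ρ) (hφ : InClass m T φ)
    (hrange : ∀ t ∈ Icc 0 T, ∀ x, ρ t x ∈ Icc δ M) :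
    ∃ v w, ReducedSolution c μ m T a b (fun t => G.comp (ρ t)) φ v w := by
  obtain ⟨vρ, hvρ⟩ := hρ.2
  obtain ⟨vφ, hvφ⟩ := hφ.2
  obtain ⟨w₁, hw₁⟩ := hvρ.exists_intDeriv hT (by linarith) h.continuousOn_density
  obtain ⟨w, hw⟩ := hvφ.exists_intDeriv hT (by linarith) h.continuousOn_angle
  obtain ⟨R₁, hR₁⟩ := hρ.1.ae_sobE_le
  obtain ⟨R₂, hR₂⟩ := hφ.1.ae_sobE_le
  obtain ⟨ρt, Ωt, hρt, hΩt, heq⟩ := h.equations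
  have hG1 : ContDiff ℝ 1 G := contDiff_infty.1 S.smooth_G 1
  have hr := hw₁.comp_map hT.le (F := G) (F' := ⟨deriv G, hG1.continuous_deriv le_rfl⟩)
    fun x => (hG1.differentiable one_ne_zero x).hasDerivAt
  set v : ℝ → C(Torus, ℝ) := fun t =>
    ContinuousMap.comp ⟨deriv G, hG1.continuous_deriv le_rfl⟩ (ρ t) * w₁ t
  have hgr : ∀ t ∈ Icc 0 T, g.comp (G.comp (ρ t)) = ρ t := fun t ht => by
    ext x; exact S.g_G _ (hrange t ht x)
  -- Differentiating `ρ = g(G(ρ))` yields `∂ₜρ` in the form `b g v` that `SymVars.massEquation_iff`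
  -- expects.
  have hρd := (hr.comp_map hT.le (F := g) (F' := b * g) S.hasDerivAt_g).congr_left hT.le hgr
  have hρae := hρt.ae_eq hT le_rfl hρd
  have hdir := fun j => hw.comp_map hT.le (F := directionMap j) (F' := normalMap j)
    (hasDerivAt_direction j)
  have hΩae := ae_all_iff.2 fun j => (hΩt j).ae_eq hT le_rfl (hdir j)
  obtain ⟨C, hC, hCle⟩ := exists_sobE_comp_le S.smooth_G hm (ENNReal.ofReal_ne_top (r := R₁))
  have hbdr : ∀ᵐ t ∂(volume.restrict (Ioo 0 T)), sobE m (G.comp (ρ t)) ≠ ⊤ :=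
    hR₁.mono fun t ht => ((hCle _ ht).trans_lt hC.lt_top).ne
  have hbdφ : ∀ᵐ t ∂(volume.restrict (Ioo 0 T)), sobE m (φ t) ≠ ⊤ :=
    hR₂.mono fun t ht => (ht.trans_lt ENNReal.ofReal_lt_top).ne
  refine ⟨v, w, hr, hw, ⟨max C.toReal R₂, ?_⟩, ?_, ?_⟩
  · filter_upwards [hR₁, hR₂] with t h1 h2
    refine ⟨(hCle _ h1).trans ?_, h2.trans (ENNReal.ofReal_le_ofReal (le_max_right _ _))⟩
    rw [← ENNReal.ofReal_toReal hC]
    exact ENNReal.ofReal_le_ofReal (by simp)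
  · filter_upwards [heq, hρae, hbdr, hbdφ, ae_restrict_mem measurableSet_Ioo] with t h1 h2 h3 h4 ht
    rw [← S.massEquation_iff hm h3 h4, hgr t (Ioo_subset_Icc_self ht)]
    obtain ⟨D, hD, hx⟩ := h1.1
    refine ⟨D, hD, ?_⟩
    filter_upwards [hx, h2] with x e1 e2
    rw [← e1, ← e2]; rfl
  · filter_upwards [heq, hΩae, hbdr, hbdφ, ae_restrict_mem measurableSet_Ioo] with t h1 h2 h3 h4 ht
      q hq
    have ht' := Ioo_subset_Icc_self ht
    refine (S.momentumEquation_iff hm h3 h4 hp hδ (fun x => ?_) hq (w := fun x => w t x)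
      (Ωt := fun j => Ωt j t) fun j => ?_).1 ?_
    · rw [ContinuousMap.comp_apply, S.g_G _ (hrange t ht' x)]; exact hrange t ht' x
    · exact (h2 j).symm
    · rw [hgr t ht']; exact h1.2

end SelfPropelled
end

noncomputable section
namespace SelfPropelled
open Filter Topology

/-! ### Existence of symmetrizing variables -/

open scoped ComplexConjugate

/-- A smooth function bounded below by a positive constant is the derivative of a diffeomorphism
of the line. -/
theorem exists_diffeomorph_of_deriv {h : ℝ → ℝ} (hh : ContDiff ℝ ∞ h) {ε : ℝ} (hε : 0 < ε)
    (hle : ∀ y, ε ≤ h y) : ∃ Ψ Y : ℝ → ℝ, ContDiff ℝ ∞ Ψ ∧ ContDiff ℝ ∞ Y ∧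
      (∀ y, Ψ (Y y) = y) ∧ (∀ y, Y (Ψ y) = y) ∧ ∀ y, HasDerivAt Y (h (Y y))⁻¹ y := by
  let Ψ : ℝ → ℝ := fun y => ∫ s in 0..y, h s
  have hΨ : ∀ y, HasDerivAt Ψ (h y) y := fun y =>
    (hh.continuous.integral_hasStrictDerivAt 0 y).hasDerivAt
  have hΨs : ContDiff ℝ ∞ Ψ := contDiff_infty_iff_deriv.2
    ⟨fun y => (hΨ y).differentiableAt, by rw [funext fun y => (hΨ y).deriv]; exact hh⟩
  have hmono : StrictMono Ψ := strictMono_of_deriv_pos fun y => by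
    rw [(hΨ y).deriv]; exact hε.trans_le (hle y)
  -- The primitive grows at least linearly in both directions, which gives surjectivity.
  have hlin : Monotone fun y => Ψ y - ε * y := by
    refine monotone_of_deriv_nonneg ?_ fun y => ?_
    · exact fun y => ((hΨ y).sub ((hasDerivAt_id y).const_mul ε)).differentiableAt
    · have : HasDerivAt (fun y => Ψ y - ε * y) (h y - ε * 1) y :=
        (hΨ y).sub ((hasDerivAt_id y).const_mul ε)
      rw [this.deriv]; linarith [hle y]
  have hΨ0 : Ψ 0 = 0 := by simp [Ψ]
  have htop : Tendsto Ψ atTop atTop := by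
    refine tendsto_atTop_mono' _ ?_ (tendsto_id.const_mul_atTop hε)
    filter_upwards [eventually_ge_atTop (0 : ℝ)] with y hy
    have := hlin hy
    simp only [hΨ0, mul_zero, sub_zero] at this
    simp only [id]; linarith
  have hbot : Tendsto Ψ atBot atBot := by
    refine tendsto_atBot_mono' _ ?_ (tendsto_id.const_mul_atBot hε)
    filter_upwards [eventually_le_atBot (0 : ℝ)] with y hy
    have := hlin hy
    simp only [hΨ0, mul_zero, sub_zero] at this
    simp only [id]; linarith
  let e := hmono.orderIsoOfSurjective Ψ (hΨs.continuous.surjective htop hbot)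
  have h1 : ∀ y, Ψ (e.symm y) = y := fun y => e.apply_symm_apply y
  have hd : ∀ y, HasDerivAt e.symm (h (e.symm y))⁻¹ y := fun y =>
    HasDerivAt.of_local_left_inverse e.symm.continuous.continuousAt (hΨ _)
      (hε.trans_le (hle _)).ne' (Eventually.of_forall h1)
  refine ⟨Ψ, e.symm, hΨs, ?_, h1, fun y => e.symm_apply_apply y, hd⟩
  -- Bootstrap on the equation `Y' = 1 / h(Y)`: regularity of order `n` for `Y` gives order `n + 1`.
  rw [contDiff_infty]
  intro n
  induction n with
  | zero => exact contDiff_zero.2 e.symm.continuous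
  | succ n ih =>
    rw [Nat.cast_succ, contDiff_succ_iff_deriv]
    refine ⟨fun y => (hd y).differentiableAt, fun h => by simp at h, ?_⟩
    rw [funext fun y => (hd y).deriv]
    exact ((contDiff_infty.1 hh n).comp ih).inv fun y => (hε.trans_le (hle _)).ne'

/-- In the variable `y = log ρ` the condition on `r` reads `dr/dy = √p'(e^y)`. This derivative is
modified far from the relevant values to equal `1`, so that it is bounded below and `r` runs through
the whole line. Then `g = exp ∘ Y` with `Y` the inverse of `y ↦ r`, and `a`, `b` are this derivative
and its reciprocal, taken as functions of `r`. -/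
theorem exists_symVars {p : ℝ → ℝ} (hp : ContDiffOn ℝ ∞ p (Ioi 0))
    (hp' : ∀ r : ℝ, 0 < r → 0 < deriv p r) {δ : ℝ} (hδ : 0 < δ) (M : ℝ) :
    ∃ a b g G : C(ℝ, ℝ), SymVars p δ M a b g G := by
  let q : ℝ → ℝ := fun y => deriv p (Real.exp y)
  have hq : ContDiff ℝ ∞ q := by
    have h1 : ContDiffOn ℝ ∞ (deriv p) (Ioi 0) := hp.deriv_of_isOpen isOpen_Ioi (by simp)
    exact contDiffOn_univ.1 (h1.comp Real.contDiff_exp.contDiffOn fun y _ => Real.exp_pos y)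
  have hq0 : ∀ y, 0 < q y := fun y => hp' _ (Real.exp_pos y)
  -- `K` exceeds `|log ρ|` for every `ρ ∈ [δ, M]`, so the modification does not touch these
  -- densities.
  set K := |Real.log δ| + |Real.log M| + 1 with hK
  let χ : ContDiffBump (0 : ℝ) := ⟨K, K + 1, by positivity, by linarith⟩
  have hχ : ContDiff ℝ ∞ χ := χ.contDiff
  let D : ℝ → ℝ := fun y => q y * χ y + (1 - χ y)
  have hD : ContDiff ℝ ∞ D := (hq.mul hχ).add (contDiff_const.sub hχ)
  have hD0 : ∀ y, 0 < D y := fun y => by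
    have h1 := χ.nonneg (x := y)
    have h2 := χ.le_one (x := y)
    rcases h1.eq_or_lt with h3 | h3
    · simp [D, ← h3]
    · exact add_pos_of_pos_of_nonneg (mul_pos (hq0 y) h3) (by linarith)
  obtain ⟨ε, hε, hεle⟩ : ∃ ε, 0 < ε ∧ ∀ y, ε ≤ D y := by
    obtain ⟨y₀, -, hy₀⟩ := (isCompact_closedBall (0 : ℝ) (K + 1)).exists_isMinOn
      ⟨0, Metric.mem_closedBall_self (by positivity)⟩ hD.continuous.continuousOn
    refine ⟨min (D y₀) 1, lt_min (hD0 _) one_pos, fun y => ?_⟩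
    by_cases hy : y ∈ Metric.closedBall (0 : ℝ) (K + 1)
    · exact (min_le_left _ _).trans (hy₀ hy)
    · rw [Metric.mem_closedBall, not_le] at hy
      have : χ y = 0 := χ.zero_of_le_dist hy.le
      simp [D, this]
  let h : ℝ → ℝ := fun y => √(D y)
  have hh : ContDiff ℝ ∞ h := hD.sqrt fun y => (hD0 y).ne'
  obtain ⟨Ψ, Y, hΨ, hY, hΨY, hYΨ, hYd⟩ := exists_diffeomorph_of_deriv hh (Real.sqrt_pos.2 hε)
    fun y => Real.sqrt_le_sqrt (hεle y)
  have hh0 : ∀ y, h y ≠ 0 := fun y => (Real.sqrt_pos.2 (hD0 y)).ne'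
  have ha : ContDiff ℝ ∞ fun y => h (Y y) := hh.comp hY
  have hb : ContDiff ℝ ∞ fun y => (h (Y y))⁻¹ := ha.inv fun y => hh0 _
  have hg : ContDiff ℝ ∞ fun y => Real.exp (Y y) := Real.contDiff_exp.comp hY
  have hΨlog : ContDiffOn ℝ ∞ (fun x => Ψ (Real.log x)) (Ioi 0) :=
    hΨ.comp_contDiffOn (Real.contDiffOn_log.mono fun x hx => ne_of_gt hx)
  obtain ⟨G, hG, hGeq⟩ := exists_contDiff_eqOn hΨlog (half_pos hδ)
  refine ⟨⟨_, ha.continuous⟩, ⟨_, hb.continuous⟩, ⟨_, hg.continuous⟩, ⟨G, hG.continuous⟩, ha, hb,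
    hg, hG, fun y => Real.exp_pos _, fun y => ?_, fun y => mul_inv_cancel₀ (hh0 _), fun ρ hρ => ?_,
    fun y hy => ?_⟩
  · have := (Real.hasDerivAt_exp (Y y)).comp y (hYd y)
    rw [mul_comm] at this
    exact this
  · change Real.exp (Y (G ρ)) = ρ
    have h0 : 0 < ρ := hδ.trans_le hρ.1
    rw [hGeq ρ ((half_lt_self hδ).trans_le hρ.1), hYΨ, Real.exp_log h0]
  · change deriv p (Real.exp (Y y)) = √(D (Y y)) ^ 2
    rw [Real.sq_sqrt (hD0 _).le]
    have hy1 : δ ≤ Real.exp (Y y) := hy.1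
    have hy2 : Real.exp (Y y) ≤ M := hy.2
    have hM : 0 < M := (Real.exp_pos _).trans_le hy2
    have h1 : Real.log δ ≤ Y y := (Real.log_le_iff_le_exp hδ).2 hy1
    have h2 : Y y ≤ Real.log M := (Real.le_log_iff_exp_le hM).2 hy2
    have : χ (Y y) = 1 := by
      refine χ.one_of_mem_closedBall ?_
      rw [mem_closedBall_zero_iff, Real.norm_eq_abs, abs_le]
      change -K ≤ _ ∧ _ ≤ K
      have h3 := neg_abs_le (Real.log δ)
      have h4 := le_abs_self (Real.log M)
      have h5 := abs_nonneg (Real.log δ)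
      have h6 := abs_nonneg (Real.log M)
      constructor <;> linarith
    simp only [D, this, mul_one, sub_self, add_zero, q]

end SelfPropelled
end

noncomputable section
namespace SelfPropelled
open Filter Topology

/-! ### Existence -/

open scoped ComplexConjugate

/-- The Laplacian of `f`, as a continuous function. -/
def lap (f : C(Torus, ℝ)) : C(Torus, ℝ) := synth fun k => -(laplaceSymbol k : ℂ) * fourierCoeff f k

theorem norm_laplaceSymbol_mul_le (k : Freq) (z : ℂ) :
    ‖-(laplaceSymbol k : ℂ) * z‖ ≤ wt 2 k * ‖z‖ := by
  rw [norm_mul, norm_neg, Complex.norm_real, Real.norm_of_nonneg (laplaceSymbol_nonneg k), wt_two]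
  exact mul_le_mul_of_nonneg_right (by linarith) (norm_nonneg z)

theorem fourierCoeff_lap {f : C(Torus, ℝ)} (h : wsum 2 f ≠ ⊤) (k : Freq) :
    fourierCoeff (lap f) k = -(laplaceSymbol k : ℂ) * fourierCoeff f k := by
  refine fourierCoeff_synth ?_ (fun k => ?_) k
  · exact (summable_norm_of_wsum h).of_nonneg_of_le (fun _ => norm_nonneg _)
      fun k => norm_laplaceSymbol_mul_le k _
  · rw [laplaceSymbol_neg, fourierCoeff_neg_index, map_mul, map_neg, Complex.conj_ofReal]

theorem sobE_lap_le {m : ℝ} (hm : 2 < m) (f : C(Torus, ℝ)) :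
    sobE (m - 1) (lap f) ≤ sobE (m + 1) f := by
  by_cases hf : sobE (m + 1) f = ⊤
  · rw [hf]; exact le_top
  · have h := wsum_ne_top (s := 2) (t := m + 1) (by linarith) hf
    refine ENNReal.tsum_le_tsum fun k => pow_le_pow_left' ?_ 2
    rw [fourierCoeff_lap h, show m + 1 = (m - 1) + 2 by ring, ew_add, mul_assoc]
    gcongr
    rw [← ofReal_norm, ← ofReal_norm]
    refine (ENNReal.ofReal_le_ofReal (norm_laplaceSymbol_mul_le k _)).trans_eq ?_
    rw [ENNReal.ofReal_mul (wt_pos _ _).le]; rfl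

theorem ReducedSolution.mono {c μ m T T' : ℝ} {a b : C(ℝ, ℝ)} {r φ v w : ℝ → C(Torus, ℝ)}
    (h : ReducedSolution c μ m T a b r φ v w) (h0 : 0 ≤ T') (hT : T' ≤ T) :
    ReducedSolution c μ m T' a b r φ v w := by
  have hsub : Ioo 0 T' ⊆ Ioo 0 T := Ioo_subset_Ioo_right hT
  obtain ⟨R, hR⟩ := h.bounded
  exact ⟨h.density.mono h0 hT, h.angle.mono h0 hT,
    ⟨R, ae_restrict_of_ae_restrict_of_subset hsub hR⟩,
    ae_restrict_of_ae_restrict_of_subset hsub h.eq_density,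
    ae_restrict_of_ae_restrict_of_subset hsub h.eq_angle⟩

/-- `v ∈ L²(0,T; H^s)`, for `v` measurable. -/
def SobFinite (s T : ℝ) (v : ℝ → C(Torus, ℝ)) : Prop :=
  (∀ᵐ t ∂(volume.restrict (Ioo 0 T)), sobE s (v t) ≠ ⊤) ∧ ∫⁻ t in Ioo 0 T, sobE s (v t) < ⊤

theorem SobFinite.mono {s T T' : ℝ} {v : ℝ → C(Torus, ℝ)} (h : SobFinite s T v) (hT : T' ≤ T) :
    SobFinite s T' v := by
  have hsub : Ioo 0 T' ⊆ Ioo 0 T := Ioo_subset_Ioo_right hT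
  exact ⟨ae_restrict_of_ae_restrict_of_subset hsub h.1, (lintegral_mono_set hsub).trans_lt h.2⟩

theorem sobFinite_of_le {s T : ℝ} {v : ℝ → C(Torus, ℝ)} {C : ℝ≥0∞} (hC : C ≠ ⊤) {f : ℝ → ℝ≥0∞}
    (hf : ∀ᵐ t ∂(volume.restrict (Ioo 0 T)), f t ≠ ⊤) (hfi : ∫⁻ t in Ioo 0 T, f t < ⊤)
    (h : ∀ᵐ t ∂(volume.restrict (Ioo 0 T)), sobE s (v t) ≤ C * f t) : SobFinite s T v := by
  constructor
  · filter_upwards [hf, h] with t h1 h2 using (h2.trans_lt (ENNReal.mul_lt_top hC.lt_top h1.lt_top)).ne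
  · refine (lintegral_mono_ae h).trans_lt ?_
    rw [lintegral_const_mul' _ _ hC]
    exact ENNReal.mul_lt_top hC.lt_top hfi

theorem sobFinite_of_bounded {s T : ℝ} {v : ℝ → C(Torus, ℝ)} {C : ℝ≥0∞} (hC : C ≠ ⊤)
    (h : ∀ᵐ t ∂(volume.restrict (Ioo 0 T)), sobE s (v t) ≤ C) : SobFinite s T v :=
  sobFinite_of_le (f := fun _ => 1) hC (Eventually.of_forall fun _ => by simp)
    (by simp) (by simpa using h)

theorem IntDeriv.hasTimeDeriv_of_sobFinite {s T : ℝ} {u v : ℝ → C(Torus, ℝ)} (hT : 0 ≤ T)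
    (h : IntDeriv T u v) (hu : SobFinite s T u) (hv : SobFinite s T v) :
    HasTimeDeriv s T (fun t x => u t x) fun t x => v t x :=
  h.hasTimeDeriv hT hu.1 hv.1 hu.2 hv.2

theorem SobFinite.of_le {s s' T : ℝ} {v : ℝ → C(Torus, ℝ)} (h : SobFinite s T v) (hs : s' ≤ s) :
    SobFinite s' T v :=
  sobFinite_of_le (C := 1) (by simp) h.1 h.2
    (Eventually.of_forall fun t => by rw [one_mul]; exact sobE_mono hs _)

theorem SobFinite.comp_mul {m T R : ℝ} (hm : 2 < m) {F : C(ℝ, ℝ)} (hF : ContDiff ℝ ∞ F)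
    {u v : ℝ → C(Torus, ℝ)} (hu : ∀ t ∈ Icc 0 T, sobE m (u t) ≤ ENNReal.ofReal R)
    (hv : SobFinite (m - 1) T v) : SobFinite (m - 1) T fun t => F.comp (u t) * v t := by
  obtain ⟨C, hC, hCle⟩ := exists_sobE_mul_le (s := m - 1) (by linarith)
  obtain ⟨B, hB, hBle⟩ := exists_sobE_comp_le hF hm (ENNReal.ofReal_ne_top (r := R))
  refine sobFinite_of_le (C := C * B) (by finiteness) hv.1 hv.2 ?_
  filter_upwards [ae_restrict_mem measurableSet_Ioo] with t ht
  refine (hCle (F.comp (u t)) (v t) (memLp_continuousMap _ 2) (memLp_continuousMap _ 2)).trans ?_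
  rw [mul_assoc]
  gcongr
  exact (sobE_mono (by linarith) _).trans (hBle _ (hu t (Ioo_subset_Icc_self ht)))

/-- The coefficient equations are reassembled into an integral equation in the space of continuous
functions. For `μ > 0` this relies on `φ ∈ L²(0,T;H^{m+1})`, which places `Δφ` in `L²(0,T;H^{m-1})`;
for `μ = 0` no Laplacian occurs. -/
theorem exists_reducedSolution (c : ℝ) {μ m : ℝ} (hμ : 0 ≤ μ) (hm : 2 < m) {a b : C(ℝ, ℝ)}
    (ha : ContDiff ℝ ∞ a) (hb : ContDiff ℝ ∞ b) {r₀ φ₀ : C(Torus, ℝ)} (hr₀ : sobE m r₀ ≠ ⊤)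
    (hφ₀ : sobE m φ₀ ≠ ⊤) :
    ∃ T R : ℝ, 0 < T ∧ ∃ r φ v w : ℝ → C(Torus, ℝ), ReducedSolution c μ m T a b r φ v w ∧
      r 0 = r₀ ∧ φ 0 = φ₀ ∧
      (∀ t ∈ Icc 0 T, sobE m (r t) ≤ ENNReal.ofReal R ∧ sobE m (φ t) ≤ ENNReal.ofReal R) ∧
      SobFinite (m - 1) T v ∧ SobFinite (m - 1) T w ∧ (0 < μ → SobFinite (m + 1) T φ) := by
  obtain ⟨T, R, hT, r, φ, hrc, hφc, hr0, hφ0, H, hreg⟩ :=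
    exists_coefficient_solution c hμ hm ha hb hr₀ hφ₀
  have hrR := fun t ht => (H t ht).1
  have hφR := fun t ht => (H t ht).2.1
  have hcoef := fun t ht => (H t ht).2.2
  obtain ⟨hfr, hfφ⟩ := continuousOn_flux hm c μ a b hrc hφc hrR hφR
  have hIoo : ∀ᵐ t ∂(volume.restrict (Ioo 0 T)), t ∈ Icc 0 T :=
    (ae_restrict_mem measurableSet_Ioo).mono fun t ht => Ioo_subset_Icc_self ht
  set v : ℝ → C(Torus, ℝ) := fun t => fluxDensity a (r t) (φ t) with hv
  set w : ℝ → C(Torus, ℝ) := fun t => fluxAngle c μ a b (r t) (φ t) + μ • lap (φ t) with hw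
  obtain ⟨C₁, hC₁, h₁⟩ := sobBounded_fluxDensity hm ha _ (ENNReal.ofReal_ne_top (r := R))
  obtain ⟨C₂, hC₂, h₂⟩ := sobBounded_fluxAngle c μ hm ha hb _ (ENNReal.ofReal_ne_top (r := R))
  -- measurability of `t ↦ sobE (m + 1) (φ t)`
  have hφm : AEMeasurable (fun t => sobE (m + 1) (φ t)) (volume.restrict (Ioo 0 T)) :=
    AEMeasurable.tsum fun k => ((((((continuousOn_fourierCoeff hφc k).mono
      Ioo_subset_Icc_self).aestronglyMeasurable measurableSet_Ioo).enorm).const_mul _).pow_const 2)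
  have hreg' : 0 < μ → SobFinite (m + 1) T φ := fun h =>
    ⟨(ae_lt_top' hφm (hreg h).ne).mono fun t ht => ht.ne, hreg h⟩
  have hvS : SobFinite (m - 1) T v := sobFinite_of_bounded hC₁
    (hIoo.mono fun t ht => h₁ _ _ (hrR t ht) (hφR t ht))
  have hwS : SobFinite (m - 1) T w := by
    have hle : ∀ᵐ t ∂(volume.restrict (Ioo 0 T)), sobE (m - 1) (w t) ≤
        2 * (C₂ + ‖μ‖ₑ ^ 2 * sobE (m + 1) (φ t)) := hIoo.mono fun t ht => by
      have h3 := sobE_add_le (m - 1) (integrable_continuousMap (fluxAngle c μ a b (r t) (φ t)))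
        (integrable_continuousMap (μ • lap (φ t)))
      refine h3.trans ?_
      rw [mul_add]
      gcongr
      · exact h₂ _ _ (hrR t ht) (hφR t ht)
      · refine (sobE_const_mul (m - 1) μ (lap (φ t))).trans_le ?_
        gcongr
        exact sobE_lap_le hm _
    refine sobFinite_of_le (by finiteness) ?_ ?_ hle
    · rcases hμ.eq_or_lt with h0 | h0
      · simp [← h0, hC₂]
      · filter_upwards [(hreg' h0).1] with t ht
        finiteness
    · rw [lintegral_add_left measurable_const, lintegral_const_mul' _ _ (by finiteness)]
      refine ENNReal.add_lt_top.2 ⟨by simp [lt_top_iff_ne_top, ENNReal.mul_eq_top, hC₂], ?_⟩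
      rcases hμ.eq_or_lt with h0 | h0
      · simp [← h0]
      · exact ENNReal.mul_lt_top (by finiteness) (hreg h0)
  have hwc : ∀ᵐ t ∂(volume.restrict (Ioo 0 T)), ∀ k, fourierCoeff (w t) k =
      fourierCoeff (fluxAngle c μ a b (r t) (φ t)) k
        + μ * (-(laplaceSymbol k : ℂ) * fourierCoeff (φ t) k) := by
    -- When `μ = 0` the coefficients defining `lap (φ t)` need not be summable and `lap` may take a
    -- default value; the factor `μ` removes it.
    rcases hμ.eq_or_lt with h0 | h0
    · refine Eventually.of_forall fun t k => ?_
      simp only [hw, fourierCoeff_add_smul, ← h0, Complex.ofReal_zero, zero_mul]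
    · filter_upwards [(hreg' h0).1] with t ht k
      simp only [hw, fourierCoeff_add_smul]
      rw [fourierCoeff_lap (wsum_ne_top (t := m + 1) (by linarith) ht)]
  have hwm : AEStronglyMeasurable w (volume.restrict (Ioo 0 T)) := by
    refine aestronglyMeasurable_of_coeff (fun k => ?_) (hwS.1.mono fun t ht =>
      wsum_ne_top (by linarith) ht)
    refine AEStronglyMeasurable.congr (f := fun t => fourierCoeff (fluxAngle c μ a b (r t) (φ t)) k
        + μ * (-(laplaceSymbol k : ℂ) * fourierCoeff (φ t) k)) ?_
      (hwc.mono fun t ht => (ht k).symm)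
    exact (((continuousOn_fourierCoeff hfφ k).add (continuousOn_const.mul (continuousOn_const.mul
      (continuousOn_fourierCoeff hφc k)))).mono Ioo_subset_Icc_self).aestronglyMeasurable
        measurableSet_Ioo
  obtain ⟨C, hC, hCle⟩ := exists_wsum_sq_le (s := 0) (t := m - 1) (by linarith)
  have hwi : IntervalIntegrable w volume 0 T := by
    refine (intervalIntegrable_iff_integrableOn_Ioo_of_le hT.le).2
      ((memLp_two_of_lintegral hwm ?_).integrable one_le_two)
    have : ∫⁻ t in Ioo 0 T, ‖w t‖ₑ ^ 2 ≤ ∫⁻ t in Ioo 0 T, C * sobE (m - 1) (w t) :=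
      lintegral_mono fun t => (pow_le_pow_left' (enorm_le_wsum (w t)) 2).trans (hCle _)
    refine this.trans_lt ?_
    rw [lintegral_const_mul' _ _ hC]
    exact ENNReal.mul_lt_top hC.lt_top hwS.2
  have hvi : IntervalIntegrable v volume 0 T :=
    ContinuousOn.intervalIntegrable (by rwa [uIcc_of_le hT.le])
  -- Taking a coefficient commutes with the time integral, and a continuous function is determined
  -- by its coefficients.
  have hprim : ∀ {u u' : ℝ → C(Torus, ℝ)} {u₀ : C(Torus, ℝ)} {q : Freq → ℝ → ℂ},
      IntervalIntegrable u' volume 0 T → u 0 = u₀ →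
      (∀ t ∈ Icc 0 T, ∀ k, fourierCoeff (u t) k = fourierCoeff u₀ k + ∫ s in 0..t, q k s) →
      (∀ᵐ t ∂(volume.restrict (Ioo 0 T)), ∀ k, fourierCoeff (u' t) k = q k t) →
      IntDeriv T u u' := by
    intro u u' u₀ q hi h0 hq hae
    refine ⟨hi, fun t ht => eq_of_fourierCoeff_eq fun k => ?_⟩
    have hi' : IntervalIntegrable u' volume 0 t :=
      hi.mono_set (uIcc_subset_uIcc_left (by rw [uIcc_of_le hT.le]; exact ht))
    have h2 := (coeffCLM k).map_add (u 0) (∫ s in 0..t, u' s)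
    simp only [coeffCLM_apply] at h2
    rw [h2, hq t ht k, h0, coeffCLM_integral hi']
    congr 1
    refine (intervalIntegral.integral_congr_ae_restrict ?_).symm
    rw [uIoc_of_le ht.1, ← restrict_Ioo_eq_restrict_Ioc]
    filter_upwards [ae_restrict_of_ae_restrict_of_subset (Ioo_subset_Ioo_right ht.2) hae] with s hs
    exact hs k
  refine ⟨T, R, hT, r, φ, v, w, ⟨?_, ?_, ⟨R, hIoo.mono fun t ht => ⟨hrR t ht, hφR t ht⟩⟩,
    Eventually.of_forall fun t => rfl, ?_⟩, hr0, hφ0, fun t ht => ⟨hrR t ht, hφR t ht⟩,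
    hvS, hwS, hreg'⟩
  · exact hprim hvi hr0 (fun t ht k => (hcoef t ht k).1) (Eventually.of_forall fun t k => rfl)
  · exact hprim hwi hφ0 (fun t ht k => (hcoef t ht k).2) hwc
  · filter_upwards [hwc] with t ht q hq
    refine ae_eq_of_fourierCoeff_eq (integrable_continuousMap _)
      ((integrable_continuousMap _).add (hq.2.1.const_mul μ)) fun k => ?_
    rw [fourierCoeff_add (integrable_continuousMap _) (hq.2.1.const_mul μ), fourierCoeff_const_mul,
      hq.2.2, ht k]

/-- Solutions of the symmetrized system give solutions of the original one. -/
theorem ReducedSolution.isSolution {c μ m T R : ℝ} (hT : 0 < T) (hm : 2 < m) {p : ℝ → ℝ}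
    (hp : ContDiffOn ℝ ∞ p (Ioi 0)) {δ M : ℝ} (hδ : 0 < δ) {a b g G : C(ℝ, ℝ)}
    (S : SymVars p δ M a b g G) {r φ v w : ℝ → C(Torus, ℝ)}
    (h : ReducedSolution c μ m T a b r φ v w)
    (hrR : ∀ t ∈ Icc 0 T, sobE m (r t) ≤ ENNReal.ofReal R)
    (hφR : ∀ t ∈ Icc 0 T, sobE m (φ t) ≤ ENNReal.ofReal R)
    (hv : SobFinite (m - 1) T v) (hw : SobFinite (m - 1) T w)
    (hrange : ∀ t ∈ Icc 0 T, ∀ x, g (r t x) ∈ Icc δ M) :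
    IsSolution c μ p (g.comp (r 0)) (φ 0) T (fun t => g.comp (r t)) φ ∧
      InClass m T (fun t => g.comp (r t)) ∧ InClass m T φ := by
  have hρ := h.density.comp_map hT.le (F := g) (F' := b * g) S.hasDerivAt_g
  have hρv := hv.comp_mul hm (F := b * g) (S.smooth_b.mul S.smooth_g) hrR
  obtain ⟨B, hB, hBle⟩ := exists_sobE_comp_le S.smooth_g hm (ENNReal.ofReal_ne_top (r := R))
  have hρB : ∀ t ∈ Icc 0 T, sobE m (g.comp (r t)) ≤ ENNReal.ofReal B.toReal := fun t ht => by
    rw [ENNReal.ofReal_toReal hB]; exact hBle _ (hrR t ht)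
  have hIoo : ∀ᵐ t ∂(volume.restrict (Ioo 0 T)), t ∈ Icc 0 T :=
    (ae_restrict_mem measurableSet_Ioo).mono fun t ht => Ioo_subset_Icc_self ht
  have hbd : ∀ {u : ℝ → C(Torus, ℝ)} {R : ℝ}, (∀ t ∈ Icc 0 T, sobE m (u t) ≤ ENNReal.ofReal R) →
      SobFinite (m - 1) T u := fun hu => SobFinite.of_le
    (sobFinite_of_bounded ENNReal.ofReal_ne_top (hIoo.mono hu)) (by linarith)
  have hdir := fun j => h.angle.comp_map hT.le (F := directionMap j) (F' := normalMap j)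
    (hasDerivAt_direction j)
  have hdirB : ∀ j, SobFinite (m - 1) T fun t => (directionMap j).comp (φ t) := fun j => by
    obtain ⟨B, hB, hBle⟩ := exists_sobE_comp_le (contDiff_direction j) hm
      (ENNReal.ofReal_ne_top (r := R))
    exact SobFinite.of_le (sobFinite_of_bounded hB (hIoo.mono fun t ht => hBle _ (hφR t ht)))
      (by linarith)
  have hm1 : (0 : ℝ) ≤ m - 1 := by linarith
  refine ⟨⟨hρ.continuousOn hT.le, h.angle.continuousOn hT.le, rfl, rfl, fun t _ x => S.g_pos _,
    fun t x => ((b * g).comp (r t) * v t) x, fun j t x => ((normalMap j).comp (φ t) * w t) x,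
    hρ.hasTimeDeriv_of_sobFinite hT.le ((hbd hρB).of_le hm1) (hρv.of_le hm1), fun j =>
    (hdir j).hasTimeDeriv_of_sobFinite hT.le ((hdirB j).of_le hm1)
      ((hw.comp_mul hm (F := normalMap j) (contDiff_normalDir j) hφR).of_le hm1), ?_⟩,
    ⟨memBochner_top (hρ.continuousOn hT.le) hρB, _,
      hρ.hasTimeDeriv_of_sobFinite hT.le (hbd hρB) hρv⟩,
    ⟨memBochner_top (h.angle.continuousOn hT.le) hφR, _,
      h.angle.hasTimeDeriv_of_sobFinite hT.le (hbd hφR) hw⟩⟩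
  filter_upwards [hIoo, h.eq_density, h.eq_angle] with t ht h1 h2
  have hr' := ((hrR t ht).trans_lt ENNReal.ofReal_lt_top).ne
  have hφ' := ((hφR t ht).trans_lt ENNReal.ofReal_lt_top).ne
  obtain ⟨q, hq⟩ := exists_hasWeakLaplacian hm hφ'
  exact ⟨(S.massEquation_iff hm hr' hφ').2 h1, (S.momentumEquation_iff hm hr' hφ' hp hδ (hrange t ht)
    hq (w := fun x => w t x) fun j => Eventually.of_forall fun x => rfl).2 (h2 q hq)⟩

end SelfPropelled
end

noncomputable section
namespace SelfPropelled
open Filter Topology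

/-! ### The energy estimate for differences of solutions -/

open scoped ComplexConjugate

theorem mul_mul_le_of_abs_le {N x d e : ℝ} (h : |x| ≤ N) :
    x * (d * e) ≤ N * ((d ^ 2 + e ^ 2) / 2) := by
  have h1 : |d * e| ≤ (d ^ 2 + e ^ 2) / 2 := by
    rw [abs_le]; constructor <;> nlinarith [sq_nonneg (d + e), sq_nonneg (d - e)]
  calc x * (d * e) ≤ |x| * |d * e| := by rw [← abs_mul]; exact le_abs_self _
    _ ≤ _ := mul_le_mul h h1 (abs_nonneg _) ((abs_nonneg _).trans h)

theorem two_mul_mul_sub_le {N g e E : ℝ} (h : |g| ≤ N) :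
    2 * g * e * E - E ^ 2 / 2 ≤ 2 * N ^ 2 * e ^ 2 := by
  have h1 : g ^ 2 ≤ N ^ 2 := by rw [← sq_abs g]; exact pow_le_pow_left₀ (abs_nonneg _) h 2
  have h2 := mul_le_mul_of_nonneg_right h1 (sq_nonneg e)
  nlinarith [sq_nonneg (E - 2 * g * e)]

theorem mul_le_of_abs_le_add {N x d e : ℝ} (h : |x| ≤ N * (|d| + |e|)) :
    d * x ≤ N * (|d| ^ 2 + |d| * |e|) := by
  calc d * x ≤ |d| * |x| := by rw [← abs_mul]; exact le_abs_self _
    _ ≤ |d| * (N * (|d| + |e|)) := mul_le_mul_of_nonneg_left h (abs_nonneg _)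
    _ = _ := by ring

/-- The pointwise form of the `L²` estimate: `d`, `e` are the differences of `r` and `φ`, `E` is the
gradient of `e`, `q` is `Δφ₂`, and `Rr`, `Rφ` collect differences of coefficients. No gradient of
`d` remains, and the terms linear in `E` are absorbed by `-|E|²`. -/
theorem remainder_le {c μ N K d e q b : ℝ} {A B g h k E : Fin 2 → ℝ} {Rr Rφ : ℝ} (hμ : 0 ≤ μ)
    (hN : 0 ≤ N) (hA : ∀ j, |A j| ≤ N) (hB : ∀ j, |B j| ≤ N) (hg : ∀ j, |g j| ≤ N)
    (hh : ∀ j, |h j| ≤ N) (hk : ∀ j, |k j| ≤ N) (hb : |b| ≤ N) (hq : μ * |q| ≤ K)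
    (hRr : |Rr| ≤ N * (|d| + |e|)) (hRφ : |Rφ| ≤ N * (|e| + |d|)) :
    (A 0 + A 1) / 2 * d ^ 2 + c / 2 * (A 0 + A 1) * e ^ 2 + (B 0 + B 1) * d * e + d * Rr + e * Rφ
      + μ * (2 * (g 0 * E 0 + g 1 * E 1) * e - 2 * (k 0 + k 1) * e * d
        - 2 * d * (h 0 * E 0 + h 1 * E 1) - E 0 ^ 2 - E 1 ^ 2) - 2 * b * e * d * (μ * q) ≤
      (N * (4 + |c|) + μ * (4 * N ^ 2 + 2 * N) + N * K) * (d ^ 2 + e ^ 2) := by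
  have hd := sq_nonneg d
  have he := sq_nonneg e
  have h1 : (A 0 + A 1) / 2 * d ^ 2 ≤ N * d ^ 2 :=
    mul_le_mul_of_nonneg_right (by linarith [(abs_le.1 (hA 0)).2, (abs_le.1 (hA 1)).2]) hd
  have h2 : c / 2 * (A 0 + A 1) * e ^ 2 ≤ |c| * N * e ^ 2 := by
    refine mul_le_mul_of_nonneg_right ?_ he
    refine (le_abs_self _).trans ?_
    rw [abs_mul, abs_div, abs_two]
    have := (abs_add_le (A 0) (A 1)).trans (add_le_add (hA 0) (hA 1))
    calc |c| / 2 * |A 0 + A 1| ≤ |c| / 2 * (N + N) := by gcongr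
      _ = |c| * N := by ring
  have h3 := mul_mul_le_of_abs_le (d := d) (e := e) (hB 0)
  have h4 := mul_mul_le_of_abs_le (d := d) (e := e) (hB 1)
  have h5 := mul_le_of_abs_le_add hRr
  have h6 := mul_le_of_abs_le_add hRφ
  have h7 : |d| * |e| ≤ (d ^ 2 + e ^ 2) / 2 := by
    rw [← sq_abs d, ← sq_abs e]; nlinarith [sq_nonneg (|d| - |e|)]
  have h8 := mul_le_mul_of_nonneg_left h7 hN
  have h9 := two_mul_mul_sub_le (e := e) (E := E 0) (hg 0)
  have h10 := two_mul_mul_sub_le (e := e) (E := E 1) (hg 1)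
  have h11 := two_mul_mul_sub_le (e := d) (E := E 0) (N := N) (g := -h 0) (by rw [abs_neg]; exact hh 0)
  have h12 := two_mul_mul_sub_le (e := d) (E := E 1) (N := N) (g := -h 1) (by rw [abs_neg]; exact hh 1)
  have h13 := mul_mul_le_of_abs_le (d := d) (e := e) (N := N) (x := -k 0) (by rw [abs_neg]; exact hk 0)
  have h14 := mul_mul_le_of_abs_le (d := d) (e := e) (N := N) (x := -k 1) (by rw [abs_neg]; exact hk 1)
  have h15 : |-(b * (μ * q))| ≤ N * K := by
    rw [abs_neg, abs_mul, abs_mul, abs_of_nonneg hμ]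
    exact mul_le_mul hb hq (by positivity) hN
  have h16 := mul_mul_le_of_abs_le (d := d) (e := e) h15
  have h17 : 2 * (g 0 * E 0 + g 1 * E 1) * e - 2 * (k 0 + k 1) * e * d
        - 2 * d * (h 0 * E 0 + h 1 * E 1) - E 0 ^ 2 - E 1 ^ 2 ≤
      (4 * N ^ 2 + 2 * N) * (d ^ 2 + e ^ 2) := by linarith
  have h18 := mul_le_mul_of_nonneg_left h17 hμ
  rw [sq_abs] at h5 h6
  linarith [mul_nonneg (mul_nonneg (abs_nonneg c) hN) hd, mul_nonneg hN he]

theorem hasWeakPartial_mul_map {j : Fin 2} {f f' g g' : C(Torus, ℝ)} (hf : HasWeakPartial j f f')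
    (hg : HasWeakPartial j g g') :
    HasWeakPartial j (f * g : C(Torus, ℝ)) (f' * g + f * g' : C(Torus, ℝ)) :=
  hf.mul hg (memLp_continuousMap _ 2) (memLp_continuousMap _ 2) (memLp_continuousMap _ 2)
    (memLp_continuousMap _ 2)

theorem integrable_continuousMap_mul (f : C(Torus, ℝ)) {q : Torus → ℝ}
    (hq : Integrable q torusMeasure) : Integrable (fun x => f x * q x) torusMeasure :=
  hq.bdd_mul (c := ‖f‖) f.continuous.aestronglyMeasurable
    (Eventually.of_forall fun x => f.norm_coe_le_norm x)

/-- Green's formula. -/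
theorem integral_grad_mul_grad {m : ℝ} (hm : 2 < m) {f : C(Torus, ℝ)} (hf : sobE m f ≠ ⊤)
    {q : Torus → ℝ} (hq : HasWeakLaplacian f q) {ψ : C(Torus, ℝ)} {ψ' : Fin 2 → C(Torus, ℝ)}
    (hψ : ∀ j, HasWeakPartial j ψ (ψ' j)) :
    ∫ x, (ψ' 0 x * pd 0 f x + ψ' 1 x * pd 1 f x + ψ x * q x) ∂torusMeasure = 0 := by
  choose f₂ hf₂L hf₂ using exists_second_partial hm hf
  have h1 := (hasWeakLaplacian_of_partials (hasWeakPartial_pd_of_sobE hm hf) hf₂).ae_eq hq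
  have h2 := fun j => (hψ j).mul (hf₂ j) (memLp_continuousMap _ 2) (memLp_continuousMap _ 2)
    (memLp_continuousMap _ 2) (hf₂L j)
  have h3 : (fun x => ψ' 0 x * pd 0 f x + ψ' 1 x * pd 1 f x + ψ x * q x) =ᵐ[torusMeasure]
      fun x => (ψ' 0 x * pd 0 f x + ψ x * f₂ 0 x) + (ψ' 1 x * pd 1 f x + ψ x * f₂ 1 x) := by
    filter_upwards [h1] with x hx
    rw [← hx, Fin.sum_univ_two]; ring
  rw [integral_congr_ae h3, integral_add (h2 0).2.1 (h2 1).2.1, (h2 0).integral_eq_zero,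
    (h2 1).integral_eq_zero, add_zero]

theorem exists_comp_lipschitz {F : ℝ → ℝ} (hF : ContDiff ℝ ∞ F) (M : ℝ) : ∃ Q : ℝ, 0 ≤ Q ∧
    (∀ x, |x| ≤ M → |F x| ≤ Q ∧ |deriv F x| ≤ Q) ∧
    ∀ x y, |x| ≤ M → |y| ≤ M → |F x - F y| ≤ Q * |x - y| := by
  have hF1 : ContDiff ℝ 1 F := contDiff_infty.1 hF 1
  obtain ⟨Q₁, h₁⟩ := (isCompact_Icc (a := -M) (b := M)).exists_bound_of_continuousOn
    hF1.continuous.continuousOn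
  obtain ⟨Q₂, h₂⟩ := (isCompact_Icc (a := -M) (b := M)).exists_bound_of_continuousOn
    (hF1.continuous_deriv le_rfl).continuousOn
  have hQ : ∀ x ∈ Icc (-M) M, ‖deriv F x‖ ≤ max 0 (max Q₁ Q₂) := fun x hx =>
    (h₂ x hx).trans ((le_max_right _ _).trans (le_max_right _ _))
  refine ⟨max 0 (max Q₁ Q₂), le_max_left _ _, fun x hx => ⟨?_, hQ x (abs_le.1 hx)⟩,
    fun x y hx hy => ?_⟩
  · exact (h₁ x (abs_le.1 hx)).trans ((le_max_left _ _).trans (le_max_right _ _))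
  · exact (convex_Icc (-M) M).norm_image_sub_le_of_norm_deriv_le
      (fun z _ => hF1.differentiable one_ne_zero z) hQ (abs_le.1 hy) (abs_le.1 hx)

theorem abs_direction_le (θ : ℝ) (j : Fin 2) : |direction θ j| ≤ 1 := by
  fin_cases j
  · exact Real.abs_cos_le_one θ
  · exact Real.abs_sin_le_one θ

theorem abs_normalDir_le (θ : ℝ) (j : Fin 2) : |normalDir θ j| ≤ 1 := by
  fin_cases j
  · exact (abs_neg _).trans_le (Real.abs_sin_le_one θ)
  · exact Real.abs_cos_le_one θ

theorem abs_direction_sub_le (θ η : ℝ) (j : Fin 2) :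
    |direction θ j - direction η j| ≤ |θ - η| := by
  have := Convex.norm_image_sub_le_of_norm_hasDerivWithin_le (f := fun θ => direction θ j)
    (fun x _ => (hasDerivAt_direction j x).hasDerivWithinAt) (fun x _ => abs_normalDir_le x j)
    convex_univ (mem_univ η) (mem_univ θ)
  simpa using this

theorem abs_normalDir_sub_le (θ η : ℝ) (j : Fin 2) :
    |normalDir θ j - normalDir η j| ≤ |θ - η| := by
  have := Convex.norm_image_sub_le_of_norm_hasDerivWithin_le (f := fun θ => normalDir θ j)
    (fun x _ => (hasDerivAt_normalDir j x).hasDerivWithinAt)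
    (fun x _ => (abs_neg _).trans_le (abs_direction_le x j))
    convex_univ (mem_univ η) (mem_univ θ)
  simpa using this

/-- No bound on `∇(r₁ - r₂)` by the difference itself is available, so its occurrences are
integrated away. Transport terms are half of a total derivative, the two coupling terms combine by
symmetry, and `2μ b(r₁) e ∇d·∇φ₂` is integrated by parts against `∇φ₂`. The last operation creates
`μΔφ₂`, whence the dependence on `K`; it is kept linear because `K` will be only integrable in time.
-/
theorem exists_difference_estimate (c : ℝ) {μ m : ℝ} (hμ : 0 ≤ μ) (hm : 2 < m) {a b : C(ℝ, ℝ)}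
    (ha : ContDiff ℝ ∞ a) (hb : ContDiff ℝ ∞ b) (R : ℝ) : ∃ C : ℝ, 0 ≤ C ∧
      ∀ r₁ φ₁ r₂ φ₂ : C(Torus, ℝ), sobE m r₁ ≤ ENNReal.ofReal R → sobE m φ₁ ≤ ENNReal.ofReal R →
      sobE m r₂ ≤ ENNReal.ofReal R → sobE m φ₂ ≤ ENNReal.ofReal R → ∀ (q₁ q₂ : Torus → ℝ) (K : ℝ),
      HasWeakLaplacian φ₁ q₁ → HasWeakLaplacian φ₂ q₂ →
      (∀ᵐ x ∂torusMeasure, μ * |q₂ x| ≤ K) → ∀ w : C(Torus, ℝ),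
      (∀ᵐ x ∂torusMeasure, w x = fluxAngle c μ a b r₁ φ₁ x - fluxAngle c μ a b r₂ φ₂ x +
        μ * (q₁ x - q₂ x)) →
      ∫ x, ((r₁ - r₂) * (fluxDensity a r₁ φ₁ - fluxDensity a r₂ φ₂) + (φ₁ - φ₂) * w :
        C(Torus, ℝ)) x ∂torusMeasure ≤
      C * (1 + K) * ∫ x, ((r₁ - r₂) * (r₁ - r₂) + (φ₁ - φ₂) * (φ₁ - φ₂) : C(Torus, ℝ)) x
        ∂torusMeasure := by
  obtain ⟨M, hM, hMle⟩ := exists_norm_pd_le hm (ENNReal.ofReal_ne_top (r := R))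
  obtain ⟨Qa, hQa, ha1, ha2⟩ := exists_comp_lipschitz ha M
  obtain ⟨Qb, hQb, hb1, hb2⟩ := exists_comp_lipschitz hb M
  -- The sum of all the coefficient bounds needed below, so that each of them is dominated by `N`.
  set N : ℝ := M + 2 * Qa * M + Qb * M + Qb * M * M + Qb + 2 * (1 + 2 * Qa) * M +
    (2 * |c| * M + 4 * Qa * M + 4 * μ * Qb * M ^ 2) with hN
  have n1 : 0 ≤ Qa * M := by positivity
  have n2 : 0 ≤ Qb * M := by positivity
  have n3 : 0 ≤ Qb * M * M := by positivity
  have n4 : 0 ≤ |c| * M := by positivity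
  have n5 : 0 ≤ μ * Qb * M ^ 2 := by positivity
  have hN0 : 0 ≤ N := by positivity
  refine ⟨N * (4 + |c|) + μ * (4 * N ^ 2 + 2 * N) + N, by positivity, ?_⟩
  intro r₁ φ₁ r₂ φ₂ hr₁ hφ₁ hr₂ hφ₂ q₁ q₂ K hq₁ hq₂ hK w hw
  have hne : ∀ {f : C(Torus, ℝ)}, sobE m f ≤ ENNReal.ofReal R → sobE m f ≠ ⊤ := fun h =>
    (h.trans_lt ENNReal.ofReal_lt_top).ne
  have hval : ∀ {f : C(Torus, ℝ)}, sobE m f ≤ ENNReal.ofReal R → ∀ x, |f x| ≤ M := fun h x =>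
    ((ContinuousMap.norm_coe_le_norm _ x).trans (hMle _ h).1)
  have hpd : ∀ {f : C(Torus, ℝ)}, sobE m f ≤ ENNReal.ofReal R → ∀ j x, |pd j f x| ≤ M :=
    fun h j x => ((ContinuousMap.norm_coe_le_norm _ x).trans ((hMle _ h).2 j))
  have hP : ∀ {f : C(Torus, ℝ)}, sobE m f ≤ ENNReal.ofReal R → ∀ j, HasWeakPartial j f (pd j f) :=
    fun h j => hasWeakPartial_pd_of_sobE hm (hne h) j
  set d : C(Torus, ℝ) := r₁ - r₂ with hd
  set e : C(Torus, ℝ) := φ₁ - φ₂ with he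
  set D : Fin 2 → C(Torus, ℝ) := fun j => pd j r₁ - pd j r₂ with hD
  set E : Fin 2 → C(Torus, ℝ) := fun j => pd j φ₁ - pd j φ₂ with hE
  have hdD : ∀ j, HasWeakPartial j d (D j) := fun j => (hP hr₁ j).sub (hP hr₂ j)
  have heE : ∀ j, HasWeakPartial j e (E j) := fun j => (hP hφ₁ j).sub (hP hφ₂ j)
  have ha' := (contDiff_infty.1 ha 1).continuous_deriv le_rfl
  have hb' := (contDiff_infty.1 hb 1).continuous_deriv le_rfl
  let a' : C(ℝ, ℝ) := ⟨deriv a, ha'⟩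
  let b' : C(ℝ, ℝ) := ⟨deriv b, hb'⟩
  let A : Fin 2 → C(Torus, ℝ) := fun j => (directionMap j).comp φ₁
  let A' : Fin 2 → C(Torus, ℝ) := fun j => (normalMap j).comp φ₁ * pd j φ₁
  let n : Fin 2 → C(Torus, ℝ) := fun j => (normalMap j).comp φ₁
  let n' : Fin 2 → C(Torus, ℝ) := fun j => -((directionMap j).comp φ₁) * pd j φ₁
  have hAA : ∀ j, HasWeakPartial j (A j) (A' j) := fun j =>
    hasWeakPartial_comp_of_hasDerivAt hm (hne hφ₁) (contDiff_direction j)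
      (hasDerivAt_direction j) j
  have hnn : ∀ j, HasWeakPartial j (n j) (n' j) := fun j =>
    hasWeakPartial_comp_of_hasDerivAt hm (hne hφ₁) (contDiff_normalDir j)
      (hasDerivAt_normalDir j) j
  have har : ∀ j, HasWeakPartial j (a.comp r₁) (a'.comp r₁ * pd j r₁ : C(Torus, ℝ)) := fun j =>
    hasWeakPartial_comp_pd hm (hne hr₁) (contDiff_infty.1 ha 1) j
  have hbr : ∀ j, HasWeakPartial j (b.comp r₁) (b'.comp r₁ * pd j r₁ : C(Torus, ℝ)) := fun j =>
    hasWeakPartial_comp_pd hm (hne hr₁) (contDiff_infty.1 hb 1) j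
  -- quantities of vanishing integral
  have z1 := fun j => (hasWeakPartial_mul_map (hAA j)
    (hasWeakPartial_mul_map (hdD j) (hdD j))).integral_eq_zero
  have z2 := fun j => (hasWeakPartial_mul_map (hAA j)
    (hasWeakPartial_mul_map (heE j) (heE j))).integral_eq_zero
  have z3 := fun j => (hasWeakPartial_mul_map (hasWeakPartial_mul_map (har j) (hnn j))
    (hasWeakPartial_mul_map (hdD j) (heE j))).integral_eq_zero
  have z4 := integral_grad_mul_grad hm (hne hφ₂) hq₂ fun j => hasWeakPartial_mul_map (hbr j)
    (hasWeakPartial_mul_map (heE j) (hdD j))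
  have z5 := integral_grad_mul_grad hm (hne hφ₁) hq₁ heE
  have z6 := integral_grad_mul_grad hm (hne hφ₂) hq₂ heE
  have hI : ∀ f : C(Torus, ℝ), Integrable f torusMeasure := fun f => integrable_continuousMap f
  have zadd : ∀ {f g : Torus → ℝ}, (Integrable f torusMeasure ∧ ∫ x, f x ∂torusMeasure = 0) →
      (Integrable g torusMeasure ∧ ∫ x, g x ∂torusMeasure = 0) →
      (Integrable (fun x => f x + g x) torusMeasure ∧ ∫ x, (f x + g x) ∂torusMeasure = 0) :=
    fun hf hg => ⟨hf.1.add hg.1, by rw [integral_add hf.1 hg.1, hf.2, hg.2, add_zero]⟩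
  have zmul : ∀ {f : Torus → ℝ} (l : ℝ), (Integrable f torusMeasure ∧
      ∫ x, f x ∂torusMeasure = 0) →
      (Integrable (fun x => l * f x) torusMeasure ∧ ∫ x, l * f x ∂torusMeasure = 0) :=
    fun l hf => ⟨hf.1.const_mul l, by rw [integral_const_mul, hf.2, mul_zero]⟩
  have y : ∀ {q : Torus → ℝ} (ψ : C(Torus, ℝ)) (ψ' : Fin 2 → C(Torus, ℝ)) (f : C(Torus, ℝ)),
      Integrable q torusMeasure → Integrable (fun x => ψ' 0 x * pd 0 f x + ψ' 1 x * pd 1 f x +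
        ψ x * q x) torusMeasure := fun ψ ψ' f hq =>
    ((hI (ψ' 0 * pd 0 f)).add (hI (ψ' 1 * pd 1 f))).add (integrable_continuousMap_mul ψ hq)
  -- A combination of null integrals to be added to the integrand. The weights `1/2`, `c/2`, `1` and
  -- `-2μ` cancel every gradient of `d`, and the pair `-μ`, `μ` trades `μ e (q₁ - q₂)` for `-μ|E|²`.
  have Z := zadd (zadd (zadd (zmul (1 / 2) (zadd ⟨hI _, z1 0⟩ ⟨hI _, z1 1⟩))
    (zmul (c / 2) (zadd ⟨hI _, z2 0⟩ ⟨hI _, z2 1⟩))) (zadd ⟨hI _, z3 0⟩ ⟨hI _, z3 1⟩))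
    (zadd (zmul (-2 * μ) ⟨y (b.comp r₁ * (e * d)) (fun j => b'.comp r₁ * pd j r₁ * (e * d) +
      b.comp r₁ * (E j * d + e * D j)) φ₂ hq₂.2.1, z4⟩)
      (zadd (zmul (-μ) ⟨y e E φ₁ hq₁.2.1, z5⟩) (zmul μ ⟨y e E φ₂ hq₂.2.1, z6⟩)))
  set F : C(Torus, ℝ) := d * (fluxDensity a r₁ φ₁ - fluxDensity a r₂ φ₂) + e * w with hF
  have hFZ := integral_add (hI F) Z.1
  rw [Z.2, add_zero] at hFZ
  rw [← hFZ, ← integral_const_mul]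
  have hK0 : 0 ≤ K := by
    obtain ⟨x, hx⟩ := hK.exists
    exact (mul_nonneg hμ (abs_nonneg _)).trans hx
  refine integral_mono_ae ((hI F).add Z.1) ((hI _).const_mul _) ?_
  filter_upwards [hw, hK] with x hwx hKx
  have hprod : ∀ {u v U V : ℝ}, |u| ≤ U → |v| ≤ V → |u * v| ≤ U * V := fun hu hv => by
    rw [abs_mul]; exact mul_le_mul hu hv (abs_nonneg _) ((abs_nonneg _).trans hu)
  have hA : ∀ j, |A' j x| ≤ N := fun j =>
    (hprod (abs_normalDir_le (φ₁ x) j) (hpd hφ₁ j x)).trans (by linarith)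
  have hB : ∀ j, |a' (r₁ x) * pd j r₁ x * n j x + a (r₁ x) * n' j x| ≤ N := fun j => by
    have h1 := hprod (hprod (ha1 _ (hval hr₁ x)).2 (hpd hr₁ j x)) (abs_normalDir_le (φ₁ x) j)
    have h2 := hprod (ha1 _ (hval hr₁ x)).1 (hprod ((abs_neg _).trans_le
      (abs_direction_le (φ₁ x) j)) (hpd hφ₁ j x))
    exact (abs_add_le _ _).trans ((add_le_add h1 h2).trans (by linarith))
  have hg : ∀ j, |b (r₁ x) * pd j r₁ x| ≤ N := fun j =>
    (hprod (hb1 _ (hval hr₁ x)).1 (hpd hr₁ j x)).trans (by linarith)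
  have hh : ∀ j, |b (r₁ x) * pd j φ₂ x| ≤ N := fun j =>
    (hprod (hb1 _ (hval hr₁ x)).1 (hpd hφ₂ j x)).trans (by linarith)
  have hk : ∀ j, |b' (r₁ x) * pd j r₁ x * pd j φ₂ x| ≤ N := fun j =>
    (hprod (hprod (hb1 _ (hval hr₁ x)).2 (hpd hr₁ j x)) (hpd hφ₂ j x)).trans (by linarith)
  have hbx : |b (r₁ x)| ≤ N := (hb1 _ (hval hr₁ x)).1.trans (by linarith)
  have hdx : d x = r₁ x - r₂ x := rfl
  have hex : e x = φ₁ x - φ₂ x := rfl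
  have han : ∀ j, |a (r₁ x) * normalDir (φ₁ x) j - a (r₂ x) * normalDir (φ₂ x) j| ≤
      Qa * (|d x| + |e x|) := fun j => by
    have h1 := hprod (ha2 _ _ (hval hr₁ x) (hval hr₂ x)) (abs_normalDir_le (φ₁ x) j)
    have h2 := hprod (ha1 _ (hval hr₂ x)).1 (abs_normalDir_sub_le (φ₁ x) (φ₂ x) j)
    rw [show a (r₁ x) * normalDir (φ₁ x) j - a (r₂ x) * normalDir (φ₂ x) j =
      (a (r₁ x) - a (r₂ x)) * normalDir (φ₁ x) j +
        a (r₂ x) * (normalDir (φ₁ x) j - normalDir (φ₂ x) j) by ring]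
    exact (abs_add_le _ _).trans ((add_le_add h1 h2).trans (by rw [hdx, hex]; linarith))
  have hdir : ∀ j, |direction (φ₁ x) j - direction (φ₂ x) j| ≤ |e x| := fun j =>
    abs_direction_sub_le _ _ j
  have hbd : |b (r₁ x) - b (r₂ x)| ≤ Qb * |d x| := hb2 _ _ (hval hr₁ x) (hval hr₂ x)
  have hd0 := abs_nonneg (d x)
  have he0 := abs_nonneg (e x)
  have hRr : |-((direction (φ₁ x) 0 - direction (φ₂ x) 0) * pd 0 r₂ x +
      (direction (φ₁ x) 1 - direction (φ₂ x) 1) * pd 1 r₂ x +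
      ((a (r₁ x) * normalDir (φ₁ x) 0 - a (r₂ x) * normalDir (φ₂ x) 0) * pd 0 φ₂ x +
      (a (r₁ x) * normalDir (φ₁ x) 1 - a (r₂ x) * normalDir (φ₂ x) 1) * pd 1 φ₂ x))| ≤
      N * (|d x| + |e x|) := by
    have t1 := hprod (hdir 0) (hpd hr₂ 0 x)
    have t2 := hprod (hdir 1) (hpd hr₂ 1 x)
    have t3 := hprod (han 0) (hpd hφ₂ 0 x)
    have t4 := hprod (han 1) (hpd hφ₂ 1 x)
    have hN1 : 2 * (1 + 2 * Qa) * M * (|d x| + |e x|) ≤ N * (|d x| + |e x|) :=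
      mul_le_mul_of_nonneg_right (by linarith) (by positivity)
    have s1 : 0 ≤ Qa * M * (|d x| + |e x|) := by positivity
    have s2 : 0 ≤ M * |d x| := by positivity
    rw [abs_neg]
    refine (abs_add_le _ _).trans ((add_le_add ((abs_add_le _ _).trans (add_le_add t1 t2))
      ((abs_add_le _ _).trans (add_le_add t3 t4))).trans ?_)
    linarith
  have hRφ : |-c * ((direction (φ₁ x) 0 - direction (φ₂ x) 0) * pd 0 φ₂ x) +
      -c * ((direction (φ₁ x) 1 - direction (φ₂ x) 1) * pd 1 φ₂ x) +
      -((a (r₁ x) * normalDir (φ₁ x) 0 - a (r₂ x) * normalDir (φ₂ x) 0) * pd 0 r₂ x +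
      (a (r₁ x) * normalDir (φ₁ x) 1 - a (r₂ x) * normalDir (φ₂ x) 1) * pd 1 r₂ x) +
      (2 * μ * ((b (r₁ x) - b (r₂ x)) * (pd 0 r₂ x * pd 0 φ₂ x)) +
      2 * μ * ((b (r₁ x) - b (r₂ x)) * (pd 1 r₂ x * pd 1 φ₂ x)))| ≤ N * (|e x| + |d x|) := by
    have t1 := hprod (abs_neg c).le (hprod (hdir 0) (hpd hφ₂ 0 x))
    have t2 := hprod (abs_neg c).le (hprod (hdir 1) (hpd hφ₂ 1 x))
    have t3 := hprod (han 0) (hpd hr₂ 0 x)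
    have t4 := hprod (han 1) (hpd hr₂ 1 x)
    have hμ2 : |2 * μ| ≤ 2 * μ := (abs_of_nonneg (by positivity)).le
    have t5 := hprod hμ2 (hprod hbd (hprod (hpd hr₂ 0 x) (hpd hφ₂ 0 x)))
    have t6 := hprod hμ2 (hprod hbd (hprod (hpd hr₂ 1 x) (hpd hφ₂ 1 x)))
    have hN1 : (2 * |c| * M + 4 * Qa * M + 4 * μ * Qb * M ^ 2) * (|e x| + |d x|) ≤
        N * (|e x| + |d x|) := mul_le_mul_of_nonneg_right (by linarith) (by positivity)
    have s1 : 0 ≤ Qa * M * (|d x| + |e x|) := by positivity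
    have s2 : 0 ≤ |c| * M * |d x| := by positivity
    have s3 : 0 ≤ μ * Qb * M ^ 2 * |e x| := by positivity
    refine (abs_add_le _ _).trans ((add_le_add ((abs_add_le _ _).trans (add_le_add
      ((abs_add_le _ _).trans (add_le_add t1 t2)) ((abs_neg _).trans_le ((abs_add_le _ _).trans
      (add_le_add t3 t4))))) ((abs_add_le _ _).trans (add_le_add t5 t6))).trans ?_)
    linarith
  have key := remainder_le (c := c) (E := fun j => E j x) hμ hN0 hA hB hg hh hk hbx hKx hRr hRφ
  have hFx : F x = d x * (fluxDensity a r₁ φ₁ x - fluxDensity a r₂ φ₂ x) + e x * w x := rfl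
  have hrhs : (d * d + e * e : C(Torus, ℝ)) x = d x ^ 2 + e x ^ 2 := by
    change d x * d x + e x * e x = _
    ring
  rw [hrhs]
  have hfin : (N * (4 + |c|) + μ * (4 * N ^ 2 + 2 * N) + N * K) * (d x ^ 2 + e x ^ 2) ≤
      (N * (4 + |c|) + μ * (4 * N ^ 2 + 2 * N) + N) * (1 + K) * (d x ^ 2 + e x ^ 2) := by
    refine mul_le_mul_of_nonneg_right ?_ (by positivity)
    have : 0 ≤ (N * (4 + |c|) + μ * (4 * N ^ 2 + 2 * N)) * K := by positivity
    linarith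
  -- With the null integrand added, the left side agrees pointwise with that of `remainder_le`; what
  -- remains is algebra.
  refine le_trans (le_of_eq ?_) (key.trans hfin)
  rw [hFx, hwx, fluxDensity_apply, fluxDensity_apply, fluxAngle_apply, fluxAngle_apply]
  have c1 : ∀ j, A j x = direction (φ₁ x) j := fun j => rfl
  have c2 : ∀ j, n j x = normalDir (φ₁ x) j := fun j => rfl
  simp only [ContinuousMap.add_apply, ContinuousMap.mul_apply, ContinuousMap.comp_apply, c1, c2,
    hdx, hex, hD, hE, ContinuousMap.sub_apply]
  ring

end SelfPropelled
end

noncomputable section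
namespace SelfPropelled
open Filter Topology

/-! ### Uniqueness -/

open scoped ComplexConjugate

/-- Gronwall's inequality with an integrable rate, by the integrating factor `exp(-∫β)`. -/
theorem IntDeriv.nonpos_of_le_mul {T : ℝ} (hT : 0 ≤ T) {y y' β : ℝ → ℝ} (h : IntDeriv T y y')
    (h0 : y 0 ≤ 0) (hβ : IntervalIntegrable β volume 0 T)
    (hle : ∀ᵐ t ∂(volume.restrict (Ioo 0 T)), y' t ≤ β t * y t) {t : ℝ} (ht : t ∈ Icc 0 T) :
    y t ≤ 0 := by
  have hB : IntDeriv T (fun t => ∫ s in 0..t, -β s) fun t => -β t :=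
    ⟨hβ.neg, fun t _ => by simp⟩
  have hz := h.mul hT (hB.comp hT (F := Real.exp) (F' := Real.exp) Real.hasDerivAt_exp
    Real.continuous_exp)
  have h1 := hz.2 t ht
  have h2 : ∫ s in 0..t, (y' s * Real.exp (∫ s in 0..s, -β s) +
      y s * (Real.exp (∫ s in 0..s, -β s) * -β s)) ≤ 0 := by
    rw [intervalIntegral.integral_of_le ht.1, integral_Ioc_eq_integral_Ioo]
    refine integral_nonpos_of_ae ?_
    filter_upwards [ae_restrict_of_ae_restrict_of_subset (Ioo_subset_Ioo_right ht.2) hle] with s hs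
    have := mul_le_mul_of_nonneg_right hs (Real.exp_nonneg (∫ s in 0..s, -β s))
    simp only [Pi.zero_apply]
    linarith
  beta_reduce at h1
  rw [intervalIntegral.integral_same, Real.exp_zero, mul_one] at h1
  exact nonpos_of_mul_nonpos_left (by linarith) (Real.exp_pos _)

/-- Integration over the torus. -/
def integralCLM : C(Torus, ℝ) →L[ℝ] ℝ := Complex.reCLM.comp (coeffCLM 0)

theorem integralCLM_apply (f : C(Torus, ℝ)) : integralCLM f = ∫ x, f x ∂torusMeasure := by
  change Complex.re (fourierCoeff f 0) = _
  rw [fourierCoeff_zero_eq, Complex.ofReal_re]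

theorem eq_zero_of_integral_sq_add_sq {f g : C(Torus, ℝ)}
    (h : ∫ x, (f * f + g * g : C(Torus, ℝ)) x ∂torusMeasure ≤ 0) : f = 0 ∧ g = 0 := by
  have h0 : 0 ≤ᵐ[torusMeasure] fun x => (f * f + g * g : C(Torus, ℝ)) x :=
    Eventually.of_forall fun x => add_nonneg (mul_self_nonneg _) (mul_self_nonneg _)
  have h1 := (integral_eq_zero_iff_of_nonneg_ae h0 (integrable_continuousMap _)).1
    (h.antisymm (integral_nonneg_of_ae h0))
  constructor
  · refine eq_of_ae_eq (h1.mono fun x hx => ?_)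
    have : f x * f x + g x * g x = 0 := hx
    exact mul_self_eq_zero.1 (by nlinarith [mul_self_nonneg (f x), mul_self_nonneg (g x)])
  · refine eq_of_ae_eq (h1.mono fun x hx => ?_)
    have : f x * f x + g x * g x = 0 := hx
    exact mul_self_eq_zero.1 (by nlinarith [mul_self_nonneg (f x), mul_self_nonneg (g x)])

theorem exists_norm_le_of_sobE_le {s : ℝ} (hs : 1 < s) {R : ℝ≥0∞} (hR : R ≠ ⊤) :
    ∃ A : ℝ, ∀ f : C(Torus, ℝ), sobE s f ≤ R → ‖f‖ ≤ A := by
  obtain ⟨C, hC, hle⟩ := exists_wsum_sq_le (s := 0) (t := s) (by linarith)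
  have hfin : 1 + C * R ≠ ⊤ := by finiteness
  refine ⟨(1 + C * R).toReal, fun f hf => ?_⟩
  rw [← ENNReal.ofReal_le_ofReal_iff ENNReal.toReal_nonneg, ENNReal.ofReal_toReal hfin,
    ofReal_norm]
  refine (enorm_le_wsum f).trans ?_
  -- A number is at most `1` or at most its square, so the bound on the square suffices and no root
  -- is needed.
  rcases le_total (wsum 0 f) 1 with h | h
  · exact h.trans le_self_add
  · calc wsum 0 f ≤ wsum 0 f ^ 2 := le_self_pow₀ h two_ne_zero
      _ ≤ C * sobE s f := hle f
      _ ≤ C * R := by gcongr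
      _ ≤ _ := le_add_self

/-- Gronwall for the squared `L²` distance. The equation itself gives `μΔφ₂ = w₂ - fluxAngle`, so
its sup norm is at most `‖w₂‖ + A`, which is integrable in time though possibly unbounded. -/
theorem ReducedSolution.eq {c μ m T : ℝ} (hT : 0 ≤ T) (hμ : 0 ≤ μ) (hm : 2 < m) {a b : C(ℝ, ℝ)}
    (ha : ContDiff ℝ ∞ a) (hb : ContDiff ℝ ∞ b) {r₁ φ₁ v₁ w₁ r₂ φ₂ v₂ w₂ : ℝ → C(Torus, ℝ)}
    (h₁ : ReducedSolution c μ m T a b r₁ φ₁ v₁ w₁) (h₂ : ReducedSolution c μ m T a b r₂ φ₂ v₂ w₂)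
    (hr : r₁ 0 = r₂ 0) (hφ : φ₁ 0 = φ₂ 0) {t : ℝ} (ht : t ∈ Icc 0 T) :
    r₁ t = r₂ t ∧ φ₁ t = φ₂ t := by
  obtain ⟨R₁, hR₁⟩ := h₁.bounded
  obtain ⟨R₂, hR₂⟩ := h₂.bounded
  set R := max R₁ R₂
  have hle₁ : ENNReal.ofReal R₁ ≤ ENNReal.ofReal R := ENNReal.ofReal_le_ofReal (le_max_left _ _)
  have hle₂ : ENNReal.ofReal R₂ ≤ ENNReal.ofReal R := ENNReal.ofReal_le_ofReal (le_max_right _ _)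
  obtain ⟨C, hC, hdiff⟩ := exists_difference_estimate c hμ hm ha hb R
  obtain ⟨B, hB, hflux⟩ := sobBounded_fluxAngle c μ hm ha hb _ (ENNReal.ofReal_ne_top (r := R))
  obtain ⟨A, hA⟩ := exists_norm_le_of_sobE_le (s := m - 1) (by linarith) hB
  have hd := h₁.density.sub h₂.density
  have he := h₁.angle.sub h₂.angle
  have hy := ((hd.mul_map hT hd).add (he.mul_map hT he)).clm integralCLM
  have hβ : IntervalIntegrable (fun t => 2 * (C * (1 + (‖w₂ t‖ + A)))) volume 0 T :=
    (((intervalIntegrable_const (c := (1 : ℝ))).add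
      (h₂.angle.1.norm.add intervalIntegrable_const)).const_mul C).const_mul 2
  have hle := hy.nonpos_of_le_mul hT (by simp [hr, hφ]) hβ ?_ ht
  · rw [integralCLM_apply] at hle
    obtain ⟨h3, h4⟩ := eq_zero_of_integral_sq_add_sq hle
    exact ⟨sub_eq_zero.1 h3, sub_eq_zero.1 h4⟩
  filter_upwards [hR₁, hR₂, h₁.eq_density, h₂.eq_density, h₁.eq_angle, h₂.eq_angle] with
    t b1 b2 d1 d2 a1 a2
  have f2 := b2.2.trans hle₂
  obtain ⟨q₁, hq₁⟩ := exists_hasWeakLaplacian hm (b1.2.trans_lt ENNReal.ofReal_lt_top).ne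
  obtain ⟨q₂, hq₂⟩ := exists_hasWeakLaplacian hm (b2.2.trans_lt ENNReal.ofReal_lt_top).ne
  have key := hdiff (r₁ t) (φ₁ t) (r₂ t) (φ₂ t) (b1.1.trans hle₁) (b1.2.trans hle₁)
    (b2.1.trans hle₂) f2 q₁ q₂ (‖w₂ t‖ + A) hq₁ hq₂ ?_ (w₁ t - w₂ t) ?_
  · rw [integralCLM_apply, integralCLM_apply, mul_assoc]
    refine le_trans (le_of_eq ?_) (mul_le_mul_of_nonneg_left key zero_le_two)
    rw [← integral_const_mul]
    congr 1
    ext x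
    simp only [d1, d2, ContinuousMap.add_apply, ContinuousMap.mul_apply, ContinuousMap.sub_apply]
    ring
  · filter_upwards [a2 q₂ hq₂] with x hx
    rw [show μ * |q₂ x| = |μ * q₂ x| by rw [abs_mul, abs_of_nonneg hμ],
      show μ * q₂ x = w₂ t x - fluxAngle c μ a b (r₂ t) (φ₂ t) x by rw [hx]; ring]
    exact (abs_sub _ _).trans (add_le_add ((w₂ t).norm_coe_le_norm x)
      ((ContinuousMap.norm_coe_le_norm _ x).trans (hA _ (hflux _ _ (b2.1.trans hle₂) f2))))
  · filter_upwards [a1 q₁ hq₁, a2 q₂ hq₂] with x h1 h2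
    rw [ContinuousMap.sub_apply, h1, h2]; ring

end SelfPropelled
end

noncomputable section
namespace SelfPropelled
open Filter Topology

/-! ### Bounds for positive densities -/

theorem exists_forall_mem_Icc {T : ℝ} (hT : 0 ≤ T) {ρ : ℝ → C(Torus, ℝ)}
    (hρ : ContinuousOn ρ (Icc 0 T)) (hpos : ∀ t ∈ Icc 0 T, ∀ x, 0 < ρ t x) :
    ∃ δ M : ℝ, 0 < δ ∧ ∀ t ∈ Icc 0 T, ∀ x, ρ t x ∈ Icc δ M := by
  have hc : ContinuousOn (fun z : ℝ × Torus => ρ z.1 z.2) (Icc 0 T ×ˢ univ) :=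
    (hρ.comp continuousOn_fst fun z hz => hz.1).eval continuousOn_snd
  have hK : IsCompact (Icc (0 : ℝ) T ×ˢ (univ : Set Torus)) := isCompact_Icc.prod isCompact_univ
  have hne : (Icc (0 : ℝ) T ×ˢ (univ : Set Torus)).Nonempty := ⟨(0, 0), ⟨le_rfl, hT⟩, mem_univ _⟩
  obtain ⟨z, hz, hmin⟩ := hK.exists_isMinOn hne hc
  obtain ⟨z', _, hmax⟩ := hK.exists_isMaxOn hne hc
  exact ⟨ρ z.1 z.2, ρ z'.1 z'.2, hpos _ hz.1 _, fun t ht x =>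
    ⟨hmin (show (t, x) ∈ _ from ⟨ht, mem_univ _⟩), hmax (show (t, x) ∈ _ from ⟨ht, mem_univ _⟩)⟩⟩

/-- The functions with values in an open interval form an open set in sup norm, because the torus is
compact; continuity in time does the rest. -/
theorem ReducedSolution.exists_forall_mem_Icc {c μ m T : ℝ} {a b : C(ℝ, ℝ)}
    {r φ v w : ℝ → C(Torus, ℝ)} (h : ReducedSolution c μ m T a b r φ v w) (hT : 0 < T) {g : C(ℝ, ℝ)}
    {δ M : ℝ} (h0 : ∀ x, g (r 0 x) ∈ Ioo δ M) :
    ∃ T' : ℝ, 0 < T' ∧ T' ≤ T ∧ ∀ t ∈ Icc 0 T', ∀ x, g (r t x) ∈ Icc δ M := by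
  have hc : ContinuousOn (fun t => g.comp (r t)) (Icc 0 T) :=
    (ContinuousMap.continuous_postcomp g).comp_continuousOn (h.density.continuousOn hT.le)
  have hopen : IsOpen {f : C(Torus, ℝ) | MapsTo f univ (Ioo δ M)} :=
    ContinuousMap.isOpen_setOfPred_mapsTo isCompact_univ isOpen_Ioo
  have hev : ∀ᶠ t in 𝓝[≥] (0 : ℝ), ∀ x, g (r t x) ∈ Ioo δ M := by
    have h1 := (hc 0 ⟨le_rfl, hT.le⟩).eventually (hopen.mem_nhds fun x _ => h0 x)
    rw [nhdsWithin_Icc_eq_nhdsGE hT] at h1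
    exact h1.mono fun t ht x => ht (mem_univ x)
  obtain ⟨T', hT', hsub⟩ := (mem_nhdsGE_iff_exists_Icc_subset).1 hev
  refine ⟨min T T', lt_min hT hT', min_le_left _ _, fun t ht x => ?_⟩
  exact Ioo_subset_Icc_self (hsub ⟨ht.1, ht.2.trans (min_le_right _ _)⟩ x)

/-- By compactness both densities have values in one interval `[δ, M]` throughout `[0,T]`. A single
change of variables built for that interval serves both solutions, and no continuation argument is
needed. -/
theorem IsSolution.eq {c μ m T : ℝ} (hT : 0 < T) (hμ : 0 ≤ μ) (hm : 2 < m) {p : ℝ → ℝ}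
    (hp : ContDiffOn ℝ ∞ p (Ioi 0)) (hp' : ∀ r : ℝ, 0 < r → 0 < deriv p r)
    {ρ₀ φ₀ : C(Torus, ℝ)} {ρ₁ φ₁ ρ₂ φ₂ : ℝ → C(Torus, ℝ)}
    (h₁ : IsSolution c μ p ρ₀ φ₀ T ρ₁ φ₁) (hρ₁ : InClass m T ρ₁) (hφ₁ : InClass m T φ₁)
    (h₂ : IsSolution c μ p ρ₀ φ₀ T ρ₂ φ₂) (hρ₂ : InClass m T ρ₂) (hφ₂ : InClass m T φ₂)
    {t : ℝ} (ht : t ∈ Icc 0 T) : ρ₁ t = ρ₂ t ∧ φ₁ t = φ₂ t := by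
  obtain ⟨δ₁, M₁, hδ₁, hr₁⟩ := exists_forall_mem_Icc hT.le h₁.continuousOn_density h₁.density_pos
  obtain ⟨δ₂, M₂, hδ₂, hr₂⟩ := exists_forall_mem_Icc hT.le h₂.continuousOn_density h₂.density_pos
  obtain ⟨a, b, g, G, S⟩ := exists_symVars hp hp' (lt_min hδ₁ hδ₂) (max M₁ M₂)
  have hr₁' : ∀ t ∈ Icc 0 T, ∀ x, ρ₁ t x ∈ Icc (min δ₁ δ₂) (max M₁ M₂) := fun t ht x =>
    Icc_subset_Icc (min_le_left _ _) (le_max_left _ _) (hr₁ t ht x)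
  have hr₂' : ∀ t ∈ Icc 0 T, ∀ x, ρ₂ t x ∈ Icc (min δ₁ δ₂) (max M₁ M₂) := fun t ht x =>
    Icc_subset_Icc (min_le_right _ _) (le_max_right _ _) (hr₂ t ht x)
  obtain ⟨v₁, w₁, H₁⟩ := h₁.exists_reducedSolution hT hm hp (lt_min hδ₁ hδ₂) S hρ₁ hφ₁ hr₁'
  obtain ⟨v₂, w₂, H₂⟩ := h₂.exists_reducedSolution hT hm hp (lt_min hδ₁ hδ₂) S hρ₂ hφ₂ hr₂'
  obtain ⟨e₁, e₂⟩ := H₁.eq hT.le hμ hm S.smooth_a S.smooth_b H₂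
    (by rw [h₁.initial_density, h₂.initial_density]) (by rw [h₁.initial_angle, h₂.initial_angle]) ht
  refine ⟨?_, e₂⟩
  ext x
  have := congrArg g (DFunLike.congr_fun e₁ x)
  simpa only [ContinuousMap.comp_apply, S.g_G _ (hr₁' t ht x), S.g_G _ (hr₂' t ht x)] using this

end SelfPropelled
end

/-! ### The main theorem -/

theorem mainTheorem1 (c μ m : ℝ) (hμ : 0 ≤ μ) (hm : 2 < m)
    (p : ℝ → ℝ) (hp : ContDiffOn ℝ ∞ p (Ioi 0)) (hp' : ∀ r : ℝ, 0 < r → 0 < deriv p r)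
    (ρ₀ φ₀ : C(SelfPropelled.Torus, ℝ))
    (hρ₀ : SelfPropelled.MemSobolev m ρ₀) (hφ₀ : SelfPropelled.MemSobolev m φ₀)
    (hpos : ∀ x, 0 < ρ₀ x) :
    ∃ T : ℝ, 0 < T ∧ ∃ ρ φ : ℝ → C(SelfPropelled.Torus, ℝ),
      SelfPropelled.IsSolution c μ p ρ₀ φ₀ T ρ φ ∧
      SelfPropelled.InClass m T ρ ∧ SelfPropelled.InClass m T φ ∧
      (∀ ρ' φ' : ℝ → C(SelfPropelled.Torus, ℝ),
        SelfPropelled.IsSolution c μ p ρ₀ φ₀ T ρ' φ' →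
        SelfPropelled.InClass m T ρ' → SelfPropelled.InClass m T φ' →
        ∀ t ∈ Icc 0 T, ρ' t = ρ t ∧ φ' t = φ t) ∧
      (0 < μ → SelfPropelled.MemBochner 2 (m + 1) T (fun t x => φ t x)) := by
  open SelfPropelled in
  -- Applied to a constant path on the degenerate interval `[0,0]`, this gives positive bounds for
  -- the initial density.
  obtain ⟨δ, M, hδ, hρ⟩ := exists_forall_mem_Icc (T := 0) le_rfl (ρ := fun _ => ρ₀)
    continuousOn_const fun _ _ => hpos
  replace hρ := hρ 0 ⟨le_rfl, le_rfl⟩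
  -- Widening `[δ, M]` to `[δ / 2, M + 1]` leaves the density room to move for a short time.
  obtain ⟨a, b, g, G, S⟩ := exists_symVars hp hp' (half_pos hδ) (M + 1)
  have hsub : Icc δ M ⊆ Ioo (δ / 2) (M + 1) := fun y hy =>
    ⟨by linarith [hy.1], by linarith [hy.2]⟩
  have hgG : g.comp (G.comp ρ₀) = ρ₀ := by
    ext x; exact S.g_G _ (Ioo_subset_Icc_self (hsub (hρ x)))
  obtain ⟨T₁, R, hT₁, r, φ, v, w, H, hr0, hφ0, hR, hv, hw, hφ⟩ := exists_reducedSolution c hμ hm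
    S.smooth_a S.smooth_b (sobE_comp_ne_top hm S.smooth_G (memSobolev_iff.1 hρ₀).2)
    (memSobolev_iff.1 hφ₀).2
  obtain ⟨T, hT, hTT, hrange⟩ := H.exists_forall_mem_Icc hT₁ (g := g) (δ := δ / 2) (M := M + 1)
    fun x => by
      rw [hr0]
      have := DFunLike.congr_fun hgG x
      simp only [ContinuousMap.comp_apply] at this
      rw [ContinuousMap.comp_apply, this]
      exact hsub (hρ x)
  have hR' : ∀ t ∈ Icc 0 T, sobE m (r t) ≤ ENNReal.ofReal R ∧ sobE m (φ t) ≤ ENNReal.ofReal R :=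
    fun t ht => hR t ⟨ht.1, ht.2.trans hTT⟩
  obtain ⟨hsol, hρc, hφc⟩ := (H.mono hT.le hTT).isSolution hT hm hp (half_pos hδ) S
    (fun t ht => (hR' t ht).1) (fun t ht => (hR' t ht).2) (hv.mono hTT) (hw.mono hTT) hrange
  rw [hr0, hφ0, hgG] at hsol
  refine ⟨T, hT, fun t => g.comp (r t), φ, hsol, hρc, hφc, fun ρ' φ' h' hρ' hφ' t ht =>
    h'.eq hT hμ hm hp hp' hρ' hφ' hsol hρc hφc ht, fun h => ?_⟩
  have hreg := (hφ h).mono hTT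
  exact exists_memLp_sobolevPath (fun k => ((continuousOn_fourierCoeff hsol.continuousOn_angle
    k).mono Ioo_subset_Icc_self).aestronglyMeasurable measurableSet_Ioo)
    (Filter.Eventually.of_forall fun t => memLp_continuousMap _ 2) hreg.1 hreg.2
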